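/- Let $K$ be an imaginary quadratic field with ring of integers $\mathcal O_K$, $p$ a rational prime, $\mathfrak n=(p)\mathfrak m$ with $\mathfrak m\subseteq\mathcal O_K$ a non-zero ideal coprime to $(p)$, and $k,\ell\ge 0$ integers. Let $L\subset\mathbb C_p$ be a finite extension of $\mathbb Q_p$ containing the images of both embeddings $\sigma_1\neq\sigma_2$ of $K$, let $v_p$ be the valuation with $v_p(p)=1$, and put $\mathcal O_{K,p}=\mathcal O_K\otimes\mathbb Z_p$, embedded in $\mathbb C_p^2$ by $(\sigma_1,\sigma_2)$. **Levels and Hecke operators.** Let $(I_i)$ be integral representatives of the ideal classes of $K$, coprime to $\mathfrak n$ and to the different, with $I_1=\mathcal O_K$ and the others prime. For an ideal $\mathfrak a$ let $\Gamma_i(\mathfrak a)$ be the group of $\begin{pmatrix}a&b\\c&d\end{pmatrix}\in\mathrm{SL}_2(K)$ with $a,d\in\mathcal O_K$, $b\in I_i$, $c\in\mathfrak a I_i^{-1}$. For every prime $\mathfrak p\mid p$ and every $i$ fix $\alpha_i\in K^\times$ (depending on $\mathfrak p$) and $j_i$ with $\mathfrak pI_i=(\alpha_i)I_{j_i}$.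 Let $\mathbf C=(\mathbf C_i)$ be a family of non-empty subsets of $\mathbb P^1(K)$ such that $\mathbf C_i$ is $\Gamma_i(\mathfrak n)$-invariant and $\begin{pmatrix}1&0\\0&\alpha_i\end{pmatrix}\mathbf C_i\subseteq\mathbf C_{j_i}$ for all $\mathfrak p\mid p$ and all $i$. Let $\Delta^0_{\mathbf C_i}$ be the group of divisors of degree $0$ on $\mathbf C_i$. For a right module $V$ put $\phi|_\gamma(D)=\phi(\gamma D)|_\gamma$, $\mathrm{Symb}_{K_0(\mathfrak n),\mathbf C}(V)=\bigoplus_i\mathrm{Hom}_{\Gamma_i(\mathfrak n)}(\Delta^0_{\mathbf C_i},V)$, and let $U_\mathfrak p$ send $(\phi_i)_i$ to the family with $i$-th component $\phi_{j_i}\big|\big[\Gamma_{j_i}(\mathfrak n)\begin{pmatrix}1&0\\0&\alpha_i\end{pmatrix}\Gamma_i(\mathfrak n)\big]=\sum_{\gamma}\phi_{j_i}|_\gamma$, $\gamma$ running over representatives of $\Gamma_{j_i}(\mathfrak n)\backslash\Gamma_{j_i}(\mathfrak n)\begin{pmatrix}1&0\\0&\alpha_i\end{pmatrix}\Gamma_i(\mathfrak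 n)$. **Coefficients.** Write $\sigma_i(\gamma)=\begin{pmatrix}a_i&b_i\\c_i&d_i\end{pmatrix}$. $V_{k,\ell}(L)$ is the space of polynomials over $L$ homogeneous of degree $k$ in $X,Y$ and of degree $\ell$ in $\overline X,\overline Y$, with $\gamma\cdot P=P(d_1X+b_1Y,\,c_1X+a_1Y,\,d_2\overline X+b_2\overline Y,\,c_2\overline X+a_2\overline Y)$; its dual $V^*_{k,\ell}(L)$ has the right action $(\mu|_\gamma)(P)=\mu(\gamma\cdot P)$. For $r,s>0$ let $\mathbb A[L,r,s]$ be the Banach space of rigid analytic functions over $L$ on $\{(x,y)\in\mathbb C_p^2:\exists u\in\mathcal O_{K,p},\ |x-\sigma_1(u)|\le r,\ |y-\sigma_2(u)|\le s\}$. $\mathcal D_{k,\ell}(L)$ is the projective limit, over $r,s\to0$, of the Banach duals of the $\mathbb A[L,r,s]$, with the right action (of the semigroup $\Sigma_0(p)$ of matrices over $\mathcal O_{K,p}$ with $p\mid c$, $a$ a unit and non-zero determinant) dual to $(\gamma\cdot\zeta)(x,y)=(a_1+c_1x)^k(a_2+c_2y)^\ell\,\zeta\big(\tfrac{b_1+d_1x}{a_1+c_1x},\tfrac{b_2+d_2y}{a_2+c_2y}\big)$.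 The specialization map $\rho:\mathrm{Symb}_{K_0(\mathfrak n),\mathbf C}(\mathcal D_{k,\ell}(L))\to\mathrm{Symb}_{K_0(\mathfrak n),\mathbf C}(V^*_{k,\ell}(L))$ is induced by the dual of the inclusion $P\mapsto P(x,1,y,1)$. **Theorem.** (1) For each prime $\mathfrak p\mid p$ let $\lambda_\mathfrak p\in L^\times$. Suppose that $v_p(\lambda_\mathfrak p)<(\min\{k,\ell\}+1)/e$ if $\mathfrak p$ is the only prime above $p$, with ramification index $e$; or, if $p$ splits as $\mathfrak p\overline{\mathfrak p}$ with $\mathfrak p$ the prime induced by $\sigma_1$, that $v_p(\lambda_\mathfrak p)<k+1$ and $v_p(\lambda_{\overline{\mathfrak p}})<\ell+1$. Then $\rho$ restricts to an isomorphism of $L$-vector spaces $$\mathrm{Symb}_{K_0(\mathfrak n),\mathbf C}(\mathcal D_{k,\ell}(L))^{\{U_\mathfrak p=\lambda_\mathfrak p:\,\mathfrak p\mid p\}}\;\xrightarrow{\ \sim\ }\;\mathrm{Symb}_{K_0(\mathfrak n),\mathbf C}(V^*_{k,\ell}(L))^{\{U_\mathfrak p=\lambda_\mathfrak p:\,\mathfrak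 p\mid p\}}.$$ (2) If all primes of $K$ above $p$ are principal (for instance if $K$ has class number $1$ or $p$ is inert), then the family $\mathbf C_i=C_i:=\Gamma_i(\mathfrak m)\infty\cup\Gamma_i(\mathfrak m)0$ satisfies the conditions imposed on $\mathbf C$, so that (1) applies to it. -/

import Mathlib

open NumberField
open scoped nonZeroDivisors

noncomputable section

set_option linter.unusedSectionVars false

namespace Bianchi

section Coefficients

/-- A pair `(σ₁, σ₂)` of distinct embeddings of `K` into a field `L ⊆ ℂ_p`. -/
structure EmbPair (p : ℕ) [Fact p.Prime] (K L : Type*) [Field K] [Field L] where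
  /-- The embeddings `σ₁ = σ 0` and `σ₂ = σ 1`. -/
  σ : Fin 2 → K →+* L
  ne : σ 0 ≠ σ 1

variable {p : ℕ} [Fact p.Prime] {L : Type*} [Field L] [Algebra L ℂ_[p]] {K : Type*} [Field K]

/-- The map `a ↦ (σ₁(a), σ₂(a))` attached to two embeddings of `K` into `L ⊆ ℂ_p`. -/
def emb (σ : EmbPair p K L) : K →+* (Fin 2 → ℂ_[p]) :=
  RingHom.pi fun i => (algebraMap L ℂ_[p]).comp (σ.σ i)

/-- The image of `𝓞_K ⊗ ℤ_p` in `ℂ_p × ℂ_p` under `(σ₁, σ₂)`, that is, the topological closure of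
the image of `𝓞_K`. -/
def OKp (σ : EmbPair p K L) : Subring (Fin 2 → ℂ_[p]) :=
  ((emb σ).comp (algebraMap (𝓞 K) K)).range.topologicalClosure

lemma norm_le_one_of_integral (σ : EmbPair p K L) (x : 𝓞 K) (i : Fin 2) :
    ‖emb σ (x : K) i‖ ≤ 1 := by
  obtain ⟨f, hf, hfx⟩ := x.isIntegral_coe
  have hO : IsIntegral (NormedField.valuation (K := ℂ_[p])).integer (emb σ (x : K) i) := by
    refine ⟨f.map (Int.castRingHom _), hf.map _, ?_⟩
    have h := congrArg ((algebraMap L ℂ_[p]).comp (σ.σ i)) hfx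
    rw [Polynomial.hom_eval₂, map_zero] at h
    rw [Polynomial.eval₂_map, ← h]
    exact congrArg (fun g => Polynomial.eval₂ g _ f) (RingHom.ext_int _ _)
  have := (Valuation.integer.integers (NormedField.valuation (K := ℂ_[p]))).mem_of_integral hO
  have h3 : NormedField.valuation (emb σ (x : K) i) ≤ 1 := this
  exact_mod_cast h3

lemma isClosed_OKp (σ : EmbPair p K L) : IsClosed (OKp σ : Set (Fin 2 → ℂ_[p])) :=
  Subring.isClosed_topologicalClosure _

lemma emb_mem_OKp (σ : EmbPair p K L) (x : 𝓞 K) : emb σ (x : K) ∈ OKp σ :=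
  Subring.le_topologicalClosure _ ⟨x, rfl⟩

lemma norm_le_one_of_mem_OKp {σ : EmbPair p K L} {u : Fin 2 → ℂ_[p]} (hu : u ∈ OKp σ)
    (i : Fin 2) : ‖u i‖ ≤ 1 := by
  have hc : IsClosed {u : Fin 2 → ℂ_[p] | ‖u i‖ ≤ 1} :=
    isClosed_le (continuous_norm.comp (continuous_apply i)) continuous_const
  have hsub : (((emb σ).comp (algebraMap (𝓞 K) K)).range : Set (Fin 2 → ℂ_[p])) ⊆
      {u | ‖u i‖ ≤ 1} := by
    rintro _ ⟨x, rfl⟩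
    exact norm_le_one_of_integral σ x i
  exact closure_minimal hsub hc hu

lemma norm_p_lt_one : ‖(p : ℂ_[p])‖ < 1 := by
  have h := PadicComplex.norm_extends' p (p : ℚ_[p])
  have h2 : (((p : ℚ_[p]) : PadicAlgCl p) : ℂ_[p]) = (p : ℂ_[p]) := by simp
  have h3 : ‖(p : ℂ_[p])‖ = ‖(p : ℚ_[p])‖ := by
    rw [← h]; congr 1; exact h2.symm
  rw [h3]
  exact Padic.norm_p_lt_one

lemma exists_inv_one_add {σ : EmbPair p K L} {w : Fin 2 → ℂ_[p]} (hw : w ∈ OKp σ) :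
    ∃ v ∈ OKp σ, (1 + (p : Fin 2 → ℂ_[p]) * w) * v = 1 := by
  set y : Fin 2 → ℂ_[p] := -((p : Fin 2 → ℂ_[p]) * w) with hy
  have hyO : y ∈ OKp σ := neg_mem (mul_mem (natCast_mem _ p) hw)
  have hn : ‖y‖ < 1 := by
    rw [pi_norm_lt_iff one_pos]
    intro i
    have h1 := norm_le_one_of_mem_OKp hw i
    have h2 := norm_p_lt_one (p := p)
    simp only [hy, Pi.neg_apply, Pi.mul_apply, Pi.natCast_apply, norm_neg, norm_mul]
    nlinarith [norm_nonneg (w i), norm_nonneg (p : ℂ_[p])]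
  have hs := summable_geometric_of_norm_lt_one hn
  refine ⟨∑' n, y ^ n, ?_, ?_⟩
  · refine (isClosed_OKp σ).mem_of_tendsto hs.hasSum (Filter.Eventually.of_forall fun s => ?_)
    exact sum_mem fun n _ => pow_mem hyO n
  · have := mul_neg_geom_series y hn
    simpa [hy] using this

/-- A matrix of `GL₂(K)` whose image under `(σ₁, σ₂)` lies in the semigroup `Σ₀(p)` of matrices
over `𝓞_K ⊗ ℤ_p` with lower left entry divisible by `p`, upper left entry a unit and nonzero
determinant. -/
def InSigma0 (σ : EmbPair p K L) (γ : GL (Fin 2) K) : Prop :=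
  (∀ i j, emb σ (γ i j) ∈ OKp σ) ∧
  (∃ u ∈ OKp σ, emb σ (γ 1 0) = (p : Fin 2 → ℂ_[p]) * u) ∧
  (∃ v ∈ OKp σ, emb σ (γ 0 0) * v = 1)

lemma InSigma0.mul {σ : EmbPair p K L} {γ δ : GL (Fin 2) K} (hγ : InSigma0 σ γ)
    (hδ : InSigma0 σ δ) : InSigma0 σ (γ * δ) := by
  obtain ⟨h1, ⟨c, hc, h2⟩, v, hv, h3⟩ := hγ
  obtain ⟨k1, ⟨c', hc', k2⟩, v', hv', k3⟩ := hδ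
  have e : ∀ i j, emb σ ((γ * δ) i j) = emb σ (γ i 0) * emb σ (δ 0 j) +
      emb σ (γ i 1) * emb σ (δ 1 j) := fun i j => by
    simp [Matrix.mul_apply, Fin.sum_univ_two]
  refine ⟨fun i j => ?_, ⟨c * emb σ (δ 0 0) + emb σ (γ 1 1) * c', ?_, ?_⟩, ?_⟩
  · rw [e]; exact add_mem (mul_mem (h1 _ _) (k1 _ _)) (mul_mem (h1 _ _) (k1 _ _))
  · exact add_mem (mul_mem hc (k1 _ _)) (mul_mem (h1 _ _) hc')
  · rw [e, h2, k2]; ring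
  · obtain ⟨w, hw, hw2⟩ := exists_inv_one_add
      (mul_mem (mul_mem hv hv') (mul_mem (h1 0 1) hc'))
    refine ⟨v * v' * w, mul_mem (mul_mem hv hv') hw, ?_⟩
    rw [e, k2]
    linear_combination hw2 + w * (v' * emb σ (δ 0 0)) * h3 + w * k3

/-- The `(r₁, r₂)`-neighbourhood `B(𝓞_K ⊗ ℤ_p, r₁, r₂)` of `𝓞_K ⊗ ℤ_p` in `ℂ_p²`. -/
def nbhd (σ : EmbPair p K L) (r : Fin 2 → ℝ) : Set (Fin 2 → ℂ_[p]) :=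
  {z | ∃ u ∈ OKp σ, ∀ i, ‖z i - u i‖ ≤ r i}

/-- The space `𝔸[L, r₁, r₂]` of rigid analytic functions on `B(𝓞_K ⊗ ℤ_p, r₁, r₂)` defined
over `L`. The neighbourhood is a finite disjoint union of closed polydiscs with centres in
`𝓞_K ⊗ ℤ_p ⊆ L²`; on each polydisc the rigid analytic functions over `L` (the convergent power
series) are the uniform limits of the polynomials over `L`. -/
def rigid (σ : EmbPair p K L) (r : Fin 2 → ℝ) : Submodule L (nbhd σ r → ℂ_[p]) where
  carrier := {F | ∀ u ∈ OKp σ, ∀ ε > 0, ∃ P : MvPolynomial (Fin 2) L,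
    ∀ z : nbhd σ r, (∀ i, ‖z.1 i - u i‖ ≤ r i) → ‖F z - MvPolynomial.aeval z.1 P‖ ≤ ε}
  zero_mem' := fun u _ ε hε => ⟨0, fun z _ => by simpa using hε.le⟩
  add_mem' := by
    intro F G hF hG u hu ε hε
    obtain ⟨P, hP⟩ := hF u hu ε hε
    obtain ⟨Q, hQ⟩ := hG u hu ε hε
    refine ⟨P + Q, fun z hz => ?_⟩
    have h := IsUltrametricDist.norm_add_le_max (F z - MvPolynomial.aeval z.1 P)
      (G z - MvPolynomial.aeval z.1 Q)
    have : (F + G) z - MvPolynomial.aeval z.1 (P + Q) =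
        (F z - MvPolynomial.aeval z.1 P) + (G z - MvPolynomial.aeval z.1 Q) := by
      simp only [Pi.add_apply, map_add]; ring
    rw [this]
    exact h.trans (max_le (hP z hz) (hQ z hz))
  smul_mem' := by
    intro c F hF u hu ε hε
    obtain ⟨P, hP⟩ := hF u hu (ε / (‖algebraMap L ℂ_[p] c‖ + 1)) (by positivity)
    refine ⟨c • P, fun z hz => ?_⟩
    have : (c • F) z - MvPolynomial.aeval z.1 (c • P) =
        algebraMap L ℂ_[p] c * (F z - MvPolynomial.aeval z.1 P) := by
      rw [map_smul, Pi.smul_apply, mul_sub, Algebra.smul_def, Algebra.smul_def]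
    rw [this, norm_mul]
    have h := hP z hz
    have h0 := norm_nonneg (algebraMap L ℂ_[p] c)
    calc ‖algebraMap L ℂ_[p] c‖ * ‖F z - MvPolynomial.aeval z.1 P‖
        ≤ (‖algebraMap L ℂ_[p] c‖ + 1) * (ε / (‖algebraMap L ℂ_[p] c‖ + 1)) := by gcongr; linarith
      _ = ε := by field_simp

/-- Pairs of radii `(r₁, r₂)` with `0 < r₁, r₂ ≤ 1`; these are cofinal (as `r₁, r₂ → 0`) in the
projective system defining the locally analytic distributions. -/
def Radii : Type := {r : Fin 2 → ℝ // ∀ i, 0 < r i ∧ r i ≤ 1}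

lemma nbhd_mono (σ : EmbPair p K L) {r s : Fin 2 → ℝ} (h : r ≤ s) : nbhd σ r ⊆ nbhd σ s :=
  fun _ ⟨u, hu, hz⟩ => ⟨u, hu, fun i => (hz i).trans (h i)⟩

/-- Restriction of rigid analytic functions to a smaller neighbourhood. -/
def restrict (σ : EmbPair p K L) {r s : Fin 2 → ℝ} (h : r ≤ s) : rigid σ s →ₗ[L] rigid σ r where
  toFun F := ⟨fun z => F.1 ⟨z.1, nbhd_mono σ h z.2⟩, fun u hu ε hε => by
    obtain ⟨P, hP⟩ := F.2 u hu ε hε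
    exact ⟨P, fun z hz => hP ⟨z.1, nbhd_mono σ h z.2⟩ fun i => (hz i).trans (h i)⟩⟩
  map_add' _ _ := rfl
  map_smul' _ _ := rfl

/-- A linear functional on `𝔸[L, r₁, r₂]` is continuous for the supremum norm. -/
def IsBoundedFunctional {σ : EmbPair p K L} {r : Fin 2 → ℝ}
    (μ : Module.Dual L (rigid σ r)) : Prop :=
  ∃ B : ℝ, ∀ (F : rigid σ r) (M : ℝ), (∀ z, ‖F.1 z‖ ≤ M) → ‖algebraMap L ℂ_[p] (μ F)‖ ≤ B * M

/-- The space `𝒟(L)` of locally analytic distributions: the projective limit of the Banach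
duals `𝔻[L, r₁, r₂]` of the spaces `𝔸[L, r₁, r₂]`. -/
def Dist (σ : EmbPair p K L) :
    Submodule L (∀ r : Radii, Module.Dual L (rigid σ r.1)) where
  carrier := {μ | (∀ r, IsBoundedFunctional (μ r)) ∧
    ∀ (r s : Radii) (h : r.1 ≤ s.1) (F : rigid σ s.1), μ r (restrict σ h F) = μ s F}
  zero_mem' := ⟨fun _ => ⟨0, fun F M _ => by simp⟩, fun _ _ _ _ => rfl⟩
  add_mem' := by
    rintro μ ν ⟨h1, h2⟩ ⟨h3, h4⟩
    refine ⟨fun r => ?_, fun r s h F => ?_⟩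
    · obtain ⟨B, hB⟩ := h1 r
      obtain ⟨C, hC⟩ := h3 r
      refine ⟨B + C, fun F M hM => ?_⟩
      have := norm_add_le (algebraMap L ℂ_[p] (μ r F)) (algebraMap L ℂ_[p] (ν r F))
      have h5 := hB F M hM
      have h6 := hC F M hM
      simp only [Pi.add_apply, LinearMap.add_apply, map_add]
      linarith
    · simp only [Pi.add_apply, LinearMap.add_apply, h2 r s h F, h4 r s h F]
  smul_mem' := by
    rintro c μ ⟨h1, h2⟩
    refine ⟨fun r => ?_, fun r s h F => ?_⟩
    · obtain ⟨B, hB⟩ := h1 r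
      refine ⟨‖algebraMap L ℂ_[p] c‖ * B, fun F M hM => ?_⟩
      have h5 := mul_le_mul_of_nonneg_left (hB F M hM) (norm_nonneg (algebraMap L ℂ_[p] c))
      simp only [Pi.smul_apply, LinearMap.smul_apply, smul_eq_mul, map_mul, norm_mul]
      linarith
    · simp only [Pi.smul_apply, LinearMap.smul_apply, h2 r s h F]

/-- The transformation `z_i ↦ (b_i + d_i z_i) / (a_i + c_i z_i)`, where `a_i = σ_i(a)`, etc. -/
def moebius (σ : EmbPair p K L) (γ : GL (Fin 2) K) (z : Fin 2 → ℂ_[p]) : Fin 2 → ℂ_[p] :=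
  fun i => (emb σ (γ 0 1) i + emb σ (γ 1 1) i * z i) / (emb σ (γ 0 0) i + emb σ (γ 1 0) i * z i)

/-- The automorphy factor `∏ (a_i + c_i z_i) ^ κ_i`. -/
def autFactor (κ : Fin 2 → ℕ) (σ : EmbPair p K L) (γ : GL (Fin 2) K) (z : Fin 2 → ℂ_[p]) :
    ℂ_[p] :=
  ∏ i, (emb σ (γ 0 0) i + emb σ (γ 1 0) i * z i) ^ κ i

lemma norm_le_one_of_near {σ : EmbPair p K L} {u z : Fin 2 → ℂ_[p]} (hu : u ∈ OKp σ)
    (i : Fin 2) (hz : ‖z i - u i‖ ≤ 1) : ‖z i‖ ≤ 1 := by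
  have := IsUltrametricDist.norm_add_le_max (z i - u i) (u i)
  rw [sub_add_cancel] at this
  exact this.trans (max_le hz (norm_le_one_of_mem_OKp hu i))

lemma InSigma0.norm_a {σ : EmbPair p K L} {γ : GL (Fin 2) K} (h : InSigma0 σ γ) (i : Fin 2) :
    ‖emb σ (γ 0 0) i‖ = 1 := by
  obtain ⟨h1, -, v, hv, h3⟩ := h
  have ha := norm_le_one_of_mem_OKp (h1 0 0) i
  have hb := norm_le_one_of_mem_OKp hv i
  have hc : ‖emb σ (γ 0 0) i‖ * ‖v i‖ = 1 := by
    rw [← norm_mul]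
    have := congrFun h3 i
    simp only [Pi.mul_apply, Pi.one_apply] at this
    rw [this, norm_one]
  nlinarith [norm_nonneg (emb σ (γ 0 0) i), norm_nonneg (v i)]

lemma InSigma0.norm_c {σ : EmbPair p K L} {γ : GL (Fin 2) K} (h : InSigma0 σ γ) (i : Fin 2) :
    ‖emb σ (γ 1 0) i‖ ≤ ‖(p : ℂ_[p])‖ := by
  obtain ⟨-, ⟨u, hu, h2⟩, -⟩ := h
  rw [h2]
  simp only [Pi.mul_apply, Pi.natCast_apply, norm_mul]
  nlinarith [norm_le_one_of_mem_OKp hu i, norm_nonneg (p : ℂ_[p])]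

lemma InSigma0.norm_denom {σ : EmbPair p K L} {γ : GL (Fin 2) K} (h : InSigma0 σ γ)
    (i : Fin 2) {z : ℂ_[p]} (hz : ‖z‖ ≤ 1) :
    ‖emb σ (γ 0 0) i + emb σ (γ 1 0) i * z‖ = 1 := by
  have h1 : ‖emb σ (γ 1 0) i * z‖ < ‖emb σ (γ 0 0) i‖ := by
    rw [h.norm_a, norm_mul]
    nlinarith [h.norm_c i, norm_p_lt_one (p := p), norm_nonneg (emb σ (γ 1 0) i), norm_nonneg z]
  rw [IsUltrametricDist.norm_add_eq_max_of_norm_ne_norm h1.ne', max_eq_left h1.le, h.norm_a]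

lemma InSigma0.moebius_mem_OKp {σ : EmbPair p K L} {γ : GL (Fin 2) K} (h : InSigma0 σ γ)
    {u : Fin 2 → ℂ_[p]} (hu : u ∈ OKp σ) : moebius σ γ u ∈ OKp σ := by
  obtain ⟨h1, ⟨c, hc, h2⟩, v, hv, h3⟩ := id h
  obtain ⟨w, hw, h4⟩ := exists_inv_one_add (mul_mem (mul_mem hv hc) hu)
  have key : moebius σ γ u = (emb σ (γ 0 1) + emb σ (γ 1 1) * u) * (v * w) := by
    funext i
    have h0 : emb σ (γ 0 0) i + emb σ (γ 1 0) i * u i ≠ 0 := by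
      rw [← norm_ne_zero_iff, h.norm_denom i (norm_le_one_of_mem_OKp hu i)]
      exact one_ne_zero
    have e2 := congrFun h2 i
    have e3 := congrFun h3 i
    have e4 := congrFun h4 i
    simp only [Pi.mul_apply, Pi.add_apply, Pi.one_apply, Pi.natCast_apply] at e2 e3 e4 ⊢
    rw [moebius, div_eq_iff h0, mul_assoc]
    have : v i * w i * (emb σ (γ 0 0) i + emb σ (γ 1 0) i * u i) = 1 := by
      rw [e2]
      linear_combination e4 + (w i) * e3
    rw [this, mul_one]
  rw [key]
  exact mul_mem (add_mem (h1 0 1) (mul_mem (h1 1 1) hu)) (mul_mem hv hw)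

lemma InSigma0.norm_moebius_sub {σ : EmbPair p K L} {γ : GL (Fin 2) K} (h : InSigma0 σ γ)
    {u z : Fin 2 → ℂ_[p]} (i : Fin 2) (hu : ‖u i‖ ≤ 1) (hz : ‖z i‖ ≤ 1) :
    ‖moebius σ γ z i - moebius σ γ u i‖ ≤ ‖z i - u i‖ := by
  have n1 := h.norm_denom i hu
  have n2 := h.norm_denom i hz
  have h0 : emb σ (γ 0 0) i + emb σ (γ 1 0) i * u i ≠ 0 := by
    rw [← norm_ne_zero_iff, n1]; exact one_ne_zero
  have h0' : emb σ (γ 0 0) i + emb σ (γ 1 0) i * z i ≠ 0 := by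
    rw [← norm_ne_zero_iff, n2]; exact one_ne_zero
  have e : moebius σ γ z i - moebius σ γ u i =
      ((emb σ (γ 0 0) * emb σ (γ 1 1) - emb σ (γ 0 1) * emb σ (γ 1 0)) i) * (z i - u i) /
      ((emb σ (γ 0 0) i + emb σ (γ 1 0) i * z i) * (emb σ (γ 0 0) i + emb σ (γ 1 0) i * u i)) := by
    simp only [moebius, Pi.sub_apply, Pi.mul_apply]
    rw [div_sub_div _ _ h0' h0]
    congr 1
    ring
  rw [e, norm_div, norm_mul, norm_mul, n1, n2, mul_one, div_one]
  have hd := norm_le_one_of_mem_OKp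
    (sub_mem (mul_mem (h.1 0 0) (h.1 1 1)) (mul_mem (h.1 0 1) (h.1 1 0))) i
  nlinarith [norm_nonneg (z i - u i)]

lemma InSigma0.moebius_mem_nbhd {σ : EmbPair p K L} {γ : GL (Fin 2) K} (h : InSigma0 σ γ)
    (r : Radii) {z : Fin 2 → ℂ_[p]} (hz : z ∈ nbhd σ r.1) : moebius σ γ z ∈ nbhd σ r.1 := by
  obtain ⟨u, hu, huz⟩ := hz
  refine ⟨moebius σ γ u, h.moebius_mem_OKp hu, fun i => ?_⟩
  exact (h.norm_moebius_sub i (norm_le_one_of_mem_OKp hu i)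
    (norm_le_one_of_near hu i ((huz i).trans (r.2 i).2))).trans (huz i)

/-- `G` is a uniform limit on `S` of polynomials with coefficients in `L`. -/
def Approx (L : Type*) [Field L] [Algebra L ℂ_[p]] (S : Set (Fin 2 → ℂ_[p]))
    (G : (Fin 2 → ℂ_[p]) → ℂ_[p]) : Prop :=
  ∀ ε > 0, ∃ P : MvPolynomial (Fin 2) L, ∀ z ∈ S, ‖G z - MvPolynomial.aeval z P‖ ≤ ε

lemma Approx.of_poly (S : Set (Fin 2 → ℂ_[p])) (P : MvPolynomial (Fin 2) L) :
    Approx L S (fun z => MvPolynomial.aeval z P) :=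
  fun ε hε => ⟨P, fun z _ => by simpa using hε.le⟩

lemma Approx.add {S : Set (Fin 2 → ℂ_[p])} {G H : (Fin 2 → ℂ_[p]) → ℂ_[p]}
    (hG : Approx L S G) (hH : Approx L S H) : Approx L S (fun z => G z + H z) := by
  intro ε hε
  obtain ⟨P, hP⟩ := hG ε hε
  obtain ⟨Q, hQ⟩ := hH ε hε
  refine ⟨P + Q, fun z hz => ?_⟩
  rw [map_add, add_sub_add_comm]
  exact (IsUltrametricDist.norm_add_le_max _ _).trans (max_le (hP z hz) (hQ z hz))

lemma poly_bounded (P : MvPolynomial (Fin 2) L) :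
    ∃ B : ℝ, ∀ z : Fin 2 → ℂ_[p], (∀ i, ‖z i‖ ≤ 1) → ‖MvPolynomial.aeval z P‖ ≤ B := by
  induction P using MvPolynomial.induction_on with
  | C a => exact ⟨‖algebraMap L ℂ_[p] a‖, fun z _ => by simp⟩
  | add P Q hP hQ =>
    obtain ⟨B, hB⟩ := hP
    obtain ⟨C, hC⟩ := hQ
    refine ⟨B + C, fun z hz => ?_⟩
    rw [map_add]
    exact (norm_add_le _ _).trans (add_le_add (hB z hz) (hC z hz))
  | mul_X P i hP =>
    obtain ⟨B, hB⟩ := hP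
    refine ⟨B, fun z hz => ?_⟩
    rw [map_mul, MvPolynomial.aeval_X, norm_mul]
    nlinarith [hB z hz, hz i, norm_nonneg (z i), norm_nonneg (MvPolynomial.aeval z P)]

lemma Approx.bounded {S : Set (Fin 2 → ℂ_[p])} (hS : ∀ z ∈ S, ∀ i, ‖z i‖ ≤ 1)
    {G : (Fin 2 → ℂ_[p]) → ℂ_[p]} (hG : Approx L S G) : ∃ B > 0, ∀ z ∈ S, ‖G z‖ ≤ B := by
  obtain ⟨P, hP⟩ := hG 1 one_pos
  obtain ⟨B, hB⟩ := poly_bounded (p := p) P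
  refine ⟨|B| + 1, by positivity, fun z hz => ?_⟩
  have h1 := hP z hz
  have h2 := hB z (hS z hz)
  have h3 := norm_add_le (G z - MvPolynomial.aeval z P) (MvPolynomial.aeval z P)
  rw [sub_add_cancel] at h3
  linarith [le_abs_self B]

lemma Approx.mul {S : Set (Fin 2 → ℂ_[p])} (hS : ∀ z ∈ S, ∀ i, ‖z i‖ ≤ 1)
    {G H : (Fin 2 → ℂ_[p]) → ℂ_[p]} (hG : Approx L S G) (hH : Approx L S H) :
    Approx L S (fun z => G z * H z) := by
  intro ε hε
  obtain ⟨B, hB0, hB⟩ := hH.bounded hS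
  obtain ⟨P, hP⟩ := hG (ε / B) (by positivity)
  obtain ⟨C, hC⟩ := poly_bounded (p := p) P
  obtain ⟨Q, hQ⟩ := hH (ε / (|C| + 1)) (by positivity)
  refine ⟨P * Q, fun z hz => ?_⟩
  have e : G z * H z - MvPolynomial.aeval z (P * Q) =
      (G z - MvPolynomial.aeval z P) * H z +
        MvPolynomial.aeval z P * (H z - MvPolynomial.aeval z Q) := by
    rw [map_mul]; ring
  rw [e]
  refine (IsUltrametricDist.norm_add_le_max _ _).trans (max_le ?_ ?_)
  · rw [norm_mul]
    calc _ ≤ (ε / B) * B := by gcongr; exacts [hP z hz, hB z hz]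
      _ = ε := by field_simp
  · rw [norm_mul]
    calc _ ≤ (|C| + 1) * (ε / (|C| + 1)) := by
          gcongr
          · linarith [hC z (hS z hz), le_abs_self C]
          · exact hQ z hz
      _ = ε := by field_simp

lemma InSigma0.approx_inv {σ : EmbPair p K L} {γ : GL (Fin 2) K} (h : InSigma0 σ γ)
    {S : Set (Fin 2 → ℂ_[p])} (hS : ∀ z ∈ S, ∀ i, ‖z i‖ ≤ 1) (i : Fin 2) :
    Approx L S (fun z => (emb σ (γ 0 0) i + emb σ (γ 1 0) i * z i)⁻¹) := by
  intro ε hε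
  obtain ⟨N, hN⟩ := exists_pow_lt_of_lt_one hε (norm_p_lt_one (p := p))
  let a₀ : L := σ.σ i (γ 0 0)
  let c₀ : L := σ.σ i (γ 1 0)
  let a : ℂ_[p] := algebraMap L ℂ_[p] a₀
  let c : ℂ_[p] := algebraMap L ℂ_[p] c₀
  refine ⟨MvPolynomial.C a₀⁻¹ *
    ∑ n ∈ Finset.range N, (-(MvPolynomial.C (c₀ * a₀⁻¹) * MvPolynomial.X i)) ^ n, fun z hz => ?_⟩
  have ea : emb σ (γ 0 0) i = a := rfl
  have ec : emb σ (γ 1 0) i = c := rfl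
  have na := h.norm_a i
  have nc := h.norm_c i
  have nd := h.norm_denom i (hS z hz i)
  rw [ea] at na nd
  rw [ec] at nc nd
  rw [ea, ec]
  have a0 : a ≠ 0 := by rw [← norm_ne_zero_iff, na]; exact one_ne_zero
  have d0 : a + c * z i ≠ 0 := by rw [← norm_ne_zero_iff, nd]; exact one_ne_zero
  set t : ℂ_[p] := -(c * a⁻¹ * z i) with ht
  have e1 : MvPolynomial.aeval z (MvPolynomial.C a₀⁻¹ *
      ∑ n ∈ Finset.range N, (-(MvPolynomial.C (c₀ * a₀⁻¹) * MvPolynomial.X i)) ^ n :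
      MvPolynomial (Fin 2) L) = a⁻¹ * ∑ n ∈ Finset.range N, t ^ n := by
    simp only [map_mul, map_sum, map_pow, map_neg, MvPolynomial.aeval_X, MvPolynomial.aeval_C, ht, map_inv₀]
    rfl
  have e2 : (a + c * z i)⁻¹ - a⁻¹ * ∑ n ∈ Finset.range N, t ^ n =
      t ^ N * (a + c * z i)⁻¹ := by
    have g := mul_neg_geom_sum t N
    have e3 : a + c * z i = a * (1 - t) := by rw [ht]; field_simp; ring
    have t0 : 1 - t ≠ 0 := by
      intro h0; rw [e3, h0, mul_zero] at d0; exact d0 rfl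
    rw [e3]
    field_simp
    linear_combination -g
  rw [e1, e2, norm_mul, norm_inv, nd, inv_one, mul_one, norm_pow]
  have nt : ‖t‖ ≤ ‖(p : ℂ_[p])‖ := by
    rw [ht, norm_neg, norm_mul, norm_mul, norm_inv, na, inv_one, mul_one]
    nlinarith [hS z hz i, norm_nonneg c, norm_nonneg (z i)]
  exact (pow_le_pow_left₀ (norm_nonneg _) nt N).trans hN.le

lemma InSigma0.approx_comp {σ : EmbPair p K L} {γ : GL (Fin 2) K} (h : InSigma0 σ γ)
    {S : Set (Fin 2 → ℂ_[p])} (hS : ∀ z ∈ S, ∀ i, ‖z i‖ ≤ 1) (P : MvPolynomial (Fin 2) L) :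
    Approx L S (fun z => MvPolynomial.aeval (moebius σ γ z) P) := by
  induction P using MvPolynomial.induction_on with
  | C a =>
    have := Approx.of_poly S (MvPolynomial.C a : MvPolynomial (Fin 2) L)
    simpa only [MvPolynomial.aeval_C] using this
  | add P Q hP hQ => simpa only [map_add] using hP.add hQ
  | mul_X P i hP =>
    have h1 := Approx.of_poly S (MvPolynomial.C (σ.σ i (γ 0 1)) +
      MvPolynomial.C (σ.σ i (γ 1 1)) * MvPolynomial.X i : MvPolynomial (Fin 2) L)
    have h2 := hP.mul hS (h1.mul hS (h.approx_inv hS i))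
    simp only [map_mul, map_add, MvPolynomial.aeval_C, MvPolynomial.aeval_X] at h2 ⊢
    exact h2

lemma approx_autFactor (κ : Fin 2 → ℕ) (σ : EmbPair p K L) (γ : GL (Fin 2) K)
    (S : Set (Fin 2 → ℂ_[p])) : Approx L S (autFactor κ σ γ) := by
  have h := Approx.of_poly S (∏ i, (MvPolynomial.C (σ.σ i (γ 0 0)) +
      MvPolynomial.C (σ.σ i (γ 1 0)) * MvPolynomial.X i) ^ κ i : MvPolynomial (Fin 2) L)
  have e : (fun z => MvPolynomial.aeval z (∏ i, (MvPolynomial.C (σ.σ i (γ 0 0)) +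
      MvPolynomial.C (σ.σ i (γ 1 0)) * MvPolynomial.X i) ^ κ i : MvPolynomial (Fin 2) L)) =
      autFactor κ σ γ := by
    funext z
    simp only [map_prod, map_pow, map_add, map_mul, MvPolynomial.aeval_C, MvPolynomial.aeval_X]
    rfl
  rwa [e] at h

lemma InSigma0.norm_autFactor (κ : Fin 2 → ℕ) {σ : EmbPair p K L} {γ : GL (Fin 2) K}
    (h : InSigma0 σ γ) {z : Fin 2 → ℂ_[p]} (hz : ∀ i, ‖z i‖ ≤ 1) : ‖autFactor κ σ γ z‖ = 1 := by
  rw [autFactor, norm_prod]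
  refine Finset.prod_eq_one fun i _ => ?_
  rw [norm_pow, h.norm_denom i (hz i), one_pow]

lemma norm_le_one_of_mem_nbhd {σ : EmbPair p K L} (r : Radii) {z : Fin 2 → ℂ_[p]}
    (hz : z ∈ nbhd σ r.1) (i : Fin 2) : ‖z i‖ ≤ 1 := by
  obtain ⟨u, hu, huz⟩ := hz
  exact norm_le_one_of_near hu i ((huz i).trans (r.2 i).2)

/-- The weight `κ = (k, ℓ)` action of `Σ₀(p)` on `𝔸[L, r₁, r₂]`:
`(γ · ζ)(x, y) = (a₁ + c₁x)^k (a₂ + c₂y)^ℓ ζ((b₁ + d₁x)/(a₁ + c₁x), (b₂ + d₂y)/(a₂ + c₂y))`. -/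
def rigidAct (κ : Fin 2 → ℕ) {σ : EmbPair p K L} {γ : GL (Fin 2) K} (h : InSigma0 σ γ)
    (r : Radii) : rigid σ r.1 →ₗ[L] rigid σ r.1 where
  toFun F := ⟨fun z => autFactor κ σ γ z.1 * F.1 ⟨moebius σ γ z.1, h.moebius_mem_nbhd r z.2⟩, by
    intro u hu ε hε
    set S : Set (Fin 2 → ℂ_[p]) := {z | z ∈ nbhd σ r.1 ∧ ∀ i, ‖z i - u i‖ ≤ r.1 i} with hSdef
    have hS : ∀ z ∈ S, ∀ i, ‖z i‖ ≤ 1 := fun z hz i => norm_le_one_of_mem_nbhd r hz.1 i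
    obtain ⟨Q, hQ⟩ := F.2 (moebius σ γ u) (h.moebius_mem_OKp hu) ε hε
    obtain ⟨P, hP⟩ := (approx_autFactor κ σ γ S).mul hS (h.approx_comp hS Q) ε hε
    refine ⟨P, fun z hz => ?_⟩
    have h1 := hP z.1 ⟨z.2, hz⟩
    have h2 := hQ ⟨moebius σ γ z.1, h.moebius_mem_nbhd r z.2⟩ fun i =>
      (h.norm_moebius_sub i (norm_le_one_of_mem_OKp hu i)
        (norm_le_one_of_mem_nbhd r z.2 i)).trans (hz i)
    have e : autFactor κ σ γ z.1 * F.1 ⟨moebius σ γ z.1, h.moebius_mem_nbhd r z.2⟩ -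
        MvPolynomial.aeval z.1 P =
        autFactor κ σ γ z.1 * (F.1 ⟨moebius σ γ z.1, h.moebius_mem_nbhd r z.2⟩ -
          MvPolynomial.aeval (moebius σ γ z.1) Q) +
        (autFactor κ σ γ z.1 * MvPolynomial.aeval (moebius σ γ z.1) Q -
          MvPolynomial.aeval z.1 P) := by ring
    rw [e]
    refine (IsUltrametricDist.norm_add_le_max _ _).trans (max_le ?_ h1)
    rw [norm_mul, h.norm_autFactor κ (norm_le_one_of_mem_nbhd r z.2), one_mul]
    exact h2⟩
  map_add' F G := by
    ext z
    simp only [Submodule.coe_add, Pi.add_apply, mul_add]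
  map_smul' c F := by
    ext z
    simp only [Submodule.coe_smul, Pi.smul_apply, RingHom.id_apply, mul_smul_comm]

open Classical in
/-- The right weight `κ` action of `Σ₀(p)` on `𝒟(L)` dual to the action on `𝔸[L, r₁, r₂]`:
`(μ|γ)(ζ) = μ(γ · ζ)`. (Extended by `0` to the matrices outside `Σ₀(p)`, which never occur below:
see `inSigma0_of_mem_Gam` and `inSigma0_of_mem_doubleCoset`.) -/
def distAct (κ : Fin 2 → ℕ) (σ : EmbPair p K L) (γ : GL (Fin 2) K) : Dist σ →ₗ[L] Dist σ :=
  if h : InSigma0 σ γ then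
    { toFun := fun μ => ⟨fun r => (μ.1 r).comp (rigidAct κ h r), by
        refine ⟨fun r => ?_, fun r s hrs F => ?_⟩
        · obtain ⟨B, hB⟩ := μ.2.1 r
          refine ⟨B, fun F M hM => hB _ M fun z => ?_⟩
          have : ‖autFactor κ σ γ z.1 * F.1 ⟨moebius σ γ z.1, h.moebius_mem_nbhd r z.2⟩‖ ≤ M := by
            rw [norm_mul, h.norm_autFactor κ (norm_le_one_of_mem_nbhd r z.2), one_mul]
            exact hM _
          exact this
        · exact μ.2.2 r s hrs (rigidAct κ h s F)⟩
      map_add' := fun _ _ => rfl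
      map_smul' := fun _ _ => rfl }
  else 0

/-- The grading on polynomials in `X, Y, X̄, Ȳ` that gives `X, Y` degree `(1, 0)` and `X̄, Ȳ` degree
`(0, 1)`. The variables are indexed as `X = (0, 0)`, `Y = (0, 1)`, `X̄ = (1, 0)`, `Ȳ = (1, 1)`. -/
def bideg (v : Fin 2 × Fin 2) : Fin 2 → ℕ := Pi.single v.1 1

/-- The space `V_{k,ℓ}(R)` of polynomials over `R` in `X, Y, X̄, Ȳ` that are homogeneous of degree `k`
in `X, Y` and of degree `ℓ` in `X̄, Ȳ`, where `κ = (k, ℓ)`. -/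
def Vpoly (R : Type*) [CommRing R] (κ : Fin 2 → ℕ) : Submodule R (MvPolynomial (Fin 2 × Fin 2) R) :=
  MvPolynomial.weightedHomogeneousSubmodule R bideg κ

/-- The substitution `X ↦ dX + bY`, `Y ↦ cX + aY`, `X̄ ↦ d̄X̄ + b̄Ȳ`, `Ȳ ↦ c̄X̄ + āȲ`, where the
coefficients are mapped to `L` by `σ₁` and the conjugate ones by `σ₂`. -/
def linSubst (σ : EmbPair p K L) (γ : GL (Fin 2) K) (v : Fin 2 × Fin 2) :
    MvPolynomial (Fin 2 × Fin 2) L :=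
  MvPolynomial.C (σ.σ v.1 (if v.2 = 0 then γ 1 1 else γ 1 0)) * MvPolynomial.X (v.1, 0) +
  MvPolynomial.C (σ.σ v.1 (if v.2 = 0 then γ 0 1 else γ 0 0)) * MvPolynomial.X (v.1, 1)

lemma linSubst_homogeneous (σ : EmbPair p K L) (γ : GL (Fin 2) K) (v : Fin 2 × Fin 2) :
    MvPolynomial.IsWeightedHomogeneous bideg (linSubst σ γ v) (bideg v) :=
  ((MvPolynomial.isWeightedHomogeneous_X L bideg (v.1, 0)).C_mul _).add
    ((MvPolynomial.isWeightedHomogeneous_X L bideg (v.1, 1)).C_mul _)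

lemma aeval_linSubst_mem (κ : Fin 2 → ℕ) (σ : EmbPair p K L) (γ : GL (Fin 2) K)
    {P : MvPolynomial (Fin 2 × Fin 2) L} (hP : P ∈ Vpoly L κ) :
    MvPolynomial.aeval (linSubst σ γ) P ∈ Vpoly L κ := by
  rw [MvPolynomial.aeval_def, MvPolynomial.eval₂_eq]
  refine Submodule.sum_mem _ fun d hd => ?_
  have h1 : MvPolynomial.IsWeightedHomogeneous bideg
      (∏ i ∈ d.support, linSubst σ γ i ^ d i) (∑ i ∈ d.support, d i • bideg i) :=
    MvPolynomial.IsWeightedHomogeneous.prod _ _ _ fun i _ => (linSubst_homogeneous σ γ i).pow _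
  have h2 : ∑ i ∈ d.support, d i • bideg i = κ := by
    have h3 := hP (MvPolynomial.mem_support_iff.mp hd)
    rwa [Finsupp.weight_apply] at h3
  rw [h2] at h1
  exact h1.C_mul _

/-- The action `(γ · P)(X, Y, X̄, Ȳ) = P(dX + bY, cX + aY, d̄X̄ + b̄Ȳ, c̄X̄ + āȲ)` on `V_{k,ℓ}(L)`. -/
def polyAct (κ : Fin 2 → ℕ) (σ : EmbPair p K L) (γ : GL (Fin 2) K) : Vpoly L κ →ₗ[L] Vpoly L κ :=
  (MvPolynomial.aeval (linSubst σ γ)).toLinearMap.restrict fun _ hP => aeval_linSubst_mem κ σ γ hP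

/-- The right action `(μ|γ)(P) = μ(γ · P)` on the dual space `V*_{k,ℓ}(L)`. -/
def dualAct (κ : Fin 2 → ℕ) (σ : EmbPair p K L) (γ : GL (Fin 2) K) :
    Module.Dual L (Vpoly L κ) →ₗ[L] Module.Dual L (Vpoly L κ) :=
  (polyAct κ σ γ).dualMap

/-- The point with coordinates `(X, Y, X̄, Ȳ) = (x, 1, y, 1)`. -/
def affinePt {R : Type*} [One R] (z : Fin 2 → R) (v : Fin 2 × Fin 2) : R :=
  if v.2 = 0 then z v.1 else 1

/-- The inclusion of `V_{k,ℓ}(L)` into the rigid analytic functions,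
`P ↦ ((x, y) ↦ P(x, 1, y, 1))`. -/
def polyToRigid (κ : Fin 2 → ℕ) (σ : EmbPair p K L) (r : Fin 2 → ℝ) :
    Vpoly L κ →ₗ[L] rigid σ r where
  toFun P := ⟨fun z => MvPolynomial.aeval (affinePt z.1) P.1, fun u _ ε hε =>
    ⟨MvPolynomial.aeval (affinePt MvPolynomial.X) P.1, fun z _ => by
      have e : MvPolynomial.aeval z.1
          (MvPolynomial.aeval (affinePt MvPolynomial.X) P.1 : MvPolynomial (Fin 2) L) =
          MvPolynomial.aeval (affinePt z.1) P.1 := by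
        rw [← AlgHom.comp_apply]
        congr 1
        ext v
        simp only [AlgHom.comp_apply, MvPolynomial.aeval_X, affinePt]
        split_ifs <;> simp
      rw [e, sub_self, norm_zero]
      exact hε.le⟩⟩
  map_add' P Q := by
    ext z
    simp
  map_smul' c P := by
    ext z
    simp

/-- The pair of radii `(1, 1)`. -/
def Radii.one : Radii := ⟨fun _ => 1, fun _ => ⟨one_pos, le_rfl⟩⟩

/-- The map `𝒟_{k,ℓ}(L) → V*_{k,ℓ}(L)` dual to the inclusion of `V_{k,ℓ}(L)` into the locally
analytic functions. -/
def specialize (κ : Fin 2 → ℕ) (σ : EmbPair p K L) :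
    Dist σ →ₗ[L] Module.Dual L (Vpoly L κ) where
  toFun μ := (μ.1 Radii.one).comp (polyToRigid κ σ Radii.one.1)
  map_add' _ _ := rfl
  map_smul' _ _ := rfl

end Coefficients

section Symbols

variable {K : Type*} [Field K] [DecidableEq K]

/-- The degree of a divisor on a set `C` of cusps in `ℙ¹(K) = K ∪ {∞}`. -/
def degree (C : Set (OnePoint K)) : (C →₀ ℤ) →+ ℤ :=
  Finsupp.liftAddHom fun _ => AddMonoidHom.id ℤ

/-- The group `Δ⁰_C` of divisors of degree `0` on `C`. -/
def Div0 (C : Set (OnePoint K)) : AddSubgroup (C →₀ ℤ) := (degree C).ker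

/-- The map `D ↦ γ · D` from divisors on `C` to divisors on `C'`, for `γ` mapping `C` into `C'`. -/
def moveDiv {C C' : Set (OnePoint K)} (γ : GL (Fin 2) K) (h : ∀ x ∈ C, γ • x ∈ C') :
    Div0 C →+ Div0 C' :=
  ((Finsupp.mapDomain.addMonoidHom fun x : C => (⟨γ • x.1, h x.1 x.2⟩ : C')).comp
    (Div0 C).subtype).codRestrict (Div0 C') fun D => by
      have e : (degree C').comp
          (Finsupp.mapDomain.addMonoidHom fun x : C => (⟨γ • x.1, h x.1 x.2⟩ : C')) =
          degree C := by
        ext x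
        simp [degree]
      have h2 := DFunLike.congr_fun e D.1
      have h3 : degree C D.1 = 0 := D.2
      rw [h3] at h2
      exact h2

variable {L M : Type*} [Field L] [AddCommGroup M] [Module L M]

/-- The operator `(φ|γ)(D) = φ(γ · D)|γ`, where `act γ` is the right action of `γ` on `M`. -/
def slash (act : GL (Fin 2) K → M →ₗ[L] M) {C C' : Set (OnePoint K)} (γ : GL (Fin 2) K)
    (h : ∀ x ∈ C, γ • x ∈ C') : (Div0 C' →+ M) →ₗ[L] (Div0 C →+ M) where
  toFun φ := ((act γ).toAddMonoidHom.comp φ).comp (moveDiv γ h)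
  map_add' φ ψ := by
    ext D
    simp
  map_smul' c φ := by
    ext D
    simp

/-- The space `Symb_{Γ,C}(M)` of partial modular symbols on `C` for `Γ` with values in `M`: the
`Γ`-invariant homomorphisms from `Δ⁰_C` to `M`. -/
def Symb (act : GL (Fin 2) K → M →ₗ[L] M) (Γ : Subgroup (GL (Fin 2) K)) (C : Set (OnePoint K))
    (hC : ∀ γ ∈ Γ, ∀ x ∈ C, γ • x ∈ C) : Submodule L (Div0 C →+ M) where
  carrier := {φ | ∀ γ (hγ : γ ∈ Γ), slash act γ (hC γ hγ) φ = φ}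
  zero_mem' := fun _ _ => map_zero _
  add_mem' := fun h1 h2 γ hγ => by rw [map_add, h1 γ hγ, h2 γ hγ]
  smul_mem' := fun c _ h γ hγ => by rw [map_smul, h γ hγ]

/-- The double coset operator `φ|[Γ' g Γ] = ∑ φ|γ`, the sum being over representatives `γ` of
`Γ' \ Γ' g Γ` (a finite set for the congruence subgroups below). On `Γ'`-invariant `φ` it does not
depend on the choice of the representatives. -/
def doubleCosetOp (act : GL (Fin 2) K → M →ₗ[L] M) (Γ' Γ : Subgroup (GL (Fin 2) K))
    (g : GL (Fin 2) K) {C C' : Set (OnePoint K)}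
    (h : ∀ γ ∈ DoubleCoset.doubleCoset g (Γ' : Set (GL (Fin 2) K)) Γ, ∀ x ∈ C, γ • x ∈ C') :
    (Div0 C' →+ M) →ₗ[L] (Div0 C →+ M) :=
  ∑ᶠ q : {q : Quotient (QuotientGroup.rightRel Γ') //
      q.out ∈ DoubleCoset.doubleCoset g (Γ' : Set (GL (Fin 2) K)) Γ},
    slash act q.1.out (h q.1.out q.2)

end Symbols

section Level

variable {K : Type*} [Field K] [NumberField K]

lemma coe_mul_inv_le_one (I 𝔞 : Ideal (𝓞 K)) :
    (I : FractionalIdeal (𝓞 K)⁰ K) * ((𝔞 : FractionalIdeal (𝓞 K)⁰ K) *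
      (I : FractionalIdeal (𝓞 K)⁰ K)⁻¹) ≤ 1 := by
  by_cases hI : (I : FractionalIdeal (𝓞 K)⁰ K) = 0
  · rw [hI, zero_mul]; exact zero_le
  · rw [mul_left_comm, mul_inv_cancel₀ hI, mul_one]
    exact FractionalIdeal.coeIdeal_le_one

/-- The group `Γ_i(𝔞)` for the representative `I = I_i`: matrices `(a, b; c, d)` in `SL₂(K)` with
`a, d ∈ 𝓞_K`, `b ∈ I` and `c ∈ 𝔞 I⁻¹`. -/
def Gam (I 𝔞 : Ideal (𝓞 K)) : Subgroup (GL (Fin 2) K) where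
  carrier := {γ | γ 0 0 * γ 1 1 - γ 0 1 * γ 1 0 = 1 ∧
    γ 0 0 ∈ (1 : FractionalIdeal (𝓞 K)⁰ K) ∧ γ 1 1 ∈ (1 : FractionalIdeal (𝓞 K)⁰ K) ∧
    γ 0 1 ∈ (I : FractionalIdeal (𝓞 K)⁰ K) ∧
    γ 1 0 ∈ (𝔞 : FractionalIdeal (𝓞 K)⁰ K) * (I : FractionalIdeal (𝓞 K)⁰ K)⁻¹}
  one_mem' := by
    refine ⟨by simp, ?_, ?_, ?_, ?_⟩
    · simp
    · simp
    · simp [FractionalIdeal.zero_mem]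
    · simp [FractionalIdeal.zero_mem]
  mul_mem' := by
    rintro γ δ ⟨h0, ha, hd, hb, hc⟩ ⟨k0, ka, kd, kb, kc⟩
    have key := coe_mul_inv_le_one I 𝔞
    have add := fun {J : FractionalIdeal (𝓞 K)⁰ K} {x y : K} (hx : x ∈ J) (hy : y ∈ J) =>
      Submodule.add_mem (J : Submodule (𝓞 K) K) hx hy
    have e : ∀ i j, (γ * δ) i j = γ i 0 * δ 0 j + γ i 1 * δ 1 j := fun i j => by
      simp [Matrix.mul_apply, Fin.sum_univ_two]
    refine ⟨?_, ?_, ?_, ?_, ?_⟩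
    · simp only [e]; linear_combination (δ 0 0 * δ 1 1 - δ 0 1 * δ 1 0) * h0 + k0
    · rw [e]
      refine add ?_ (key (FractionalIdeal.mul_mem_mul hb kc))
      simpa using FractionalIdeal.mul_mem_mul ha ka
    · rw [e]
      refine add ?_ ?_
      · rw [mul_comm]; exact key (FractionalIdeal.mul_mem_mul kb hc)
      · simpa using FractionalIdeal.mul_mem_mul hd kd
    · rw [e]
      refine add ?_ ?_
      · simpa using FractionalIdeal.mul_mem_mul ha kb
      · simpa using FractionalIdeal.mul_mem_mul hb kd
    · rw [e]
      refine add ?_ ?_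
      · have := FractionalIdeal.mul_mem_mul hc ka
        rwa [mul_one] at this
      · have := FractionalIdeal.mul_mem_mul hd kc
        rwa [one_mul] at this
  inv_mem' := by
    rintro γ ⟨h0, ha, hd, hb, hc⟩
    have neg := fun {J : FractionalIdeal (𝓞 K)⁰ K} {x : K} (hx : x ∈ J) =>
      Submodule.neg_mem (J : Submodule (𝓞 K) K) hx
    have e : ((γ⁻¹ : GL (Fin 2) K) : Matrix (Fin 2) (Fin 2) K) =
        !![γ 1 1, -γ 0 1; -γ 1 0, γ 0 0] := by
      have hdet : (γ : Matrix (Fin 2) (Fin 2) K).det = 1 := by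
        rw [Matrix.det_fin_two]; exact h0
      rw [Matrix.coe_units_inv, Matrix.inv_def, hdet, Matrix.adjugate_fin_two]
      simp
    refine ⟨?_, ?_, ?_, ?_, ?_⟩
    · rw [e]; simp; linear_combination h0
    · rw [e]; exact hd
    · rw [e]; exact ha
    · rw [e]; exact neg hb
    · rw [e]; exact neg hc

/-- Representatives `I_i` of the ideal classes of `K`, indexed by the class group: integral, coprime
to `𝔫` and to the different, with `I₁ = 𝓞_K` and the others prime. -/
structure ClassReps (𝔫 : Ideal (𝓞 K)) where
  I : ClassGroup (𝓞 K) → Ideal (𝓞 K)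
  ne_zero : ∀ i, I i ≠ 0
  class_eq : ∀ i, ClassGroup.mk0 ⟨I i, mem_nonZeroDivisors_of_ne_zero (ne_zero i)⟩ = i
  I_one : I 1 = ⊤
  isPrime : ∀ i, i ≠ 1 → (I i).IsPrime
  coprime_level : ∀ i, IsCoprime (I i) 𝔫
  coprime_different : ∀ i, IsCoprime (I i) (differentIdeal ℤ (𝓞 K))

/-- The prime ideals of `𝓞_K` above `p`. -/
abbrev PrimesAbove (K : Type*) [Field K] [NumberField K] (p : ℕ) : Set (Ideal (𝓞 K)) :=
  (Ideal.span {(p : ℤ)}).primesOver (𝓞 K)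

/-- For each prime `𝔭` above `p` and each `i`, the index `j_i` and a generator `α_i ∈ Kˣ` with
`𝔭 I_i = (α_i) I_{j_i}`. -/
structure HeckeData (p : ℕ) {𝔫 : Ideal (𝓞 K)} (R : ClassReps 𝔫) where
  j : PrimesAbove K p → ClassGroup (𝓞 K) → ClassGroup (𝓞 K)
  α : PrimesAbove K p → ClassGroup (𝓞 K) → Kˣ
  mul_eq : ∀ (𝔭 : PrimesAbove K p) (i : ClassGroup (𝓞 K)), ((𝔭 : Ideal (𝓞 K)) : FractionalIdeal (𝓞 K)⁰ K) * (R.I i) =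
    FractionalIdeal.spanSingleton (𝓞 K)⁰ (α 𝔭 i : K) * (R.I (j 𝔭 i))

/-- The matrix `(1, 0; 0, α)`. -/
def diagMat {K : Type*} [Field K] (α : Kˣ) : GL (Fin 2) K :=
  Matrix.GeneralLinearGroup.mkOfDetNeZero !![1, 0; 0, (α : K)] (by simp)

section Sigma0

variable {p : ℕ} [Fact p.Prime] {L : Type*} [Field L] [Algebra L ℂ_[p]]

lemma emb_mem_of_mul_mem {σ : EmbPair p K L} {x : K} {y z t : 𝓞 K}
    (hy : y + p * z = 1) (hxy : x * y = t) : emb σ x ∈ OKp σ := by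
  obtain ⟨v, hv, h⟩ := exists_inv_one_add (neg_mem (emb_mem_OKp σ z))
  have e : emb σ x = emb σ (t : K) * v := by
    have h1 := congrArg (fun a : 𝓞 K => emb σ (a : K)) hy
    simp only [map_add, map_mul, map_one, map_natCast] at h1
    have h2 := congrArg (emb σ) hxy
    rw [map_mul] at h2
    linear_combination v * h2 - (emb σ x) * h - v * (emb σ x) * h1
  rw [e]
  exact mul_mem (emb_mem_OKp σ t) hv

lemma exists_of_coprime {I 𝔪 : Ideal (𝓞 K)}
    (h : IsCoprime I (Ideal.span {(p : 𝓞 K)} * 𝔪)) : ∃ y ∈ I, ∃ z : 𝓞 K, y + p * z = 1 := by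
  obtain ⟨y, hy, w, hw, h1⟩ := Ideal.isCoprime_iff_exists.mp h
  have hw' : w ∈ Ideal.span {(p : 𝓞 K)} := Ideal.mul_le_left hw
  obtain ⟨z, hz⟩ := Ideal.mem_span_singleton.mp hw'
  exact ⟨y, hy, z, hz ▸ h1⟩

lemma inSigma0_of_mem_Gam {σ : EmbPair p K L} {I 𝔪 : Ideal (𝓞 K)} (hI : I ≠ 0)
    (h : IsCoprime I (Ideal.span {(p : 𝓞 K)} * 𝔪)) {γ : GL (Fin 2) K}
    (hγ : γ ∈ Gam I (Ideal.span {(p : 𝓞 K)} * 𝔪)) : InSigma0 σ γ := by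
  obtain ⟨h0, ha, hd, hb, hc⟩ := hγ
  obtain ⟨y, hyI, z, hyz⟩ := exists_of_coprime h
  obtain ⟨a, ha⟩ := (FractionalIdeal.mem_one_iff _).mp ha
  obtain ⟨d, hd⟩ := (FractionalIdeal.mem_one_iff _).mp hd
  obtain ⟨b, -, hb⟩ := (FractionalIdeal.mem_coeIdeal _).mp hb
  have hcy := FractionalIdeal.mul_mem_mul hc (FractionalIdeal.mem_coeIdeal_of_mem (𝓞 K)⁰ hyI)
  have hI0 : (I : FractionalIdeal (𝓞 K)⁰ K) ≠ 0 := FractionalIdeal.coeIdeal_ne_zero.mpr hI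
  rw [mul_assoc, inv_mul_cancel₀ hI0, mul_one] at hcy
  obtain ⟨w, hw, hw2⟩ := (FractionalIdeal.mem_coeIdeal _).mp hcy
  obtain ⟨t, rfl⟩ := Ideal.mem_span_singleton.mp (Ideal.mul_le_left hw)
  have hp0 : (p : K) ≠ 0 := Nat.cast_ne_zero.mpr (Fact.out : p.Prime).ne_zero
  have hc' : emb σ (γ 1 0 / p) ∈ OKp σ := by
    refine emb_mem_of_mul_mem (t := t) hyz ?_
    rw [map_mul, map_natCast] at hw2
    field_simp
    exact hw2.symm
  have hcc : emb σ (γ 1 0) = (p : Fin 2 → ℂ_[p]) * emb σ (γ 1 0 / p) := by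
    rw [← map_natCast (emb σ), ← map_mul]
    congr 1
    field_simp
  have hent : ∀ i j, emb σ (γ i j) ∈ OKp σ := by
    intro i j
    have m00 : emb σ (γ 0 0) ∈ OKp σ := ha ▸ emb_mem_OKp σ a
    have m01 : emb σ (γ 0 1) ∈ OKp σ := hb ▸ emb_mem_OKp σ b
    have m10 : emb σ (γ 1 0) ∈ OKp σ := hcc ▸ mul_mem (natCast_mem _ p) hc'
    have m11 : emb σ (γ 1 1) ∈ OKp σ := hd ▸ emb_mem_OKp σ d
    fin_cases i <;> fin_cases j <;> assumption
  refine ⟨hent, ⟨_, hc', hcc⟩, ?_⟩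
  obtain ⟨v, hv, hv2⟩ := exists_inv_one_add (mul_mem (hent 0 1) hc')
  refine ⟨emb σ (γ 1 1) * v, mul_mem (hent 1 1) hv, ?_⟩
  have h5 := congrArg (emb σ) h0
  rw [map_sub, map_mul, map_mul, map_one, hcc] at h5
  linear_combination hv2 + v * h5

lemma inSigma0_diagMat {σ : EmbPair p K L} {𝔪 : Ideal (𝓞 K)}
    {R : ClassReps (Ideal.span {(p : 𝓞 K)} * 𝔪)} (H : HeckeData p R) (𝔭 : PrimesAbove K p)
    (i : ClassGroup (𝓞 K)) : InSigma0 σ (diagMat (H.α 𝔭 i)) := by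
  obtain ⟨y, hyI, z, hyz⟩ := exists_of_coprime (R.coprime_level (H.j 𝔭 i))
  have h1 := FractionalIdeal.mul_mem_mul
    (FractionalIdeal.mem_spanSingleton_self (𝓞 K)⁰ (H.α 𝔭 i : K))
    (FractionalIdeal.mem_coeIdeal_of_mem (𝓞 K)⁰ hyI)
  rw [← H.mul_eq, ← FractionalIdeal.coeIdeal_mul] at h1
  obtain ⟨t, -, ht⟩ := (FractionalIdeal.mem_coeIdeal _).mp h1
  have hα : emb σ (H.α 𝔭 i : K) ∈ OKp σ := emb_mem_of_mul_mem hyz ht.symm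
  refine ⟨fun a b => ?_, ⟨0, zero_mem _, ?_⟩, 1, one_mem _, ?_⟩
  · fin_cases a <;> fin_cases b <;> simp [diagMat, Matrix.GeneralLinearGroup.mkOfDetNeZero, hα]
  · simp [diagMat, Matrix.GeneralLinearGroup.mkOfDetNeZero]
  · simp [diagMat, Matrix.GeneralLinearGroup.mkOfDetNeZero]

lemma inSigma0_of_mem_doubleCoset {σ : EmbPair p K L} {𝔪 : Ideal (𝓞 K)}
    {R : ClassReps (Ideal.span {(p : 𝓞 K)} * 𝔪)} (H : HeckeData p R) (𝔭 : PrimesAbove K p)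
    (i : ClassGroup (𝓞 K)) {γ : GL (Fin 2) K}
    (hγ : γ ∈ DoubleCoset.doubleCoset (diagMat (H.α 𝔭 i))
      (Gam (R.I (H.j 𝔭 i)) (Ideal.span {(p : 𝓞 K)} * 𝔪) : Set (GL (Fin 2) K))
      (Gam (R.I i) (Ideal.span {(p : 𝓞 K)} * 𝔪))) : InSigma0 σ γ := by
  obtain ⟨x, hx, y, hy, rfl⟩ := DoubleCoset.mem_doubleCoset.mp hγ
  exact ((inSigma0_of_mem_Gam (R.ne_zero _) (R.coprime_level _) hx).mul
    (inSigma0_diagMat H 𝔭 i)).mul (inSigma0_of_mem_Gam (R.ne_zero _) (R.coprime_level _) hy)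

end Sigma0

variable [DecidableEq K]

/-- A family `𝐂 = (𝐂_i)` of non-empty `Γ_i(𝔫)`-invariant subsets `𝐂_i` of `ℙ¹(K)` on which the
operators `U_𝔭`, for `𝔭` above `p`, act: `(1, 0; 0, α_i)` maps `𝐂_i` into `𝐂_{j_i}`. -/
structure CuspFamily {p : ℕ} {𝔫 : Ideal (𝓞 K)} {R : ClassReps 𝔫} (H : HeckeData p R) where
  cusps : ClassGroup (𝓞 K) → Set (OnePoint K)
  nonempty : ∀ i, (cusps i).Nonempty
  invariant : ∀ i, ∀ γ ∈ Gam (R.I i) 𝔫, ∀ x ∈ cusps i, γ • x ∈ cusps i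
  stable : ∀ 𝔭 i, ∀ x ∈ cusps i, diagMat (H.α 𝔭 i) • x ∈ cusps (H.j 𝔭 i)

/-- The set of cusps `C_i = Γ_i(𝔪)∞ ∪ Γ_i(𝔪)0`, for the representative `I = I_i`. -/
def standardCusps (I 𝔪 : Ideal (𝓞 K)) : Set (OnePoint K) :=
  {x | ∃ γ ∈ Gam I 𝔪, x = γ • (OnePoint.infty : OnePoint K) ∨ x = γ • ((0 : K) : OnePoint K)}

variable {p : ℕ} {𝔫 : Ideal (𝓞 K)} {R : ClassReps 𝔫} {H : HeckeData p R}

lemma CuspFamily.doubleCoset_smul_mem (C : CuspFamily H) (𝔭 : PrimesAbove K p)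
    (i : ClassGroup (𝓞 K)) : ∀ γ ∈ DoubleCoset.doubleCoset (diagMat (H.α 𝔭 i))
      (Gam (R.I (H.j 𝔭 i)) 𝔫 : Set (GL (Fin 2) K)) (Gam (R.I i) 𝔫),
      ∀ x ∈ C.cusps i, γ • x ∈ C.cusps (H.j 𝔭 i) := by
  intro γ hγ x hx
  obtain ⟨a, ha, b, hb, rfl⟩ := DoubleCoset.mem_doubleCoset.mp hγ
  rw [mul_smul, mul_smul]
  exact C.invariant _ a ha _ (C.stable 𝔭 i _ (C.invariant _ b hb x hx))

variable {L M : Type*} [Field L] [AddCommGroup M] [Module L M]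

/-- Families `(φ_i)_i` of homomorphisms `φ_i : Δ⁰_{𝐂_i} → M`. -/
def HomFam (C : CuspFamily H) (M : Type*) [AddCommGroup M] : Type _ :=
  ∀ i, Div0 (C.cusps i) →+ M

instance (C : CuspFamily H) : AddCommGroup (HomFam C M) :=
  inferInstanceAs (AddCommGroup (∀ i, Div0 (C.cusps i) →+ M))

instance (C : CuspFamily H) : Module L (HomFam C M) :=
  inferInstanceAs (Module L (∀ i, Div0 (C.cusps i) →+ M))

/-- The space `⨁_i Symb_{Γ_i(𝔫), 𝐂_i}(M)` of partial Bianchi modular symbols on `𝐂` of level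
`K₀(𝔫)` with values in `M`. -/
def BianchiSymb (act : GL (Fin 2) K → M →ₗ[L] M) (C : CuspFamily H) :
    Submodule L (HomFam C M) :=
  Submodule.pi Set.univ fun i => Symb act (Gam (R.I i) 𝔫) (C.cusps i) (C.invariant i)

/-- The Hecke operator `U_𝔭`: the `i`-th component of `(φ_i)_i | U_𝔭` is
`φ_{j_i} | [Γ_{j_i}(𝔫) (1, 0; 0, α_i) Γ_i(𝔫)]`. -/
def heckeU (act : GL (Fin 2) K → M →ₗ[L] M) (C : CuspFamily H) (𝔭 : PrimesAbove K p) :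
    Module.End L (HomFam C M) :=
  LinearMap.pi fun i => (doubleCosetOp act (Gam (R.I (H.j 𝔭 i)) 𝔫) (Gam (R.I i) 𝔫)
    (diagMat (H.α 𝔭 i)) (C.doubleCoset_smul_mem 𝔭 i)).comp (LinearMap.proj (H.j 𝔭 i))

/-- The simultaneous eigenspace of the operators `U_𝔭`, `𝔭` above `p`, with eigenvalues `lam 𝔭` in
the space of partial Bianchi modular symbols. -/
def eigenSymb (act : GL (Fin 2) K → M →ₗ[L] M) (C : CuspFamily H) (lam : PrimesAbove K p → Lˣ) :
    Submodule L (HomFam C M) :=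
  BianchiSymb act C ⊓ ⨅ 𝔭, (heckeU act C 𝔭).eigenspace (lam 𝔭 : L)

/-- The restriction of the linear map `f` to the subspaces `A` and `B` is an isomorphism `A ≅ B`. -/
def RestrictsToIso {V W : Type*} [AddCommGroup V] [Module L V] [AddCommGroup W] [Module L W]
    (f : V →ₗ[L] W) (A : Submodule L V) (B : Submodule L W) : Prop :=
  ∃ e : A ≃ₗ[L] B, ∀ x : A, (e x : W) = f x

/-- Composition of the members of a family of homomorphisms with a linear map. -/
def HomFam.map {N : Type*} [AddCommGroup N] [Module L N] (C : CuspFamily H) (f : M →ₗ[L] N) :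
    HomFam C M →ₗ[L] HomFam C N where
  toFun Φ := fun i => f.toAddMonoidHom.comp (Φ i)
  map_add' Φ Ψ := by
    funext i
    ext D
    exact map_add f _ _
  map_smul' c Φ := by
    funext i
    ext D
    exact map_smul f _ _

end Level

section Control

variable {K : Type*} [Field K] [NumberField K] [DecidableEq K] {p : ℕ} [Fact p.Prime]
  {L : Type*} [Field L] [Algebra L ℂ_[p]]

/-- The specialization map `ρ`, obtained by composing symbols with `𝒟_{k,ℓ}(L) → V*_{k,ℓ}(L)`. -/
def specMap (κ : Fin 2 → ℕ) (σ : EmbPair p K L) {𝔫 : Ideal (𝓞 K)} {R : ClassReps 𝔫}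
    {H : HeckeData p R} (C : CuspFamily H) :
    HomFam C (Dist σ) →ₗ[L] HomFam C (Module.Dual L (Vpoly L κ)) :=
  HomFam.map C (specialize κ σ)

/-- The `p`-adic valuation on `L ⊆ ℂ_p` with `v_p(p) = 1` (for non-zero arguments). -/
def vp (p : ℕ) [Fact p.Prime] {L : Type*} [Field L] [Algebra L ℂ_[p]] (x : L) : ℝ := -Real.logb p ‖algebraMap L ℂ_[p] x‖

/-- The small slope condition. If there is only one prime `𝔭` above `p`, with ramification index
`e`, then `v_p(λ_𝔭) < (min{k, ℓ} + 1) / e`. If `p` splits as `𝔭 𝔮` with `𝔭` the prime induced by the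
embedding `σ₁` (the one for the weight `k`), then `v_p(λ_𝔭) < k + 1` and `v_p(λ_𝔮) < ℓ + 1`. -/
def SmallSlope (σ : EmbPair p K L) (k ℓ : ℕ) (lam : PrimesAbove K p → Lˣ) : Prop :=
  (∀ 𝔭 : PrimesAbove K p, (∀ 𝔮 : PrimesAbove K p, 𝔮 = 𝔭) →
    vp p (lam 𝔭 : L) < ((min k ℓ : ℕ) + 1 : ℝ) / ((𝔭 : Ideal (𝓞 K)).ramificationIdx ℤ : ℝ)) ∧
  (∀ 𝔭 𝔮 : PrimesAbove K p, 𝔭 ≠ 𝔮 → (∀ x ∈ (𝔭 : Ideal (𝓞 K)), ‖emb σ (x : K) 0‖ < 1) →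
    vp p (lam 𝔭 : L) < k + 1 ∧ vp p (lam 𝔮 : L) < ℓ + 1)

end Control

end Bianchi

namespace Bianchi
-- Distributions, their norms, and families of test functions
section Distributions

variable {p : ℕ} [Fact p.Prime] {L : Type*} [Field L] [Algebra L ℂ_[p]] {K : Type*} [Field K]
  {σ : EmbPair p K L} {κ : Fin 2 → ℕ}

/-! The operator `U_𝔭` acts through matrices `(1, b; 0, α)`, hence on functions through
substitutions `z ↦ b + αz` with `α` small at an embedding `σ_s` that induces `𝔭`. Such a
substitution multiplies the `m`-th Taylor coefficient by `α ^ m`, so the new function is a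
polynomial of degree at most `k` up to an error of size `|α| ^ (k + 1)`. A distribution that
vanishes on polynomials sees only this error. Hence on the kernel of specialization the operators
`λ⁻ⁿ U_𝔭ⁿ` tend to `0` geometrically once `|λ|` exceeds the `(k + 1)`-st power of the size of the
elements of `𝔭`, and this is the slope condition (`norm_pullback_sub_interp_le`,
`contracts_of_contractsMat`).

Injectivity: an eigensymbol in the kernel equals `λ⁻ⁿ U_𝔭ⁿ` of itself, so it vanishes
(`eqMod_zero_of_contracts`). Surjectivity: a symbol with values in `V*` is lifted to bounded
homomorphisms without any equivariance, and `λ⁻ⁿ U_𝔭ⁿ` of the lift converges. The failure of the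
lift to be invariant or an eigenvector takes values in the kernel, so the contraction removes it in
the limit (`exists_lift_of_contracts`).

Both arguments need symbols whose values are bounded in each norm. As `Σ₀(p)` does not increase
norms, it suffices to bound finitely many values, provided that `Γ_i(𝔫)` contains a finitely
generated subgroup with finitely many orbits on `ℙ¹(K)` (`exists_le_Gam`,
`exists_forall_mem_of_stable`). This is proved for principal congruence subgroups by a Euclidean
descent on determinants, using that `𝓞_K` has finitely many units.

For split `p` one passes through an intermediate space: distributions on functions that are
polynomials of degree at most `k` in `x`. Going from `V*` to this space uses only the second
coordinate and the prime of `σ₂`; going on to all distributions uses only the first coordinate and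
the prime of `σ₁`. This is why the two slopes are bounded separately. `TestProj` describes the space
of test functions reached, and the submodule `N` the distributions that vanish on the previous one,
so that a single lifting theorem covers both stages and the single stage for a unique prime. The
eigenvalue at the other prime is carried along by uniqueness, since a power of the contracting
operator commutes with all operators (`exists_eigen_lift`).

In the second assertion principality gives `j_i = i` and makes `α_i` a generator of `𝔭`; the image
of a column under `(1, 0; 0, α_i)` is then completed explicitly to a matrix of `Γ_i(𝔪)`
(`diagMat_smul_mem_standardCusps`). -/

lemma zero_mem_nbhd (r : Radii) : (0 : Fin 2 → ℂ_[p]) ∈ nbhd σ r.1 :=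
  ⟨0, zero_mem _, fun i => by simpa using (r.2 i).1.le⟩

lemma nonneg_of_bound {r : Radii} {F : nbhd σ r.1 → ℂ_[p]} {M : ℝ} (h : ∀ z, ‖F z‖ ≤ M) :
    0 ≤ M :=
  (norm_nonneg _).trans (h ⟨0, zero_mem_nbhd r⟩)

lemma rigidAct_apply {γ : GL (Fin 2) K} (h : InSigma0 σ γ) (r : Radii) (F : rigid σ r.1)
    (z : nbhd σ r.1) : (rigidAct κ h r F).1 z =
      autFactor κ σ γ z.1 * F.1 ⟨moebius σ γ z.1, h.moebius_mem_nbhd r z.2⟩ := rfl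

lemma distAct_apply {γ : GL (Fin 2) K} (h : InSigma0 σ γ) (μ : Dist σ) (r : Radii)
    (F : rigid σ r.1) : (distAct κ σ γ μ).1 r F = μ.1 r (rigidAct κ h r F) := by
  rw [distAct, dif_pos h]; rfl

lemma InSigma0.denom_ne_zero {γ : GL (Fin 2) K} (h : InSigma0 σ γ) (i : Fin 2) {z : ℂ_[p]}
    (hz : ‖z‖ ≤ 1) : emb σ (γ 0 0) i + emb σ (γ 1 0) i * z ≠ 0 := by
  rw [← norm_ne_zero_iff, h.norm_denom i hz]
  exact one_ne_zero

lemma emb_mul_apply (γ δ : GL (Fin 2) K) (i j l) : emb σ ((γ * δ) i j) l =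
    emb σ (γ i 0) l * emb σ (δ 0 j) l + emb σ (γ i 1) l * emb σ (δ 1 j) l := by
  have : (γ * δ) i j = γ i 0 * δ 0 j + γ i 1 * δ 1 j := by
    simp [Matrix.mul_apply, Fin.sum_univ_two]
  rw [this, map_add, map_mul, map_mul]; rfl

lemma denom_mul {γ : GL (Fin 2) K} (hγ : InSigma0 σ γ) (δ : GL (Fin 2) K) {z : Fin 2 → ℂ_[p]}
    (hz : ∀ i, ‖z i‖ ≤ 1) (i : Fin 2) :
    emb σ ((γ * δ) 0 0) i + emb σ ((γ * δ) 1 0) i * z i =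
      (emb σ (γ 0 0) i + emb σ (γ 1 0) i * z i) *
        (emb σ (δ 0 0) i + emb σ (δ 1 0) i * moebius σ γ z i) := by
  have := hγ.denom_ne_zero i (hz i)
  rw [moebius, emb_mul_apply, emb_mul_apply]
  field_simp
  ring

lemma moebius_mul {γ δ : GL (Fin 2) K} (hγ : InSigma0 σ γ) {z : Fin 2 → ℂ_[p]}
    (hz : ∀ i, ‖z i‖ ≤ 1) : moebius σ (γ * δ) z = moebius σ δ (moebius σ γ z) := by
  funext i
  have h0 := hγ.denom_ne_zero i (hz i)
  have key := denom_mul hγ δ hz i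
  have num : emb σ ((γ * δ) 0 1) i + emb σ ((γ * δ) 1 1) i * z i =
      (emb σ (γ 0 0) i + emb σ (γ 1 0) i * z i) *
        (emb σ (δ 0 1) i + emb σ (δ 1 1) i * moebius σ γ z i) := by
    rw [moebius, emb_mul_apply, emb_mul_apply]
    field_simp
    ring
  rw [moebius, key, num, mul_div_mul_left _ _ h0]
  rfl

lemma autFactor_mul {γ δ : GL (Fin 2) K} (hγ : InSigma0 σ γ) {z : Fin 2 → ℂ_[p]}
    (hz : ∀ i, ‖z i‖ ≤ 1) : autFactor κ σ (γ * δ) z =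
      autFactor κ σ γ z * autFactor κ σ δ (moebius σ γ z) := by
  simp only [autFactor, ← Finset.prod_mul_distrib]
  refine Finset.prod_congr rfl fun i _ => ?_
  rw [denom_mul hγ δ hz i, mul_pow]

lemma distAct_mul {γ δ : GL (Fin 2) K} (hγ : InSigma0 σ γ) (hδ : InSigma0 σ δ) (μ : Dist σ) :
    distAct κ σ (γ * δ) μ = distAct κ σ δ (distAct κ σ γ μ) := by
  ext r F
  rw [distAct_apply (hγ.mul hδ), distAct_apply hδ, distAct_apply hγ]
  congr 1
  ext z
  have hz := norm_le_one_of_mem_nbhd r z.2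
  simp only [rigidAct_apply]
  rw [autFactor_mul hγ hz, mul_assoc]
  congr 3
  exact congrArg F.1 (Subtype.ext (moebius_mul hγ hz))

/-- Taken with `t` the denominators `a_i + c_i z_i`, this absorbs the automorphy factor into the
homogeneous coordinates and makes the inclusion of polynomials equivariant. -/
lemma bihomogeneous_eval {P : MvPolynomial (Fin 2 × Fin 2) L} (hP : P ∈ Vpoly L κ)
    (t : Fin 2 → ℂ_[p]) (x : Fin 2 × Fin 2 → ℂ_[p]) :
    MvPolynomial.aeval (fun v => t v.1 * x v) P =
      (∏ i, t i ^ κ i) * MvPolynomial.aeval x P := by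
  rw [MvPolynomial.aeval_def, MvPolynomial.aeval_def, MvPolynomial.eval₂_eq', MvPolynomial.eval₂_eq',
    Finset.mul_sum]
  refine Finset.sum_congr rfl fun d hd => ?_
  have h3 := hP (MvPolynomial.mem_support_iff.mp hd)
  rw [Finsupp.weight_apply, Finsupp.sum_fintype _ _ (by simp)] at h3
  have h4 : ∏ v, t v.1 ^ d v = ∏ i, t i ^ κ i := by
    rw [← h3]
    simp only [Fintype.prod_prod_type, Fin.prod_univ_two, Finset.sum_apply, Pi.smul_apply,
      Fintype.sum_prod_type, Fin.sum_univ_two, bideg]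
    simp [pow_add]
  simp only [mul_pow, Finset.prod_mul_distrib, h4]
  ring

lemma rigidAct_polyToRigid {γ : GL (Fin 2) K} (h : InSigma0 σ γ) (r : Radii) (P : Vpoly L κ) :
    rigidAct κ h r (polyToRigid κ σ r.1 P) = polyToRigid κ σ r.1 (polyAct κ σ γ P) := by
  ext z
  have hz := norm_le_one_of_mem_nbhd r z.2
  rw [rigidAct_apply]
  change autFactor κ σ γ z.1 * MvPolynomial.aeval (affinePt (moebius σ γ z.1)) P.1 =
    MvPolynomial.aeval (affinePt z.1) (MvPolynomial.aeval (linSubst σ γ) P.1)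
  rw [autFactor, ← bihomogeneous_eval P.2, ← AlgHom.comp_apply]
  congr 1
  ext v
  obtain ⟨i, j⟩ := v
  have h0 := h.denom_ne_zero i (hz i)
  have e : ∀ x, algebraMap L ℂ_[p] (σ.σ i x) = emb σ x i := fun _ => rfl
  simp only [AlgHom.comp_apply, MvPolynomial.aeval_X, linSubst, map_add, map_mul,
    MvPolynomial.aeval_C, e]
  fin_cases j
  · simp only [affinePt, moebius, Fin.zero_eta, if_true]
    simp
    field_simp
    ring
  · simp [affinePt]
    ring

lemma specialize_distAct {γ : GL (Fin 2) K} (h : InSigma0 σ γ) (μ : Dist σ) :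
    specialize κ σ (distAct κ σ γ μ) = dualAct κ σ γ (specialize κ σ μ) := by
  ext P
  change (distAct κ σ γ μ).1 Radii.one (polyToRigid κ σ Radii.one.1 P) = _
  rw [distAct_apply h, rigidAct_polyToRigid]
  rfl

/-- A compatible family of bounded projections of the spaces of rigid analytic functions whose
images contain the polynomials of degree at most `κ` and are stable under `Σ₀(p)`. -/
structure TestProj (κ : Fin 2 → ℕ) (σ : EmbPair p K L) where
  proj : ∀ r : Radii, rigid σ r.1 →ₗ[L] rigid σ r.1
  bound : ℝ
  norm_le : ∀ (r : Radii) (F : rigid σ r.1) (M : ℝ), (∀ z, ‖F.1 z‖ ≤ M) →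
    ∀ z, ‖(proj r F).1 z‖ ≤ bound * M
  proj_restrict : ∀ (r s : Radii) (h : r.1 ≤ s.1) (F : rigid σ s.1),
    proj r (restrict σ h F) = restrict σ h (proj s F)
  idem : ∀ r F, proj r (proj r F) = proj r F
  act : ∀ {γ : GL (Fin 2) K} (h : InSigma0 σ γ) (r : Radii) (F : rigid σ r.1),
    proj r F = F → proj r (rigidAct κ h r F) = rigidAct κ h r F
  poly : ∀ (r : Radii) (P : Vpoly L κ), proj r (polyToRigid κ σ r.1 P) = polyToRigid κ σ r.1 P

/-- The identity as a family of projections. -/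
def TestProj.id (κ : Fin 2 → ℕ) (σ : EmbPair p K L) : TestProj κ σ where
  proj _ := LinearMap.id
  bound := 1
  norm_le _ _ _ h z := by simpa using h z
  proj_restrict _ _ _ _ := rfl
  idem _ _ := rfl
  act _ _ _ _ := rfl
  poly _ _ := rfl

namespace TestProj

variable (π : TestProj κ σ)

/-- The norm of `μ` on the test functions in `𝔸[L, r₁, r₂]` is at most `B`. -/
def Bd (r : Radii) (B : ℝ) (μ : Dist σ) : Prop :=
  ∀ F : rigid σ r.1, π.proj r F = F → ∀ M : ℝ, (∀ z, ‖F.1 z‖ ≤ M) →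
    ‖algebraMap L ℂ_[p] (μ.1 r F)‖ ≤ B * M

/-- The distributions that vanish on all test functions. -/
def ker : Submodule L (Dist σ) where
  carrier := {μ | ∀ (r : Radii) (F : rigid σ r.1), π.proj r F = F → μ.1 r F = 0}
  zero_mem' _ _ _ := rfl
  add_mem' h1 h2 r F hF := by
    simp only [Submodule.coe_add, Pi.add_apply, LinearMap.add_apply, h1 r F hF, h2 r F hF, add_zero]
  smul_mem' c μ h r F hF := by
    simp only [Submodule.coe_smul, Pi.smul_apply, LinearMap.smul_apply, h r F hF, smul_zero]

variable {π}

lemma mem_ker_id {μ : Dist σ} : μ ∈ (TestProj.id κ σ).ker ↔ μ = 0 := by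
  refine ⟨fun h => ?_, fun h => h ▸ zero_mem _⟩
  ext r F
  exact h r F rfl

lemma Bd.mono {r : Radii} {B C : ℝ} (h : B ≤ C) {μ : Dist σ} (hμ : π.Bd r B μ) : π.Bd r C μ :=
  fun F hF M hM => (hμ F hF M hM).trans
    (mul_le_mul_of_nonneg_right h (nonneg_of_bound hM))

lemma Bd.zero {r : Radii} {B : ℝ} (hB : 0 ≤ B) : π.Bd r B (0 : Dist σ) := fun F _ M hM => by
  change ‖algebraMap L ℂ_[p] 0‖ ≤ _
  rw [map_zero, norm_zero]
  exact mul_nonneg hB (nonneg_of_bound hM)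

lemma Bd.add {r : Radii} {B : ℝ} {μ ν : Dist σ} (hμ : π.Bd r B μ) (hν : π.Bd r B ν) :
    π.Bd r B (μ + ν) := fun F hF M hM => by
  change ‖algebraMap L ℂ_[p] (μ.1 r F + ν.1 r F)‖ ≤ _
  rw [map_add]
  exact (IsUltrametricDist.norm_add_le_max _ _).trans (max_le (hμ F hF M hM) (hν F hF M hM))

lemma Bd.smul {r : Radii} {B : ℝ} {μ : Dist σ} (hμ : π.Bd r B μ) (c : L) :
    π.Bd r (‖algebraMap L ℂ_[p] c‖ * B) (c • μ) := fun F hF M hM => by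
  change ‖algebraMap L ℂ_[p] (c * μ.1 r F)‖ ≤ _
  rw [map_mul, norm_mul, mul_assoc]
  exact mul_le_mul_of_nonneg_left (hμ F hF M hM) (norm_nonneg _)

lemma Bd.neg {r : Radii} {B : ℝ} {μ : Dist σ} (hμ : π.Bd r B μ) : π.Bd r B (-μ) :=
  fun F hF M hM => by
    change ‖algebraMap L ℂ_[p] (-(μ.1 r F))‖ ≤ _
    rw [map_neg, norm_neg]
    exact hμ F hF M hM

lemma Bd.sub {r : Radii} {B : ℝ} {μ ν : Dist σ} (hμ : π.Bd r B μ) (hν : π.Bd r B ν) :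
    π.Bd r B (μ - ν) := by
  exact (sub_eq_add_neg μ ν) ▸ hμ.add hν.neg

lemma Bd.sum {ι : Type*} (s : Finset ι) {r : Radii} {B : ℝ} (hB : 0 ≤ B) {f : ι → Dist σ}
    (h : ∀ i ∈ s, π.Bd r B (f i)) : π.Bd r B (∑ i ∈ s, f i) := by
  classical
  induction s using Finset.induction_on with
  | empty => simpa using Bd.zero hB
  | insert a s ha ih =>
    rw [Finset.sum_insert ha]
    exact (h a (Finset.mem_insert_self _ _)).add
      (ih fun i hi => h i (Finset.mem_insert_of_mem hi))

lemma norm_rigidAct_le {γ : GL (Fin 2) K} (h : InSigma0 σ γ) {r : Radii} {F : rigid σ r.1} {M : ℝ}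
    (hM : ∀ z, ‖F.1 z‖ ≤ M) (z : nbhd σ r.1) : ‖(rigidAct κ h r F).1 z‖ ≤ M := by
  rw [rigidAct_apply, norm_mul, h.norm_autFactor κ (norm_le_one_of_mem_nbhd r z.2), one_mul]
  exact hM _

/-- Automorphy factors have absolute value `1` and Möbius maps preserve the neighbourhoods, so
`Σ₀(p)` does not increase norms; the field `act` keeps the test functions stable. -/
lemma Bd.act {r : Radii} {B : ℝ} {μ : Dist σ} (hμ : π.Bd r B μ) {γ : GL (Fin 2) K}
    (h : InSigma0 σ γ) : π.Bd r B (distAct κ σ γ μ) := fun F hF M hM => by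
  rw [distAct_apply h]
  exact hμ _ (π.act h r F hF) M (norm_rigidAct_le h hM)

lemma ker_act {μ : Dist σ} (hμ : μ ∈ π.ker) {γ : GL (Fin 2) K} (h : InSigma0 σ γ) :
    distAct κ σ γ μ ∈ π.ker := fun r F hF => by
  rw [distAct_apply h]
  exact hμ r _ (π.act h r F hF)

lemma Bd.of_mem_ker {r : Radii} {B : ℝ} (hB : 0 ≤ B) {μ : Dist σ} (hμ : μ ∈ π.ker) :
    π.Bd r B μ := fun F hF M hM => by
  rw [hμ r F hF, map_zero, norm_zero]
  exact mul_nonneg hB (nonneg_of_bound hM)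

lemma Bd.of_id {r : Radii} {B : ℝ} {μ : Dist σ} (hμ : (TestProj.id κ σ).Bd r B μ) : π.Bd r B μ :=
  fun F _ M hM => hμ F rfl M hM

end TestProj

/-- Total boundedness of `𝓞_K ⊗ ℤ_p`: representatives of `𝓞_K / p ^ N` form a finite net. -/
lemma exists_mem_near [NumberField K] (σ : EmbPair p K L) {ε : ℝ} (hε : 0 < ε) :
    ∃ S : Set (Fin 2 → ℂ_[p]), S.Finite ∧ S ⊆ OKp σ ∧
      ∀ u ∈ OKp σ, ∃ v ∈ S, ∀ i, ‖u i - v i‖ ≤ ε := by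
  obtain ⟨N, hN⟩ := exists_pow_lt_of_lt_one hε (norm_p_lt_one (p := p))
  have hp0 : (p : 𝓞 K) ^ N ≠ 0 := pow_ne_zero _ (Nat.cast_ne_zero.mpr (Fact.out : p.Prime).ne_zero)
  have hfin : Finite (𝓞 K ⧸ Ideal.span {(p : 𝓞 K) ^ N}) :=
    Ideal.finiteQuotientOfFreeOfNeBot _ (by simpa using hp0)
  refine ⟨Set.range fun q : 𝓞 K ⧸ Ideal.span {(p : 𝓞 K) ^ N} => emb σ ((q.out : 𝓞 K) : K),
    Set.finite_range _, ?_, ?_⟩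
  · rintro _ ⟨q, rfl⟩
    exact emb_mem_OKp σ _
  · intro u hu
    obtain ⟨_, ⟨x, rfl⟩, hx⟩ := Metric.mem_closure_iff.mp (show u ∈ closure _ from hu) ε hε
    refine ⟨_, ⟨Ideal.Quotient.mk _ x, rfl⟩, fun i => ?_⟩
    set y : 𝓞 K := (Ideal.Quotient.mk (Ideal.span {(p : 𝓞 K) ^ N}) x).out
    have h1 : x - y ∈ Ideal.span {(p : 𝓞 K) ^ N} := by
      rw [← Ideal.Quotient.eq, Ideal.Quotient.mk_out]
    obtain ⟨t, ht⟩ := Ideal.mem_span_singleton.mp h1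
    have h2 : ‖emb σ (x : K) i - emb σ (y : K) i‖ ≤ ε := by
      have : emb σ (x : K) i - emb σ (y : K) i = (p : ℂ_[p]) ^ N * emb σ (t : K) i := by
        rw [← Pi.sub_apply, ← map_sub, ← map_sub, ht]
        simp
      rw [this, norm_mul, norm_pow]
      calc _ ≤ ‖(p : ℂ_[p])‖ ^ N * 1 := by gcongr; exact norm_le_one_of_integral σ t i
        _ ≤ ε := by rw [mul_one]; exact hN.le
    have h3 : ‖u i - emb σ (x : K) i‖ ≤ ε :=
      ((norm_le_pi_norm (u - emb σ (x : K)) i).trans_lt (by rw [← dist_eq_norm]; exact hx)).le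
    have := IsUltrametricDist.norm_add_le_max (u i - emb σ (x : K) i)
      (emb σ (x : K) i - emb σ (y : K) i)
    rw [sub_add_sub_cancel] at this
    exact this.trans (max_le h3 h2)

/-- On each disc `F` is within distance `1` of a polynomial, and finitely many discs cover the
neighbourhood. -/
lemma rigid_bounded [NumberField K] {r : Radii} (F : rigid σ r.1) :
    ∃ B : ℝ, ∀ z, ‖F.1 z‖ ≤ B := by
  have hε : 0 < min (r.1 0) (r.1 1) := lt_min (r.2 0).1 (r.2 1).1
  obtain ⟨S, hS, hSO, hcov⟩ := exists_mem_near σ hε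
  have h1 : ∀ v : Fin 2 → ℂ_[p], ∃ B : ℝ, v ∈ S → ∀ z : nbhd σ r.1, (∀ i, ‖z.1 i - v i‖ ≤ r.1 i) →
      ‖F.1 z‖ ≤ B := by
    intro v
    by_cases hv : v ∈ S
    swap
    · exact ⟨0, fun h => absurd h hv⟩
    obtain ⟨P, hP⟩ := F.2 v (hSO hv) 1 one_pos
    obtain ⟨B, hB⟩ := poly_bounded (p := p) P
    refine ⟨max 1 B, fun _ z hz => ?_⟩
    have := IsUltrametricDist.norm_add_le_max (F.1 z - MvPolynomial.aeval z.1 P)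
      (MvPolynomial.aeval z.1 P)
    rw [sub_add_cancel] at this
    exact this.trans (max_le_max (hP z hz) (hB _ (norm_le_one_of_mem_nbhd r z.2)))
  choose B hB using h1
  obtain ⟨C, hC⟩ := (hS.image B).bddAbove
  refine ⟨C, fun z => ?_⟩
  obtain ⟨u, hu, huz⟩ := z.2
  obtain ⟨v, hv, huv⟩ := hcov u hu
  refine (hB v hv z fun i => ?_).trans (hC ⟨v, hv, rfl⟩)
  have := IsUltrametricDist.norm_add_le_max (z.1 i - u i) (u i - v i)
  rw [sub_add_sub_cancel] at this
  refine this.trans (max_le (huz i) ((huv i).trans ?_))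
  fin_cases i
  · exact min_le_left _ _
  · exact min_le_right _ _

namespace TestProj

variable {π : TestProj κ σ}

lemma mem_ker_of_bd [NumberField K] {μ : Dist σ}
    (h : ∀ r, ∀ ε > 0, π.Bd r ε μ) : μ ∈ π.ker := fun r F hF => by
  obtain ⟨B, hB⟩ := rigid_bounded F
  have hB0 := nonneg_of_bound hB
  have h1 : ‖algebraMap L ℂ_[p] (μ.1 r F)‖ ≤ 0 := by
    refine le_of_forall_pos_le_add fun ε hε => ?_
    refine (h r (ε / (B + 1)) (by positivity) F hF B hB).trans ?_
    rw [zero_add, div_mul_eq_mul_div, div_le_iff₀ (by positivity)]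
    nlinarith
  rw [norm_le_zero_iff, map_eq_zero] at h1
  exact h1

end TestProj

end Distributions

/-! ### Completeness of the space of distributions -/

section Limits

variable {p : ℕ} [Fact p.Prime] {L : Type*} [Field L] [Algebra L ℂ_[p]] {K : Type*} [Field K]
  {σ : EmbPair p K L} {κ : Fin 2 → ℕ}

/-- A finite-dimensional `ℚ_p`-subspace of `ℂ_p` is closed. This keeps limits of values of
distributions, and values of rigid functions at points of `L²`, inside `L`. -/
lemma isClosed_range_algebraMap [Algebra ℚ_[p] L] [FiniteDimensional ℚ_[p] L]
    [IsScalarTower ℚ_[p] L ℂ_[p]] : IsClosed (Set.range (algebraMap L ℂ_[p])) := by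
  have := Submodule.closed_of_finiteDimensional
    (LinearMap.range (IsScalarTower.toAlgHom ℚ_[p] L ℂ_[p]).toLinearMap)
  exact this

lemma exists_eq_algebraMap_of_approx (hcl : IsClosed (Set.range (algebraMap L ℂ_[p]))) {x : ℂ_[p]}
    (h : ∀ ε > 0, ∃ a : L, ‖x - algebraMap L ℂ_[p] a‖ ≤ ε) : ∃ a : L, algebraMap L ℂ_[p] a = x := by
  have : x ∈ closure (Set.range (algebraMap L ℂ_[p])) := by
    refine Metric.mem_closure_iff.mpr fun ε hε => ?_
    obtain ⟨a, ha⟩ := h (ε / 2) (half_pos hε)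
    exact ⟨_, ⟨a, rfl⟩, by rw [dist_eq_norm]; linarith⟩
  rw [hcl.closure_eq] at this
  exact this

lemma norm_sub_le_of_geometric {a : ℕ → ℂ_[p]} {C c : ℝ} (hC : 0 ≤ C) (hc0 : 0 ≤ c) (hc : c ≤ 1)
    {n₀ : ℕ} (h : ∀ n, n₀ ≤ n → ‖a (n + 1) - a n‖ ≤ C * c ^ n) {n m : ℕ} (hn : n₀ ≤ n)
    (hm : n ≤ m) : ‖a m - a n‖ ≤ C * c ^ n := by
  induction m, hm using Nat.le_induction with
  | base => simpa using mul_nonneg hC (pow_nonneg hc0 n)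
  | succ m hm ih =>
    have := IsUltrametricDist.norm_add_le_max (a (m + 1) - a m) (a m - a n)
    rw [sub_add_sub_cancel] at this
    refine this.trans (max_le ((h m (hn.trans hm)).trans ?_) ih)
    exact mul_le_mul_of_nonneg_left (pow_le_pow_of_le_one hc0 hc hm) hC

lemma exists_limit_of_geometric (hcl : IsClosed (Set.range (algebraMap L ℂ_[p]))) {a : ℕ → L}
    {C c : ℝ} (hC : 0 ≤ C) (hc0 : 0 ≤ c) (hc : c < 1) {n₀ : ℕ}
    (h : ∀ n, n₀ ≤ n → ‖algebraMap L ℂ_[p] (a (n + 1)) - algebraMap L ℂ_[p] (a n)‖ ≤ C * c ^ n) :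
    ∃ b : L, Filter.Tendsto (fun n => algebraMap L ℂ_[p] (a n)) Filter.atTop
      (nhds (algebraMap L ℂ_[p] b)) := by
  have h1 : CauchySeq fun n => algebraMap L ℂ_[p] (a (n + n₀)) := by
    refine cauchySeq_of_le_geometric c C hc fun n => ?_
    rw [dist_eq_norm, norm_sub_rev, Nat.add_right_comm]
    refine (h (n + n₀) (Nat.le_add_left _ _)).trans (mul_le_mul_of_nonneg_left ?_ hC)
    exact pow_le_pow_of_le_one hc0 hc.le (Nat.le_add_right _ _)
  obtain ⟨x, hx⟩ := cauchySeq_tendsto_of_complete h1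
  obtain ⟨b, rfl⟩ : x ∈ Set.range (algebraMap L ℂ_[p]) :=
    hcl.mem_of_tendsto hx (Filter.Eventually.of_forall fun n => ⟨_, rfl⟩)
  exact ⟨b, (Filter.tendsto_add_atTop_iff_nat n₀).mp hx⟩

lemma exists_bound (μ : Dist σ) (r : Radii) : ∃ B, 0 ≤ B ∧ (TestProj.id κ σ).Bd r B μ := by
  obtain ⟨B, hB⟩ := μ.2.1 r
  refine ⟨|B|, abs_nonneg _, fun F _ M hM => (hB F M hM).trans ?_⟩
  exact mul_le_mul_of_nonneg_right (le_abs_self B) (nonneg_of_bound hM)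

/-- The limit is taken pointwise on rigid functions; linearity and compatibility with restriction
follow from uniqueness of limits. The index `n₀` depends on `r` because contraction sets in later
for smaller radii. -/
lemma exists_limit [NumberField K] (hcl : IsClosed (Set.range (algebraMap L ℂ_[p]))) {c : ℝ}
    (hc0 : 0 ≤ c) (hc : c < 1) {C : Radii → ℝ} (hC : ∀ r, 0 ≤ C r) {n₀ : Radii → ℕ}
    {x : ℕ → Dist σ}
    (h : ∀ r n, n₀ r ≤ n → (TestProj.id κ σ).Bd r (C r * c ^ n) (x (n + 1) - x n)) :
    ∃ y : Dist σ, ∀ r n, n₀ r ≤ n → (TestProj.id κ σ).Bd r (C r * c ^ n) (y - x n) := by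
  have hd : ∀ (r : Radii) (F : rigid σ r.1) (M : ℝ), (∀ z, ‖F.1 z‖ ≤ M) → ∀ n, n₀ r ≤ n →
      ‖algebraMap L ℂ_[p] ((x (n + 1)).1 r F) - algebraMap L ℂ_[p] ((x n).1 r F)‖ ≤
        (C r * M) * c ^ n := by
    intro r F M hM n hn
    have := h r n hn F rfl M hM
    rw [← map_sub, mul_right_comm]
    exact this
  have hlim : ∀ (r : Radii) (F : rigid σ r.1), ∃ b : L,
      Filter.Tendsto (fun n => algebraMap L ℂ_[p] ((x n).1 r F)) Filter.atTop
      (nhds (algebraMap L ℂ_[p] b)) := by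
    intro r F
    obtain ⟨M, hM⟩ := rigid_bounded F
    exact exists_limit_of_geometric hcl (mul_nonneg (hC r) (nonneg_of_bound hM)) hc0 hc
      (hd r F M hM)
  choose b hb using hlim
  have uniq : ∀ {u : ℕ → ℂ_[p]} {s t : L},
      Filter.Tendsto u Filter.atTop (nhds (algebraMap L ℂ_[p] s)) →
      Filter.Tendsto u Filter.atTop (nhds (algebraMap L ℂ_[p] t)) → s = t := fun h1 h2 =>
    (algebraMap L ℂ_[p]).injective (tendsto_nhds_unique h1 h2)
  let y₀ : ∀ r : Radii, Module.Dual L (rigid σ r.1) := fun r =>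
    { toFun := b r
      map_add' := fun F G => uniq (hb r (F + G)) (by
        simp only [map_add]; exact (hb r F).add (hb r G))
      map_smul' := fun t F => uniq (hb r (t • F)) (by
        simp only [map_smul, smul_eq_mul, map_mul, RingHom.id_apply]
        exact (hb r F).const_mul _) }
  have key : ∀ (r : Radii) (n : ℕ), n₀ r ≤ n → ∀ (F : rigid σ r.1) (M : ℝ), (∀ z, ‖F.1 z‖ ≤ M) →
      ‖algebraMap L ℂ_[p] (b r F) - algebraMap L ℂ_[p] ((x n).1 r F)‖ ≤ C r * c ^ n * M := by
    intro r n hn F M hM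
    refine le_of_tendsto ((hb r F).sub_const _).norm ?_
    filter_upwards [Filter.eventually_ge_atTop n] with m hm
    rw [mul_right_comm]
    exact norm_sub_le_of_geometric (a := fun n => algebraMap L ℂ_[p] ((x n).1 r F))
      (mul_nonneg (hC r) (nonneg_of_bound hM)) hc0 hc.le (hd r F M hM) hn hm
  refine ⟨⟨y₀, fun r => ?_, fun r s hrs F => ?_⟩, fun r n hn F _ M hM => ?_⟩
  · obtain ⟨B, -, hB⟩ := exists_bound (κ := κ) (x (n₀ r)) r
    refine ⟨max (C r * c ^ n₀ r) B, fun F M hM => ?_⟩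
    have h1 := key r (n₀ r) le_rfl F M hM
    have h2 := hB F rfl M hM
    have h3 := IsUltrametricDist.norm_add_le_max
      (algebraMap L ℂ_[p] (b r F) - algebraMap L ℂ_[p] ((x (n₀ r)).1 r F))
      (algebraMap L ℂ_[p] ((x (n₀ r)).1 r F))
    rw [sub_add_cancel] at h3
    rw [max_mul_of_nonneg _ _ (nonneg_of_bound hM)]
    exact h3.trans (max_le_max h1 h2)
  · refine uniq (hb r (restrict σ hrs F)) ?_
    have : ∀ n, (x n).1 r (restrict σ hrs F) = (x n).1 s F := fun n => (x n).2.2 r s hrs F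
    simp only [this]
    exact hb s F
  · have := key r n hn F M hM
    rw [← map_sub] at this
    exact this

namespace TestProj

variable (π : TestProj κ σ)

/-- The endomorphism of the space of distributions dual to a family of projections. -/
def dual : Dist σ →ₗ[L] Dist σ where
  toFun μ := ⟨fun r => (μ.1 r).comp (π.proj r), by
    refine ⟨fun r => ?_, fun r s hrs F => ?_⟩
    · obtain ⟨B, hB⟩ := μ.2.1 r
      refine ⟨B * π.bound, fun F M hM => ?_⟩
      rw [mul_assoc]
      exact hB _ _ (π.norm_le r F M hM)
    · rw [LinearMap.comp_apply, π.proj_restrict]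
      exact μ.2.2 r s hrs _⟩
  map_add' _ _ := rfl
  map_smul' _ _ := rfl

variable {π}

lemma Bd.dual {r : Radii} {B : ℝ} {μ : Dist σ} (hμ : π.Bd r B μ) :
    (TestProj.id κ σ).Bd r (B * π.bound) (π.dual μ) := fun F _ M hM => by
  rw [mul_assoc]
  exact hμ _ (π.idem r F) _ (π.norm_le r F M hM)

lemma dual_sub_mem_ker (μ : Dist σ) : π.dual μ - μ ∈ π.ker := fun r F hF => by
  change μ.1 r (π.proj r F) - μ.1 r F = 0
  rw [hF, sub_self]

lemma bound_nonneg : 0 ≤ π.bound := by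
  have h := π.norm_le Radii.one 0 1 (fun z => by
    change ‖(0 : ℂ_[p])‖ ≤ 1
    simp) ⟨0, zero_mem_nbhd _⟩
  rw [mul_one] at h
  exact (norm_nonneg _).trans h

/-- Geometric convergence of a sequence of homomorphisms with values in the distributions, in all
the norms on test functions. -/
theorem exists_limit_hom [NumberField K] (hcl : IsClosed (Set.range (algebraMap L ℂ_[p])))
    {A : Type*} [AddCommGroup A] {c : ℝ} (hc0 : 0 ≤ c) (hc : c < 1) {C : Radii → ℝ}
    (hC : ∀ r, 0 ≤ C r) {n₀ : Radii → ℕ} (X : ℕ → A →+ Dist σ)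
    (h : ∀ r n, n₀ r ≤ n → ∀ a, π.Bd r (C r * c ^ n) (X (n + 1) a - X n a)) :
    ∃ Y : A →+ Dist σ,
      (∀ r n, n₀ r ≤ n → ∀ a, π.Bd r (C r * π.bound * c ^ n) (Y a - X n a)) ∧
      ∀ r n, n₀ r ≤ n → ∀ a,
        (TestProj.id κ σ).Bd r (C r * π.bound * c ^ n) (Y a - π.dual (X n a)) := by
  have hCb : ∀ r, 0 ≤ C r * π.bound := fun r => mul_nonneg (hC r) π.bound_nonneg
  -- Convergence is known only on test functions. The sequence is therefore replaced by its image
  -- under `π.dual`, which agrees with it on test functions and converges on all functions.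
  have h1 : ∀ a, ∃ y : Dist σ, ∀ r n, n₀ r ≤ n →
      (TestProj.id κ σ).Bd r (C r * π.bound * c ^ n) (y - π.dual (X n a)) := fun a => by
    refine exists_limit hcl hc0 hc hCb fun r n hn => ?_
    have := (h r n hn a).dual
    rw [mul_right_comm] at this
    exact (map_sub π.dual (X (n + 1) a) (X n a)) ▸ this
  choose y hy using h1
  have hadd : ∀ a b, y (a + b) = y a + y b := fun a b => by
    rw [← sub_eq_zero, ← mem_ker_id (κ := κ)]
    refine mem_ker_of_bd fun r ε hε => ?_
    obtain ⟨n, hn, hn2⟩ : ∃ n, n₀ r ≤ n ∧ C r * π.bound * c ^ n ≤ ε := by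
      have ht : Filter.Tendsto (fun n => C r * π.bound * c ^ n) Filter.atTop (nhds 0) := by
        simpa using (tendsto_pow_atTop_nhds_zero_of_lt_one hc0 hc).const_mul (C r * π.bound)
      obtain ⟨n, h1, h2⟩ := ((ht.eventually (gt_mem_nhds hε)).and
        (Filter.eventually_ge_atTop (n₀ r))).exists
      exact ⟨n, h2, h1.le⟩
    have e : y (a + b) - (y a + y b) = (y (a + b) - π.dual (X n (a + b))) -
        ((y a - π.dual (X n a)) + (y b - π.dual (X n b))) := by
      rw [map_add, map_add]; abel
    rw [e]
    exact ((hy _ r n hn).sub ((hy a r n hn).add (hy b r n hn))).mono hn2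
  refine ⟨AddMonoidHom.mk' y hadd, fun r n hn a => ?_, fun r n hn a => hy a r n hn⟩
  have e : y a - X n a = (y a - π.dual (X n a)) + (π.dual (X n a) - X n a) := by abel
  change π.Bd r _ (y a - X n a)
  rw [e]
  exact (hy a r n hn).of_id.add
    (Bd.of_mem_ker (mul_nonneg (hCb r) (pow_nonneg hc0 n)) (dual_sub_mem_ker _))

end TestProj

end Limits

/-! ### Coefficient bounds and the error of polynomial interpolation -/

section GaussNorm

open Polynomial

variable {p : ℕ} [Fact p.Prime]

lemma norm_sub_le_max_padic (x y : ℂ_[p]) : ‖x - y‖ ≤ max ‖x‖ ‖y‖ := by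
  simpa [sub_eq_add_neg] using IsUltrametricDist.norm_add_le_max x (-y)

lemma norm_natCast_le_one (n : ℕ) : ‖(n : ℂ_[p])‖ ≤ 1 := by
  induction n with
  | zero => simp
  | succ n ih =>
    rw [Nat.cast_succ]
    exact (IsUltrametricDist.norm_add_le_max _ _).trans (max_le ih (by simp))

lemma norm_mul_p_add_one (t : ℕ) : ‖((p * t + 1 : ℕ) : ℂ_[p])‖ = 1 := by
  have h : ‖((p * t : ℕ) : ℂ_[p])‖ < ‖(1 : ℂ_[p])‖ := by
    rw [Nat.cast_mul, norm_mul, norm_one]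
    nlinarith [norm_natCast_le_one (p := p) t, norm_p_lt_one (p := p), norm_nonneg (t : ℂ_[p]),
      norm_nonneg (p : ℂ_[p])]
  rw [Nat.cast_add, Nat.cast_one, IsUltrametricDist.norm_add_eq_max_of_norm_ne_norm h.ne,
    max_eq_right h.le, norm_one]

/-- The coefficients of a polynomial are bounded by its supremum on the closed unit disc. -/
theorem norm_coeff_le {Q : ℂ_[p][X]} {M : ℝ} (hM : ∀ x : ℂ_[p], ‖x‖ ≤ 1 → ‖Q.eval x‖ ≤ M)
    (m : ℕ) : ‖Q.coeff m‖ ≤ M := by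
  have hM0 : 0 ≤ M := (norm_nonneg _).trans (hM 0 (by simp))
  by_cases hm : Q.natDegree < m
  · rw [coeff_eq_zero_of_natDegree_lt hm, norm_zero]; exact hM0
  push Not at hm
  -- `N` exceeds the degree, so distinct exponents remain distinct modulo `N`; and `N ≡ 1` modulo
  -- `p`, so averaging over the `N`-th roots of unity involves no division by a non-unit.
  set N := p * (Q.natDegree + 1) + 1 with hN
  have hNdeg : Q.natDegree < N := by
    have := (Fact.out : p.Prime).one_lt
    nlinarith
  have : NeZero (N : ℂ_[p]) := ⟨by rw [← norm_ne_zero_iff, hN, norm_mul_p_add_one]; exact one_ne_zero⟩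
  have := IsSepClosed.hasEnoughRootsOfUnity ℂ_[p] N
  obtain ⟨ζ, hζ⟩ := HasEnoughRootsOfUnity.exists_primitiveRoot ℂ_[p] N
  have hN0 : N ≠ 0 := by omega
  have nζ : ‖ζ‖ = 1 := by
    have := congrArg norm hζ.pow_eq_one
    rw [norm_pow, norm_one] at this
    exact (pow_eq_one_iff_of_nonneg (norm_nonneg _) hN0).mp this
  have hsum : ∀ i ∈ Finset.range (Q.natDegree + 1),
      ∑ j ∈ Finset.range N, (ζ ^ j) ^ (N - m) * (Q.coeff i * (ζ ^ j) ^ i) =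
        if i = m then (N : ℂ_[p]) * Q.coeff i else 0 := by
    intro i hi
    rw [Finset.mem_range] at hi
    have e : ∀ j, (ζ ^ j) ^ (N - m) * (Q.coeff i * (ζ ^ j) ^ i) =
        Q.coeff i * (ζ ^ (N - m + i)) ^ j := fun j => by
      rw [mul_left_comm, ← pow_add, ← pow_mul, ← pow_mul, mul_comm j]
    simp only [e, ← Finset.mul_sum]
    split_ifs with him
    · subst him
      rw [Nat.sub_add_cancel (by omega), hζ.pow_eq_one]
      simp [mul_comm]
    · have h1 : ζ ^ (N - m + i) ≠ 1 := by
        intro h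
        have h2 := (hζ.pow_eq_one_iff_dvd _).mp h
        obtain ⟨c, hc⟩ := h2
        have hc1 : c = 1 := by
          rcases Nat.lt_or_ge c 1 with h | h
          · have : c = 0 := by omega
            subst this; omega
          · by_contra h3
            have : 2 ≤ c := by omega
            have : N * 2 ≤ N * c := Nat.mul_le_mul_left _ this
            omega
        subst hc1; omega
      have h2 := mul_geom_sum (ζ ^ (N - m + i)) N
      rw [← pow_mul, mul_comm (N - m + i), pow_mul, hζ.pow_eq_one, one_pow, sub_self,
        mul_eq_zero] at h2
      rw [h2.resolve_left (sub_ne_zero.mpr h1), mul_zero]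
  have htot : ∑ j ∈ Finset.range N, (ζ ^ j) ^ (N - m) * Q.eval (ζ ^ j) = N * Q.coeff m := by
    simp only [eval_eq_sum_range, Finset.mul_sum]
    rw [Finset.sum_comm, Finset.sum_congr rfl hsum, Finset.sum_ite_eq', if_pos]
    exact Finset.mem_range.mpr (by omega)
  have h3 : ‖(N : ℂ_[p]) * Q.coeff m‖ ≤ M := by
    rw [← htot]
    refine IsUltrametricDist.norm_sum_le_of_forall_le_of_nonneg hM0 fun j _ => ?_
    rw [norm_mul, norm_pow, norm_pow, nζ, one_pow, one_pow, one_mul]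
    exact hM _ (by rw [norm_pow, nζ, one_pow])
  rwa [norm_mul, hN, norm_mul_p_add_one, one_mul] at h3

lemma norm_eval_le {Q : ℂ_[p][X]} {δ : ℝ} (hδ : 0 ≤ δ) (h : ∀ m, ‖Q.coeff m‖ ≤ δ) {x : ℂ_[p]}
    (hx : ‖x‖ ≤ 1) : ‖Q.eval x‖ ≤ δ := by
  rw [eval_eq_sum_range]
  refine IsUltrametricDist.norm_sum_le_of_forall_le_of_nonneg hδ fun m _ => ?_
  rw [norm_mul, norm_pow]
  calc _ ≤ δ * 1 := by
        gcongr
        · exact h m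
        · exact pow_le_one₀ (norm_nonneg _) hx
    _ = δ := mul_one δ

/-- The Lagrange basis polynomials with nodes `0, …, k`. -/
def lag (F : Type*) [Field F] (k i : ℕ) : F[X] :=
  Lagrange.basis (Finset.range (k + 1)) (fun i : ℕ => (i : F)) i

lemma lag_map {F E : Type*} [Field F] [Field E] [Algebra F E] (k i : ℕ) :
    (lag F k i).map (algebraMap F E) = lag E k i := by
  simp only [lag, Lagrange.basis, Polynomial.map_prod, Lagrange.basisDivisor, Polynomial.map_mul,
    Polynomial.map_sub, Polynomial.map_X, Polynomial.map_C, map_inv₀, map_sub, map_natCast]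
  simp

lemma natDegree_lag_le {F : Type*} [Field F] [CharZero F] (k i : ℕ)
    (hi : i ∈ Finset.range (k + 1)) : (lag F k i).natDegree ≤ k := by
  have := Lagrange.degree_basis (s := Finset.range (k + 1)) (v := fun i : ℕ => (i : F))
    (Nat.cast_injective.injOn) hi
  rw [Finset.card_range, Nat.add_sub_cancel] at this
  exact natDegree_le_of_degree_le this.le

lemma sum_eval_lag {k : ℕ} {Q : ℂ_[p][X]} (hQ : Q.natDegree ≤ k) (x : ℂ_[p]) :
    ∑ i ∈ Finset.range (k + 1), Q.eval (i : ℂ_[p]) * (lag ℂ_[p] k i).eval x = Q.eval x := by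
  have h1 : Q.degree < (Finset.range (k + 1)).card := by
    rw [Finset.card_range]
    exact (degree_le_of_natDegree_le hQ).trans_lt (by exact_mod_cast Nat.lt_succ_self k)
  have := Lagrange.eq_interpolate (v := fun i : ℕ => (i : ℂ_[p])) (Nat.cast_injective.injOn) h1
  conv_rhs => rw [this]
  rw [Lagrange.interpolate_apply, eval_finsetSum]
  simp [lag]

lemma exists_lag_bound (k : ℕ) : ∃ C : ℝ, 1 ≤ C ∧ ∀ i ∈ Finset.range (k + 1), ∀ x : ℂ_[p],
    ‖x‖ ≤ 1 → ‖(lag ℂ_[p] k i).eval x‖ ≤ C := by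
  have h : ∀ Q : ℂ_[p][X], ∃ C : ℝ, ∀ x : ℂ_[p], ‖x‖ ≤ 1 → ‖Q.eval x‖ ≤ C := fun Q =>
    ⟨∑ m ∈ Finset.range (Q.natDegree + 1), ‖Q.coeff m‖,
      fun x hx => norm_eval_le (Finset.sum_nonneg fun _ _ => norm_nonneg _) (fun m => by
        by_cases hm : m ∈ Finset.range (Q.natDegree + 1)
        · exact Finset.single_le_sum (f := fun m => ‖Q.coeff m‖) (fun _ _ => norm_nonneg _) hm
        · rw [coeff_eq_zero_of_natDegree_lt (by simpa using hm), norm_zero]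
          exact Finset.sum_nonneg fun _ _ => norm_nonneg _) hx⟩
  choose C hC using fun i => h (lag ℂ_[p] k i)
  obtain ⟨B, hB⟩ := ((Finset.range (k + 1)).finite_toSet.image C).bddAbove
  exact ⟨max 1 B, le_max_left _ _, fun i hi x hx =>
    (hC i x hx).trans ((hB ⟨i, hi, rfl⟩).trans (le_max_right _ _))⟩

/-- A bound for the Lagrange basis polynomials on the closed unit disc. -/
def lagBound (p : ℕ) [Fact p.Prime] (k : ℕ) : ℝ := (exists_lag_bound (p := p) k).choose

lemma one_le_lagBound (k : ℕ) : 1 ≤ lagBound p k := (exists_lag_bound (p := p) k).choose_spec.1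

lemma norm_lag_le {k i : ℕ} (hi : i ∈ Finset.range (k + 1)) {x : ℂ_[p]} (hx : ‖x‖ ≤ 1) :
    ‖(lag ℂ_[p] k i).eval x‖ ≤ lagBound p k :=
  (exists_lag_bound (p := p) k).choose_spec.2 i hi x hx

/-- The value at `x` of the polynomial of degree at most `k` that agrees with `f` at `0, …, k`. -/
def interp (k : ℕ) (f : ℂ_[p] → ℂ_[p]) (x : ℂ_[p]) : ℂ_[p] :=
  ∑ i ∈ Finset.range (k + 1), f i * (lag ℂ_[p] k i).eval x

lemma norm_interp_le {k : ℕ} {f : ℂ_[p] → ℂ_[p]} {M : ℝ} (hM0 : 0 ≤ M) (hM : ∀ i : ℕ, ‖f i‖ ≤ M)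
    {x : ℂ_[p]} (hx : ‖x‖ ≤ 1) : ‖interp k f x‖ ≤ lagBound p k * M := by
  have h1 := (zero_le_one.trans (one_le_lagBound (p := p) k))
  refine IsUltrametricDist.norm_sum_le_of_forall_le_of_nonneg (mul_nonneg h1 hM0) fun i hi => ?_
  rw [norm_mul, mul_comm]
  gcongr
  · exact norm_lag_le hi hx
  · exact hM i

/-- Interpolation reproduces the truncation `Q₀` of degree `k` exactly, so only the tail
contributes. The nodes are integers, hence lie in the unit disc where the tail is at most `δ`. -/
lemma norm_sub_interp_le {k : ℕ} {Q : ℂ_[p][X]} {δ : ℝ} (hδ : 0 ≤ δ)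
    (h : ∀ m, k < m → ‖Q.coeff m‖ ≤ δ) {x : ℂ_[p]} (hx : ‖x‖ ≤ 1) :
    ‖Q.eval x - interp k (fun y => Q.eval y) x‖ ≤ lagBound p k * δ := by
  set Q₀ : ℂ_[p][X] := ∑ m ∈ Finset.range (k + 1), monomial m (Q.coeff m) with hQ₀
  have hdeg : Q₀.natDegree ≤ k := by
    refine natDegree_sum_le_of_forall_le _ _ fun m hm => (natDegree_monomial_le _).trans ?_
    rw [Finset.mem_range] at hm; omega
  have hcoeff : ∀ m, ‖(Q - Q₀).coeff m‖ ≤ δ := by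
    intro m
    rw [coeff_sub, hQ₀, finsetSum_coeff]
    simp only [coeff_monomial]
    rw [Finset.sum_ite_eq']
    split_ifs with hm
    · simpa using hδ
    · rw [sub_zero]
      exact h m (by simpa using hm)
  have e : Q.eval x - interp k (fun y => Q.eval y) x =
      (Q - Q₀).eval x - interp k (fun y => (Q - Q₀).eval y) x := by
    have h1 := sum_eval_lag hdeg x
    simp only [interp, eval_sub, sub_mul, Finset.sum_sub_distrib]
    rw [h1]; ring
  rw [e]
  refine (norm_sub_le_max_padic _ _).trans (max_le ?_ ?_)
  · refine (norm_eval_le hδ hcoeff hx).trans ?_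
    nlinarith [one_le_lagBound (p := p) k]
  · exact norm_interp_le hδ (fun i => norm_eval_le hδ hcoeff (norm_natCast_le_one i)) hx

/-- The interpolation error of a function on the closed unit disc that extends to an analytic
function on a larger disc. -/
lemma norm_sub_interp_le_of_approx {k : ℕ} {f : ℂ_[p] → ℂ_[p]} {M : ℝ} (hM : 0 ≤ M)
    {a w : ℂ_[p]} (ha : a ≠ 0) (haw : ‖a‖ ≤ ‖w‖)
    (h : ∀ ε > 0, ∃ R : ℂ_[p][X], (∀ x, ‖x‖ ≤ 1 → ‖R.eval x‖ ≤ M + ε) ∧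
      ∀ x, ‖x‖ ≤ 1 → ‖f x - R.eval (a / w * x)‖ ≤ ε) {x : ℂ_[p]} (hx : ‖x‖ ≤ 1) :
    ‖f x - interp k f x‖ ≤ lagBound p k * (M * (‖a‖ / ‖w‖) ^ (k + 1)) := by
  have hw : 0 < ‖w‖ := (norm_pos_iff.mpr ha).trans_le haw
  set t := ‖a‖ / ‖w‖ with ht
  have ht0 : 0 < t := div_pos (norm_pos_iff.mpr ha) hw
  have ht1 : t ≤ 1 := (div_le_one hw).mpr haw
  have hC := one_le_lagBound (p := p) k
  refine le_of_forall_pos_le_add fun ε hε => ?_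
  -- Small enough that the approximation error stays below `ε` even after interpolation has
  -- multiplied it by `lagBound p k`.
  set η := ε * t ^ (k + 1) / lagBound p k with hη
  have hη0 : 0 < η := by positivity
  obtain ⟨R, hR, hfR⟩ := h η hη0
  set Q := R.comp (C (a / w) * X) with hQ
  have hQe : ∀ y, Q.eval y = R.eval (a / w * y) := fun y => by simp [hQ]
  -- The rescaling by `a / w` multiplies the coefficient of index `m` by a factor of absolute value
  -- `t ^ m`, which is at most `t ^ (k + 1)` as `m > k` and `t ≤ 1`.
  have hQc : ∀ m, k < m → ‖Q.coeff m‖ ≤ (M + η) * t ^ (k + 1) := by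
    intro m hm
    rw [hQ, comp_C_mul_X_coeff, norm_mul, norm_pow, norm_div]
    exact mul_le_mul (norm_coeff_le hR m) (pow_le_pow_of_le_one ht0.le ht1 hm) (by positivity)
      (by positivity)
  have e : f x - interp k f x = (f x - Q.eval x) - interp k (fun y => f y - Q.eval y) x +
      (Q.eval x - interp k (fun y => Q.eval y) x) := by
    simp only [interp, sub_mul, Finset.sum_sub_distrib]; ring
  have hd : ∀ y, ‖y‖ ≤ 1 → ‖f y - Q.eval y‖ ≤ η := fun y hy => by rw [hQe]; exact hfR y hy
  have hb : lagBound p k * η ≤ ε := by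
    rw [hη, mul_div_cancel₀ _ (by positivity)]
    exact mul_le_of_le_one_right hε.le (pow_le_one₀ ht0.le ht1)
  have hb2 : lagBound p k * ((M + η) * t ^ (k + 1)) ≤
      lagBound p k * (M * t ^ (k + 1)) + ε := by
    have h2 : lagBound p k * (η * t ^ (k + 1)) ≤ ε := by
      rw [← mul_assoc]
      exact (mul_le_of_le_one_right (by positivity) (pow_le_one₀ ht0.le ht1)).trans hb
    nlinarith
  have hM' : ε ≤ lagBound p k * (M * t ^ (k + 1)) + ε := by
    have : 0 ≤ lagBound p k * (M * t ^ (k + 1)) := by positivity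
    linarith
  rw [e]
  refine (IsUltrametricDist.norm_add_le_max _ _).trans (max_le ?_ ?_)
  · refine (norm_sub_le_max_padic _ _).trans (max_le ?_ ?_)
    · refine (hd x hx).trans (le_trans ?_ hM')
      nlinarith
    · exact (norm_interp_le hη0.le (fun i => hd i (norm_natCast_le_one i)) hx).trans (hb.trans hM')
  · exact (norm_sub_interp_le (by positivity) hQc hx).trans hb2

end GaussNorm

/-! ### Interpolation of rigid functions in one coordinate -/

section Interpolation

open Polynomial

variable {p : ℕ} [Fact p.Prime] {L : Type*} [Field L] [Algebra L ℂ_[p]] {K : Type*} [Field K]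
  {σ : EmbPair p K L} {κ : Fin 2 → ℕ}

/-- Replacing the coordinate `s` by a natural number preserves the neighbourhood of radii `r`. -/
def UpdStable (σ : EmbPair p K L) (s : Fin 2) (r : Radii) : Prop :=
  ∀ z ∈ nbhd σ r.1, ∀ i : ℕ, Function.update z s (i : ℂ_[p]) ∈ nbhd σ r.1

/-- When the radius is `1`, the coordinate `s` fills the closed unit disc whatever the centre is. -/
lemma update_mem_nbhd {s : Fin 2} {r : Radii} (hr : r.1 s = 1) {z : Fin 2 → ℂ_[p]}
    (hz : z ∈ nbhd σ r.1) {x : ℂ_[p]} (hx : ‖x‖ ≤ 1) : Function.update z s x ∈ nbhd σ r.1 := by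
  obtain ⟨u, hu, h⟩ := hz
  refine ⟨u, hu, fun j => ?_⟩
  by_cases hj : j = s
  · subst hj
    rw [Function.update_self, hr]
    exact (norm_sub_le_max_padic _ _).trans (max_le hx (norm_le_one_of_mem_OKp hu j))
  · rw [Function.update_of_ne hj]; exact h j

lemma updStable_of_eq_one {s : Fin 2} {r : Radii} (hr : r.1 s = 1) : UpdStable σ s r :=
  fun _ hz i => update_mem_nbhd hr hz (norm_natCast_le_one i)

/-- The hypothesis says that the idempotent of the coordinate `s` lies in `𝓞_K ⊗ ℤ_p`, as happens
for split `p`; coordinates can then be changed independently. -/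
lemma update_mem_OKp {s : Fin 2} (h : Pi.single s 1 ∈ OKp σ) {u v : Fin 2 → ℂ_[p]}
    (hu : u ∈ OKp σ) (hv : v ∈ OKp σ) : Function.update u s (v s) ∈ OKp σ := by
  have e : Function.update u s (v s) = u + Pi.single s 1 * (v - u) := by
    funext j
    by_cases hj : j = s
    · subst hj; simp
    · simp [hj]
  rw [e]
  exact add_mem hu (mul_mem h (sub_mem hv hu))

lemma updStable_of_single {s : Fin 2} (h : Pi.single s 1 ∈ OKp σ) (r : Radii) :
    UpdStable σ s r := fun z hz i => by
  obtain ⟨u, hu, hz⟩ := hz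
  refine ⟨_, update_mem_OKp h hu (natCast_mem _ i), fun j => ?_⟩
  by_cases hj : j = s
  · subst hj
    simpa using (r.2 j).1.le
  · rw [Function.update_of_ne hj, Function.update_of_ne hj]; exact hz j

lemma lag_aeval (k i : ℕ) (x : ℂ_[p]) :
    aeval x (lag L k i) = (lag ℂ_[p] k i).eval x := by
  rw [← lag_map (F := L) (E := ℂ_[p]) k i, eval_map_algebraMap]

lemma norm_sub_le_of_le {x y z : ℂ_[p]} {r : ℝ} (h1 : ‖x - y‖ ≤ r) (h2 : ‖y - z‖ ≤ r) :
    ‖x - z‖ ≤ r := by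
  have := IsUltrametricDist.norm_add_le_max (x - y) (y - z)
  rw [sub_add_sub_cancel] at this
  exact this.trans (max_le h1 h2)

lemma norm_update_sub_le {s : Fin 2} {r : Radii} {z u : Fin 2 → ℂ_[p]}
    (h : ∀ j, ‖z j - u j‖ ≤ r.1 j) (x : ℂ_[p]) (j : Fin 2) :
    ‖Function.update z s x j - Function.update u s x j‖ ≤ r.1 j := by
  by_cases hj : j = s
  · subst hj; simpa using (r.2 j).1.le
  · rw [Function.update_of_ne hj, Function.update_of_ne hj]; exact h j

/-- Interpolation in the coordinate `s` at the nodes `0, …, κ s`. -/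
def interpRigid (κ : Fin 2 → ℕ) (s : Fin 2) (r : Radii) (hs : UpdStable σ s r) :
    rigid σ r.1 →ₗ[L] rigid σ r.1 where
  toFun F := ⟨fun z => ∑ i ∈ Finset.range (κ s + 1),
      F.1 ⟨Function.update z.1 s (i : ℂ_[p]), hs z.1 z.2 i⟩ * (lag ℂ_[p] (κ s) i).eval (z.1 s), by
    intro u hu ε hε
    have hC := one_le_lagBound (p := p) (κ s)
    have hC0 := zero_lt_one.trans_le hC
    have hun : u ∈ nbhd σ r.1 := ⟨u, hu, fun i => by simpa using (r.2 i).1.le⟩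
    have h1 : ∀ i : ℕ, ∃ P : MvPolynomial (Fin 2) L, ∀ z : nbhd σ r.1,
        (∀ j, ‖z.1 j - u j‖ ≤ r.1 j) →
        ‖F.1 ⟨Function.update z.1 s (i : ℂ_[p]), hs z.1 z.2 i⟩ -
          MvPolynomial.aeval (Function.update z.1 s (i : ℂ_[p])) P‖ ≤ ε / lagBound p (κ s) := by
      intro i
      obtain ⟨v, hv, huv⟩ := hs u hun i
      obtain ⟨P, hP⟩ := F.2 v hv (ε / lagBound p (κ s)) (by positivity)
      refine ⟨P, fun z hz => hP ⟨_, hs z.1 z.2 i⟩ fun j => ?_⟩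
      exact norm_sub_le_of_le (norm_update_sub_le hz _ j) (huv j)
    choose P hP using h1
    refine ⟨∑ i ∈ Finset.range (κ s + 1),
      MvPolynomial.aeval (Function.update MvPolynomial.X s (MvPolynomial.C (i : L))) (P i) *
        aeval (MvPolynomial.X s : MvPolynomial (Fin 2) L) (lag L (κ s) i), fun z hz => ?_⟩
    have e : ∀ i : ℕ, MvPolynomial.aeval z.1
        (MvPolynomial.aeval (Function.update MvPolynomial.X s (MvPolynomial.C (i : L))) (P i) :
          MvPolynomial (Fin 2) L) =
        MvPolynomial.aeval (Function.update z.1 s (i : ℂ_[p])) (P i) := fun i => by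
      rw [← AlgHom.comp_apply]
      congr 1
      ext j
      by_cases hj : j = s
      · subst hj; simp
      · simp [hj]
    have e2 : ∀ i : ℕ, MvPolynomial.aeval z.1
        (aeval (MvPolynomial.X s : MvPolynomial (Fin 2) L) (lag L (κ s) i)) =
        (lag ℂ_[p] (κ s) i).eval (z.1 s) := fun i => by
      rw [← lag_aeval (L := L), ← aeval_algHom_apply, MvPolynomial.aeval_X]
    rw [map_sum, ← Finset.sum_sub_distrib]
    refine IsUltrametricDist.norm_sum_le_of_forall_le_of_nonneg hε.le fun i hi => ?_
    rw [map_mul, e, e2, ← sub_mul, norm_mul]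
    calc _ ≤ (ε / lagBound p (κ s)) * lagBound p (κ s) := by
          gcongr
          · exact hP i z hz
          · exact norm_lag_le hi (norm_le_one_of_mem_nbhd r z.2 s)
      _ = ε := by field_simp⟩
  map_add' F G := by
    ext z
    simp only [Submodule.coe_add, Pi.add_apply, add_mul, Finset.sum_add_distrib]
  map_smul' c F := by
    ext z
    simp only [Submodule.coe_smul, Pi.smul_apply, RingHom.id_apply, smul_mul_assoc, Finset.smul_sum]

variable {s : Fin 2} {r : Radii} (hs : UpdStable σ s r)

lemma interpRigid_apply (F : rigid σ r.1) (z : nbhd σ r.1) :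
    (interpRigid κ s r hs F).1 z = ∑ i ∈ Finset.range (κ s + 1),
      F.1 ⟨Function.update z.1 s (i : ℂ_[p]), hs z.1 z.2 i⟩ * (lag ℂ_[p] (κ s) i).eval (z.1 s) := rfl

lemma norm_interpRigid_le {F : rigid σ r.1} {M : ℝ} (hM : ∀ z, ‖F.1 z‖ ≤ M) (z : nbhd σ r.1) :
    ‖(interpRigid κ s r hs F).1 z‖ ≤ lagBound p (κ s) * M := by
  have h1 := (zero_le_one.trans (one_le_lagBound (p := p) (κ s)))
  rw [interpRigid_apply]
  refine IsUltrametricDist.norm_sum_le_of_forall_le_of_nonneg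
    (mul_nonneg h1 (nonneg_of_bound hM)) fun i hi => ?_
  rw [norm_mul, mul_comm]
  gcongr
  · exact norm_lag_le hi (norm_le_one_of_mem_nbhd r z.2 s)
  · exact hM _

/-- On the neighbourhood of radii `r`, the function `F` is a polynomial of degree at most `k` in the
coordinate `s`. -/
def IsPolyIn (s : Fin 2) (k : ℕ) (r : Radii) (F : nbhd σ r.1 → ℂ_[p]) : Prop :=
  ∀ w : Fin 2 → ℂ_[p], ∃ q : ℂ_[p][X], q.natDegree ≤ k ∧
    ∀ x, ∀ hx : Function.update w s x ∈ nbhd σ r.1, F ⟨Function.update w s x, hx⟩ = q.eval x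

/-- Together with `isPolyIn_interpRigid`, this makes interpolation a projection onto the functions
that are polynomials of degree at most `κ s` in the coordinate `s`. Unlike Taylor truncation it uses
the same nodes on all discs and for all radii, so the polynomial is global and the projection
commutes with restriction. -/
lemma interpRigid_eq_self {F : rigid σ r.1} (hF : IsPolyIn s (κ s) r F.1) :
    interpRigid κ s r hs F = F := by
  ext z
  obtain ⟨q, hq, h⟩ := hF z.1
  rw [interpRigid_apply]
  have e : F.1 z = q.eval (z.1 s) := by
    rw [← h (z.1 s) (by rw [Function.update_eq_self]; exact z.2)]
    exact congrArg F.1 (Subtype.ext (Function.update_eq_self _ _).symm)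
  rw [e, ← sum_eval_lag hq]
  exact Finset.sum_congr rfl fun i _ => by rw [h]

lemma isPolyIn_interpRigid (F : rigid σ r.1) :
    IsPolyIn s (κ s) r (interpRigid κ s r hs F).1 := by
  intro w
  by_cases hw : ∃ x, Function.update w s x ∈ nbhd σ r.1
  swap
  · exact ⟨0, by simp, fun x hx => absurd ⟨x, hx⟩ hw⟩
  obtain ⟨x₀, hx₀⟩ := hw
  have hm : ∀ i : ℕ, Function.update w s (i : ℂ_[p]) ∈ nbhd σ r.1 := fun i => by
    have := hs _ hx₀ i
    rwa [Function.update_idem] at this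
  refine ⟨∑ i ∈ Finset.range (κ s + 1), C (F.1 ⟨_, hm i⟩) * lag ℂ_[p] (κ s) i, ?_, fun x hx => ?_⟩
  · exact natDegree_sum_le_of_forall_le _ _ fun i hi =>
      (natDegree_C_mul_le _ _).trans (natDegree_lag_le _ _ hi)
  · rw [interpRigid_apply, eval_finsetSum]
    refine Finset.sum_congr rfl fun i _ => ?_
    rw [eval_mul, eval_C]
    simp only [Function.update_self, Function.update_idem]

lemma isPolyIn_of_interpRigid_eq {F : rigid σ r.1} (h : interpRigid κ s r hs F = F) :
    IsPolyIn s (κ s) r F.1 := h ▸ isPolyIn_interpRigid hs F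

/-- A polynomial of degree at most `k` stays one under the weight `k` action. -/
lemma exists_homogenized {q : ℂ_[p][X]} {k : ℕ} (hq : q.natDegree ≤ k) (a b c d : ℂ_[p]) :
    ∃ Q : ℂ_[p][X], Q.natDegree ≤ k ∧ ∀ x, a + c * x ≠ 0 →
      Q.eval x = (a + c * x) ^ k * q.eval ((b + d * x) / (a + c * x)) := by
  have hlin : ∀ e f : ℂ_[p], (C e + C f * X : ℂ_[p][X]).natDegree ≤ 1 := fun e f => by
    refine (natDegree_add_le _ _).trans (max_le (by simp) ((natDegree_C_mul_le _ _).trans (by simp)))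
  refine ⟨∑ m ∈ Finset.range (k + 1), C (q.coeff m) * ((C b + C d * X) ^ m *
    (C a + C c * X) ^ (k - m)), ?_, fun x hx => ?_⟩
  · refine natDegree_sum_le_of_forall_le _ _ fun m hm => (natDegree_C_mul_le _ _).trans ?_
    rw [Finset.mem_range] at hm
    refine natDegree_mul_le.trans ?_
    have h1 := natDegree_pow_le_of_le m (hlin b d)
    have h2 := natDegree_pow_le_of_le (k - m) (hlin a c)
    omega
  · rw [eval_eq_sum_range' (show q.natDegree < k + 1 by omega), eval_finsetSum, Finset.mul_sum]
    refine Finset.sum_congr rfl fun m hm => ?_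
    rw [Finset.mem_range] at hm
    simp only [eval_mul, eval_C, eval_pow, eval_add, eval_X, div_pow]
    have : (a + c * x) ^ k = (a + c * x) ^ m * (a + c * x) ^ (k - m) := by
      rw [← pow_add]; congr 1; omega
    have hm0 : (a + c * x) ^ m ≠ 0 := pow_ne_zero _ hx
    calc _ = q.coeff m * (b + d * x) ^ m * (a + c * x) ^ (k - m) *
          ((a + c * x) ^ m / (a + c * x) ^ m) := by rw [div_self hm0]; ring
      _ = _ := by rw [this]; ring

lemma moebius_update (γ : GL (Fin 2) K) (z : Fin 2 → ℂ_[p]) (x : ℂ_[p]) :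
    moebius σ γ (Function.update z s x) = Function.update (moebius σ γ z) s
      ((emb σ (γ 0 1) s + emb σ (γ 1 1) s * x) / (emb σ (γ 0 0) s + emb σ (γ 1 0) s * x)) := by
  funext j
  by_cases hj : j = s
  · subst hj; simp [moebius]
  · simp [moebius, hj]

lemma autFactor_update (γ : GL (Fin 2) K) (z : Fin 2 → ℂ_[p]) (x : ℂ_[p]) :
    autFactor κ σ γ (Function.update z s x) =
      (emb σ (γ 0 0) s + emb σ (γ 1 0) s * x) ^ κ s *
      ∏ i ∈ Finset.univ.erase s, (emb σ (γ 0 0) i + emb σ (γ 1 0) i * z i) ^ κ i := by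
  rw [autFactor, ← Finset.mul_prod_erase _ _ (Finset.mem_univ s)]
  congr 1
  · simp
  · refine Finset.prod_congr rfl fun i hi => ?_
    rw [Function.update_of_ne (Finset.ne_of_mem_erase hi)]

/-- The automorphy factor of exponent `κ s` clears the denominators of a polynomial of degree at
most `κ s`; the factor from the other coordinate is constant in the coordinate `s`. -/
lemma IsPolyIn.rigidAct {F : rigid σ r.1} (hF : IsPolyIn s (κ s) r F.1) {γ : GL (Fin 2) K}
    (h : InSigma0 σ γ) : IsPolyIn s (κ s) r (rigidAct κ h r F).1 := by
  intro w
  obtain ⟨q, hq, hqe⟩ := hF (moebius σ γ w)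
  obtain ⟨Q, hQ, hQe⟩ := exists_homogenized hq (emb σ (γ 0 0) s) (emb σ (γ 0 1) s)
    (emb σ (γ 1 0) s) (emb σ (γ 1 1) s)
  refine ⟨C (∏ i ∈ Finset.univ.erase s, (emb σ (γ 0 0) i + emb σ (γ 1 0) i * w i) ^ κ i) * Q,
    (natDegree_C_mul_le _ _).trans hQ, fun x hx => ?_⟩
  have hx1 : ‖x‖ ≤ 1 := by simpa using norm_le_one_of_mem_nbhd r hx s
  have hm := h.moebius_mem_nbhd r hx
  rw [rigidAct_apply, autFactor_update, eval_mul, eval_C, hQe x (h.denom_ne_zero s hx1)]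
  have e : F.1 ⟨moebius σ γ (Function.update w s x), hm⟩ = q.eval
      ((emb σ (γ 0 1) s + emb σ (γ 1 1) s * x) / (emb σ (γ 0 0) s + emb σ (γ 1 0) s * x)) := by
    rw [← hqe _ (by rw [← moebius_update]; exact hm)]
    exact congrArg F.1 (Subtype.ext (moebius_update γ w x))
  rw [e]
  ring

lemma isPolyIn_polyToRigid (P : Vpoly L κ) : IsPolyIn s (κ s) r (polyToRigid κ σ r.1 P).1 := by
  intro w
  refine ⟨∑ d ∈ P.1.support, C (algebraMap L ℂ_[p] (P.1.coeff d) *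
    ∏ i ∈ Finset.univ.erase s, w i ^ d (i, 0)) * X ^ d (s, 0), ?_, fun x hx => ?_⟩
  · refine natDegree_sum_le_of_forall_le _ _ fun d hd => (natDegree_C_mul_X_pow_le _ _).trans ?_
    have h3 := P.2 (MvPolynomial.mem_support_iff.mp hd)
    rw [Finsupp.weight_apply, Finsupp.sum_fintype _ _ (by simp)] at h3
    rw [← h3, Finset.sum_apply]
    have := Finset.single_le_sum (f := fun v => (d v • bideg v) s) (fun _ _ => Nat.zero_le _)
      (Finset.mem_univ (s, (0 : Fin 2)))
    simpa [bideg] using this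
  · change MvPolynomial.aeval (affinePt (Function.update w s x)) P.1 = _
    rw [MvPolynomial.aeval_def, MvPolynomial.eval₂_eq', eval_finsetSum]
    refine Finset.sum_congr rfl fun d _ => ?_
    rw [eval_mul, eval_C, eval_pow, eval_X, mul_assoc]
    congr 1
    rw [Fintype.prod_prod_type, ← Finset.mul_prod_erase _ _ (Finset.mem_univ s), mul_comm]
    congr 1
    · refine Finset.prod_congr rfl fun i hi => ?_
      simp [affinePt, Function.update_of_ne (Finset.ne_of_mem_erase hi)]
    · simp [affinePt]

/-- Interpolation in one coordinate as a family of projections, for split `p`. -/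
def TestProj.interp (κ : Fin 2 → ℕ) {s : Fin 2} (h : Pi.single s 1 ∈ OKp σ) : TestProj κ σ where
  proj r := interpRigid κ s r (updStable_of_single h r)
  bound := lagBound p (κ s)
  norm_le _ _ _ hM z := norm_interpRigid_le _ hM z
  proj_restrict _ _ _ _ := rfl
  idem _ F := interpRigid_eq_self _ (isPolyIn_interpRigid _ F)
  act h' _ _ hF := interpRigid_eq_self _ ((isPolyIn_of_interpRigid_eq _ hF).rigidAct h')
  poly _ P := interpRigid_eq_self _ (isPolyIn_polyToRigid P)

end Interpolation

/-! ### Pullback along `z ↦ b + Az` and its approximation by polynomials -/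

section Contraction

open Polynomial

variable {p : ℕ} [Fact p.Prime] {L : Type*} [Field L] [Algebra L ℂ_[p]] {K : Type*} [Field K]
  {σ : EmbPair p K L} {κ : Fin 2 → ℕ}

/-- The matrix `(1, b; 0, A)`. -/
def affMat (b : K) (A : Kˣ) : GL (Fin 2) K :=
  Matrix.GeneralLinearGroup.mkOfDetNeZero !![1, b; 0, (A : K)] (by simp)

@[simp] lemma affMat_zero_zero (b : K) (A : Kˣ) : affMat b A 0 0 = 1 := rfl
@[simp] lemma affMat_zero_one (b : K) (A : Kˣ) : affMat b A 0 1 = b := rfl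
@[simp] lemma affMat_one_zero (b : K) (A : Kˣ) : affMat b A 1 0 = 0 := rfl
@[simp] lemma affMat_one_one (b : K) (A : Kˣ) : affMat b A 1 1 = A := rfl

lemma inSigma0_affMat {b : K} {A : Kˣ} (hb : emb σ b ∈ OKp σ) (hA : emb σ (A : K) ∈ OKp σ) :
    InSigma0 σ (affMat b A) := by
  refine ⟨fun i j => ?_, ⟨0, zero_mem _, ?_⟩, 1, one_mem _, ?_⟩
  · fin_cases i <;> fin_cases j <;> simp [hb, hA]
  · simp
  · simp

lemma moebius_affMat (b : K) (A : Kˣ) (z : Fin 2 → ℂ_[p]) :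
    moebius σ (affMat b A) z = fun j => emb σ b j + emb σ (A : K) j * z j := by
  funext j
  simp [moebius]

lemma autFactor_affMat (b : K) (A : Kˣ) (z : Fin 2 → ℂ_[p]) :
    autFactor κ σ (affMat b A) z = 1 := by
  simp [autFactor]

/-- The map `z ↦ b + A z` maps polydiscs of radii `r'` around points of `𝓞_K ⊗ ℤ_p` into polydiscs of
radii `r` around such points. -/
def MapsDiscs (σ : EmbPair p K L) (r r' : Radii) (b : K) (A : Kˣ) : Prop :=
  ∀ u ∈ OKp σ, ∃ v ∈ OKp σ, ∀ z : Fin 2 → ℂ_[p], (∀ j, ‖z j - u j‖ ≤ r'.1 j) →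
    ∀ j, ‖emb σ b j + emb σ (A : K) j * z j - v j‖ ≤ r.1 j

lemma MapsDiscs.mem {r r' : Radii} {b : K} {A : Kˣ} (h : MapsDiscs σ r r' b A)
    {z : Fin 2 → ℂ_[p]} (hz : z ∈ nbhd σ r'.1) :
    (fun j => emb σ b j + emb σ (A : K) j * z j) ∈ nbhd σ r.1 := by
  obtain ⟨u, hu, huz⟩ := hz
  obtain ⟨v, hv, hvz⟩ := h u hu
  exact ⟨v, hv, hvz z huz⟩

/-- Composition with `z ↦ b + A z`. -/
def pullback {r r' : Radii} {b : K} {A : Kˣ} (h : MapsDiscs σ r r' b A) :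
    rigid σ r.1 →ₗ[L] rigid σ r'.1 where
  toFun F := ⟨fun z => F.1 ⟨_, h.mem z.2⟩, by
    intro u hu ε hε
    obtain ⟨v, hv, hvz⟩ := h u hu
    obtain ⟨P, hP⟩ := F.2 v hv ε hε
    refine ⟨MvPolynomial.aeval (fun j => MvPolynomial.C (σ.σ j b) +
      MvPolynomial.C (σ.σ j (A : K)) * MvPolynomial.X j) P, fun z hz => ?_⟩
    have e : MvPolynomial.aeval z.1 (MvPolynomial.aeval (fun j => MvPolynomial.C (σ.σ j b) +
        MvPolynomial.C (σ.σ j (A : K)) * MvPolynomial.X j) P : MvPolynomial (Fin 2) L) =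
        MvPolynomial.aeval (fun j => emb σ b j + emb σ (A : K) j * z.1 j) P := by
      rw [← AlgHom.comp_apply]
      congr 1
      ext j
      simp only [AlgHom.comp_apply, MvPolynomial.aeval_X, map_add, map_mul, MvPolynomial.aeval_C]
      rfl
    rw [e]
    exact hP ⟨_, h.mem z.2⟩ (hvz z.1 hz)⟩
  map_add' _ _ := rfl
  map_smul' _ _ := rfl

lemma pullback_apply {r r' : Radii} {b : K} {A : Kˣ} (h : MapsDiscs σ r r' b A) (F : rigid σ r.1)
    (z : nbhd σ r'.1) : (pullback h F).1 z = F.1 ⟨_, h.mem z.2⟩ := rfl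

/-- The gain in radius: a function on the small neighbourhood `r` pulls back to one on the larger
neighbourhood `r'`, so only the norm of `μ` at `r'` matters, however small `r` is. -/
lemma distAct_affMat {r r' : Radii} (hrr' : r.1 ≤ r'.1) {b : K} {A : Kˣ}
    (h : MapsDiscs σ r r' b A) (hβ : InSigma0 σ (affMat b A)) (μ : Dist σ) (F : rigid σ r.1) :
    (distAct κ σ (affMat b A) μ).1 r F = μ.1 r' (pullback h F) := by
  rw [distAct_apply hβ]
  refine Eq.trans ?_ (μ.2.2 r r' hrr' (pullback h F))
  congr 1
  ext z
  rw [rigidAct_apply, autFactor_affMat, one_mul]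
  exact congrArg F.1 (Subtype.ext (moebius_affMat b A z.1))

lemma IsPolyIn.pullback {s : Fin 2} {k : ℕ} {r r' : Radii} {b : K} {A : Kˣ}
    (h : MapsDiscs σ r r' b A) {F : rigid σ r.1} (hF : IsPolyIn s k r F.1) :
    IsPolyIn s k r' (pullback h F).1 := by
  intro w
  obtain ⟨q, hq, hqe⟩ := hF fun j => emb σ b j + emb σ (A : K) j * w j
  refine ⟨q.comp (C (emb σ b s) + C (emb σ (A : K) s) * X), ?_, fun x hx => ?_⟩
  · refine natDegree_comp_le.trans ((Nat.mul_le_mul hq ?_).trans (mul_one k).le)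
    exact (natDegree_add_le _ _).trans (max_le (by simp) ((natDegree_C_mul_le _ _).trans (by simp)))
  · have e : (fun j => emb σ b j + emb σ (A : K) j * Function.update w s x j) =
        Function.update (fun j => emb σ b j + emb σ (A : K) j * w j) s
          (emb σ b s + emb σ (A : K) s * x) := by
      funext j
      by_cases hj : j = s
      · subst hj; simp
      · simp [hj]
    have hm := h.mem hx
    rw [e] at hm
    rw [pullback_apply, eval_comp, eval_add, eval_mul, eval_C, eval_C, eval_X, ← hqe _ hm]
    exact congrArg F.1 (Subtype.ext e)

lemma eval_slice (P : MvPolynomial (Fin 2) L) (w : Fin 2 → ℂ_[p]) (s : Fin 2) (e f x : ℂ_[p]) :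
    (MvPolynomial.aeval (Function.update (fun j => C (w j)) s (C e + C f * X)) P : ℂ_[p][X]).eval x =
      MvPolynomial.aeval (Function.update w s (e + f * x)) P := by
  rw [← Polynomial.coe_aeval_eq_eval]
  change ((Polynomial.aeval x).restrictScalars L) _ = _
  rw [← AlgHom.comp_apply]
  congr 1
  ext j
  by_cases hj : j = s
  · subst hj; simp
  · simp [hj]

/-- On the disc of radius `‖w‖` the function `x ↦ F (b + w x)` is still analytic and bounded by `M`,
and the pullback is its composition with `x ↦ (A / w) x`. An element `w` is used instead of the
radius itself, which need not be an absolute value. -/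
lemma norm_pullback_sub_interp_le {s : Fin 2} {r r' : Radii} (hr' : r'.1 s = 1) {b : K} {A : Kˣ}
    (h : MapsDiscs σ r r' b A) {w : ℂ_[p]} (hAw : ‖emb σ (A : K) s‖ ≤ ‖w‖) (hw : ‖w‖ ≤ r.1 s)
    {F : rigid σ r.1} {M : ℝ} (hM : ∀ z, ‖F.1 z‖ ≤ M) (hs : UpdStable σ s r') (z : nbhd σ r'.1) :
    ‖(pullback h F - interpRigid κ s r' hs (pullback h F)).1 z‖ ≤
      lagBound p (κ s) * (M * (‖emb σ (A : K) s‖ / ‖w‖) ^ (κ s + 1)) := by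
  classical
  have hM0 := nonneg_of_bound hM
  have ha : emb σ (A : K) s ≠ 0 := by
    simp [emb]
  have hw0 : w ≠ 0 := norm_pos_iff.mp ((norm_pos_iff.mpr ha).trans_le hAw)
  -- The value `0` off the unit disc is never used: the nodes and the points of evaluation all lie
  -- in the disc.
  let f : ℂ_[p] → ℂ_[p] := fun x => if hx : ‖x‖ ≤ 1 then
    (pullback h F).1 ⟨Function.update z.1 s x, update_mem_nbhd hr' z.2 hx⟩ else 0
  have hzs := norm_le_one_of_mem_nbhd r' z.2 s
  have hf : ∀ x (hx : ‖x‖ ≤ 1), f x =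
      (pullback h F).1 ⟨Function.update z.1 s x, update_mem_nbhd hr' z.2 hx⟩ := fun x hx =>
    dif_pos hx
  have e1 : (pullback h F - interpRigid κ s r' hs (pullback h F)).1 z =
      f (z.1 s) - interp (κ s) f (z.1 s) := by
    change (pullback h F).1 z - (interpRigid κ s r' hs (pullback h F)).1 z = _
    rw [interpRigid_apply, hf _ hzs]
    congr 1
    · exact congrArg (pullback h F).1 (Subtype.ext (Function.update_eq_self _ _).symm)
    · exact Finset.sum_congr rfl fun i _ => by rw [hf _ (norm_natCast_le_one i)]
  rw [e1]
  refine norm_sub_interp_le_of_approx hM0 ha hAw (fun ε hε => ?_) hzs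
  obtain ⟨u, hu, huz⟩ := z.2
  obtain ⟨v, hv, hvz⟩ := h u hu
  obtain ⟨P, hP⟩ := F.2 v hv ε hε
  set y : Fin 2 → ℂ_[p] := fun j => emb σ b j + emb σ (A : K) j * z.1 j with hy
  -- By the ultrametric inequality, moving the coordinate `s` to any point within `‖w‖` of `b` stays
  -- in the disc of radius `r.1 s` around `v`, where `P` approximates `F`.
  have near : ∀ x : ℂ_[p], ‖x‖ ≤ 1 → ∀ j,
      ‖Function.update y s (emb σ b s + w * x) j - v j‖ ≤ r.1 j := by
    intro x hx j
    by_cases hj : j = s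
    · subst hj
      rw [Function.update_self]
      have e : emb σ b j + w * x - v j = (emb σ b j + emb σ (A : K) j * z.1 j - v j) +
          (w * x - emb σ (A : K) j * z.1 j) := by ring
      rw [e]
      refine (IsUltrametricDist.norm_add_le_max _ _).trans (max_le (hvz z.1 huz j) ?_)
      refine (norm_sub_le_max_padic _ _).trans (max_le ?_ ?_) <;> rw [norm_mul]
      · exact (mul_le_of_le_one_right (norm_nonneg _) hx).trans hw
      · exact (mul_le_of_le_one_right (norm_nonneg _) hzs).trans (hAw.trans hw)
    · rw [Function.update_of_ne hj]; exact hvz z.1 huz j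
  refine ⟨MvPolynomial.aeval (Function.update (fun j => C (y j)) s (C (emb σ b s) + C w * X)) P,
    fun x hx => ?_, fun x hx => ?_⟩
  · rw [eval_slice]
    have h1 := hP ⟨_, v, hv, near x hx⟩ (near x hx)
    have h2 := norm_sub_le (F.1 ⟨_, v, hv, near x hx⟩)
      (F.1 ⟨_, v, hv, near x hx⟩ - MvPolynomial.aeval (Function.update y s (emb σ b s + w * x)) P)
    rw [sub_sub_cancel] at h2
    exact h2.trans (add_le_add (hM _) h1)
  · have hx' : ‖emb σ (A : K) s / w * x‖ ≤ 1 := by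
      rw [norm_mul, norm_div]
      exact mul_le_one₀ ((div_le_one (norm_pos_iff.mpr hw0)).mpr hAw) (norm_nonneg _) hx
    have e2 : emb σ b s + w * (emb σ (A : K) s / w * x) = emb σ b s + emb σ (A : K) s * x := by
      field_simp
    have e3 : (fun j => emb σ b j + emb σ (A : K) j * Function.update z.1 s x j) =
        Function.update y s (emb σ b s + emb σ (A : K) s * x) := by
      funext j
      by_cases hj : j = s
      · subst hj; simp
      · simp [hj, hy]
    rw [eval_slice, hf x hx, pullback_apply, e2]
    have h1 := near _ hx'
    rw [e2] at h1
    have := hP ⟨_, v, hv, h1⟩ h1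
    simp only [e3]
    exact this

/-- Only the coordinate `s` shrinks, and there the disc can be recentred at `b`; the other
coordinate keeps the centre `b + Au`. The idempotent provides a point of `𝓞_K ⊗ ℤ_p` with these
coordinates. -/
lemma mapsDiscs_of_single {s : Fin 2} (h : Pi.single s 1 ∈ OKp σ) {r r' : Radii}
    (hs : r'.1 s = 1) (hr : ∀ j ≠ s, r'.1 j = r.1 j) {b : K} {A : Kˣ} (hb : emb σ b ∈ OKp σ)
    (hA : emb σ (A : K) ∈ OKp σ) (hAr : ‖emb σ (A : K) s‖ ≤ r.1 s) : MapsDiscs σ r r' b A := by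
  intro u hu
  refine ⟨_, update_mem_OKp h (add_mem hb (mul_mem hA hu)) hb, fun z hz j => ?_⟩
  by_cases hj : j = s
  · subst hj
    rw [Function.update_self, add_sub_cancel_left, norm_mul]
    refine (mul_le_of_le_one_right (norm_nonneg _) ?_).trans hAr
    exact norm_le_one_of_near hu j (by simpa [hs] using hz j)
  · rw [Function.update_of_ne hj, Pi.add_apply, Pi.mul_apply, add_sub_add_left_eq_sub, ← mul_sub,
      norm_mul]
    refine (mul_le_of_le_one_left (norm_nonneg _) (norm_le_one_of_mem_OKp hA j)).trans ?_
    rw [← hr j hj]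
    exact hz j

lemma mapsDiscs_one {r : Radii} {b : K} {A : Kˣ} (hb : emb σ b ∈ OKp σ)
    (hAr : ∀ j, ‖emb σ (A : K) j‖ ≤ r.1 j) : MapsDiscs σ r Radii.one b A := by
  intro u hu
  refine ⟨_, hb, fun z hz j => ?_⟩
  rw [add_sub_cancel_left, norm_mul]
  exact (mul_le_of_le_one_right (norm_nonneg _) (norm_le_one_of_near hu j (hz j))).trans (hAr j)

/-- The homogenization of degree `k` of a polynomial, in the variables `(s, 0)` and `(s, 1)`. -/
def homog (s : Fin 2) (k : ℕ) (q : L[X]) : MvPolynomial (Fin 2 × Fin 2) L :=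
  ∑ m ∈ Finset.range (k + 1), MvPolynomial.C (q.coeff m) *
    (MvPolynomial.X (s, 0) ^ m * MvPolynomial.X (s, 1) ^ (k - m))

lemma homog_isWeightedHomogeneous (s : Fin 2) (k : ℕ) (q : L[X]) :
    MvPolynomial.IsWeightedHomogeneous bideg (homog s k q) (Pi.single s k) := by
  refine Submodule.sum_mem (MvPolynomial.weightedHomogeneousSubmodule L bideg (Pi.single s k))
    fun m hm => ?_
  rw [Finset.mem_range] at hm
  have h1 := ((MvPolynomial.isWeightedHomogeneous_X L bideg (s, (0 : Fin 2))).pow m).mul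
    ((MvPolynomial.isWeightedHomogeneous_X L bideg (s, (1 : Fin 2))).pow (k - m))
  have e : m • bideg (s, (0 : Fin 2)) + (k - m) • bideg (s, (1 : Fin 2)) = Pi.single s k := by
    rw [show bideg (s, (1 : Fin 2)) = bideg (s, (0 : Fin 2)) from rfl, ← add_smul,
      Nat.add_sub_cancel' (by omega)]
    funext j
    simp [bideg, Pi.single_apply]
  rw [e] at h1
  exact h1.C_mul _

lemma aeval_homog {s : Fin 2} {k : ℕ} {q : L[X]} (hq : q.natDegree ≤ k) (z : Fin 2 → ℂ_[p]) :
    MvPolynomial.aeval (affinePt z) (homog s k q) = aeval (z s) q := by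
  rw [homog, map_sum, aeval_eq_sum_range' (show q.natDegree < k + 1 by omega)]
  refine Finset.sum_congr rfl fun m _ => ?_
  simp [affinePt, Algebra.smul_def]

end Contraction

/-! ### Contraction of distributions that vanish on polynomials -/

section Estimates

open Polynomial

variable {p : ℕ} [Fact p.Prime] {L : Type*} [Field L] [Algebra L ℂ_[p]] {K : Type*} [Field K]
  {σ : EmbPair p K L} {κ : Fin 2 → ℕ}

lemma exists_value_mem (hcl : IsClosed (Set.range (algebraMap L ℂ_[p]))) {r : Radii}
    (F : rigid σ r.1) (x : Fin 2 → L) (hx : (fun j => algebraMap L ℂ_[p] (x j)) ∈ nbhd σ r.1) :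
    ∃ a : L, algebraMap L ℂ_[p] a = F.1 ⟨_, hx⟩ := by
  refine exists_eq_algebraMap_of_approx hcl fun ε hε => ?_
  obtain ⟨u, hu, h⟩ := id hx
  obtain ⟨P, hP⟩ := F.2 u hu ε hε
  refine ⟨MvPolynomial.aeval x P, ?_⟩
  have e : algebraMap L ℂ_[p] (MvPolynomial.aeval x P) =
      MvPolynomial.aeval (fun j => algebraMap L ℂ_[p] (x j)) P := by
    exact (MvPolynomial.aeval_algebraMap_apply ℂ_[p] x P).symm
  rw [e]
  exact hP ⟨_, hx⟩ h

lemma natDegree_lag_le_of_algebra (p : ℕ) [Fact p.Prime] [Algebra L ℂ_[p]] (k i : ℕ)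
    (hi : i ∈ Finset.range (k + 1)) : (lag L k i).natDegree ≤ k := by
  rw [← natDegree_map (algebraMap L ℂ_[p]), lag_map]
  exact natDegree_lag_le k i hi

/-- Interpolation in both coordinates yields a polynomial of degree at most `κ` over `L`. -/
lemma exists_polyToRigid_eq (hcl : IsClosed (Set.range (algebraMap L ℂ_[p]))) {r : Radii}
    (h0 : UpdStable σ 0 r) (h1 : UpdStable σ 1 r) (F : rigid σ r.1) :
    ∃ P : Vpoly L κ, interpRigid κ 0 r h0 (interpRigid κ 1 r h1 F) = polyToRigid κ σ r.1 P := by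
  have hpt : ∀ i j : ℕ, (fun l => algebraMap L ℂ_[p] ((![(i : L), (j : L)] : Fin 2 → L) l)) ∈
      nbhd σ r.1 := fun i j => by
    have h := h1 _ (h0 _ (zero_mem_nbhd r) i) j
    convert h using 1
    funext l
    fin_cases l <;> simp
  choose a ha using fun i j => exists_value_mem hcl F _ (hpt i j)
  have hmem : (∑ i ∈ Finset.range (κ 0 + 1), ∑ j ∈ Finset.range (κ 1 + 1),
      MvPolynomial.C (a i j) * (homog 0 (κ 0) (lag L (κ 0) i) * homog 1 (κ 1) (lag L (κ 1) j))) ∈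
      Vpoly L κ := by
    refine Submodule.sum_mem _ fun i _ => Submodule.sum_mem _ fun j _ => ?_
    have h := (homog_isWeightedHomogeneous 0 (κ 0) (lag L (κ 0) i)).mul
      (homog_isWeightedHomogeneous 1 (κ 1) (lag L (κ 1) j))
    have e : (Pi.single 0 (κ 0) + Pi.single 1 (κ 1) : Fin 2 → ℕ) = κ := by
      funext l; fin_cases l <;> simp
    rw [e] at h
    exact h.C_mul _
  refine ⟨⟨_, hmem⟩, ?_⟩
  ext z
  change _ = MvPolynomial.aeval (affinePt z.1) (∑ i ∈ Finset.range (κ 0 + 1),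
    ∑ j ∈ Finset.range (κ 1 + 1), MvPolynomial.C (a i j) *
      (homog 0 (κ 0) (lag L (κ 0) i) * homog 1 (κ 1) (lag L (κ 1) j)))
  rw [interpRigid_apply, map_sum]
  refine Finset.sum_congr rfl fun i hi => ?_
  rw [interpRigid_apply, map_sum, Finset.sum_mul]
  refine Finset.sum_congr rfl fun j hj => ?_
  rw [map_mul, map_mul, aeval_homog (natDegree_lag_le_of_algebra p _ _ hi),
    aeval_homog (natDegree_lag_le_of_algebra p _ _ hj), lag_aeval, lag_aeval, MvPolynomial.aeval_C, ha]
  have e : (fun l => algebraMap L ℂ_[p] ((![(i : L), (j : L)] : Fin 2 → L) l)) =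
      Function.update (Function.update z.1 0 (i : ℂ_[p])) 1 (j : ℂ_[p]) := by
    funext l; fin_cases l <;> simp
  simp only [e]
  rw [Function.update_of_ne (by decide)]
  ring

lemma polyToRigid_eq_zero {μ : Dist σ} (hμ : specialize κ σ μ = 0) (r : Radii) (P : Vpoly L κ) :
    μ.1 r (polyToRigid κ σ r.1 P) = 0 := by
  have h1 : μ.1 Radii.one (polyToRigid κ σ Radii.one.1 P) = 0 := DFunLike.congr_fun hμ P
  rw [← h1]
  exact μ.2.2 r Radii.one (fun j => (r.2 j).2) (polyToRigid κ σ Radii.one.1 P)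

/-- Since `μ` kills `G`, it sees of `H` only its distance to `G`; `G` will be an interpolation of
`H`. -/
lemma norm_le_of_sub {μ : Dist σ} {r : Radii} {B : ℝ} (hB : (TestProj.id κ σ).Bd r B μ)
    {G H : rigid σ r.1} (hG : μ.1 r G = 0) {M : ℝ} (hM : ∀ z, ‖(H - G).1 z‖ ≤ M) :
    ‖algebraMap L ℂ_[p] (μ.1 r H)‖ ≤ B * M := by
  have := hB (H - G) rfl M hM
  rwa [map_sub, hG, sub_zero] at this

/-- Contraction in one coordinate `s` of distributions that vanish on the functions which are
polynomials of degree at most `κ s` in this coordinate. -/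
lemma bd_distAct_of_mem_ker_interp {s : Fin 2} (hs : Pi.single s 1 ∈ OKp σ) {r r' : Radii}
    (hr' : r'.1 s = 1) (hr : ∀ j ≠ s, r'.1 j = r.1 j) {b : K} {A : Kˣ} (hb : emb σ b ∈ OKp σ)
    (hA : emb σ (A : K) ∈ OKp σ) {w : ℂ_[p]} (hAw : ‖emb σ (A : K) s‖ ≤ ‖w‖) (hw : ‖w‖ ≤ r.1 s)
    {μ : Dist σ} (hμ : μ ∈ (TestProj.interp κ hs).ker) {B : ℝ}
    (hB : (TestProj.id κ σ).Bd r' B μ) :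
    (TestProj.id κ σ).Bd r (B * lagBound p (κ s) * (‖emb σ (A : K) s‖ / ‖w‖) ^ (κ s + 1))
      (distAct κ σ (affMat b A) μ) := by
  intro F _ M hM
  have hd := mapsDiscs_of_single hs hr' hr hb hA (hAw.trans hw)
  have hrr' : r.1 ≤ r'.1 := fun j => by
    by_cases hj : j = s
    · subst hj; rw [hr']; exact (r.2 j).2
    · exact (hr j hj).ge
  rw [distAct_affMat hrr' hd (inSigma0_affMat hb hA)]
  refine (norm_le_of_sub hB (hμ r' _ ((TestProj.interp κ hs).idem r' (pullback hd F)))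
    (norm_pullback_sub_interp_le hr' hd hAw hw hM (updStable_of_single hs r'))).trans_eq ?_
  ring

/-- Write `H - I₀ I₁ H = (H - I₀ H) + I₀ (H - I₁ H)`, where `I₀` enlarges norms by at most
`lagBound`. -/
lemma norm_sub_interp_interp_le {r : Radii} (h0 : UpdStable σ 0 r) (h1 : UpdStable σ 1 r)
    {H : rigid σ r.1} {δ₀ δ₁ : ℝ} (e0 : ∀ z, ‖(H - interpRigid κ 0 r h0 H).1 z‖ ≤ δ₀)
    (e1 : ∀ z, ‖(H - interpRigid κ 1 r h1 H).1 z‖ ≤ δ₁) (z : nbhd σ r.1) :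
    ‖(H - interpRigid κ 0 r h0 (interpRigid κ 1 r h1 H)).1 z‖ ≤ max δ₀ (lagBound p (κ 0) * δ₁) := by
  have e : H - interpRigid κ 0 r h0 (interpRigid κ 1 r h1 H) =
      (H - interpRigid κ 0 r h0 H) + interpRigid κ 0 r h0 (H - interpRigid κ 1 r h1 H) := by
    rw [map_sub]; abel
  rw [e]
  exact (IsUltrametricDist.norm_add_le_max _ _).trans
    (max_le_max (e0 z) (norm_interpRigid_le h0 e1 z))

/-- Contraction in the second coordinate, on functions that are polynomials in the first one, of
distributions that vanish on polynomials. -/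
lemma bd_interp_distAct_of_specialize_eq_zero
    (hcl : IsClosed (Set.range (algebraMap L ℂ_[p]))) (hs0 : Pi.single 0 1 ∈ OKp σ)
    (hs1 : Pi.single 1 1 ∈ OKp σ) {r r' : Radii}
    (hr' : r'.1 1 = 1) (hr : r'.1 0 = r.1 0) {b : K} {A : Kˣ} (hb : emb σ b ∈ OKp σ)
    (hA : emb σ (A : K) ∈ OKp σ) {w : ℂ_[p]} (hAw : ‖emb σ (A : K) 1‖ ≤ ‖w‖) (hw : ‖w‖ ≤ r.1 1)
    {μ : Dist σ} (hμ : specialize κ σ μ = 0) {B : ℝ}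
    (hB : (TestProj.id κ σ).Bd r' B μ) :
    (TestProj.interp κ hs0).Bd r (B * (lagBound p (κ 0) * lagBound p (κ 1)) *
      (‖emb σ (A : K) 1‖ / ‖w‖) ^ (κ 1 + 1)) (distAct κ σ (affMat b A) μ) := by
  intro F hF M hM
  have hr2 : ∀ j ≠ (1 : Fin 2), r'.1 j = r.1 j := fun j hj => by
    fin_cases j
    · exact hr
    · exact absurd rfl hj
  have hd := mapsDiscs_of_single hs1 hr' hr2 hb hA (hAw.trans hw)
  have hrr' : r.1 ≤ r'.1 := fun j => by
    by_cases hj : j = 1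
    · subst hj; rw [hr']; exact (r.2 1).2
    · exact (hr2 j hj).ge
  rw [distAct_affMat hrr' hd (inSigma0_affMat hb hA)]
  have u0 := updStable_of_single hs0 r'
  have u1 := updStable_of_single hs1 r'
  -- The pullback is still a polynomial in the first coordinate, so interpolation there is exact and
  -- only the second coordinate contributes an error.
  have hH : interpRigid κ 0 r' u0 (pullback hd F) = pullback hd F :=
    interpRigid_eq_self _ (IsPolyIn.pullback hd
      (isPolyIn_of_interpRigid_eq (updStable_of_single hs0 r) hF))
  have hM0 := nonneg_of_bound hM
  have e1 := norm_pullback_sub_interp_le (κ := κ) hr' hd hAw hw hM u1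
  obtain ⟨P, hP⟩ := exists_polyToRigid_eq (κ := κ) hcl u0 u1 (pullback hd F)
  have e2 := norm_sub_interp_interp_le u0 u1 (δ₀ := 0) (fun z => by
    rw [hH, sub_self]
    change ‖(0 : ℂ_[p])‖ ≤ 0
    simp) e1
  have hpos : 0 ≤ lagBound p (κ 0) * (lagBound p (κ 1) *
      (M * (‖emb σ (A : K) 1‖ / ‖w‖) ^ (κ 1 + 1))) := by
    have := one_le_lagBound (p := p) (κ 0)
    have := one_le_lagBound (p := p) (κ 1)
    positivity
  rw [max_eq_right hpos] at e2
  refine (norm_le_of_sub hB ?_ e2).trans_eq (by ring)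
  rw [hP]
  exact polyToRigid_eq_zero hμ r' P

/-- Contraction in both coordinates of distributions that vanish on polynomials. -/
lemma bd_distAct_of_specialize_eq_zero
    (hcl : IsClosed (Set.range (algebraMap L ℂ_[p]))) {r : Radii} {b : K} {A : Kˣ}
    (hb : emb σ b ∈ OKp σ) (hA : emb σ (A : K) ∈ OKp σ) {w : ℂ_[p]}
    (hAw : ∀ s, ‖emb σ (A : K) s‖ ≤ ‖w‖) (hw : ∀ s, ‖w‖ ≤ r.1 s)
    {μ : Dist σ} (hμ : specialize κ σ μ = 0) {B δ : ℝ}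
    (hδ : ∀ s, (‖emb σ (A : K) s‖ / ‖w‖) ^ (κ s + 1) ≤ δ)
    (hB : (TestProj.id κ σ).Bd Radii.one B μ) :
    (TestProj.id κ σ).Bd r (B * (lagBound p (κ 0) * lagBound p (κ 1)) * δ)
      (distAct κ σ (affMat b A) μ) := by
  intro F hF M hM
  have hd := mapsDiscs_one (r := r) (A := A) hb fun j => (hAw j).trans (hw j)
  rw [distAct_affMat (fun j => (r.2 j).2) hd (inSigma0_affMat hb hA)]
  -- At radius `1` integer nodes are admissible in both coordinates even when `p` does not split.
  have u : ∀ s, UpdStable σ s Radii.one := fun s => updStable_of_eq_one rfl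
  have hM0 := nonneg_of_bound hM
  have e := fun s => norm_pullback_sub_interp_le (κ := κ) (s := s) (r' := Radii.one) rfl hd
    (hAw s) (hw s) hM (u s)
  obtain ⟨P, hP⟩ := exists_polyToRigid_eq (κ := κ) hcl (u 0) (u 1) (pullback hd F)
  have e2 := norm_sub_interp_interp_le (u 0) (u 1) (e 0) (e 1)
  have hδ0 : 0 ≤ δ := le_trans (by positivity) (hδ 0)
  have c0 := one_le_lagBound (p := p) (κ 0)
  have c1 := one_le_lagBound (p := p) (κ 1)
  have e3 : max (lagBound p (κ 0) * (M * (‖emb σ (A : K) 0‖ / ‖w‖) ^ (κ 0 + 1)))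
      (lagBound p (κ 0) * (lagBound p (κ 1) * (M * (‖emb σ (A : K) 1‖ / ‖w‖) ^ (κ 1 + 1)))) ≤
      lagBound p (κ 0) * lagBound p (κ 1) * δ * M := by
    have h0 : M * (‖emb σ (A : K) 0‖ / ‖w‖) ^ (κ 0 + 1) ≤ M * δ :=
      mul_le_mul_of_nonneg_left (hδ 0) hM0
    have h1 : M * (‖emb σ (A : K) 1‖ / ‖w‖) ^ (κ 1 + 1) ≤ M * δ :=
      mul_le_mul_of_nonneg_left (hδ 1) hM0
    have h2 : M * δ ≤ lagBound p (κ 1) * (M * δ) := by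
      nlinarith [mul_nonneg hM0 hδ0]
    have e4 : lagBound p (κ 0) * lagBound p (κ 1) * δ * M =
        lagBound p (κ 0) * (lagBound p (κ 1) * (M * δ)) := by ring
    rw [e4]
    exact max_le (mul_le_mul_of_nonneg_left (h0.trans h2) (by linarith))
      (mul_le_mul_of_nonneg_left (mul_le_mul_of_nonneg_left h1 (by linarith)) (by linarith))
  refine (norm_le_of_sub hB ?_ fun z => (e2 z).trans e3).trans_eq (by ring)
  rw [hP]
  exact polyToRigid_eq_zero hμ Radii.one P

end Estimates

/-! ### Bounded preimages under specialization -/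

section Surjectivity

variable {p : ℕ} [Fact p.Prime] {L : Type*} [Field L] [Algebra L ℂ_[p]] {K : Type*} [Field K]
  {σ : EmbPair p K L} {κ : Fin 2 → ℕ}

/-- Evaluation at a point of `𝓞_K` as a distribution. -/
lemma exists_eval_dist (hcl : IsClosed (Set.range (algebraMap L ℂ_[p]))) (u : 𝓞 K) :
    ∃ μ : Dist σ, (∀ r, (TestProj.id κ σ).Bd r 1 μ) ∧ ∀ P : Vpoly L κ,
      algebraMap L ℂ_[p] (specialize κ σ μ P) =
        MvPolynomial.aeval (affinePt (emb σ (u : K))) P.1 := by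
  have hmem : ∀ r : Radii, (fun j => algebraMap L ℂ_[p] (σ.σ j (u : K))) ∈ nbhd σ r.1 := fun r =>
    ⟨emb σ (u : K), emb_mem_OKp σ u, fun i => by
      have : algebraMap L ℂ_[p] (σ.σ i (u : K)) - emb σ (u : K) i = 0 := sub_self _
      rw [this, norm_zero]
      exact (r.2 i).1.le⟩
  choose f hf using fun (r : Radii) (F : rigid σ r.1) =>
    exists_value_mem hcl F (fun j => σ.σ j (u : K)) (hmem r)
  have inj := (algebraMap L ℂ_[p]).injective
  refine ⟨⟨fun r => { toFun := f r, map_add' := fun F G => inj ?_, map_smul' := fun c F => inj ?_ },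
    fun r => ⟨1, fun F M hM => ?_⟩, fun r s h F => inj ?_⟩, fun r F _ M hM => ?_, fun P => ?_⟩
  · rw [map_add, hf, hf, hf]; rfl
  · rw [hf, RingHom.id_apply, smul_eq_mul, map_mul, hf]
    exact Algebra.smul_def _ _
  · change ‖algebraMap L ℂ_[p] (f r F)‖ ≤ _
    rw [hf, one_mul]
    exact hM _
  · change algebraMap L ℂ_[p] (f r _) = algebraMap L ℂ_[p] (f s F)
    rw [hf, hf]; rfl
  · change ‖algebraMap L ℂ_[p] (f r F)‖ ≤ _
    rw [hf, one_mul]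
    exact hM _
  · exact hf _ _

lemma EmbPair.exists_ne [NumberField K] (σ : EmbPair p K L) : ∃ u : 𝓞 K,
    emb σ (u : K) 0 ≠ emb σ (u : K) 1 := by
  by_contra! h
  refine σ.ne (IsFractionRing.ringHom_ext (A := 𝓞 K) fun x => ?_)
  exact (algebraMap L ℂ_[p]).injective (h x)

/-- The points of `𝓞_K` are Zariski dense in the affine plane. -/
lemma eq_zero_of_eval_emb_eq_zero [NumberField K] (σ : EmbPair p K L)
    (Q : MvPolynomial (Fin 2) ℂ_[p])
    (h : ∀ u : 𝓞 K, MvPolynomial.eval (emb σ (u : K)) Q = 0) (z : Fin 2 → ℂ_[p]) :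
    MvPolynomial.eval z Q = 0 := by
  obtain ⟨u, hu⟩ := σ.exists_ne
  set ω : Fin 2 → ℂ_[p] := emb σ (u : K) with hω
  -- `R` is `Q` in the coordinates `(a, b)` of the points `a + bω`. It vanishes at all integers `a,
  -- b`, hence identically, and the change of coordinates is invertible because the two conjugates
  -- of `ω` differ.
  set R : MvPolynomial (Fin 2) ℂ_[p] := MvPolynomial.aeval
    (fun j => MvPolynomial.X 0 + MvPolynomial.C (ω j) * MvPolynomial.X 1) Q with hR
  have hRe : ∀ x : Fin 2 → ℂ_[p], MvPolynomial.eval x R =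
      MvPolynomial.eval (fun j => x 0 + ω j * x 1) Q := fun x => by
    rw [hR, ← MvPolynomial.coe_aeval_eq_eval, ← MvPolynomial.coe_aeval_eq_eval,
      RingHom.coe_coe, RingHom.coe_coe, ← AlgHom.comp_apply]
    congr 1
    ext j
    simp
  have hR0 : R = 0 := by
    refine MvPolynomial.funext_set (fun _ => Set.range (Int.cast : ℤ → ℂ_[p]))
      (fun _ => Set.infinite_range_of_injective Int.cast_injective) fun x hx => ?_
    obtain ⟨a, ha⟩ := hx 0 trivial
    obtain ⟨b, hb⟩ := hx 1 trivial
    rw [hRe, map_zero, ← h (a + b * u)]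
    congr 2
    funext j
    simp [← ha, ← hb, hω, mul_comm]
  have hne : ω 1 - ω 0 ≠ 0 := sub_ne_zero.mpr (Ne.symm hu)
  have h2 := hRe ![z 0 - ω 0 * ((z 1 - z 0) / (ω 1 - ω 0)), (z 1 - z 0) / (ω 1 - ω 0)]
  rw [hR0, map_zero] at h2
  rw [h2]
  congr 2
  funext j
  fin_cases j
  · simp
  · simp; field_simp; ring

/-- Where both `Y`-coordinates are non-zero, bihomogeneity reduces the value of `P` to one at an
affine point, and density of `𝓞_K` applies; a polynomial vanishing on this open set is zero. -/
lemma eq_zero_of_affinePt_eq_zero [NumberField K] (P : Vpoly L κ)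
    (h : ∀ u : 𝓞 K, MvPolynomial.aeval (affinePt (emb σ (u : K))) P.1 = 0) : P = 0 := by
  set P' := MvPolynomial.map (algebraMap L ℂ_[p]) P.1 with hP'
  have hev : ∀ x : Fin 2 × Fin 2 → ℂ_[p], MvPolynomial.eval x P' = MvPolynomial.aeval x P.1 :=
    fun x => by rw [hP', MvPolynomial.eval_map, MvPolynomial.aeval_def]
  set Q : MvPolynomial (Fin 2) ℂ_[p] := MvPolynomial.aeval (affinePt MvPolynomial.X) P' with hQ
  have hQe : ∀ z : Fin 2 → ℂ_[p], MvPolynomial.eval z Q = MvPolynomial.aeval (affinePt z) P.1 := by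
    intro z
    rw [← hev, hQ, ← MvPolynomial.coe_aeval_eq_eval, ← MvPolynomial.coe_aeval_eq_eval,
      RingHom.coe_coe, RingHom.coe_coe, ← AlgHom.comp_apply]
    congr 1
    ext v
    simp only [AlgHom.comp_apply, MvPolynomial.aeval_X, affinePt]
    split_ifs <;> simp
  have hz := eq_zero_of_eval_emb_eq_zero σ Q fun u => by rw [hQe, h u]
  have h0 : P' = 0 := by
    refine MvPolynomial.funext_set (fun _ => {0}ᶜ) (fun _ => Set.Finite.infinite_compl (by simp))
      fun x hx => ?_
    have hx0 : ∀ i, x (i, 1) ≠ 0 := fun i => hx (i, 1) trivial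
    have e : x = fun v => x (v.1, 1) * affinePt (fun i => x (i, 0) / x (i, 1)) v := by
      funext ⟨i, j⟩
      fin_cases j
      · simp [affinePt, mul_div_cancel₀ _ (hx0 i)]
      · simp [affinePt]
    rw [hev, map_zero, e]
    refine (bihomogeneous_eval P.2 (fun i => x (i, 1)) _).trans ?_
    rw [← hQe, hz, mul_zero]
  exact Subtype.ext ((MvPolynomial.map_injective _ (algebraMap L ℂ_[p]).injective)
    (h0.trans (map_zero _).symm))

/-- Bihomogeneity determines the exponents of `Y` and `Ȳ` from those of `X` and `X̄`, so finitely
many coefficients determine `P`. -/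
instance finiteDimensional_Vpoly : FiniteDimensional L (Vpoly L κ) := by
  let d : Fin (κ 0 + 1) × Fin (κ 1 + 1) → (Fin 2 × Fin 2 →₀ ℕ) := fun a =>
    Finsupp.equivFunOnFinite.symm fun v => if v.1 = 0 then
      (if v.2 = 0 then a.1 else κ 0 - a.1) else (if v.2 = 0 then a.2 else κ 1 - a.2)
  let f : Vpoly L κ →ₗ[L] (Fin (κ 0 + 1) × Fin (κ 1 + 1) → L) :=
    LinearMap.pi fun a => (MvPolynomial.lcoeff L (d a)).comp (Submodule.subtype _)
  refine Module.Finite.of_injective f ((injective_iff_map_eq_zero f).mpr fun P hP => ?_)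
  ext e
  by_contra hne
  have h3 := P.2 hne
  rw [Finsupp.weight_apply, Finsupp.sum_fintype _ _ (by simp)] at h3
  have h30 := congrFun h3 0
  have h31 := congrFun h3 1
  simp [Fintype.sum_prod_type, bideg] at h30 h31
  have he : e = d (⟨e (0, 0), by omega⟩, ⟨e (1, 0), by omega⟩) := by
    ext ⟨i, j⟩
    fin_cases i <;> fin_cases j <;> simp [d] <;> omega
  refine hne ?_
  have := congrFun hP (⟨e (0, 0), by omega⟩, ⟨e (1, 0), by omega⟩)
  simp only [f, LinearMap.pi_apply, LinearMap.comp_apply, Submodule.subtype_apply,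
    MvPolynomial.lcoeff_apply, ← he] at this
  exact this

/-- Every functional on `V_{k,ℓ}(L)` is the specialization of a distribution which is bounded
uniformly in the radii. -/
theorem exists_specialize_eq [NumberField K] (hcl : IsClosed (Set.range (algebraMap L ℂ_[p])))
    (φ : Module.Dual L (Vpoly L κ)) :
    ∃ μ : Dist σ, specialize κ σ μ = φ ∧ ∃ n : ℕ, ∀ r, (TestProj.id κ σ).Bd r n μ := by
  let S : Submodule L (Dist σ) :=
    { carrier := {μ | ∃ n : ℕ, ∀ r, (TestProj.id κ σ).Bd r n μ}
      zero_mem' := ⟨0, fun r => TestProj.Bd.zero (by simp)⟩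
      add_mem' := by
        rintro μ ν ⟨m, hm⟩ ⟨n, hn⟩
        exact ⟨max m n, fun r => ((hm r).mono (by simp)).add ((hn r).mono (by simp))⟩
      smul_mem' := by
        rintro c μ ⟨m, hm⟩
        obtain ⟨n, hn⟩ := exists_nat_ge (‖algebraMap L ℂ_[p] c‖ * m)
        exact ⟨n, fun r => ((hm r).smul c).mono hn⟩ }
  -- By finite dimension it suffices that no non-zero polynomial is killed by all of `S`. The
  -- evaluations at points of `𝓞_K` belong to `S`, being of norm at most `1` for all radii, and they
  -- separate polynomials.
  have hS : S.map (specialize κ σ) = ⊤ := by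
    have h1 : (S.map (specialize κ σ)).dualCoannihilator = ⊥ := by
      rw [eq_bot_iff]
      intro P hP
      rw [Submodule.mem_bot]
      refine eq_zero_of_affinePt_eq_zero (σ := σ) P fun u => ?_
      obtain ⟨μ, hμ, hμP⟩ := exists_eval_dist (σ := σ) (κ := κ) hcl u
      rw [← hμP, (Submodule.mem_dualCoannihilator _).mp hP (specialize κ σ μ)
        ⟨μ, ⟨1, by simpa using hμ⟩, rfl⟩, map_zero]
    have h2 := Subspace.finrank_add_finrank_dualCoannihilator_eq (S.map (specialize κ σ))
    rw [h1, finrank_bot, add_zero, ← Subspace.dual_finrank_eq] at h2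
    exact Submodule.eq_top_of_finrank_eq h2
  obtain ⟨μ, hμ, rfl⟩ : φ ∈ S.map (specialize κ σ) := hS ▸ Submodule.mem_top
  exact ⟨μ, rfl, hμ⟩

end Surjectivity

/-! ### Cosets of the matrices `(1, b; 0, A)` -/

section Hecke

variable {K : Type*} [Field K]

lemma affMat_mul (b b' : K) (A A' : Kˣ) :
    affMat b' A' * affMat b A = affMat (b + A * b') (A * A') := by
  ext i j
  fin_cases i <;> fin_cases j <;>
    simp [affMat, Matrix.GeneralLinearGroup.mkOfDetNeZero, Matrix.mul_apply, Fin.sum_univ_two]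
  · ring
  · ring

lemma diagMat_eq (A : Kˣ) : diagMat A = affMat 0 A := rfl

variable [NumberField K]

lemma add_mem_frac {I : FractionalIdeal (𝓞 K)⁰ K} {x y : K} (hx : x ∈ I) (hy : y ∈ I) :
    x + y ∈ I := Submodule.add_mem (I : Submodule (𝓞 K) K) hx hy

lemma sub_mem_frac {I : FractionalIdeal (𝓞 K)⁰ K} {x y : K} (hx : x ∈ I) (hy : y ∈ I) :
    x - y ∈ I := Submodule.sub_mem (I : Submodule (𝓞 K) K) hx hy

lemma mul_mem_frac {I : FractionalIdeal (𝓞 K)⁰ K} {x y : K}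
    (hx : x ∈ (1 : FractionalIdeal (𝓞 K)⁰ K)) (hy : y ∈ I) : x * y ∈ I := by
  simpa using FractionalIdeal.mul_mem_mul hx hy

lemma mul_mem_of_mem_inv {I 𝔫 : Ideal (𝓞 K)} {b c : K} (hb : b ∈ (I : FractionalIdeal (𝓞 K)⁰ K))
    (hc : c ∈ (𝔫 : FractionalIdeal (𝓞 K)⁰ K) * (I : FractionalIdeal (𝓞 K)⁰ K)⁻¹) :
    b * c ∈ (𝔫 : FractionalIdeal (𝓞 K)⁰ K) := by
  have h := FractionalIdeal.mul_mem_mul hb hc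
  by_cases hI : (I : FractionalIdeal (𝓞 K)⁰ K) = 0
  · rw [hI, zero_mul] at h
    exact (FractionalIdeal.zero_le (𝔫 : FractionalIdeal (𝓞 K)⁰ K)) h
  · rwa [mul_left_comm, mul_inv_cancel₀ hI, mul_one] at h

lemma affMat_one_mem_Gam {I 𝔫 : Ideal (𝓞 K)} {b : K}
    (hb : b ∈ (I : FractionalIdeal (𝓞 K)⁰ K)) : affMat b 1 ∈ Gam I 𝔫 :=
  ⟨by simp, by simp, by simp, by simpa using hb, by simp [FractionalIdeal.zero_mem]⟩

variable [DecidableEq K]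

section Move

variable {L M : Type*} [Field L] [AddCommGroup M] [Module L M]

lemma moveDiv_moveDiv {C C' C'' : Set (OnePoint K)} {γ δ : GL (Fin 2) K}
    (hδ : ∀ x ∈ C, δ • x ∈ C') (hγ : ∀ x ∈ C', γ • x ∈ C'') (h : ∀ x ∈ C, (γ * δ) • x ∈ C'')
    (D : Div0 C) : moveDiv γ hγ (moveDiv δ hδ D) = moveDiv (γ * δ) h D := by
  apply Subtype.ext
  change Finsupp.mapDomain _ (Finsupp.mapDomain _ D.1) = Finsupp.mapDomain _ D.1
  rw [← Finsupp.mapDomain_comp]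
  congr 1
  funext x
  exact Subtype.ext (mul_smul γ δ x.1).symm

end Move

variable {p : ℕ} {𝔫 : Ideal (𝓞 K)} {R : ClassReps 𝔫} {H : HeckeData p R}

/-- An ideal `𝔞` dividing a power of the level, with `𝔞 I_i = (A_i) I_{J i}` for all `i`, such that
the matrices `(1, 0; 0, A_i)` act on the cusps, and finite systems of representatives `T_i` of
`I_i / 𝔞 I_i`. -/
structure CosetData (C : CuspFamily H) where
  𝔞 : Ideal (𝓞 K)
  J : ClassGroup (𝓞 K) → ClassGroup (𝓞 K)
  A : ClassGroup (𝓞 K) → Kˣ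
  T : ClassGroup (𝓞 K) → Finset K
  mul_eq : ∀ i, (𝔞 : FractionalIdeal (𝓞 K)⁰ K) * (R.I i) =
    FractionalIdeal.spanSingleton (𝓞 K)⁰ (A i : K) * (R.I (J i))
  level : ∃ m, 𝔫 ^ m ≤ 𝔞
  stable : ∀ i, ∀ x ∈ C.cusps i, diagMat (A i) • x ∈ C.cusps (J i)
  mem : ∀ i, ∀ b ∈ T i, b ∈ (R.I i : FractionalIdeal (𝓞 K)⁰ K)
  cover : ∀ i, ∀ b ∈ (R.I i : FractionalIdeal (𝓞 K)⁰ K), ∃ t ∈ T i,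
    b - t ∈ (𝔞 : FractionalIdeal (𝓞 K)⁰ K) * (R.I i)
  inj : ∀ i, ∀ s ∈ T i, ∀ t ∈ T i,
    s - t ∈ (𝔞 : FractionalIdeal (𝓞 K)⁰ K) * (R.I i) → s = t

namespace CosetData

variable {C : CuspFamily H} (D E : CosetData C)

lemma mem_iff (i : ClassGroup (𝓞 K)) (x : K) :
    x ∈ (D.𝔞 : FractionalIdeal (𝓞 K)⁰ K) * (R.I i) ↔
      x / D.A i ∈ (R.I (D.J i) : FractionalIdeal (𝓞 K)⁰ K) := by
  rw [D.mul_eq, FractionalIdeal.mem_singleton_mul]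
  constructor
  · rintro ⟨y, hy, rfl⟩
    rwa [mul_div_cancel_left₀ _ (D.A i).ne_zero]
  · intro h
    exact ⟨_, h, by rw [mul_div_cancel₀ _ (D.A i).ne_zero]⟩

/-- One has `(A_i) = 𝔞 I_i I_{J i}⁻¹` with `𝔞` integral; so the lower left entry stays admissible
when a matrix of `Γ_i(𝔫)` is moved across `(1, b; 0, A_i)`. -/
lemma mul_mem_level {i : ClassGroup (𝓞 K)} {c : K} (hc : c ∈ (𝔫 : FractionalIdeal (𝓞 K)⁰ K) *
    (R.I i : FractionalIdeal (𝓞 K)⁰ K)⁻¹) : D.A i * c ∈ (𝔫 : FractionalIdeal (𝓞 K)⁰ K) *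
    (R.I (D.J i) : FractionalIdeal (𝓞 K)⁰ K)⁻¹ := by
  have h0 : ∀ i, (R.I i : FractionalIdeal (𝓞 K)⁰ K) ≠ 0 := fun i =>
    FractionalIdeal.coeIdeal_ne_zero.mpr (R.ne_zero i)
  have h1 := FractionalIdeal.mul_mem_mul
    (FractionalIdeal.mem_spanSingleton_self (𝓞 K)⁰ (D.A i : K)) hc
  have e : FractionalIdeal.spanSingleton (𝓞 K)⁰ (D.A i : K) =
      (D.𝔞 : FractionalIdeal (𝓞 K)⁰ K) * (R.I i) * (R.I (D.J i) : FractionalIdeal (𝓞 K)⁰ K)⁻¹ := by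
    rw [D.mul_eq, mul_assoc, mul_inv_cancel₀ (h0 _), mul_one]
  have e2 : FractionalIdeal.spanSingleton (𝓞 K)⁰ (D.A i : K) *
      ((𝔫 : FractionalIdeal (𝓞 K)⁰ K) * (R.I i : FractionalIdeal (𝓞 K)⁰ K)⁻¹) =
      (D.𝔞 : FractionalIdeal (𝓞 K)⁰ K) * ((𝔫 : FractionalIdeal (𝓞 K)⁰ K) *
        (R.I (D.J i) : FractionalIdeal (𝓞 K)⁰ K)⁻¹) := by
    rw [e]
    calc _ = (D.𝔞 : FractionalIdeal (𝓞 K)⁰ K) * ((𝔫 : FractionalIdeal (𝓞 K)⁰ K) *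
        (R.I (D.J i) : FractionalIdeal (𝓞 K)⁰ K)⁻¹) *
        ((R.I i : FractionalIdeal (𝓞 K)⁰ K) * (R.I i : FractionalIdeal (𝓞 K)⁰ K)⁻¹) := by ring
      _ = _ := by rw [mul_inv_cancel₀ (h0 _), mul_one]
  rw [e2] at h1
  exact FractionalIdeal.mul_le.mpr
    (fun x hx y hy => mul_mem_frac (FractionalIdeal.coeIdeal_le_one hx) hy) h1

lemma affMat_smul_mem (i : ClassGroup (𝓞 K)) {b : K}
    (hb : b ∈ (R.I i : FractionalIdeal (𝓞 K)⁰ K)) :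
    ∀ x ∈ C.cusps i, affMat b (D.A i) • x ∈ C.cusps (D.J i) := by
  intro x hx
  have e : affMat b (D.A i) = diagMat (D.A i) * affMat b 1 := by
    rw [diagMat_eq, affMat_mul]; simp
  rw [e, mul_smul]
  exact D.stable i _ (C.invariant i _ (affMat_one_mem_Gam hb) x hx)

/-- Right multiplication by `Γ_i(𝔫)` permutes the cosets of the matrices `(1, b; 0, A_i)`. -/
lemma exists_mul_eq {i : ClassGroup (𝓞 K)} {b : K} (hb : b ∈ (R.I i : FractionalIdeal (𝓞 K)⁰ K))
    {γ : GL (Fin 2) K} (hγ : γ ∈ Gam (R.I i) 𝔫) : ∃ b' ∈ D.T i, ∃ γ' ∈ Gam (R.I (D.J i)) 𝔫,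
      affMat b (D.A i) * γ = γ' * affMat b' (D.A i) := by
  obtain ⟨h0, ha, hd, hb0, hc⟩ := hγ
  have hle1 : (𝔫 : FractionalIdeal (𝓞 K)⁰ K) ≤ 1 := FractionalIdeal.coeIdeal_le_one
  have hbc := mul_mem_of_mem_inv hb hc
  have hbc0 := mul_mem_of_mem_inv hb0 hc
  set a := γ 0 0 + b * γ 1 0 with hadef
  set x := γ 0 1 + b * γ 1 1 with hxdef
  have haO : a ∈ (1 : FractionalIdeal (𝓞 K)⁰ K) := add_mem_frac ha (hle1 hbc)
  have hxI : x ∈ (R.I i : FractionalIdeal (𝓞 K)⁰ K) := by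
    refine add_mem_frac hb0 ?_
    rw [mul_comm]; exact mul_mem_frac hd hb
  -- The determinant gives `γ₁₁ a ≡ 1` modulo `𝔫`, so `a` is invertible modulo any power of `𝔫` and
  -- hence modulo `𝔞`. With `s` an inverse, the new representative must be `b' ≡ s x` modulo `𝔞
  -- I_i`.
  obtain ⟨s, hs⟩ : ∃ s : 𝓞 K, 1 - s * a ∈ (D.𝔞 : FractionalIdeal (𝓞 K)⁰ K) := by
    obtain ⟨a₀, ha₀⟩ := (FractionalIdeal.mem_one_iff _).mp haO
    obtain ⟨d₀, hd₀⟩ := (FractionalIdeal.mem_one_iff _).mp hd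
    have h1 : 1 - d₀ * a₀ ∈ 𝔫 := by
      have e : algebraMap (𝓞 K) K (1 - d₀ * a₀) = 0 - (γ 0 1 * γ 1 0 + γ 1 1 * (b * γ 1 0)) := by
        rw [map_sub, map_mul, map_one, ha₀, hd₀, hadef]
        linear_combination -h0
      have h2 := sub_mem_frac (FractionalIdeal.zero_mem (𝔫 : FractionalIdeal (𝓞 K)⁰ K))
        (add_mem_frac hbc0 (mul_mem_frac hd hbc))
      rw [← e] at h2
      obtain ⟨z, hz, hz2⟩ := (FractionalIdeal.mem_coeIdeal _).mp h2
      rwa [← FaithfulSMul.algebraMap_injective (𝓞 K) K hz2]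
    have hcop : IsCoprime (Ideal.span {a₀}) 𝔫 := Ideal.isCoprime_iff_exists.mpr
      ⟨d₀ * a₀, Ideal.mul_mem_left _ _ (Ideal.mem_span_singleton_self _), _, h1, by ring⟩
    obtain ⟨m, hm⟩ := D.level
    obtain ⟨y, hy, w, hw, hyw⟩ := Ideal.isCoprime_iff_exists.mp (hcop.pow_right (n := m))
    obtain ⟨s, rfl⟩ := Ideal.mem_span_singleton'.mp hy
    refine ⟨s, ?_⟩
    have : (1 : K) - s * a = algebraMap (𝓞 K) K w := by
      rw [← ha₀, ← map_mul, ← map_one (algebraMap (𝓞 K) K), ← map_sub, ← hyw, add_sub_cancel_left]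
    rw [this]
    exact FractionalIdeal.mem_coeIdeal_of_mem _ (hm hw)
  obtain ⟨b', hb', hbb'⟩ := D.cover i (s * x)
    (mul_mem_frac ((FractionalIdeal.mem_one_iff _).mpr ⟨s, rfl⟩) hxI)
  have hb'I := D.mem i b' hb'
  have hb'c := mul_mem_of_mem_inv hb'I hc
  have key : (x - b' * a) / D.A i ∈ (R.I (D.J i) : FractionalIdeal (𝓞 K)⁰ K) := by
    rw [← D.mem_iff]
    have e : x - b' * a = (1 - s * a) * x + a * (s * x - b') := by ring
    rw [e]
    exact add_mem_frac (FractionalIdeal.mul_mem_mul hs hxI) (mul_mem_frac haO hbb')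
  have hA := (D.A i).ne_zero
  have hdet : a * (γ 1 1 - b' * γ 1 0) - (x - b' * a) / D.A i * (D.A i * γ 1 0) = 1 := by
    field_simp
    rw [hadef, hxdef]
    linear_combination h0
  let γ' : GL (Fin 2) K := Matrix.GeneralLinearGroup.mkOfDetNeZero
    !![a, (x - b' * a) / D.A i; D.A i * γ 1 0, γ 1 1 - b' * γ 1 0] (by
      rw [Matrix.det_fin_two_of, hdet]; exact one_ne_zero)
  refine ⟨b', hb', γ', ⟨hdet, haO, sub_mem_frac hd (hle1 hb'c), key, D.mul_mem_level hc⟩, ?_⟩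
  ext k l
  fin_cases k <;> fin_cases l <;>
    simp [affMat, γ', Matrix.GeneralLinearGroup.mkOfDetNeZero, Matrix.mul_apply, Fin.sum_univ_two]
  · rfl
  · rw [hxdef]; field_simp; ring
  · ring

/-- The first row of the equation gives `γ₀₀ = 1` and `b - b' = γ₀₁ A_i`, an element of `A_i I_{J i}
= 𝔞 I_i`. -/
lemma eq_of_mul_eq {i : ClassGroup (𝓞 K)} {b b' : K} (hb : b ∈ D.T i) (hb' : b' ∈ D.T i)
    {γ : GL (Fin 2) K} (hγ : γ ∈ Gam (R.I (D.J i)) 𝔫)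
    (h : affMat b (D.A i) = γ * affMat b' (D.A i)) : b = b' := by
  have e : ∀ k l, affMat b (D.A i) k l = γ k 0 * affMat b' (D.A i) 0 l +
      γ k 1 * affMat b' (D.A i) 1 l := fun k l => by
    rw [h]; simp [Matrix.mul_apply, Fin.sum_univ_two]
  have h00 := e 0 0
  have h01 := e 0 1
  simp only [affMat_zero_zero, affMat_one_zero, affMat_zero_one, affMat_one_one, mul_one,
    mul_zero, add_zero] at h00 h01
  refine D.inj i b hb b' hb' ?_
  rw [D.mem_iff, h01, ← h00, one_mul, add_sub_cancel_left, mul_div_cancel_right₀ _ (D.A i).ne_zero]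
  exact hγ.2.2.2.1

/-- The permutation of the cosets induced by right multiplication by an element of `Γ_i(𝔫)`. -/
lemma exists_perm {i : ClassGroup (𝓞 K)} {γ : GL (Fin 2) K} (hγ : γ ∈ Gam (R.I i) 𝔫) :
    ∃ e : D.T i ≃ D.T i, ∀ b : D.T i, ∃ γ' ∈ Gam (R.I (D.J i)) 𝔫,
      affMat b.1 (D.A i) * γ = γ' * affMat (e b).1 (D.A i) := by
  choose f hf g hg hfg using fun b : D.T i => D.exists_mul_eq (D.mem i b.1 b.2) hγ
  have hinj : Function.Injective fun b : D.T i => (⟨f b, hf b⟩ : D.T i) := by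
    intro b c hbc
    have hbc' : f b = f c := congrArg Subtype.val hbc
    refine Subtype.ext (D.eq_of_mul_eq b.2 c.2 (mul_mem (hg b) (inv_mem (hg c))) ?_)
    have h1 := hfg b
    have h2 := hfg c
    rw [hbc'] at h1
    rw [eq_inv_mul_of_mul_eq h2.symm] at h1
    have h3 := congrArg (· * γ⁻¹) h1
    simpa [mul_assoc] using h3
  exact ⟨Equiv.ofBijective _ (Finite.injective_iff_bijective.mp hinj),
    fun b => ⟨g b, hg b, hfg b⟩⟩

end CosetData

end Hecke

/-! ### Composition, invariance and powers of the operators -/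

section HeckeOperators

variable {p : ℕ} [Fact p.Prime] {L : Type*} [Field L] [Algebra L ℂ_[p]] {K : Type*} [Field K]
  [NumberField K] [DecidableEq K]

lemma mul_mem_inj {I : FractionalIdeal (𝓞 K)⁰ K} {A : Kˣ} {x : K} :
    (A : K) * x ∈ FractionalIdeal.spanSingleton (𝓞 K)⁰ (A : K) * I ↔ x ∈ I := by
  rw [FractionalIdeal.mem_singleton_mul]
  constructor
  · rintro ⟨y, hy, h⟩
    rwa [mul_left_cancel₀ A.ne_zero h]
  · exact fun h => ⟨x, h, rfl⟩

lemma mul_le_right_frac (𝔞 : Ideal (𝓞 K)) (I : FractionalIdeal (𝓞 K)⁰ K) :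
    (𝔞 : FractionalIdeal (𝓞 K)⁰ K) * I ≤ I :=
  FractionalIdeal.mul_le.mpr fun _ hx _ hy => mul_mem_frac (FractionalIdeal.coeIdeal_le_one hx) hy

namespace CosetData

section Comp

variable {𝔫 : Ideal (𝓞 K)} {R : ClassReps 𝔫} {H : HeckeData p R} {C : CuspFamily H}
  (D E : CosetData C)

lemma smul_J_mem {i : ClassGroup (𝓞 K)} {x : K}
    (hx : x ∈ (R.I (D.J i) : FractionalIdeal (𝓞 K)⁰ K)) :
    D.A i * x ∈ (D.𝔞 : FractionalIdeal (𝓞 K)⁰ K) * (R.I i) := by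
  rw [D.mul_eq]; exact mul_mem_inj.mpr hx

/-- The coset data for the product of the two ideals. -/
def comp : CosetData C where
  𝔞 := D.𝔞 * E.𝔞
  J i := E.J (D.J i)
  A i := D.A i * E.A (D.J i)
  -- The product `(1, b'; 0, A') (1, b; 0, A)` has upper right entry `b + A b'`.
  T i := (D.T i ×ˢ E.T (D.J i)).image fun b => b.1 + D.A i * b.2
  mul_eq i := by
    rw [FractionalIdeal.coeIdeal_mul, mul_right_comm, D.mul_eq, mul_right_comm, mul_assoc,
      E.mul_eq, ← mul_assoc,
      FractionalIdeal.spanSingleton_mul_spanSingleton, Units.val_mul]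
  level := by
    obtain ⟨m, hm⟩ := D.level
    obtain ⟨n, hn⟩ := E.level
    exact ⟨m + n, by rw [pow_add]; exact Ideal.mul_mono hm hn⟩
  stable i x hx := by
    have e : diagMat (D.A i * E.A (D.J i)) = diagMat (E.A (D.J i)) * diagMat (D.A i) := by
      simp only [diagMat_eq, affMat_mul, mul_zero, add_zero]
    rw [e, mul_smul]
    exact E.stable _ _ (D.stable i x hx)
  mem i b hb := by
    obtain ⟨⟨b, b'⟩, h, rfl⟩ := Finset.mem_image.mp hb
    obtain ⟨h1, h2⟩ := Finset.mem_product.mp h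
    exact add_mem_frac (D.mem i b h1)
      (mul_le_right_frac _ _ (D.smul_J_mem (E.mem _ b' h2)))
  cover i b hb := by
    obtain ⟨t, ht, hbt⟩ := D.cover i b hb
    obtain ⟨t', ht', hbt'⟩ := E.cover (D.J i) _ ((D.mem_iff i _).mp hbt)
    refine ⟨t + D.A i * t', Finset.mem_image.mpr ⟨(t, t'), Finset.mem_product.mpr ⟨ht, ht'⟩, rfl⟩, ?_⟩
    have e : b - (t + D.A i * t') = D.A i * ((b - t) / D.A i - t') := by
      rw [mul_sub, mul_div_cancel₀ _ (D.A i).ne_zero]; ring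
    rw [e, FractionalIdeal.coeIdeal_mul, mul_right_comm, D.mul_eq, mul_assoc, mul_mem_inj, mul_comm]
    exact hbt'
  inj i s hs t ht hst := by
    obtain ⟨⟨s, s'⟩, h, rfl⟩ := Finset.mem_image.mp hs
    obtain ⟨h1, h2⟩ := Finset.mem_product.mp h
    obtain ⟨⟨t, t'⟩, h, rfl⟩ := Finset.mem_image.mp ht
    obtain ⟨h3, h4⟩ := Finset.mem_product.mp h
    dsimp only at h1 h2 h3 h4 hst ⊢
    rw [FractionalIdeal.coeIdeal_mul, mul_right_comm] at hst
    have h5 : s = t := by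
      refine D.inj i s h1 t h3 ?_
      have h6 := sub_mem_frac (D.smul_J_mem (E.mem _ s' h2)) (D.smul_J_mem (E.mem _ t' h4))
      rw [mul_comm] at hst
      have h7 := sub_mem_frac (mul_le_right_frac _ _ hst) h6
      have e : s + D.A i * s' - (t + D.A i * t') - (D.A i * s' - D.A i * t') = s - t := by ring
      rwa [e] at h7
    subst h5
    rw [add_sub_add_left_eq_sub, ← mul_sub, D.mul_eq, mul_assoc, mul_mem_inj, mul_comm] at hst
    rw [E.inj _ s' h2 t' h4 hst]

lemma comp_injOn (i : ClassGroup (𝓞 K)) :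
    Set.InjOn (fun b : K × K => b.1 + D.A i * b.2) (D.T i ×ˢ E.T (D.J i) : Finset (K × K)) := by
  rintro ⟨s, s'⟩ hs ⟨t, t'⟩ ht (h : s + D.A i * s' = t + D.A i * t')
  obtain ⟨h1, h2⟩ := Finset.mem_product.mp hs
  obtain ⟨h3, h4⟩ := Finset.mem_product.mp ht
  have h5 : s = t := by
    refine D.inj i s h1 t h3 ?_
    have h6 := sub_mem_frac (D.smul_J_mem (E.mem _ t' h4)) (D.smul_J_mem (E.mem _ s' h2))
    have e : D.A i * t' - D.A i * s' = s - t := by linear_combination -h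
    rwa [e] at h6
  subst h5
  rw [mul_left_cancel₀ (D.A i).ne_zero (add_left_cancel h)]

end Comp

section Operator

variable {𝔫 : Ideal (𝓞 K)} {R : ClassReps 𝔫} {H : HeckeData p R} {C : CuspFamily H}
  {M : Type*} [AddCommGroup M] [Module L M] (act : GL (Fin 2) K → M →ₗ[L] M) (D : CosetData C)

/-- The operator whose `i`-th component sends `Φ` to the sum of the `Φ_{J i}|(1, b; 0, A_i)`, for `b`
in the system of representatives of `I_i / 𝔞 I_i`. -/
def hecke : HomFam C M →ₗ[L] HomFam C M :=
  LinearMap.pi fun i => (∑ b : D.T i, slash act (affMat b.1 (D.A i))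
    (D.affMat_smul_mem i (D.mem i b.1 b.2))).comp (LinearMap.proj (D.J i))

lemma hecke_apply (Φ : HomFam C M) (i : ClassGroup (𝓞 K)) (X : Div0 (C.cusps i)) :
    D.hecke act Φ i X = ∑ b : D.T i, act (affMat b.1 (D.A i))
      (Φ (D.J i) (moveDiv _ (D.affMat_smul_mem i (D.mem i b.1 b.2)) X)) := by
  have h : D.hecke act Φ i = (∑ b : D.T i, slash act (affMat b.1 (D.A i))
    (D.affMat_smul_mem i (D.mem i b.1 b.2))) (Φ (D.J i)) := rfl
  rw [h, LinearMap.sum_apply, AddMonoidHom.finsetSum_apply]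
  rfl

end Operator

end CosetData

section Sigma0

variable {𝔪 : Ideal (𝓞 K)} {R : ClassReps (Ideal.span {(p : 𝓞 K)} * 𝔪)} {H : HeckeData p R}
  {C : CuspFamily H} {σ : EmbPair p K L}
  {M : Type*} [AddCommGroup M] [Module L M]

/-- The operators `act γ` define a right action of the matrices in `Σ₀(p)`. -/
def IsRightAct (σ : EmbPair p K L) (act : GL (Fin 2) K → M →ₗ[L] M) : Prop :=
  ∀ {γ δ}, InSigma0 σ γ → InSigma0 σ δ → ∀ m, act (γ * δ) m = act δ (act γ m)

/-- The submodule `N` is stable under the matrices in `Σ₀(p)`. -/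
def IsStable (σ : EmbPair p K L) (act : GL (Fin 2) K → M →ₗ[L] M) (N : Submodule L M) : Prop :=
  ∀ {γ}, InSigma0 σ γ → ∀ {m}, m ∈ N → act γ m ∈ N

/-- The family `Φ` is invariant under the groups `Γ_i(𝔫)` modulo the submodule `N`. -/
def InvMod (act : GL (Fin 2) K → M →ₗ[L] M) (N : Submodule L M) (Φ : HomFam C M) : Prop :=
  ∀ i γ (hγ : γ ∈ Gam (R.I i) (Ideal.span {(p : 𝓞 K)} * 𝔪)) X,
    act γ (Φ i (moveDiv γ (C.invariant i γ hγ) X)) - Φ i X ∈ N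

namespace CosetData

variable (D E : CosetData C)

lemma exists_mul_eq_mem (i : ClassGroup (𝓞 K)) {y : 𝓞 K} (hy : y ∈ R.I (D.J i)) :
    ∃ t ∈ D.𝔞, (D.A i : K) * y = (t : 𝓞 K) := by
  have h1 := D.smul_J_mem (FractionalIdeal.mem_coeIdeal_of_mem (𝓞 K)⁰ hy)
  rw [mul_comm] at h1
  replace h1 := mul_le_right_frac _ _ h1
  obtain ⟨t, ht, ht2⟩ := (FractionalIdeal.mem_coeIdeal _).mp h1
  exact ⟨t, ht, ht2.symm⟩

lemma emb_A_mem (i : ClassGroup (𝓞 K)) : emb σ (D.A i : K) ∈ OKp σ := by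
  obtain ⟨y, hyI, z, hyz⟩ := exists_of_coprime (R.coprime_level (D.J i))
  obtain ⟨t, -, ht⟩ := D.exists_mul_eq_mem i hyI
  exact emb_mem_of_mul_mem hyz ht

lemma inSigma0 {i : ClassGroup (𝓞 K)} {b : K} (hb : b ∈ (R.I i : FractionalIdeal (𝓞 K)⁰ K)) :
    InSigma0 σ (affMat b (D.A i)) := by
  obtain ⟨b, -, rfl⟩ := (FractionalIdeal.mem_coeIdeal _).mp hb
  exact inSigma0_affMat (emb_mem_OKp σ b) (D.emb_A_mem i)

end CosetData

lemma inSigma0_of_mem {i : ClassGroup (𝓞 K)} {γ : GL (Fin 2) K}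
    (hγ : γ ∈ Gam (R.I i) (Ideal.span {(p : 𝓞 K)} * 𝔪)) : InSigma0 σ γ :=
  inSigma0_of_mem_Gam (R.ne_zero i) (R.coprime_level i) hγ

variable {act : GL (Fin 2) K → M →ₗ[L] M} {N : Submodule L M}

/-- Replacing a representative `β` by `γβ` changes the corresponding term by the failure of `Φ` to
be invariant under `γ`, transported by `β`. Independence of representatives and the control of
invariance both rest on this. -/
lemma act_left_mul (hact : IsRightAct σ act) (Φ : HomFam C M) {i j : ClassGroup (𝓞 K)}
    {γ β g : GL (Fin 2) K} (hγ : γ ∈ Gam (R.I j) (Ideal.span {(p : 𝓞 K)} * 𝔪))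
    (hβ0 : InSigma0 σ β) (e : g = γ * β) (hβ : ∀ x ∈ C.cusps i, β • x ∈ C.cusps j)
    (hg : ∀ x ∈ C.cusps i, g • x ∈ C.cusps j) (X : Div0 (C.cusps i)) :
    act g (Φ j (moveDiv g hg X)) - act β (Φ j (moveDiv β hβ X)) =
      act β (act γ (Φ j (moveDiv γ (C.invariant j γ hγ) (moveDiv β hβ X))) -
        Φ j (moveDiv β hβ X)) := by
  subst e
  rw [moveDiv_moveDiv hβ (C.invariant j γ hγ) hg, hact (inSigma0_of_mem hγ) hβ0, map_sub]

namespace CosetData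

variable (D E : CosetData C)

/-- Because of this, a power of an operator is again a sum over single matrices `(1, b; 0, A)` with
`A` highly divisible, and estimates need only treat one such matrix. -/
lemma hecke_comp (hact : IsRightAct σ act) (Φ : HomFam C M) :
    (D.comp E).hecke act Φ = D.hecke act (E.hecke act Φ) := by
  funext i
  ext X
  rw [hecke_apply, hecke_apply]
  have h1 : ∀ b : D.T i, act (affMat b.1 (D.A i)) (E.hecke act Φ (D.J i)
      (moveDiv _ (D.affMat_smul_mem i (D.mem i b.1 b.2)) X)) =
      ∑ b' : E.T (D.J i), act (affMat (b.1 + D.A i * b'.1) (D.A i * E.A (D.J i)))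
        (Φ (E.J (D.J i)) (moveDiv _ ((D.comp E).affMat_smul_mem i ((D.comp E).mem i _
          (Finset.mem_image_of_mem _ (Finset.mem_product (p := (b.1, b'.1)).mpr ⟨b.2, b'.2⟩))))
            X)) := fun b => by
    rw [hecke_apply, map_sum]
    refine Finset.sum_congr rfl fun b' _ => ?_
    rw [← hact (E.inSigma0 (E.mem _ _ b'.2)) (D.inSigma0 (D.mem _ _ b.2))]
    have hm := affMat_mul b.1 b'.1 (D.A i) (E.A (D.J i))
    rw [moveDiv_moveDiv (γ := affMat b'.1 (E.A (D.J i))) (C'' := C.cusps (E.J (D.J i)))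
      (D.affMat_smul_mem i (D.mem i b.1 b.2)) _ (by
        intro x hx
        rw [mul_smul]
        exact E.affMat_smul_mem _ (E.mem _ b'.1 b'.2) _
          (D.affMat_smul_mem i (D.mem i b.1 b.2) x hx))]
    simp only [hm]
    rfl
  simp only [h1]
  rw [← Finset.sum_product' (f := fun (b : D.T i) (b' : E.T (D.J i)) => act (affMat (b.1 + D.A i * b'.1) (D.A i * E.A (D.J i)))
        (Φ (E.J (D.J i)) (moveDiv _ ((D.comp E).affMat_smul_mem i ((D.comp E).mem i _
          (Finset.mem_image_of_mem _ (Finset.mem_product (p := (b.1, b'.1)).mpr ⟨b.2, b'.2⟩))))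
            X)))]
  symm
  refine Finset.sum_bij (fun bb _ => (⟨bb.1.1 + D.A i * bb.2.1, Finset.mem_image_of_mem
    (fun b : K × K => b.1 + D.A i * b.2)
    (Finset.mem_product (p := (bb.1.1, bb.2.1)).mpr ⟨bb.1.2, bb.2.2⟩)⟩ : (D.comp E).T i))
    (fun _ _ => Finset.mem_univ _) ?_ ?_ ?_
  · rintro ⟨b, b'⟩ - ⟨c, c'⟩ - h
    have h2 := D.comp_injOn E i (Finset.mem_coe.mpr (Finset.mem_product (p := (b.1, b'.1)).mpr ⟨b.2, b'.2⟩))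
      (Finset.mem_coe.mpr (Finset.mem_product (p := (c.1, c'.1)).mpr ⟨c.2, c'.2⟩)) (congrArg Subtype.val h)
    rw [Prod.mk.injEq] at h2
    exact Prod.ext (Subtype.ext h2.1) (Subtype.ext h2.2)
  · rintro ⟨b, hb⟩ -
    obtain ⟨⟨b, b'⟩, h, rfl⟩ := Finset.mem_image.mp hb
    obtain ⟨h1, h2⟩ := Finset.mem_product.mp h
    exact ⟨(⟨b, h1⟩, ⟨b', h2⟩), Finset.mem_univ _, rfl⟩
  · intro _ _
    rfl

/-- Modulo `N`, the operator on invariant families does not depend on the representatives. -/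
lemma hecke_sub_hecke_mem (hact : IsRightAct σ act) (hN : IsStable σ act N) (h𝔞 : D.𝔞 = E.𝔞)
    (hJ : D.J = E.J) (hA : D.A = E.A) {Φ : HomFam C M} (hΦ : InvMod act N Φ)
    (i : ClassGroup (𝓞 K)) (X : Div0 (C.cusps i)) :
    D.hecke act Φ i X - E.hecke act Φ i X ∈ N := by
  obtain ⟨𝔞, J, A, T, mul_eq, level, stable, mem, cover, inj⟩ := D
  obtain ⟨𝔞', J', A', T', mul_eq', level', stable', mem', cover', inj'⟩ := E
  dsimp only at h𝔞 hJ hA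
  subst h𝔞 hJ hA
  set D : CosetData C := ⟨𝔞, J, A, T, mul_eq, level, stable, mem, cover, inj⟩ with hD
  set E : CosetData C := ⟨𝔞, J, A, T', mul_eq', level', stable', mem', cover', inj'⟩ with hE
  have hneg : ∀ {x y : K}, x - y ∈ (𝔞 : FractionalIdeal (𝓞 K)⁰ K) * (R.I i) →
      y - x ∈ (𝔞 : FractionalIdeal (𝓞 K)⁰ K) * (R.I i) := fun {x y} h => by
    have := sub_mem_frac (FractionalIdeal.zero_mem _) h
    rwa [zero_sub, neg_sub] at this
  -- Each representative `b` is matched with the one in the other system congruent to it modulo `𝔞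
  -- I_i`; the two matrices then differ by a unipotent left factor in the group.
  choose f hf hfb using fun b : T i => cover' i b.1 (mem i b.1 b.2)
  have hbij : Function.Bijective fun b : T i => (⟨f b, hf b⟩ : T' i) := by
    constructor
    · intro b c hbc
      have h1 : f b = f c := congrArg Subtype.val hbc
      refine Subtype.ext (inj i _ b.2 _ c.2 ?_)
      have := sub_mem_frac (hfb b) (hfb c)
      rwa [h1, sub_sub_sub_cancel_right] at this
    · rintro ⟨t, ht⟩
      obtain ⟨b, hb, htb⟩ := cover i t (mem' i t ht)
      refine ⟨⟨b, hb⟩, Subtype.ext (inj' i _ (hf _) _ ht ?_)⟩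
      have := sub_mem_frac (hneg (hfb ⟨b, hb⟩)) htb
      have e : f ⟨b, hb⟩ - b - (t - b) = f ⟨b, hb⟩ - t := by ring
      rwa [e] at this
  rw [hecke_apply, hecke_apply]
  have hsum : ∑ b : E.T i, act (affMat b.1 (E.A i))
      (Φ (E.J i) (moveDiv _ (E.affMat_smul_mem i (E.mem i b.1 b.2)) X)) =
      ∑ b : D.T i, act (affMat (f b) (D.A i))
      (Φ (D.J i) (moveDiv _ (D.affMat_smul_mem i (mem' i _ (hf b))) X)) :=
    (Fintype.sum_bijective _ hbij _ _ fun _ => rfl).symm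
  rw [hsum, ← Finset.sum_sub_distrib]
  refine Submodule.sum_mem _ fun b _ => ?_
  have hA0 := (A i).ne_zero
  rw [act_left_mul hact Φ (γ := affMat ((b.1 - f b) / A i) 1)
    (affMat_one_mem_Gam ((D.mem_iff i _).mp (hfb b))) (D.inSigma0 (mem' i _ (hf b))) (by
      rw [affMat_mul, mul_one, mul_div_cancel₀ _ hA0, add_sub_cancel])
    (D.affMat_smul_mem i (mem' i _ (hf b)))]
  exact hN (D.inSigma0 (mem' i _ (hf b))) (hΦ _ _ (affMat_one_mem_Gam ((D.mem_iff i _).mp (hfb b))) _)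

/-- The failure of the invariance of `Φ|W` in terms of the failure of the invariance of `Φ`. -/
lemma hecke_defect (hact : IsRightAct σ act) (Φ : HomFam C M) {i : ClassGroup (𝓞 K)}
    {γ : GL (Fin 2) K} (hγ : γ ∈ Gam (R.I i) (Ideal.span {(p : 𝓞 K)} * 𝔪))
    (X : Div0 (C.cusps i)) : ∃ m : D.T i → M, (∀ b, ∃ γ', ∃ hγ' : γ' ∈ Gam (R.I (D.J i)) _, ∃ Y,
        m b = act γ' (Φ (D.J i) (moveDiv γ' (C.invariant _ γ' hγ') Y)) - Φ (D.J i) Y) ∧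
      act γ (D.hecke act Φ i (moveDiv γ (C.invariant i γ hγ) X)) - D.hecke act Φ i X =
        ∑ b : D.T i, act (affMat b.1 (D.A i)) (m b) := by
  obtain ⟨e, he⟩ := D.exists_perm hγ
  choose γ' hγ' he using he
  have hc : ∀ b : D.T i, ∀ x ∈ C.cusps i, affMat b.1 (D.A i) • x ∈ C.cusps (D.J i) := fun b =>
    D.affMat_smul_mem i (D.mem i b.1 b.2)
  have hs : ∀ b : D.T i, InSigma0 σ (affMat b.1 (D.A i)) := fun b => D.inSigma0 (D.mem i b.1 b.2)
  refine ⟨fun b => act (γ' (e.symm b)) (Φ (D.J i) (moveDiv _ (C.invariant _ _ (hγ' (e.symm b)))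
    (moveDiv _ (hc b) X))) - Φ (D.J i) (moveDiv _ (hc b) X),
    fun b => ⟨_, hγ' (e.symm b), _, rfl⟩, ?_⟩
  have hg : ∀ b : D.T i, ∀ x ∈ C.cusps i, (affMat b.1 (D.A i) * γ) • x ∈ C.cusps (D.J i) :=
    fun b x hx => by
      rw [mul_smul]
      exact hc b _ (C.invariant i γ hγ x hx)
  -- Right multiplication by `γ` permutes the representatives up to left factors `γ' b`, so the only
  -- discrepancy is the failure of `Φ` to be invariant under these factors.
  have key : ∀ b : D.T i, act γ (act (affMat b.1 (D.A i)) (Φ (D.J i) (moveDiv _ (hc b)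
      (moveDiv γ (C.invariant i γ hγ) X)))) = act (affMat (e b).1 (D.A i))
        (act (γ' b) (Φ (D.J i) (moveDiv _ (C.invariant _ _ (hγ' b)) (moveDiv _ (hc (e b)) X))) -
          Φ (D.J i) (moveDiv _ (hc (e b)) X)) +
      act (affMat (e b).1 (D.A i)) (Φ (D.J i) (moveDiv _ (hc (e b)) X)) := fun b => by
    rw [← act_left_mul hact Φ (hγ' b) (hs (e b)) (he b) (hc (e b)) (hg b), sub_add_cancel,
      hact (hs b) (inSigma0_of_mem hγ), moveDiv_moveDiv (C.invariant i γ hγ) (hc b) (hg b)]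
  rw [hecke_apply, hecke_apply, map_sum, Finset.sum_congr rfl (fun b _ => key b),
    Finset.sum_add_distrib, e.sum_comp (fun b : D.T i => act (affMat b.1 (D.A i))
      (Φ (D.J i) (moveDiv _ (hc b) X))), add_sub_cancel_right]
  exact Fintype.sum_equiv e _ _ fun b => by simp only [Equiv.symm_apply_apply]

lemma hecke_mem (hN : IsStable σ act N) {Φ : HomFam C M} (hΦ : ∀ i X, Φ i X ∈ N)
    (i : ClassGroup (𝓞 K)) (X : Div0 (C.cusps i)) : D.hecke act Φ i X ∈ N := by
  rw [hecke_apply]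
  exact Submodule.sum_mem _ fun b _ => hN (D.inSigma0 (D.mem i b.1 b.2)) (hΦ _ _)

/-- Powers of the operator are operators attached to powers of the ideal. -/
lemma exists_pow (hact : IsRightAct σ act) (n : ℕ) : ∃ F : CosetData C, F.𝔞 = D.𝔞 ^ (n + 1) ∧
    F.J = D.J^[n + 1] ∧ (D.J = id → ∀ i, F.A i = D.A i ^ (n + 1)) ∧
    F.hecke act = (D.hecke act) ^ (n + 1) := by
  induction n with
  | zero => exact ⟨D, by simp, by simp, by simp, by simp⟩
  | succ n ih =>
    obtain ⟨F, h1, h2, h3, h4⟩ := ih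
    refine ⟨D.comp F, ?_, ?_, fun h i => ?_, ?_⟩
    · rw [pow_succ' _ (n + 1), ← h1]; rfl
    · rw [Function.iterate_succ, ← h2]; rfl
    · change D.A i * F.A (D.J i) = _
      rw [h3 h, h, pow_succ' _ (n + 1)]; rfl
    · refine LinearMap.ext fun Φ => ?_
      rw [hecke_comp D F hact, pow_succ' _ (n + 1), h4]; rfl

end CosetData

end Sigma0

end HeckeOperators

/-! ### Representatives modulo ideals, and primes above `p` -/

section Transversals

variable {K : Type*} [Field K] [NumberField K]

lemma exists_transversal (𝔞 I : Ideal (𝓞 K)) (h𝔞 : 𝔞 ≠ 0) (hI : I ≠ 0) : ∃ T : Finset K,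
    (∀ b ∈ T, b ∈ (I : FractionalIdeal (𝓞 K)⁰ K)) ∧
    (∀ b ∈ (I : FractionalIdeal (𝓞 K)⁰ K), ∃ t ∈ T,
      b - t ∈ (𝔞 : FractionalIdeal (𝓞 K)⁰ K) * (I : FractionalIdeal (𝓞 K)⁰ K)) ∧
    ∀ s ∈ T, ∀ t ∈ T,
      s - t ∈ (𝔞 : FractionalIdeal (𝓞 K)⁰ K) * (I : FractionalIdeal (𝓞 K)⁰ K) → s = t := by
  classical
  have hfin : Finite (𝓞 K ⧸ 𝔞 * I) := Ideal.finiteQuotientOfFreeOfNeBot _ (mul_ne_zero h𝔞 hI)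
  let f : I → 𝓞 K ⧸ 𝔞 * I := fun x => Ideal.Quotient.mk _ (x : 𝓞 K)
  have hf : ∀ x y : I, f x = f y ↔ ((x : 𝓞 K) : K) - (y : 𝓞 K) ∈
      (𝔞 : FractionalIdeal (𝓞 K)⁰ K) * (I : FractionalIdeal (𝓞 K)⁰ K) := fun x y => by
    rw [← FractionalIdeal.coeIdeal_mul, FractionalIdeal.mem_coeIdeal]
    change Ideal.Quotient.mk _ _ = Ideal.Quotient.mk _ _ ↔ _
    rw [Ideal.Quotient.eq]
    constructor
    · exact fun h => ⟨_, h, map_sub _ _ _⟩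
    · rintro ⟨z, hz, h⟩
      rw [← map_sub] at h
      rwa [← FaithfulSMul.algebraMap_injective (𝓞 K) K h]
  have : Fintype (Set.range f) := Fintype.ofFinite _
  refine ⟨Finset.univ.image fun q : Set.range f => ((q.2.choose : 𝓞 K) : K), ?_, ?_, ?_⟩
  · intro b hb
    obtain ⟨q, -, rfl⟩ := Finset.mem_image.mp hb
    exact FractionalIdeal.mem_coeIdeal_of_mem _ q.2.choose.2
  · intro b hb
    obtain ⟨x, hx, rfl⟩ := (FractionalIdeal.mem_coeIdeal _).mp hb
    refine ⟨_, Finset.mem_image_of_mem _ (Finset.mem_univ ⟨f ⟨x, hx⟩, _, rfl⟩), ?_⟩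
    exact (hf ⟨x, hx⟩ _).mp (Exists.choose_spec (p := fun y => f y = f ⟨x, hx⟩) _).symm
  · intro s hs t ht h
    obtain ⟨q, -, rfl⟩ := Finset.mem_image.mp hs
    obtain ⟨q', -, rfl⟩ := Finset.mem_image.mp ht
    have h1 := (hf _ _).mpr h
    rw [q.2.choose_spec, q'.2.choose_spec] at h1
    rw [Subtype.ext h1]

variable {p : ℕ} [Fact p.Prime]

lemma natCast_mem_primesAbove (𝔭 : PrimesAbove K p) : (p : 𝓞 K) ∈ (𝔭 : Ideal (𝓞 K)) := by
  have h := 𝔭.2.2.over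
  have h1 : ((p : ℕ) : ℤ) ∈ Ideal.under ℤ (𝔭 : Ideal (𝓞 K)) :=
    h ▸ Ideal.mem_span_singleton_self _
  simpa [Ideal.under, Ideal.mem_comap] using h1

lemma primesAbove_ne_zero (𝔭 : PrimesAbove K p) : (𝔭 : Ideal (𝓞 K)) ≠ 0 := fun h => by
  have h1 := (natCast_mem_primesAbove 𝔭)
  rw [h] at h1
  exact Nat.cast_ne_zero.mpr (Fact.out : p.Prime).ne_zero (Ideal.mem_bot.mp h1)

end Transversals

/-! ### Identification of `U_𝔭` with an explicit sum of matrices -/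

section Unit

variable {p : ℕ} [Fact p.Prime] {L : Type*} [Field L] [Algebra L ℂ_[p]] {K : Type*} [Field K]
  [NumberField K] [DecidableEq K] {𝔪 : Ideal (𝓞 K)}
  {R : ClassReps (Ideal.span {(p : 𝓞 K)} * 𝔪)} {H : HeckeData p R}

lemma exists_cosetData (C : CuspFamily H) (𝔭 : PrimesAbove K p) :
    ∃ D : CosetData C, D.𝔞 = 𝔭 ∧ D.J = H.j 𝔭 ∧ D.A = H.α 𝔭 := by
  choose T h1 h2 h3 using fun i => exists_transversal (𝔭 : Ideal (𝓞 K)) (R.I i) (primesAbove_ne_zero 𝔭)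
    (R.ne_zero i)
  exact ⟨⟨𝔭, H.j 𝔭, H.α 𝔭, T, H.mul_eq 𝔭, ⟨1, by
    rw [pow_one]
    exact Ideal.mul_le_left.trans ((Ideal.span_singleton_le_iff_mem _).mpr (natCast_mem_primesAbove 𝔭))⟩,
    C.stable 𝔭, h1, h2, h3⟩, rfl, rfl, rfl⟩

variable {C : CuspFamily H} {σ : EmbPair p K L} {M : Type*} [AddCommGroup M] [Module L M]
  {act : GL (Fin 2) K → M →ₗ[L] M}

lemma mem_BianchiSymb_iff {Φ : HomFam C M} : Φ ∈ BianchiSymb act C ↔ InvMod act ⊥ Φ := by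
  simp only [InvMod, Submodule.mem_bot, sub_eq_zero]
  constructor
  · intro h i γ hγ X
    exact DFunLike.congr_fun (h i (Set.mem_univ i) γ hγ) X
  · intro h i _ γ hγ
    ext X
    exact h i γ hγ X

/-- On modular symbols, `U_𝔭` is the operator given by any system of representatives. -/
lemma heckeU_eq (hact : IsRightAct σ act) {𝔭 : PrimesAbove K p} {D : CosetData C}
    (hJ : D.J = H.j 𝔭) (hA : D.A = H.α 𝔭) {Φ : HomFam C M} (hΦ : Φ ∈ BianchiSymb act C) :
    heckeU act C 𝔭 Φ = D.hecke act Φ := by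
  obtain ⟨𝔞, J, A, T, mul_eq, level, stable, mem, cover, inj⟩ := D
  dsimp only at hJ hA
  subst hJ hA
  set D : CosetData C := ⟨𝔞, _, _, T, mul_eq, level, stable, mem, cover, inj⟩ with hD
  funext i
  ext X
  let Γ' := Gam (R.I (H.j 𝔭 i)) (Ideal.span {(p : 𝓞 K)} * 𝔪)
  have hout : ∀ g : GL (Fin 2) K, ∃ γ ∈ Γ',
      (Quotient.mk (QuotientGroup.rightRel Γ') g).out = γ * g := fun g => by
    have h1 := Quotient.exact (Quotient.out_eq (Quotient.mk (QuotientGroup.rightRel Γ') g))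
    exact ⟨_, QuotientGroup.rightRel_apply.mp ((QuotientGroup.rightRel Γ').symm h1), by group⟩
  have hmem : ∀ b : D.T i, (Quotient.mk (QuotientGroup.rightRel Γ') (affMat b.1 (D.A i))).out ∈
      DoubleCoset.doubleCoset (diagMat (H.α 𝔭 i)) (Γ' : Set (GL (Fin 2) K))
        (Gam (R.I i) (Ideal.span {(p : 𝓞 K)} * 𝔪)) := fun b => by
    obtain ⟨γ, hγ, h⟩ := hout (affMat b.1 (D.A i))
    refine DoubleCoset.mem_doubleCoset.mpr ⟨γ, hγ, affMat b.1 1,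
      affMat_one_mem_Gam (D.mem i b.1 b.2), ?_⟩
    rw [h, mul_assoc, diagMat_eq, affMat_mul]
    simp [hD]
  let f : D.T i → {q : Quotient (QuotientGroup.rightRel Γ') //
      q.out ∈ DoubleCoset.doubleCoset (diagMat (H.α 𝔭 i)) (Γ' : Set (GL (Fin 2) K))
        (Gam (R.I i) (Ideal.span {(p : 𝓞 K)} * 𝔪))} := fun b => ⟨_, hmem b⟩
  -- The matrices `(1, b; 0, α_i)` meet each coset of `Γ' \ Γ' g Γ` exactly once: distinct `b` are
  -- inequivalent, and `(1, 0; 0, α_i) y` with `y ∈ Γ_i(𝔫)` is rewritten by the case `b = 0` of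
  -- `exists_mul_eq`.
  have hf : Function.Bijective f := by
    constructor
    · intro b c hbc
      have h1 := Quotient.exact (congrArg Subtype.val hbc)
      have h2 := QuotientGroup.rightRel_apply.mp ((QuotientGroup.rightRel Γ').symm h1)
      exact Subtype.ext (D.eq_of_mul_eq b.2 c.2 h2 (by group))
    · rintro ⟨q, hq⟩
      obtain ⟨x, hx, y, hy, h⟩ := DoubleCoset.mem_doubleCoset.mp hq
      obtain ⟨b, hb, γ', hγ', h2⟩ := D.exists_mul_eq (FractionalIdeal.zero_mem _) hy
      refine ⟨⟨b, hb⟩, Subtype.ext ?_⟩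
      refine Eq.trans ?_ (Quotient.out_eq q)
      refine Quotient.sound (QuotientGroup.rightRel_apply.mpr ?_)
      have e : q.out = x * (γ' * affMat b (D.A i)) := by
        rw [h, ← h2, mul_assoc]; rfl
      change q.out * (affMat b (D.A i))⁻¹ ∈ Γ'
      rw [e, ← mul_assoc, mul_inv_cancel_right]
      exact mul_mem hx hγ'
  have : Fintype {q : Quotient (QuotientGroup.rightRel Γ') //
      q.out ∈ DoubleCoset.doubleCoset (diagMat (H.α 𝔭 i)) (Γ' : Set (GL (Fin 2) K))
        (Gam (R.I i) (Ideal.span {(p : 𝓞 K)} * 𝔪))} := Fintype.ofBijective f hf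
  have h : heckeU act C 𝔭 Φ i = doubleCosetOp act Γ' _ (diagMat (H.α 𝔭 i))
    (C.doubleCoset_smul_mem 𝔭 i) (Φ (H.j 𝔭 i)) := rfl
  rw [h, doubleCosetOp, finsum_eq_sum_of_fintype, LinearMap.sum_apply,
    AddMonoidHom.finsetSum_apply, CosetData.hecke_apply]
  refine (Fintype.sum_bijective f hf _ _ fun b => ?_).symm
  obtain ⟨γ, hγ, e⟩ := hout (affMat b.1 (D.A i))
  have h1 := act_left_mul hact Φ hγ (D.inSigma0 (D.mem i b.1 b.2)) e
    (D.affMat_smul_mem i (D.mem i b.1 b.2))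
    (C.doubleCoset_smul_mem 𝔭 i _ (hmem b)) X
  rw [(Submodule.mem_bot L).mp (mem_BianchiSymb_iff.mp hΦ _ γ hγ _), map_zero, sub_eq_zero] at h1
  exact h1.symm

end Unit

/-! ### Uniqueness and existence of lifts for a contracting operator -/

section Lifting

variable {p : ℕ} [Fact p.Prime] {L : Type*} [Field L] [Algebra L ℂ_[p]] {K : Type*} [Field K]
  [NumberField K] [DecidableEq K] {𝔪 : Ideal (𝓞 K)}
  {R : ClassReps (Ideal.span {(p : 𝓞 K)} * 𝔪)} {H : HeckeData p R} {C : CuspFamily H}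
  {σ : EmbPair p K L} {κ : Fin 2 → ℕ}

section Apply

variable {M : Type*} [AddCommGroup M] [Module L M]

lemma HomFam.smul_apply (c : L) (Φ : HomFam C M) (i : ClassGroup (𝓞 K)) (X : Div0 (C.cusps i)) :
    (c • Φ) i X = c • Φ i X := rfl

lemma HomFam.sub_apply (Φ Ψ : HomFam C M) (i : ClassGroup (𝓞 K)) (X : Div0 (C.cusps i)) :
    (Φ - Ψ) i X = Φ i X - Ψ i X := rfl

variable {act : GL (Fin 2) K → M →ₗ[L] M} {N : Submodule L M}

/-- Two families are congruent modulo the submodule `N`. -/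
def EqMod (N : Submodule L M) (Φ Ψ : HomFam C M) : Prop := ∀ i X, Φ i X - Ψ i X ∈ N

lemma EqMod.refl (Φ : HomFam C M) : EqMod N Φ Φ := fun i X => by
  rw [sub_self]; exact N.zero_mem

lemma EqMod.symm {Φ Ψ : HomFam C M} (h : EqMod N Φ Ψ) : EqMod N Ψ Φ := fun i X => by
  rw [← neg_sub]; exact N.neg_mem (h i X)

lemma EqMod.trans {Φ Ψ Θ : HomFam C M} (h : EqMod N Φ Ψ) (h' : EqMod N Ψ Θ) : EqMod N Φ Θ :=
  fun i X => by
    rw [← sub_add_sub_cancel]; exact N.add_mem (h i X) (h' i X)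

lemma EqMod.sub {Φ Ψ Φ' Ψ' : HomFam C M} (h : EqMod N Φ Ψ) (h' : EqMod N Φ' Ψ') :
    EqMod N (Φ - Φ') (Ψ - Ψ') := fun i X => by
  rw [HomFam.sub_apply, HomFam.sub_apply, sub_sub_sub_comm]; exact N.sub_mem (h i X) (h' i X)

lemma EqMod.smul (c : L) {Φ Ψ : HomFam C M} (h : EqMod N Φ Ψ) : EqMod N (c • Φ) (c • Ψ) :=
  fun i X => by
    rw [HomFam.smul_apply, HomFam.smul_apply, ← smul_sub]; exact N.smul_mem _ (h i X)

lemma EqMod.hecke (hN : IsStable σ act N) (D : CosetData C) {Φ Ψ : HomFam C M}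
    (h : EqMod N Φ Ψ) : EqMod N (D.hecke act Φ) (D.hecke act Ψ) := fun i X => by
  rw [← HomFam.sub_apply, ← map_sub]
  exact D.hecke_mem hN (Φ := Φ - Ψ) h i X

lemma EqMod.pow_self (hN : IsStable σ act N) {D : CosetData C} {c : L} {Φ : HomFam C M}
    (h : EqMod N ((c • D.hecke act) Φ) Φ) (n : ℕ) :
    EqMod N (((c • D.hecke act) ^ n) Φ) Φ := by
  induction n with
  | zero => exact EqMod.refl _
  | succ n ih =>
    rw [pow_succ']
    exact ((ih.hecke hN D).smul c).trans h

lemma pow_succ_apply_sub (T : Module.End L (HomFam C M)) (n : ℕ) (Φ : HomFam C M)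
    (i : ClassGroup (𝓞 K)) (X : Div0 (C.cusps i)) :
    (T ^ (n + 1)) (T Φ - Φ) i X = (T ^ (n + 1 + 1)) Φ i X - (T ^ (n + 1)) Φ i X := by
  rw [map_sub, pow_succ T (n + 1)]; rfl

lemma map_sub_eq (f : M →ₗ[L] M) (y z x w : M) :
    f y - x = f (y - z) + (f z - w) - (x - w) := by
  rw [map_sub]; abel

lemma hecke_sub_smul_eq {D : CosetData C} {c : L} {Φ Ψ Θ : HomFam C M}
    (h : D.hecke act Ψ = c • Θ) (i : ClassGroup (𝓞 K)) (X : Div0 (C.cusps i)) :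
    D.hecke act Φ i X - (c • Φ) i X = D.hecke act (Φ - Ψ) i X + c • (Θ i X - Ψ i X) -
      c • (Φ - Ψ) i X := by
  rw [map_sub, h]
  simp only [HomFam.sub_apply, HomFam.smul_apply, smul_sub]
  abel

lemma hecke_pow_eq {D : CosetData C} {c : L} (hc : c ≠ 0) (Φ : HomFam C M) (n : ℕ) :
    D.hecke act (((c⁻¹ • D.hecke act) ^ n) Φ) = c • ((c⁻¹ • D.hecke act) ^ (n + 1)) Φ := by
  have : ((c⁻¹ • D.hecke act) ^ (n + 1)) Φ =
      c⁻¹ • D.hecke act (((c⁻¹ • D.hecke act) ^ n) Φ) := by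
    rw [pow_succ']; rfl
  rw [this, smul_inv_smul₀ hc]

lemma EqMod.inv_smul {D : CosetData C} {c : L} (hc : c ≠ 0) {Φ : HomFam C M}
    (h : EqMod N (D.hecke act Φ) (c • Φ)) : EqMod N ((c⁻¹ • D.hecke act) Φ) Φ := by
  have h1 := h.smul c⁻¹
  rwa [inv_smul_smul₀ hc] at h1

lemma defect_smul (c : L) {Φ Ψ : HomFam C M} (h : Ψ = c • Φ) {i : ClassGroup (𝓞 K)}
    (f : M →ₗ[L] M) (X Y : Div0 (C.cusps i)) {ι : Type*} [Fintype ι] {m : ι → M}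
    (hm : f (Φ i Y) - Φ i X = ∑ b, m b) : f (Ψ i Y) - Ψ i X = ∑ b, c • m b := by
  rw [h, HomFam.smul_apply, HomFam.smul_apply, map_smul, ← smul_sub, hm, Finset.smul_sum]

lemma exists_pow_apply_eq (hact : IsRightAct σ act) (D : CosetData C) (c : L) (n : ℕ) :
    ∃ F : CosetData C, F.𝔞 = D.𝔞 ^ (n + 1) ∧ ∀ Φ : HomFam C M,
      ((c • D.hecke act) ^ (n + 1)) Φ = c ^ (n + 1) • F.hecke act Φ := by
  obtain ⟨F, h1, -, -, h4⟩ := D.exists_pow hact n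
  refine ⟨F, h1, fun Φ => ?_⟩
  rw [smul_pow, h4]
  rfl

end Apply

lemma isRightAct_distAct : IsRightAct (M := Dist σ) σ (distAct κ σ) := fun hγ hδ m => distAct_mul hγ hδ m

lemma TestProj.isStable_ker (π : TestProj κ σ) : IsStable (M := Dist σ) σ (distAct κ σ) π.ker :=
  fun hγ _ hm => TestProj.ker_act hm hγ

/-- The values of the family `Φ` are bounded in each of the spaces `𝔻[L, r₁, r₂]`. -/
def IsBdd (κ : Fin 2 → ℕ) (Φ : HomFam C (Dist σ)) : Prop :=
  ∀ r, ∃ B, 0 ≤ B ∧ ∀ i X, (TestProj.id κ σ).Bd r B (Φ i X)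

lemma IsBdd.smul {Φ : HomFam C (Dist σ)} (h : IsBdd κ Φ) (c : L) : IsBdd κ (c • Φ) := fun r => by
  obtain ⟨B, hB, h1⟩ := h r
  exact ⟨_, mul_nonneg (norm_nonneg _) hB, fun i X => (h1 i X).smul c⟩

lemma IsBdd.sub {Φ Ψ : HomFam C (Dist σ)} (h : IsBdd κ Φ) (h' : IsBdd κ Ψ) :
    IsBdd κ (Φ - Ψ) := fun r => by
  obtain ⟨B, hB, h1⟩ := h r
  obtain ⟨B', hB', h2⟩ := h' r
  exact ⟨max B B', le_max_of_le_left hB, fun i X =>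
    ((h1 i X).mono (le_max_left _ _)).sub ((h2 i X).mono (le_max_right _ _))⟩

lemma TestProj.Bd.hecke {π : TestProj κ σ} {r : Radii} {B : ℝ} (hB : 0 ≤ B)
    {Φ : HomFam C (Dist σ)} (h : ∀ i X, π.Bd r B (Φ i X)) (D : CosetData C)
    (i : ClassGroup (𝓞 K)) (X : Div0 (C.cusps i)) :
    π.Bd r B (D.hecke (distAct κ σ) Φ i X) := by
  rw [CosetData.hecke_apply]
  exact Bd.sum _ hB fun b _ => (h _ _).act (D.inSigma0 (D.mem i b.1 b.2))

lemma IsBdd.hecke {Φ : HomFam C (Dist σ)} (h : IsBdd κ Φ) (D : CosetData C) :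
    IsBdd κ (D.hecke (distAct κ σ) Φ) := fun r => by
  obtain ⟨B, hB, h1⟩ := h r
  exact ⟨B, hB, TestProj.Bd.hecke hB h1 D⟩

lemma IsBdd.pow {Φ : HomFam C (Dist σ)} (h : IsBdd κ Φ) (D : CosetData C) (c : L) (n : ℕ) :
    IsBdd κ (((c • D.hecke (distAct κ σ)) ^ n) Φ) := by
  induction n with
  | zero => exact h
  | succ n ih =>
    rw [pow_succ']
    exact (ih.hecke D).smul c

/-- On distributions in `N`, tested on the test functions of `π`, the powers of the operator
attached to `D` divided by the powers of `lam` contract geometrically. -/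
def Contracts (π : TestProj κ σ) (N : Submodule L (Dist σ)) (D : CosetData C) (lam : L) : Prop :=
  ∃ c : ℝ, 0 ≤ c ∧ c < 1 ∧ ∀ r, ∃ (r' : Radii) (B₀ : ℝ) (n₀ : ℕ), 0 ≤ B₀ ∧ ∀ n ≥ n₀,
    ∀ F : CosetData C, F.𝔞 = D.𝔞 ^ (n + 1) → ∀ i, ∀ b ∈ (R.I i : FractionalIdeal (𝓞 K)⁰ K),
      ∀ μ ∈ N, ∀ B, 0 ≤ B → (TestProj.id κ σ).Bd r' B μ →
        π.Bd r (B * B₀ * c ^ n) (lam⁻¹ ^ (n + 1) • distAct κ σ (affMat b (F.A i)) μ)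

variable {π : TestProj κ σ} {N : Submodule L (Dist σ)} {D : CosetData C} {lam : L}

/-- The power is a single sum over representatives for `𝔞 ^ (n + 1)`. By the ultrametric inequality
the number of terms does not matter, so the bound for one matrix suffices. -/
lemma bd_pow_of_contracts {c : ℝ} {r r' : Radii} {B₀ : ℝ} {n : ℕ} (hc : 0 ≤ c) (hB₀ : 0 ≤ B₀)
    (h : ∀ F : CosetData C, F.𝔞 = D.𝔞 ^ (n + 1) → ∀ i,
      ∀ b ∈ (R.I i : FractionalIdeal (𝓞 K)⁰ K),
      ∀ μ ∈ N, ∀ B, 0 ≤ B → (TestProj.id κ σ).Bd r' B μ →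
        π.Bd r (B * B₀ * c ^ n) (lam⁻¹ ^ (n + 1) • distAct κ σ (affMat b (F.A i)) μ))
    {Φ : HomFam C (Dist σ)} (hΦ : ∀ i X, Φ i X ∈ N) {B : ℝ} (hB : 0 ≤ B)
    (hB' : ∀ i X, (TestProj.id κ σ).Bd r' B (Φ i X)) (i : ClassGroup (𝓞 K))
    (X : Div0 (C.cusps i)) :
    π.Bd r (B * B₀ * c ^ n) (((lam⁻¹ • D.hecke (distAct κ σ)) ^ (n + 1)) Φ i X) := by
  obtain ⟨F, hF, hF2⟩ := exists_pow_apply_eq (M := Dist σ) (isRightAct_distAct (κ := κ)) D lam⁻¹ n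
  rw [hF2, HomFam.smul_apply, CosetData.hecke_apply, Finset.smul_sum]
  exact TestProj.Bd.sum _ (by positivity) fun b _ =>
    h F hF i b.1 (F.mem i b.1 b.2) _ (hΦ _ _) B hB (hB' _ _)

lemma exists_mul_pow_le {c : ℝ} (hc0 : 0 ≤ c) (hc : c < 1) (B : ℝ) (n₀ : ℕ) {ε : ℝ} (hε : 0 < ε) :
    ∃ n ≥ n₀, B * c ^ n ≤ ε := by
  have h := (tendsto_pow_atTop_nhds_zero_of_lt_one hc0 hc).const_mul B
  rw [mul_zero] at h
  obtain ⟨n, h1, h2⟩ := ((h.eventually (gt_mem_nhds hε)).and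
    (Filter.eventually_ge_atTop n₀)).exists
  exact ⟨n, h2, h1.le⟩

/-- A bounded family with values in `N` that is an eigenvector modulo `π.ker` of a contracting
operator has values in `π.ker`. -/
theorem eqMod_zero_of_contracts (hD : Contracts π N D lam) (hlam : lam ≠ 0)
    {Φ : HomFam C (Dist σ)} (hΦ : ∀ i X, Φ i X ∈ N) (hb : IsBdd κ Φ)
    (h : EqMod π.ker (D.hecke (distAct κ σ) Φ) (lam • Φ)) (i : ClassGroup (𝓞 K))
    (X : Div0 (C.cusps i)) : Φ i X ∈ π.ker := by
  obtain ⟨c, hc0, hc, hr⟩ := hD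
  refine TestProj.mem_ker_of_bd fun r ε hε => ?_
  obtain ⟨r', B₀, n₀, hB₀, h1⟩ := hr r
  obtain ⟨B, hB, hB'⟩ := hb r'
  obtain ⟨n, hn, hle⟩ := exists_mul_pow_le hc0 hc (B * B₀) n₀ hε
  -- Modulo `π.ker` the family is fixed by all powers of `λ⁻¹ W`, where `W` is the operator of `D`,
  -- while these powers make its values arbitrarily small on test functions.
  have hT := h.inv_smul hlam
  have h2 := (hT.pow_self π.isStable_ker (n + 1)).symm i X
  have h3 := (bd_pow_of_contracts hc0 hB₀ (h1 n hn) hΦ hB hB' i X).mono hle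
  have h4 := (TestProj.Bd.of_mem_ker hε.le h2).add h3
  have e : Φ i X - ((lam⁻¹ • D.hecke (distAct κ σ)) ^ (n + 1)) Φ i X +
    ((lam⁻¹ • D.hecke (distAct κ σ)) ^ (n + 1)) Φ i X = Φ i X :=
    sub_add_cancel (Φ i X) _
  exact e ▸ h4

set_option maxHeartbeats 2000000 in
/-- A bounded family that is, modulo `N`, invariant and an eigenvector of a contracting operator can
be changed modulo `N` so that this is true modulo `π.ker`. -/
theorem exists_lift_of_contracts (hcl : IsClosed (Set.range (algebraMap L ℂ_[p])))
    (hD : Contracts π N D lam) (hlam : lam ≠ 0) (hN : IsStable (M := Dist σ) σ (distAct κ σ) N)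
    (hNcl : ∀ μ : Dist σ, (∀ r, ∀ ε > 0, ∃ ν ∈ N, π.Bd r ε (μ - ν)) → μ ∈ N)
    {Φ : HomFam C (Dist σ)} (hb : IsBdd κ Φ) (hinv : InvMod (distAct κ σ) N Φ)
    (h : EqMod N (D.hecke (distAct κ σ) Φ) (lam • Φ)) :
    ∃ Ψ : HomFam C (Dist σ), IsBdd κ Ψ ∧ EqMod N Ψ Φ ∧ InvMod (distAct κ σ) π.ker Ψ ∧
      EqMod π.ker (D.hecke (distAct κ σ) Ψ) (lam • Ψ) := by
  obtain ⟨c, hc0, hc, hr⟩ := hD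
  choose r' B₀ n₀ hB₀ h1 using hr
  set T : Module.End L (HomFam C (Dist σ)) := lam⁻¹ • D.hecke (distAct κ σ) with hTdef
  have hT : EqMod N (T Φ) Φ := h.inv_smul hlam
  have hbT : IsBdd κ (T Φ - Φ) := ((hb.hecke D).smul _).sub hb
  choose B hB hB' using hbT
  -- Successive differences are `T ^ (n + 1)` applied to `T Φ - Φ`, whose values lie in `N`; hence
  -- the sequence converges geometrically.
  let Z : ℕ → HomFam C (Dist σ) := fun n => (T ^ (n + 1)) Φ
  have hZ : ∀ r n, n₀ r ≤ n → ∀ i X,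
      π.Bd r (B (r' r) * B₀ r * c ^ n) (Z (n + 1) i X - Z n i X) := fun r n hn i X => by
    have h2 := bd_pow_of_contracts hc0 (hB₀ r) (h1 r n hn) (Φ := T Φ - Φ) hT (hB (r' r))
      (hB' (r' r)) i X
    exact (pow_succ_apply_sub T n Φ i X) ▸ h2
  have hC : ∀ r, 0 ≤ B (r' r) * B₀ r := fun r => mul_nonneg (hB _) (hB₀ r)
  choose Y hY1 hY2 using fun i => TestProj.exists_limit_hom (π := π) hcl hc0 hc hC
    (fun n => Z n i) (fun r n hn X => hZ r n hn i X)
  have hCb : ∀ r, 0 ≤ B (r' r) * B₀ r * π.bound := fun r => mul_nonneg (hC r) π.bound_nonneg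
  have hZN : ∀ n, EqMod N (Z n) Φ := fun n => hT.pow_self hN (n + 1)
  let Y' : HomFam C (Dist σ) := Y
  refine ⟨Y', fun r => ?_, fun i X => ?_, fun i γ hγ X => ?_, fun i X => ?_⟩
  -- For each `r` the limit is compared with the one bounded family `Z (n₀ r)`.
  · obtain ⟨B₁, hB₁, h2⟩ := hb.pow D lam⁻¹ (n₀ r + 1) r
    refine ⟨max (B (r' r) * B₀ r * π.bound * c ^ n₀ r) (B₁ * π.bound),
      le_max_of_le_right (mul_nonneg hB₁ π.bound_nonneg), fun i X => ?_⟩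
    have h3 := ((hY2 i r _ le_rfl X).mono (le_max_left _ (B₁ * π.bound))).add
      (((h2 i X).of_id (π := π)).dual.mono (le_max_right _ _))
    have e : Y i X - π.dual (Z (n₀ r) i X) + π.dual (Z (n₀ r) i X) = Y i X :=
      sub_add_cancel (Y i X) _
    exact e ▸ h3
  · refine hNcl _ fun r ε hε => ?_
    obtain ⟨n, hn, hle⟩ := exists_mul_pow_le hc0 hc (B (r' r) * B₀ r * π.bound) (n₀ r) hε
    refine ⟨_, hZN n i X, ?_⟩
    have e : Y i X - Z n i X = Y i X - Φ i X - (Z n i X - Φ i X) :=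
      (sub_sub_sub_cancel_right (Y i X) (Z n i X) (Φ i X)).symm
    exact e ▸ (hY1 i r n hn X).mono hle
  · refine TestProj.mem_ker_of_bd fun r ε hε => ?_
    obtain ⟨B₁, hB₁, hb₁⟩ := hb (r' r)
    obtain ⟨n, hn, hle⟩ := exists_mul_pow_le hc0 hc
      (max (B (r' r) * B₀ r * π.bound) (B₁ * B₀ r)) (n₀ r) hε
    have hcn := pow_nonneg hc0 n
    have hle1 := (mul_le_mul_of_nonneg_right (le_max_left (B (r' r) * B₀ r * π.bound)
      (B₁ * B₀ r)) hcn).trans hle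
    have hle2 := (mul_le_mul_of_nonneg_right (le_max_right (B (r' r) * B₀ r * π.bound)
      (B₁ * B₀ r)) hcn).trans hle
    have hγ0 : InSigma0 σ γ := inSigma0_of_mem hγ
    obtain ⟨F, hF, hF2⟩ := exists_pow_apply_eq (M := Dist σ) (isRightAct_distAct (κ := κ)) D lam⁻¹ n
    have h2 := ((hY1 i r n hn (moveDiv γ (C.invariant i γ hγ) X)).mono hle1).act hγ0
    have h3 := (hY1 i r n hn X).mono hle1
    -- By `hecke_defect`, the failure of invariance of `Z n` is a sum of images, under single
    -- matrices for `𝔞 ^ (n + 1)`, of failures of invariance of `Φ`. Those lie in `N`, so they are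
    -- contracted.
    have h4 : π.Bd r ε (distAct κ σ γ (Z n i (moveDiv γ (C.invariant i γ hγ) X)) - Z n i X) := by
      obtain ⟨m, hm, hm2⟩ := F.hecke_defect isRightAct_distAct Φ hγ X
      have e : distAct κ σ γ (Z n i (moveDiv γ (C.invariant i γ hγ) X)) - Z n i X =
          ∑ b : F.T i, lam⁻¹ ^ (n + 1) • distAct κ σ (affMat b.1 (F.A i)) (m b) :=
        defect_smul _ (hF2 Φ) (distAct κ σ γ) _ _ hm2
      rw [e]
      refine TestProj.Bd.sum _ hε.le fun b _ => ?_
      obtain ⟨γ', hγ', V, hV⟩ := hm b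
      refine (h1 r n hn F hF i b.1 (F.mem i b.1 b.2) _ ?_ B₁ hB₁ ?_).mono hle2
      · rw [hV]; exact hinv _ _ hγ' _
      · rw [hV]; exact ((hb₁ _ _).act (inSigma0_of_mem hγ')).sub (hb₁ _ _)
    have e := map_sub_eq (distAct κ σ γ) (Y i (moveDiv γ (C.invariant i γ hγ) X))
      (Z n i (moveDiv γ (C.invariant i γ hγ) X)) (Y i X) (Z n i X)
    exact e ▸ (h2.add h4).sub h3
  -- With `W` the operator of `D`, one has `W Y - λY = W (Y - Z n) + λ (Z (n + 1) - Z n) - λ (Y - Z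
  -- n)`. Dividing `ε` by `Q` makes all three terms small, with or without the factor `λ`.
  · refine TestProj.mem_ker_of_bd fun r ε hε => ?_
    let Q := max 1 ‖algebraMap L ℂ_[p] lam‖
    have hQ : 0 < Q := zero_lt_one.trans_le (le_max_left _ _)
    obtain ⟨n, hn, hle⟩ := exists_mul_pow_le hc0 hc
      (max (B (r' r) * B₀ r * π.bound) (B (r' r) * B₀ r)) (n₀ r) (div_pos hε hQ)
    have hcn := pow_nonneg hc0 n
    have hle1 := (mul_le_mul_of_nonneg_right (le_max_left (B (r' r) * B₀ r * π.bound)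
      (B (r' r) * B₀ r)) hcn).trans hle
    have hle2 := (mul_le_mul_of_nonneg_right (le_max_right (B (r' r) * B₀ r * π.bound)
      (B (r' r) * B₀ r)) hcn).trans hle
    have hQ1 : ε / Q ≤ ε := div_le_self hε.le (le_max_left _ _)
    have hQ2 : ‖algebraMap L ℂ_[p] lam‖ * (ε / Q) ≤ ε := by
      calc _ ≤ Q * (ε / Q) := mul_le_mul_of_nonneg_right (le_max_right _ _) (div_pos hε hQ).le
        _ = ε := mul_div_cancel₀ _ hQ.ne'
    have hYZ : ∀ i X, π.Bd r (ε / Q) ((Y' - Z n) i X) := fun i X =>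
      (hY1 i r n hn X).mono hle1
    have h2 := (TestProj.Bd.hecke (div_pos hε hQ).le hYZ D i X).mono hQ1
    have h3 := ((hYZ i X).smul lam).mono hQ2
    have h4 := (((hZ r n hn i X).mono hle2).smul lam).mono hQ2
    have e := hecke_sub_smul_eq (Φ := Y') (hecke_pow_eq (act := distAct κ σ) (D := D) hlam Φ (n + 1)) i X
    exact e ▸ (h2.add h4).sub h3

end Lifting

/-! ### From the size of an ideal to geometric contraction -/

section Contraction

variable {p : ℕ} [Fact p.Prime] {L : Type*} [Field L] [Algebra L ℂ_[p]] {K : Type*} [Field K]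
  [NumberField K] {σ : EmbPair p K L} {κ : Fin 2 → ℕ}

lemma norm_emb_le_of_mem_pow {𝔞 : Ideal (𝓞 K)} {s : Fin 2} {θ : ℝ} (hθ : 0 ≤ θ)
    (h : ∀ x ∈ 𝔞, ‖emb σ (x : K) s‖ ≤ θ) (n : ℕ) {x : 𝓞 K} (hx : x ∈ 𝔞 ^ n) :
    ‖emb σ (x : K) s‖ ≤ θ ^ n := by
  induction n generalizing x with
  | zero => simpa using norm_le_one_of_integral σ x s
  | succ n ih =>
    rw [pow_succ] at hx
    refine Submodule.mul_induction_on hx (fun a ha b hb => ?_) fun a b ha hb => ?_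
    · have e : ((a * b : 𝓞 K) : K) = a * b := map_mul (algebraMap (𝓞 K) K) a b
      rw [e, map_mul, Pi.mul_apply, norm_mul, pow_succ]
      exact mul_le_mul (ih ha) (h b hb) (norm_nonneg _) (pow_nonneg hθ n)
    · have e : ((a + b : 𝓞 K) : K) = a + b := map_add (algebraMap (𝓞 K) K) a b
      rw [e, map_add, Pi.add_apply]
      exact (IsUltrametricDist.norm_add_le_max _ _).trans (max_le ha hb)

lemma norm_emb_eq_one {y z : 𝓞 K} (h : y + p * z = 1) (s : Fin 2) : ‖emb σ (y : K) s‖ = 1 := by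
  have h1 : emb σ (y : K) s = 1 - p * emb σ (z : K) s := by
    have := congrArg (fun a : 𝓞 K => emb σ (a : K) s) h
    simp only [map_add, map_mul, map_one, map_natCast, Pi.add_apply, Pi.mul_apply, Pi.one_apply,
      Pi.natCast_apply] at this
    rw [← this, add_sub_cancel_right]
  have h2 : ‖(p : ℂ_[p]) * emb σ (z : K) s‖ < 1 := by
    rw [norm_mul]
    nlinarith [norm_le_one_of_integral σ z s, norm_p_lt_one (p := p), norm_nonneg (p : ℂ_[p]),
      norm_nonneg (emb σ (z : K) s)]
  rw [h1, sub_eq_add_neg, IsUltrametricDist.norm_add_eq_max_of_norm_ne_norm]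
  · rw [norm_neg, norm_one, max_eq_left h2.le]
  · rw [norm_neg, norm_one]; exact h2.ne'

variable [DecidableEq K] {𝔪 : Ideal (𝓞 K)} {R : ClassReps (Ideal.span {(p : 𝓞 K)} * 𝔪)}
  {H : HeckeData p R} {C : CuspFamily H}

/-- `A_i` need not be an algebraic integer. Multiplied by an element of `I_{J i}` congruent to `1`
modulo `p`, whose absolute value is `1`, it becomes an element of `𝔞`. -/
lemma CosetData.norm_emb_A_le (F : CosetData C) {s : Fin 2} {η : ℝ}
    (h : ∀ x ∈ F.𝔞, ‖emb σ (x : K) s‖ ≤ η) (i : ClassGroup (𝓞 K)) :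
    ‖emb σ (F.A i : K) s‖ ≤ η := by
  obtain ⟨y, hyI, z, hyz⟩ := exists_of_coprime (R.coprime_level (F.J i))
  obtain ⟨t, ht, hty⟩ := F.exists_mul_eq_mem i hyI
  have h1 := h t ht
  rw [← hty, map_mul, Pi.mul_apply, norm_mul, norm_emb_eq_one hyz, mul_one] at h1
  exact h1

/-- Distributions in `N` are contracted by the matrices `(1, b; 0, A)` in the coordinates in `S`. -/
def ContractsMat (π : TestProj κ σ) (N : Submodule L (Dist σ)) (S : Finset (Fin 2)) : Prop :=
  ∀ r : Radii, ∃ (r' : Radii) (G : ℝ), 0 ≤ G ∧ ∀ (b : K) (A : Kˣ), emb σ b ∈ OKp σ →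
    emb σ (A : K) ∈ OKp σ → ∀ w : ℂ_[p], (∀ s ∈ S, ‖emb σ (A : K) s‖ ≤ ‖w‖) →
    (∀ s ∈ S, ‖w‖ ≤ r.1 s) → ∀ μ ∈ N, ∀ B, 0 ≤ B → (TestProj.id κ σ).Bd r' B μ → ∀ δ, 0 ≤ δ →
    (∀ s ∈ S, (‖emb σ (A : K) s‖ / ‖w‖) ^ (κ s + 1) ≤ δ) →
      π.Bd r (B * G * δ) (distAct κ σ (affMat b A) μ)

lemma norm_p_pos : 0 < ‖(p : ℂ_[p])‖ :=
  norm_pos_iff.mpr (Nat.cast_ne_zero.mpr (Fact.out : p.Prime).ne_zero)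

/-- Generators attached to `𝔞 ^ (n + 1)` have size at most `θ ^ (n + 1)`, so one matrix contracts by
`θ ^ ((κ s + 1) (n + 1))` up to a constant depending on `r`, and this beats the division by `lam ^
(n + 1)` exactly under `hslope`. -/
lemma contracts_of_contractsMat {π : TestProj κ σ} {N : Submodule L (Dist σ)} {S : Finset (Fin 2)}
    (h : ContractsMat π N S) {D : CosetData C} {lam : L} (hlam : lam ≠ 0) {θ : ℝ} (hθ0 : 0 ≤ θ)
    (hθ1 : θ < 1) (hθ : ∀ s ∈ S, ∀ x ∈ D.𝔞, ‖emb σ (x : K) s‖ ≤ θ)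
    (hslope : ∀ s ∈ S, θ ^ (κ s + 1) < ‖algebraMap L ℂ_[p] lam‖) : Contracts π N D lam := by
  set l := ‖algebraMap L ℂ_[p] lam‖ with hl
  have hl0 : 0 < l := norm_pos_iff.mpr (by simpa using hlam)
  obtain ⟨c, hc0, hc1, hc⟩ : ∃ c : ℝ, 0 ≤ c ∧ c < 1 ∧ ∀ s ∈ S, θ ^ (κ s + 1) ≤ c * l := by
    have h1 : ∀ s, θ ^ (κ s + 1) / l < 1 ∨ s ∉ S := fun s => by
      by_cases hs : s ∈ S
      · exact Or.inl ((div_lt_one hl0).mpr (hslope s hs))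
      · exact Or.inr hs
    -- The rate is the largest ratio `θ ^ (κ s + 1) / l`; including `0` makes it nonnegative and
    -- defined even for empty `S`.
    refine ⟨(insert 0 (S.image fun s => θ ^ (κ s + 1) / l)).sup' (Finset.insert_nonempty _ _) id,
      Finset.le_sup' id (Finset.mem_insert_self _ _), (Finset.sup'_lt_iff _).mpr ?_,
      fun s hs => ?_⟩
    · intro x hx
      rcases Finset.mem_insert.mp hx with rfl | hx
      · exact one_pos
      · obtain ⟨s, hs, rfl⟩ := Finset.mem_image.mp hx
        exact (h1 s).resolve_right (not_not.mpr hs)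
    · rw [← div_le_iff₀ hl0]
      exact Finset.le_sup' id (Finset.mem_insert_of_mem (Finset.mem_image_of_mem
        (fun s => θ ^ (κ s + 1) / l) hs))
  refine ⟨c, hc0, hc1, fun r => ?_⟩
  obtain ⟨r', G, hG, h1⟩ := h r
  -- `w` is a power of `p` small enough to fit inside both radii. It is independent of `n`, so
  -- dividing by `‖w‖` costs only the constant `W`; its exponent exceeds each `κ s`.
  obtain ⟨m, hm⟩ := exists_pow_lt_of_lt_one (lt_min (r.2 0).1 (r.2 1).1) (norm_p_lt_one (p := p))
  set w : ℂ_[p] := (p : ℂ_[p]) ^ m with hw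
  have hw0 : 0 < ‖w‖ := by rw [hw, norm_pow]; exact pow_pos norm_p_pos m
  have hw1 : ‖w‖ ≤ 1 := by rw [hw, norm_pow]; exact pow_le_one₀ (norm_nonneg _) norm_p_lt_one.le
  have hwr : ∀ s, ‖w‖ ≤ r.1 s := fun s => by
    rw [hw, norm_pow]
    refine hm.le.trans ?_
    fin_cases s
    · exact min_le_left _ _
    · exact min_le_right _ _
  -- From `n₀` on, the generators have absolute value at most `‖w‖`, as the contraction estimate
  -- requires.
  obtain ⟨n₀, hn₀⟩ := exists_pow_lt_of_lt_one hw0 hθ1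
  set W := (1 / ‖w‖) ^ (κ 0 + κ 1 + 1) with hW
  have hW0 : 0 ≤ W := by positivity
  have hw1' : 1 ≤ 1 / ‖w‖ := (one_le_div hw0).mpr hw1
  refine ⟨r', G * W, n₀, mul_nonneg hG hW0, fun n hn F hF i b hb μ hμ B hB hμB => ?_⟩
  obtain ⟨b, -, rfl⟩ := (FractionalIdeal.mem_coeIdeal _).mp hb
  have hA : ∀ s ∈ S, ‖emb σ (F.A i : K) s‖ ≤ θ ^ (n + 1) := fun s hs =>
    F.norm_emb_A_le (fun x hx => norm_emb_le_of_mem_pow hθ0 (hθ s hs) (n + 1) (hF ▸ hx)) i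
  have h2 := h1 (algebraMap (𝓞 K) K b) (F.A i) (emb_mem_OKp σ b) (F.emb_A_mem i) w
    (fun s hs => (hA s hs).trans ((pow_le_pow_of_le_one hθ0 hθ1.le (by omega)).trans hn₀.le))
    (fun s _ => hwr s) μ hμ B hB hμB (W * (c * l) ^ (n + 1)) (by positivity) (fun s hs => by
      rw [div_eq_mul_one_div, mul_pow, mul_comm]
      refine mul_le_mul (pow_le_pow_right₀ hw1' ?_) ?_ (by positivity) hW0
      · fin_cases s <;> simp
      · calc ‖emb σ (F.A i : K) s‖ ^ (κ s + 1) ≤ (θ ^ (n + 1)) ^ (κ s + 1) :=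
            pow_le_pow_left₀ (norm_nonneg _) (hA s hs) _
          _ = (θ ^ (κ s + 1)) ^ (n + 1) := by rw [← pow_mul, ← pow_mul, mul_comm]
          _ ≤ (c * l) ^ (n + 1) := pow_le_pow_left₀ (by positivity) (hc s hs) _)
  refine (h2.smul (lam⁻¹ ^ (n + 1))).mono ?_
  rw [map_pow, norm_pow, map_inv₀, norm_inv, ← hl, mul_pow]
  have e : l⁻¹ ^ (n + 1) * (B * G * (W * (c ^ (n + 1) * l ^ (n + 1)))) =
      B * (G * W) * (c ^ n * c) := by
    rw [inv_pow, pow_succ c n]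
    field_simp
  rw [e]
  refine mul_le_mul_of_nonneg_left ?_ (by positivity)
  exact mul_le_of_le_one_right (pow_nonneg hc0 n) hc1.le

lemma lagBound_nonneg (k : ℕ) : 0 ≤ lagBound p k := zero_le_one.trans (one_le_lagBound k)

/-- The case of a single prime above `p`: both coordinates shrink simultaneously, and the norm at
radii `(1, 1)` controls the norms at all radii. -/
lemma contractsMat_id (hcl : IsClosed (Set.range (algebraMap L ℂ_[p]))) :
    ContractsMat (TestProj.id κ σ) (LinearMap.ker (specialize κ σ)) Finset.univ := fun _ =>
  ⟨Radii.one, lagBound p (κ 0) * lagBound p (κ 1), mul_nonneg (lagBound_nonneg _)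
    (lagBound_nonneg _), fun _ _ hb hA _ h1 h2 _ hμ _ _ hB _ _ hδ =>
      bd_distAct_of_specialize_eq_zero hcl hb hA (fun s => h1 s (Finset.mem_univ s))
        (fun s => h2 s (Finset.mem_univ s)) (LinearMap.mem_ker.mp hμ)
        (fun s => hδ s (Finset.mem_univ s)) hB⟩

/-- Enlarge the radius in one coordinate to `1`. -/
def Radii.enlarge (r : Radii) (s : Fin 2) : Radii :=
  ⟨Function.update r.1 s 1, fun i => by
    by_cases h : i = s
    · subst h; simp
    · rw [Function.update_of_ne h]; exact r.2 i⟩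

lemma Radii.enlarge_self (r : Radii) (s : Fin 2) : (r.enlarge s).1 s = 1 :=
  Function.update_self _ _ _

lemma Radii.enlarge_of_ne (r : Radii) {s j : Fin 2} (h : j ≠ s) : (r.enlarge s).1 j = r.1 j :=
  Function.update_of_ne h _ _

/-- The second stage for split `p`: only the coordinate `s` contracts, so only its radius is
enlarged, and the other radius stays as small as it was. -/
lemma contractsMat_ker_interp {s : Fin 2} (hs : Pi.single s 1 ∈ OKp σ) :
    ContractsMat (TestProj.id κ σ) (TestProj.interp κ hs).ker {s} := by
  intro r
  refine ⟨r.enlarge s, lagBound p (κ s), lagBound_nonneg _,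
    fun b A hb hA w h1 h2 μ hμ B hB0 hB δ _ hδ => ?_⟩
  refine (bd_distAct_of_mem_ker_interp hs (r.enlarge_self s) (fun j hj => r.enlarge_of_ne hj) hb hA
    (h1 s (Finset.mem_singleton_self s)) (h2 s (Finset.mem_singleton_self s)) hμ hB).mono ?_
  exact mul_le_mul_of_nonneg_left (hδ s (Finset.mem_singleton_self s))
    (mul_nonneg hB0 (lagBound_nonneg _))

/-- The first stage for split `p`: on functions already polynomial in the first coordinate,
contraction in the second coordinate alone suffices. -/
lemma contractsMat_interp (hcl : IsClosed (Set.range (algebraMap L ℂ_[p])))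
    (hs0 : Pi.single 0 1 ∈ OKp σ) (hs1 : Pi.single 1 1 ∈ OKp σ) :
    ContractsMat (TestProj.interp κ hs0) (LinearMap.ker (specialize κ σ)) {1} := fun r => by
  refine ⟨r.enlarge 1, lagBound p (κ 0) * lagBound p (κ 1), mul_nonneg (lagBound_nonneg _)
    (lagBound_nonneg _), fun b A hb hA w h1 h2 μ hμ B hB0 hB δ _ hδ => ?_⟩
  refine (bd_interp_distAct_of_specialize_eq_zero hcl hs0 hs1 (r.enlarge_self 1)
    (r.enlarge_of_ne zero_ne_one) hb hA (h1 1 (Finset.mem_singleton_self 1))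
    (h2 1 (Finset.mem_singleton_self 1)) (LinearMap.mem_ker.mp hμ) hB).mono ?_
  exact mul_le_mul_of_nonneg_left (hδ 1 (Finset.mem_singleton_self 1))
    (mul_nonneg hB0 (mul_nonneg (lagBound_nonneg _) (lagBound_nonneg _)))

lemma isStable_ker_specialize : IsStable (M := Dist σ) σ (distAct κ σ)
    (LinearMap.ker (specialize κ σ)) := fun hγ m hm => by
  rw [LinearMap.mem_ker] at hm ⊢
  rw [specialize_distAct hγ, hm, map_zero]

/-- The kernel of the specialization map is closed for the test functions of any `π`. -/
lemma mem_ker_specialize_of_bd (π : TestProj κ σ) {μ : Dist σ}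
    (h : ∀ r, ∀ ε > 0, ∃ ν ∈ LinearMap.ker (specialize κ σ), π.Bd r ε (μ - ν)) :
    μ ∈ LinearMap.ker (specialize κ σ) := by
  rw [LinearMap.mem_ker]
  ext P
  obtain ⟨B, hB⟩ := rigid_bounded (polyToRigid κ σ Radii.one.1 P)
  have hB0 := nonneg_of_bound hB
  suffices h1 : ‖algebraMap L ℂ_[p] (specialize κ σ μ P)‖ ≤ 0 by
    simpa using norm_le_zero_iff.mp h1
  refine le_of_forall_pos_le_add fun ε hε => ?_
  obtain ⟨ν, hν, hb⟩ := h Radii.one (ε / (B + 1)) (by positivity)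
  have h2 := hb (polyToRigid κ σ Radii.one.1 P) (π.poly _ P) B hB
  have h3 : (μ - ν).1 Radii.one (polyToRigid κ σ Radii.one.1 P) = specialize κ σ μ P := by
    have h4 : specialize κ σ (μ - ν) = specialize κ σ μ :=
      (map_sub (specialize κ σ) μ ν).trans (by rw [LinearMap.mem_ker.mp hν, sub_zero])
    exact DFunLike.congr_fun h4 P
  rw [h3] at h2
  refine h2.trans ?_
  rw [zero_add, div_mul_eq_mul_div, div_le_iff₀ (by positivity)]
  nlinarith

/-- The kernel of a family of projections is closed. -/
lemma TestProj.mem_ker_of_bd_id (π : TestProj κ σ) {μ : Dist σ}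
    (h : ∀ r, ∀ ε > 0, ∃ ν ∈ π.ker, (TestProj.id κ σ).Bd r ε (μ - ν)) : μ ∈ π.ker := by
  refine TestProj.mem_ker_of_bd fun r ε hε => ?_
  obtain ⟨ν, hν, hb⟩ := h r ε hε
  have h1 := hb.of_id (π := π) |>.add (Bd.of_mem_ker hε.le hν)
  have e : μ - ν + ν = μ := sub_add_cancel μ ν
  exact e ▸ h1

lemma TestProj.ker_le_ker_specialize (π : TestProj κ σ) :
    π.ker ≤ LinearMap.ker (specialize κ σ) := fun μ hμ => by
  rw [LinearMap.mem_ker]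
  ext P
  exact hμ Radii.one _ (π.poly _ P)

end Contraction

/-! ### The primes above `p` and the two embeddings -/

section Primes

variable {p : ℕ} [Fact p.Prime] {L : Type*} [Field L] [Algebra L ℂ_[p]] {K : Type*} [Field K]
  [NumberField K]

/-- Two distinct embeddings exhaust the embeddings of a quadratic field into `ℂ_p`, so their product
is the norm. -/
lemma emb_zero_mul_emb_one (hK : Module.finrank ℚ K = 2) (σ : EmbPair p K L) (x : 𝓞 K) :
    emb σ (x : K) 0 * emb σ (x : K) 1 = ((Algebra.norm ℤ x : ℤ) : ℂ_[p]) := by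
  let f : Fin 2 → (K →ₐ[ℚ] ℂ_[p]) := fun s => ((algebraMap L ℂ_[p]).comp (σ.σ s)).toRatAlgHom
  have hf : Function.Bijective f := by
    rw [Fintype.bijective_iff_injective_and_card]
    refine ⟨fun i j hij => ?_, by rw [Fintype.card_fin, AlgHom.card, hK]⟩
    by_contra hne
    have h1 : σ.σ i = σ.σ j := by
      ext y
      exact (algebraMap L ℂ_[p]).injective (DFunLike.congr_fun hij y)
    fin_cases i <;> fin_cases j <;> simp_all
    · exact σ.ne h1
    · exact σ.ne h1.symm
  have h := Algebra.norm_eq_prod_embeddings ℚ ℂ_[p] (x : K)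
  rw [← Fintype.prod_bijective f hf (fun s => emb σ (x : K) s) _ fun _ => rfl,
    Fin.prod_univ_two] at h
  rw [← h, ← Algebra.coe_norm_int]
  simp

lemma intCast_norm_mem {I : Ideal (𝓞 K)} {x : 𝓞 K} (hx : x ∈ I) :
    ((Algebra.norm ℤ x : ℤ) : 𝓞 K) ∈ I := by
  have h1 := Ideal.absNorm_mem (Ideal.span {x})
  rw [Ideal.absNorm_span_singleton] at h1
  have h2 := (Ideal.span_singleton_le_iff_mem I).mpr hx h1
  rcases Int.natAbs_eq (Algebra.norm ℤ x) with h | h <;> rw [h]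
  · simpa using h2
  · simpa using h2

lemma norm_intCast_le_one (n : ℤ) : ‖(n : ℂ_[p])‖ ≤ 1 := by
  rcases Int.natAbs_eq n with h | h <;> rw [h]
  · simpa using norm_natCast_le_one n.natAbs
  · simpa using norm_natCast_le_one n.natAbs

lemma dvd_of_intCast_mem (𝔭 : PrimesAbove K p) {n : ℤ} (h : (n : 𝓞 K) ∈ (𝔭 : Ideal (𝓞 K))) :
    (p : ℤ) ∣ n := by
  have h1 : n ∈ Ideal.under ℤ (𝔭 : Ideal (𝓞 K)) := by
    simpa [Ideal.under, Ideal.mem_comap] using h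
  rw [← 𝔭.2.2.over] at h1
  exact Ideal.mem_span_singleton.mp h1

variable (σ : EmbPair p K L)

/-- The prime ideal above `p` induced by the embedding `σ_s`. -/
def primeAt (s : Fin 2) : Ideal (𝓞 K) where
  carrier := {x | ‖emb σ (x : K) s‖ < 1}
  zero_mem' := by simp
  add_mem' {x y} hx hy := by
    have e : ((x + y : 𝓞 K) : K) = x + y := map_add (algebraMap (𝓞 K) K) x y
    rw [Set.mem_ofPred_eq, e, map_add]
    exact (IsUltrametricDist.norm_add_le_max _ _).trans_lt (max_lt hx hy)
  smul_mem' a x hx := by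
    have e : ((a • x : 𝓞 K) : K) = a * x := map_mul (algebraMap (𝓞 K) K) a x
    rw [Set.mem_ofPred_eq, e, map_mul, Pi.mul_apply, norm_mul]
    exact (mul_le_of_le_one_left (norm_nonneg _) (norm_le_one_of_integral σ a s)).trans_lt hx

variable {σ}

lemma mem_primeAt {s : Fin 2} {x : 𝓞 K} : x ∈ primeAt σ s ↔ ‖emb σ (x : K) s‖ < 1 := Iff.rfl

lemma natCast_mem_primeAt (s : Fin 2) : (p : 𝓞 K) ∈ primeAt σ s := by
  rw [mem_primeAt]
  simpa using norm_p_lt_one (p := p)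

lemma isPrime_primeAt (s : Fin 2) : (primeAt σ s).IsPrime := by
  refine ⟨fun h => ?_, fun {x y} hxy => ?_⟩
  · have h1 := (Ideal.eq_top_iff_one _).mp h
    rw [mem_primeAt] at h1
    simp at h1
  · rw [mem_primeAt, mem_primeAt]
    by_contra! h
    have h1 := mem_primeAt.mp hxy
    have e : ((x * y : 𝓞 K) : K) = x * y := map_mul (algebraMap (𝓞 K) K) x y
    rw [e, map_mul, Pi.mul_apply, norm_mul] at h1
    nlinarith [h.1, h.2]

lemma primeAt_mem (s : Fin 2) : primeAt σ s ∈ PrimesAbove K p := by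
  have hprime := isPrime_primeAt (σ := σ) s
  refine ⟨hprime, ⟨?_⟩⟩
  have hp : Prime (p : ℤ) := Nat.prime_iff_prime_int.mp Fact.out
  have hmax : (Ideal.span {(p : ℤ)}).IsMaximal :=
    PrincipalIdealRing.isMaximal_of_irreducible hp.irreducible
  refine hmax.eq_of_le (Ideal.IsPrime.ne_top inferInstance)
    ((Ideal.span_singleton_le_iff_mem _).mpr ?_)
  have := natCast_mem_primeAt (σ := σ) s
  simpa [Ideal.under, Ideal.mem_comap] using this

lemma isMaximal_primesAbove (𝔭 : PrimesAbove K p) : (𝔭 : Ideal (𝓞 K)).IsMaximal :=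
  𝔭.2.1.isMaximal (primesAbove_ne_zero 𝔭)

/-- For `x ∈ 𝔭` the norm of `x` is divisible by `p`, so one of the two conjugates has absolute value
below `1`. Thus `𝔭` lies in the union of the two primes, hence in one of them, and `𝔭` is maximal.
-/
lemma eq_primeAt (hK : Module.finrank ℚ K = 2) (σ : EmbPair p K L) (𝔭 : PrimesAbove K p) :
    (𝔭 : Ideal (𝓞 K)) = primeAt σ 0 ∨ (𝔭 : Ideal (𝓞 K)) = primeAt σ 1 := by
  have h : ((𝔭 : Ideal (𝓞 K)) : Set (𝓞 K)) ⊆ primeAt σ 0 ∪ primeAt σ 1 := by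
    intro x hx
    obtain ⟨m, hm⟩ := dvd_of_intCast_mem 𝔭 (intCast_norm_mem hx)
    have h1 := emb_zero_mul_emb_one hK σ x
    rw [hm] at h1
    have h2 := congrArg norm h1
    push_cast at h2
    rw [norm_mul, norm_mul] at h2
    by_contra h3
    rw [Set.mem_union, not_or] at h3
    have h4 : 1 ≤ ‖emb σ (x : K) 0‖ := not_lt.mp h3.1
    have h5 : 1 ≤ ‖emb σ (x : K) 1‖ := not_lt.mp h3.2
    nlinarith [norm_p_lt_one (p := p), norm_intCast_le_one (p := p) m, norm_nonneg (p : ℂ_[p]),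
      norm_nonneg (m : ℂ_[p])]
  rcases Ideal.subset_union.mp h with h | h
  · exact Or.inl ((isMaximal_primesAbove 𝔭).eq_of_le (isPrime_primeAt 0).ne_top h)
  · exact Or.inr ((isMaximal_primesAbove 𝔭).eq_of_le (isPrime_primeAt 1).ne_top h)

lemma norm_emb_le_of_mem_span {x : 𝓞 K} (hx : x ∈ Ideal.span {(p : 𝓞 K)}) (s : Fin 2) :
    ‖emb σ (x : K) s‖ ≤ ‖(p : ℂ_[p])‖ := by
  obtain ⟨y, rfl⟩ := Ideal.mem_span_singleton'.mp hx
  have e : ((y * p : 𝓞 K) : K) = y * p :=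
    (map_mul (algebraMap (𝓞 K) K) y p).trans (by rw [map_natCast])
  rw [e, map_mul, Pi.mul_apply, norm_mul, map_natCast, Pi.natCast_apply]
  exact mul_le_of_le_one_left (norm_nonneg _) (norm_le_one_of_integral σ y s)

lemma span_natCast_ne_zero : Ideal.span {(p : 𝓞 K)} ≠ 0 := by
  rw [Ne, Ideal.zero_eq_bot, Ideal.span_singleton_eq_bot]
  exact Nat.cast_ne_zero.mpr (Fact.out : p.Prime).ne_zero

/-- If `𝔭` is the only prime above `p`, then `(p) = 𝔭 ^ e`. -/
lemma pow_ramificationIdx_eq (𝔭 : PrimesAbove K p) (h : ∀ 𝔮 : PrimesAbove K p, 𝔮 = 𝔭) :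
    (𝔭 : Ideal (𝓞 K)) ^ (𝔭 : Ideal (𝓞 K)).ramificationIdx ℤ = Ideal.span {(p : 𝓞 K)} := by
  classical
  have hp0 : (Ideal.span {(p : ℤ)}).map (algebraMap ℤ (𝓞 K)) = Ideal.span {(p : 𝓞 K)} := by
    rw [Ideal.map_span, Set.image_singleton]; simp
  have hne : (Ideal.span {(p : ℤ)}).map (algebraMap ℤ (𝓞 K)) ≠ ⊥ := by
    rw [hp0]; exact span_natCast_ne_zero
  have := 𝔭.2.1
  have := 𝔭.2.2
  rw [Ideal.IsDedekindDomain.ramificationIdx_eq_normalizedFactors_count (Ideal.span {(p : ℤ)}) _ hne]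
  have hrep : UniqueFactorizationMonoid.normalizedFactors
      ((Ideal.span {(p : ℤ)}).map (algebraMap ℤ (𝓞 K))) =
      Multiset.replicate (Multiset.card (UniqueFactorizationMonoid.normalizedFactors
        ((Ideal.span {(p : ℤ)}).map (algebraMap ℤ (𝓞 K))))) (𝔭 : Ideal (𝓞 K)) := by
    refine Multiset.eq_replicate_card.mpr fun 𝔮 h𝔮 => ?_
    have hq := UniqueFactorizationMonoid.prime_of_normalized_factor _ h𝔮
    have hqp : 𝔮.IsPrime := Ideal.isPrime_of_prime hq
    have hle := Ideal.le_of_dvd (UniqueFactorizationMonoid.dvd_of_mem_normalizedFactors h𝔮)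
    have hmem : 𝔮 ∈ PrimesAbove K p := by
      refine ⟨hqp, ⟨?_⟩⟩
      have hpp : Prime (p : ℤ) := Nat.prime_iff_prime_int.mp Fact.out
      have hmax : (Ideal.span {(p : ℤ)}).IsMaximal :=
        PrincipalIdealRing.isMaximal_of_irreducible hpp.irreducible
      exact hmax.eq_of_le (Ideal.IsPrime.ne_top inferInstance) (Ideal.map_le_iff_le_comap.mp hle)
    exact congrArg Subtype.val (h ⟨𝔮, hmem⟩)
  have hprod := Ideal.prod_normalizedFactors_eq_self hne
  rw [hrep, Multiset.prod_replicate] at hprod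
  rw [hrep, Multiset.count_replicate_self, hprod, hp0]

lemma isCoprime_primeAt (hne : primeAt σ 0 ≠ primeAt σ 1) :
    IsCoprime (primeAt σ 0) (primeAt σ 1) := by
  have := isMaximal_primesAbove ⟨_, primeAt_mem (σ := σ) 0⟩
  have := isMaximal_primesAbove ⟨_, primeAt_mem (σ := σ) 1⟩
  exact Ideal.isCoprime_of_isMaximal hne

/-- If there are two primes above `p`, then their product is `(p)`. -/
lemma primeAt_mul_primeAt (hK : Module.finrank ℚ K = 2) (hne : primeAt σ 0 ≠ primeAt σ 1) :
    primeAt σ 0 * primeAt σ 1 = Ideal.span {(p : 𝓞 K)} := by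
  have hp : p.Prime := Fact.out
  have hnp : ∀ s, Ideal.absNorm (primeAt σ s) ≠ 1 := fun s h =>
    (isPrime_primeAt s).ne_top (Ideal.absNorm_eq_one_iff.mp h)
  have hcop := isCoprime_primeAt hne
  have hle : Ideal.span {(p : 𝓞 K)} ≤ primeAt σ 0 * primeAt σ 1 := by
    rw [Ideal.mul_eq_inf_of_isCoprime hcop]
    exact le_inf ((Ideal.span_singleton_le_iff_mem _).mpr (natCast_mem_primeAt 0))
      ((Ideal.span_singleton_le_iff_mem _).mpr (natCast_mem_primeAt 1))
  obtain ⟨J, hJ⟩ := Ideal.dvd_iff_le.mpr hle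
  have hnorm : Ideal.absNorm (Ideal.span {(p : 𝓞 K)}) = p ^ 2 := by
    rw [Ideal.absNorm_span_natCast, RingOfIntegers.rank, hK]
  have h1 := congrArg Ideal.absNorm hJ
  rw [map_mul, map_mul, hnorm] at h1
  -- Both factors have norm divisible by `p`, while `(p)` has norm `p ^ 2`; this leaves no room for
  -- the cofactor `J`.
  have hd : ∀ s, p ∣ Ideal.absNorm (primeAt σ s) := fun s => by
    have h2 : Ideal.absNorm (primeAt σ s) ∣ p ^ 2 := by
      rw [h1]
      fin_cases s
      · exact dvd_mul_of_dvd_left (dvd_mul_right _ _) _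
      · exact dvd_mul_of_dvd_left (dvd_mul_left _ _) _
    obtain ⟨m, -, hm⟩ := (Nat.dvd_prime_pow hp).mp h2
    have hm0 : m ≠ 0 := fun h => hnp s (by rw [hm, h, pow_zero])
    rw [hm]
    exact dvd_pow_self p hm0
  obtain ⟨a, ha⟩ := hd 0
  obtain ⟨b, hb⟩ := hd 1
  rw [ha, hb] at h1
  have h3 : 1 = a * b * Ideal.absNorm J := by
    refine Nat.eq_of_mul_eq_mul_left (pow_pos hp.pos 2) ?_
    linarith
  have hJ1 : J = ⊤ := Ideal.absNorm_eq_one_iff.mp (Nat.eq_one_of_mul_eq_one_left h3.symm)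
  rw [hJ, hJ1, Ideal.mul_top]

lemma exists_add_eq_one (hne : primeAt σ 0 ≠ primeAt σ 1) (n : ℕ) :
    ∃ x ∈ primeAt σ 0 ^ n, ∃ y ∈ primeAt σ 1 ^ n, x + y = 1 := by
  have hcop := isCoprime_primeAt hne
  exact Ideal.isCoprime_iff_exists.mp (hcop.pow (m := n) (n := n))

lemma norm_emb_eq_one_of_add {s : Fin 2} {x y : 𝓞 K} (hx : x ∈ primeAt σ s) (h : x + y = 1) :
    ‖emb σ (y : K) s‖ = 1 := by
  refine le_antisymm (norm_le_one_of_integral σ y s) (not_lt.mp fun hy => ?_)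
  have h1 : (1 : 𝓞 K) ∈ primeAt σ s := h ▸ add_mem hx (mem_primeAt.mpr hy)
  exact (isPrime_primeAt s).ne_top ((Ideal.eq_top_iff_one _).mpr h1)

/-- A suitable element of the other prime is a unit at `σ_s`, and multiplying by it puts `x` into
`(p)` without changing its absolute value at `σ_s`. -/
lemma norm_emb_le_of_mem_primeAt (hK : Module.finrank ℚ K = 2)
    (hne : primeAt σ 0 ≠ primeAt σ 1) (s : Fin 2) {x : 𝓞 K} (hx : x ∈ primeAt σ s) :
    ‖emb σ (x : K) s‖ ≤ ‖(p : ℂ_[p])‖ := by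
  obtain ⟨a, ha, b, hb, hab⟩ := exists_add_eq_one hne 1
  rw [pow_one] at ha hb
  obtain ⟨y, hy1, hy⟩ : ∃ y : 𝓞 K, ‖emb σ (y : K) s‖ = 1 ∧ x * y ∈ Ideal.span {(p : 𝓞 K)} := by
    fin_cases s
    · exact ⟨b, norm_emb_eq_one_of_add ha hab,
        primeAt_mul_primeAt hK hne ▸ Ideal.mul_mem_mul hx hb⟩
    · exact ⟨a, norm_emb_eq_one_of_add hb ((add_comm b a).trans hab),
        primeAt_mul_primeAt hK hne ▸ mul_comm x a ▸ Ideal.mul_mem_mul ha hx⟩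
  have h1 := norm_emb_le_of_mem_span (σ := σ) hy s
  have e : ((x * y : 𝓞 K) : K) = x * y := map_mul (algebraMap (𝓞 K) K) x y
  rwa [e, map_mul, Pi.mul_apply, norm_mul, hy1, mul_one] at h1

lemma mem_OKp_of_near {z : Fin 2 → ℂ_[p]}
    (h : ∀ n : ℕ, ∃ x : 𝓞 K, ∀ i, ‖emb σ (x : K) i - z i‖ ≤ ‖(p : ℂ_[p])‖ ^ n) : z ∈ OKp σ := by
  choose x hx using h
  refine (isClosed_OKp σ).mem_of_tendsto (f := fun n => emb σ (x n : K)) (b := Filter.atTop) ?_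
    (Filter.Eventually.of_forall fun n => emb_mem_OKp σ (x n))
  rw [tendsto_pi_nhds]
  intro i
  rw [tendsto_iff_norm_sub_tendsto_zero]
  exact squeeze_zero (fun _ => norm_nonneg _) (fun n => hx n i)
    (tendsto_pow_atTop_nhds_zero_of_lt_one (norm_nonneg _) norm_p_lt_one)

/-- For split `p`, the Chinese remainder theorem modulo `n`-th powers of the two primes gives
algebraic integers converging to the idempotent; hence the coordinates separate. -/
lemma single_mem_OKp (hK : Module.finrank ℚ K = 2) (hne : primeAt σ 0 ≠ primeAt σ 1)
    (s : Fin 2) : Pi.single s 1 ∈ OKp σ := by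
  have key : ∀ s : Fin 2, ∀ n {x : 𝓞 K}, x ∈ primeAt σ s ^ n →
      ‖emb σ (x : K) s‖ ≤ ‖(p : ℂ_[p])‖ ^ n := fun s n x hx =>
    norm_emb_le_of_mem_pow (norm_nonneg _) (fun y hy => norm_emb_le_of_mem_primeAt hK hne s hy) n hx
  have hadd : ∀ {x y : 𝓞 K}, x + y = 1 → ∀ s, emb σ (y : K) s - 1 = -emb σ (x : K) s :=
    fun {x y} h s => by
      have := congrArg (fun a : 𝓞 K => emb σ (a : K) s) h
      simp only [map_add, map_one, Pi.add_apply, Pi.one_apply] at this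
      rw [← this]; ring
  refine mem_OKp_of_near fun n => ?_
  obtain ⟨x, hx, y, hy, hxy⟩ := exists_add_eq_one hne n
  fin_cases s
  · refine ⟨y, fun i => ?_⟩
    fin_cases i
    · have := hadd hxy 0
      simpa [this] using key 0 n hx
    · simpa using key 1 n hy
  · refine ⟨x, fun i => ?_⟩
    fin_cases i
    · simpa using key 0 n hx
    · have := hadd ((add_comm y x).trans hxy) 1
      simpa [this] using key 1 n hy

lemma norm_p_eq : ‖(p : ℂ_[p])‖ = (p : ℝ)⁻¹ := by
  have h := PadicComplex.norm_extends' p (p : ℚ_[p])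
  have h2 : (((p : ℚ_[p]) : PadicAlgCl p) : ℂ_[p]) = (p : ℂ_[p]) := by simp
  have h3 : ‖(p : ℂ_[p])‖ = ‖(p : ℚ_[p])‖ := by
    rw [← h]; congr 1; exact h2.symm
  rw [h3, Padic.norm_p]

lemma rpow_lt_norm_of_vp_lt {x : L} (hx : x ≠ 0) {c : ℝ} (h : vp p x < c) :
    ‖(p : ℂ_[p])‖ ^ c < ‖algebraMap L ℂ_[p] x‖ := by
  have hp1 : (1 : ℝ) < p := by exact_mod_cast (Fact.out : p.Prime).one_lt
  have hx0 : 0 < ‖algebraMap L ℂ_[p] x‖ := norm_pos_iff.mpr (by simpa using hx)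
  rw [vp, neg_lt, Real.lt_logb_iff_rpow_lt hp1 hx0] at h
  rwa [norm_p_eq, Real.inv_rpow (by positivity), ← Real.rpow_neg (by positivity)]

/-- An imaginary quadratic field has a single infinite place, so its unit rank is `0` and all units
are roots of unity. -/
lemma finite_units (hK : Module.finrank ℚ K = 2) (hK' : NumberField.IsTotallyComplex K) :
    Finite (𝓞 K)ˣ := by
  have h0 : NumberField.Units.rank K = 0 := by
    have h1 := NumberField.IsTotallyComplex.finrank K
    have h2 := NumberField.InfinitePlace.card_eq_nrRealPlaces_add_nrComplexPlaces K
    rw [NumberField.IsTotallyComplex.nrRealPlaces_eq_zero] at h2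
    rw [NumberField.Units.rank]
    omega
  refine Finite.of_surjective (fun ζ : NumberField.Units.torsion K => (ζ : (𝓞 K)ˣ)) fun x => ?_
  obtain ⟨ζe, h, -⟩ := NumberField.Units.exist_unique_eq_mul_prod K x
  have : IsEmpty (Fin (NumberField.Units.rank K)) := by rw [h0]; infer_instance
  exact ⟨ζe.1, by simpa using h.symm⟩

end Primes

/-! ### A Euclidean descent on determinants -/

section Connectivity

variable {K : Type*} [Field K] [NumberField K]

/-- Simultaneous approximation of pairs of elements of `K` by algebraic integers, with bounded
denominators. -/
lemma exists_approx_pair (K : Type*) [Field K] [NumberField K] :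
    ∃ M : ℤ, M ≠ 0 ∧ ∀ (a : Fin 2 → 𝓞 K) (b : ℤ), b ≠ 0 → ∃ n : ℤ, n ∣ M ∧ ∃ q : Fin 2 → 𝓞 K,
      ∀ s, |Algebra.norm ℤ (n • a s - b • q s)| < |Algebra.norm ℤ (algebraMap ℤ (𝓞 K) b)| := by
  classical
  set bS := RingOfIntegers.basis K with hbS
  set ι := Module.Free.ChooseBasisIndex ℤ (𝓞 K) with hι
  set abv : AbsoluteValue ℤ ℤ := AbsoluteValue.abs with habv
  have adm : abv.IsAdmissible := AbsoluteValue.absIsAdmissible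
  have hpos := ClassGroup.normBound_pos abv bS
  have dim_pos : 0 < Fintype.card ι := Fintype.card_pos_iff.mpr bS.index_nonempty
  -- Chosen so that coordinates of absolute value below `|b| ε` force a norm below that of `b`.
  set ε : ℝ := (ClassGroup.normBound abv bS : ℝ) ^ (-1 / Fintype.card ι : ℝ) with hε
  have hε0 : 0 < ε := Real.rpow_pos_of_pos (Int.cast_pos.mpr hpos) _
  -- `m` counts the boxes for the coordinates of both components together. Among the `m + 1`
  -- multiples by `0, …, m` two fall into the same box modulo `b`, and their multipliers differ by a
  -- number of absolute value at most `m`, which divides `m!`.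
  set m := adm.card ε ^ Fintype.card (Fin 2 × ι) with hm
  refine ⟨(m.factorial : ℤ), by exact_mod_cast m.factorial_ne_zero, fun a b hb => ?_⟩
  have ε_le : (ClassGroup.normBound abv bS : ℝ) * (abv b • ε) ^ Fintype.card ι
      ≤ ((|b| ^ Fintype.card ι : ℤ) : ℝ) := by
    have e : ε ^ Fintype.card ι = (ClassGroup.normBound abv bS : ℝ)⁻¹ := by
      rw [hε, ← Real.rpow_natCast, ← Real.rpow_mul (Int.cast_pos.mpr hpos).le,
        div_mul_cancel₀ _ (by exact_mod_cast dim_pos.ne'), Real.rpow_neg_one]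
    rw [Algebra.smul_def, mul_pow, e]
    have h0 : (ClassGroup.normBound abv bS : ℝ) ≠ 0 := by exact_mod_cast hpos.ne'
    apply le_of_eq
    field_simp
    simp [habv]
  obtain ⟨j, k, hjk, h⟩ := adm.exists_approx hε0 hb
    fun (j : Fin m.succ) (x : Fin 2 × ι) => ((j : ℕ) : ℤ) * bS.repr (a x.1) x.2
  refine ⟨((k : ℕ) : ℤ) - ((j : ℕ) : ℤ), ?_, fun s => ∑ i, ((((k : ℕ) : ℤ) * bS.repr (a s) i) / b -
    (((j : ℕ) : ℤ) * bS.repr (a s) i) / b) • bS i, fun s => ?_⟩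
  · have h1 : (((k : ℕ) : ℤ) - ((j : ℕ) : ℤ)).natAbs ∣ m.factorial := by
      apply Nat.dvd_factorial
      · have : (j : ℕ) ≠ k := fun h => hjk (Fin.ext h)
        omega
      · have := j.2
        have := k.2
        omega
    exact Int.natAbs_dvd.mp (Int.natCast_dvd_natCast.mpr h1)
  · have e : (((k : ℕ) : ℤ) - ((j : ℕ) : ℤ)) • a s - b • ∑ i, ((((k : ℕ) : ℤ) * bS.repr (a s) i) / b -
        (((j : ℕ) : ℤ) * bS.repr (a s) i) / b) • bS i =
        ∑ i, ((((k : ℕ) : ℤ) * bS.repr (a s) i) % b - (((j : ℕ) : ℤ) * bS.repr (a s) i) % b) •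
          bS i := by
      conv_lhs => rw [← bS.sum_repr (a s)]
      rw [Finset.smul_sum, Finset.smul_sum, ← Finset.sum_sub_distrib]
      refine Finset.sum_congr rfl fun i _ => ?_
      rw [bS.sum_repr, smul_smul, smul_smul, ← sub_smul]
      congr 1
      have h1 := Int.emod_add_mul_ediv (((k : ℕ) : ℤ) * bS.repr (a s) i) b
      have h2 := Int.emod_add_mul_ediv (((j : ℕ) : ℤ) * bS.repr (a s) i) b
      linear_combination h2 - h1
    rw [e, Algebra.norm_algebraMap_of_basis bS, abs_pow]
    have h3 := ClassGroup.norm_lt abv bS (T := ℝ) (y := abv b • ε)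
      (∑ i, ((((k : ℕ) : ℤ) * bS.repr (a s) i) % b - (((j : ℕ) : ℤ) * bS.repr (a s) i) % b) •
          bS i) fun i => by
        rw [bS.repr_sum_self]
        exact h (s, i)
    exact_mod_cast h3.trans_le ε_le

/-- The determinant of the matrix with columns `u` and `v`. -/
def cross {R : Type*} [CommRing R] (u v : Fin 2 → R) : R := u 0 * v 1 - u 1 * v 0

lemma cross_trans {R : Type*} [CommRing R] [IsDomain R] {u v w : Fin 2 → R} (hv : v ≠ 0)
    (h1 : cross u v = 0) (h2 : cross v w = 0) : cross u w = 0 := by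
  have : v 0 ≠ 0 ∨ v 1 ≠ 0 := by
    by_contra! h
    exact hv (funext fun i => by fin_cases i <;> simp [h.1, h.2])
  simp only [cross] at *
  rcases this with h | h <;> refine (mul_eq_zero.mp ?_).resolve_left h
  · linear_combination w 0 * h1 + u 0 * h2
  · linear_combination w 1 * h1 + u 1 * h2

lemma cross_comm {R : Type*} [CommRing R] (u v : Fin 2 → R) : cross v u = -cross u v := by
  simp only [cross]; ring

/-- Any two vectors are linked by a chain of pairs of vectors whose determinant divides a fixed
non-zero element. -/
lemma exists_forall_of_cross_dvd (K : Type*) [Field K] [NumberField K] :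
    ∃ N₀ : 𝓞 K, N₀ ≠ 0 ∧ ∀ r : (Fin 2 → 𝓞 K) → (Fin 2 → 𝓞 K) → Prop,
      (∀ u v w, v ≠ 0 → r u v → r v w → r u w) →
      (∀ u v, u ≠ 0 → v ≠ 0 → cross u v = 0 → r u v) →
      (∀ u v, cross u v ≠ 0 → cross u v ∣ N₀ → r u v) → ∀ u v, u ≠ 0 → v ≠ 0 → r u v := by
  obtain ⟨M, hM, happ⟩ := exists_approx_pair K
  refine ⟨(M : 𝓞 K) * M, by simpa using hM, fun r htr hpar hdvd => ?_⟩
  -- Descent on the absolute norm of the determinant: a non-zero `w` is inserted between `u` and `v`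
  -- so that both new determinants have smaller norm.
  suffices H : ∀ (n : ℕ) u v, u ≠ 0 → v ≠ 0 → (Algebra.norm ℤ (cross u v)).natAbs = n → r u v from
    fun u v hu hv => H _ u v hu hv rfl
  intro n
  induction n using Nat.strong_induction_on with
  | _ n ih =>
  intro u v hu hv hn
  by_cases h0 : cross u v = 0
  · exact hpar u v hu hv h0
  by_cases hd : cross u v ∣ (M : 𝓞 K) * M
  · exact hdvd u v h0 hd
  -- If the lattice spanned by `u` and `v` contained `M` times both standard vectors, taking
  -- determinants would show that `cross u v` divides `M ^ 2`.
  obtain ⟨w₀, hw₀⟩ : ∃ w₀ : Fin 2 → 𝓞 K, ¬ ∃ x y : 𝓞 K, (M : 𝓞 K) • w₀ = x • u + y • v := by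
    by_contra! h
    obtain ⟨x, y, h1⟩ := h ![1, 0]
    obtain ⟨x', y', h2⟩ := h ![0, 1]
    apply hd
    have a1 := congrFun h1 0
    have a2 := congrFun h1 1
    have b1 := congrFun h2 0
    have b2 := congrFun h2 1
    simp at a1 a2 b1 b2
    refine ⟨x * y' - y * x', ?_⟩
    simp only [cross]
    linear_combination (M : 𝓞 K) * a1 + (x * u 0 + y * v 0) * b2 - (x' * u 0 + y' * v 0) * a2
  obtain ⟨D, hD, δ', hδ⟩ : ∃ D : ℤ, D ≠ 0 ∧ ∃ δ', (D : 𝓞 K) = cross u v * δ' := by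
    refine ⟨Ideal.absNorm (Ideal.span {cross u v}), ?_, ?_⟩
    · simpa [Ideal.absNorm_eq_zero_iff, Ideal.span_singleton_eq_bot] using h0
    · have := Ideal.absNorm_mem (Ideal.span {cross u v})
      rw [Ideal.mem_span_singleton] at this
      exact_mod_cast this
  -- By Cramer's rule these two elements, divided by the integer `D = δ' * cross u v`, are the
  -- coordinates of `w₀` in terms of `u` and `v`. As `k` divides `M`, the vector `w` below cannot
  -- vanish, by the choice of `w₀`.
  obtain ⟨k, ⟨t, ht⟩, q, hq⟩ := happ ![δ' * cross w₀ v, δ' * cross u w₀] D hD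
  set w : Fin 2 → 𝓞 K := (k : 𝓞 K) • w₀ - q 0 • u - q 1 • v with hw
  have hδ0 : δ' ≠ 0 := by
    rintro rfl
    rw [mul_zero] at hδ
    exact hD (by exact_mod_cast hδ)
  have hw0 : w ≠ 0 := by
    intro h
    refine hw₀ ⟨t * q 0, t * q 1, ?_⟩
    have e : (M : 𝓞 K) = t * k := by rw [ht]; push_cast; ring
    have e2 : (k : 𝓞 K) • w₀ = q 0 • u + q 1 • v := by
      rw [← sub_eq_zero, ← h, hw]; abel
    rw [e, mul_smul, e2, smul_add, smul_smul, smul_smul]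
  have small : ∀ x : 𝓞 K, |Algebra.norm ℤ (δ' * x)| < |Algebra.norm ℤ (algebraMap ℤ (𝓞 K) D)| →
      (Algebra.norm ℤ x).natAbs < n := by
    intro x hx
    have e : algebraMap ℤ (𝓞 K) D = δ' * cross u v := by
      rw [eq_intCast, hδ, mul_comm]
    rw [e, map_mul, map_mul, abs_mul, abs_mul] at hx
    have h1 := lt_of_mul_lt_mul_left hx (abs_nonneg _)
    rw [Int.abs_eq_natAbs, Int.abs_eq_natAbs, hn] at h1
    exact_mod_cast h1
  have s0 := hq 0
  have s1 := hq 1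
  simp only [zsmul_eq_mul, Matrix.cons_val_zero, Matrix.cons_val_one] at s0 s1
  have c0 : (Algebra.norm ℤ (cross w v)).natAbs < n := by
    apply small
    convert s0 using 3
    rw [hδ]
    simp only [cross, hw, Pi.sub_apply, Pi.smul_apply, smul_eq_mul]
    ring
  have c1 : (Algebra.norm ℤ (cross u w)).natAbs < n := by
    apply small
    convert s1 using 3
    rw [hδ]
    simp only [cross, hw, Pi.sub_apply, Pi.smul_apply, smul_eq_mul]
    ring
  exact htr u w v hw0 (ih _ c1 u w hu hw0 rfl) (ih _ c0 w v hw0 hv rfl)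

end Connectivity

/-! ### Finite generation of principal congruence subgroups -/

section Generation

variable {K : Type*} [Field K] [NumberField K]

/-- The principal congruence subgroup of level `N` of `SL₂(𝓞_K)`. -/
def principalCongr (N : 𝓞 K) : Subgroup (Matrix.SpecialLinearGroup (Fin 2) (𝓞 K)) :=
  (Matrix.SpecialLinearGroup.map (Ideal.Quotient.mk (Ideal.span {N}))).ker

lemma mem_principalCongr {N : 𝓞 K} {γ : Matrix.SpecialLinearGroup (Fin 2) (𝓞 K)} :
    γ ∈ principalCongr N ↔ ∀ i j, N ∣ γ.1 i j - (1 : Matrix (Fin 2) (Fin 2) (𝓞 K)) i j := by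
  rw [principalCongr, MonoidHom.mem_ker, Matrix.SpecialLinearGroup.ext_iff]
  refine forall₂_congr fun i j => ?_
  rw [← Ideal.mem_span_singleton, ← Ideal.Quotient.mk_eq_mk_iff_sub_mem]
  have : (1 : Matrix.SpecialLinearGroup (Fin 2) (𝓞 K ⧸ Ideal.span {N})).1 i j =
      Ideal.Quotient.mk (Ideal.span {N}) ((1 : Matrix (Fin 2) (Fin 2) (𝓞 K)) i j) := by
    rw [Matrix.SpecialLinearGroup.coe_one, Matrix.one_apply, Matrix.one_apply]
    split_ifs <;> simp
  rw [← this]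
  rfl

/-- Finitely many ideals divide `(N₀)`, and each has finitely many generators because the unit group
is finite. -/
lemma finite_setOf_dvd [Finite (𝓞 K)ˣ] {N₀ : 𝓞 K} (h : N₀ ≠ 0) : {d : 𝓞 K | d ∣ N₀}.Finite := by
  have hI : Ideal.span {N₀} ≠ 0 := by simpa [Ideal.span_singleton_eq_bot] using h
  have := UniqueFactorizationMonoid.fintypeSubtypeDvd (Ideal.span {N₀}) hI
  refine Set.Finite.of_finite_fibers (fun d => Ideal.span {d}) ?_ ?_
  · refine (@Set.toFinite _ {I : Ideal (𝓞 K) | I ∣ Ideal.span {N₀}}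
      (@Finite.of_fintype _ this)).subset ?_
    rintro _ ⟨d, hd, rfl⟩
    exact Ideal.dvd_iff_le.mpr (Ideal.span_singleton_le_span_singleton.mpr hd)
  · rintro _ ⟨d, -, rfl⟩
    refine (Set.finite_range fun u : (𝓞 K)ˣ => d * u).subset ?_
    rintro d' ⟨-, h'⟩
    obtain ⟨u, hu⟩ := Ideal.span_singleton_eq_span_singleton.mp (Eq.symm h')
    exact ⟨u, hu⟩

lemma cross_mulVec (γ : Matrix.SpecialLinearGroup (Fin 2) (𝓞 K)) (u v : Fin 2 → 𝓞 K) :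
    cross (γ.1.mulVec u) (γ.1.mulVec v) = cross u v := by
  have h := γ.2
  rw [Matrix.det_fin_two] at h
  simp only [cross, Matrix.mulVec, dotProduct, Fin.sum_univ_two]
  linear_combination (u 0 * v 1 - u 1 * v 0) * h

/-- The matrix carrying one pair to the other is obtained by dividing by the common determinant.
That divides `N₀`, so congruence modulo `N * N₀` leaves congruence to the identity modulo `N`. -/
lemma exists_mulVec_eq {N N₀ : 𝓞 K} {u v u' v' : Fin 2 → 𝓞 K} (h0 : cross u v ≠ 0)
    (hd : cross u v ∣ N₀) (hc : cross u' v' = cross u v) (hu : ∀ i, N * N₀ ∣ u' i - u i)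
    (hv : ∀ i, N * N₀ ∣ v' i - v i) :
    ∃ γ ∈ principalCongr N, u' = γ.1.mulVec u ∧ v' = γ.1.mulVec v := by
  obtain ⟨k, rfl⟩ := hd
  choose x hx using hu
  choose y hy using hv
  set d := cross u v with hd
  set A : Matrix (Fin 2) (Fin 2) (𝓞 K) :=
    !![1 + N * k * (x 0 * v 1 - y 0 * u 1), N * k * (y 0 * u 0 - x 0 * v 0);
      N * k * (x 1 * v 1 - y 1 * u 1), 1 + N * k * (y 1 * u 0 - x 1 * v 0)] with hA
  have h1 : u' = A.mulVec u := by
    funext i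
    have := hx i
    fin_cases i <;> simp [hA, Matrix.mulVec, dotProduct, Fin.sum_univ_two] at * <;>
      simp only [cross] at hd <;> rw [hd] at this <;> linear_combination this
  have h2 : v' = A.mulVec v := by
    funext i
    have := hy i
    fin_cases i <;> simp [hA, Matrix.mulVec, dotProduct, Fin.sum_univ_two] at * <;>
      simp only [cross] at hd <;> rw [hd] at this <;> linear_combination this
  have hdet : A.det = 1 := by
    have e : cross u' v' = A.det * cross u v := by
      rw [h1, h2, Matrix.det_fin_two]
      simp only [cross, Matrix.mulVec, dotProduct, Fin.sum_univ_two]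
      ring
    exact mul_right_cancel₀ h0 ((e.symm.trans hc).trans (one_mul d).symm)
  refine ⟨⟨A, hdet⟩, mem_principalCongr.mpr fun i j => ?_, h1, h2⟩
  fin_cases i <;> fin_cases j <;> simp [hA, mul_assoc]

/-- The determinant and the residues modulo `N * N₀` take finitely many values and, by
`exists_mulVec_eq`, determine the orbit of a pair. -/
lemma exists_finite_pairs [Finite (𝓞 K)ˣ] {N N₀ : 𝓞 K} (hN : N ≠ 0) (hN₀ : N₀ ≠ 0) :
    ∃ S : Set ((Fin 2 → 𝓞 K) × (Fin 2 → 𝓞 K)), S.Finite ∧ (∀ q ∈ S, cross q.1 q.2 ≠ 0) ∧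
      ∀ u v, cross u v ≠ 0 → cross u v ∣ N₀ →
        ∃ γ ∈ principalCongr N, ∃ q ∈ S, u = γ.1.mulVec q.1 ∧ v = γ.1.mulVec q.2 := by
  set X : Set ((Fin 2 → 𝓞 K) × (Fin 2 → 𝓞 K)) :=
    {q | cross q.1 q.2 ≠ 0 ∧ cross q.1 q.2 ∣ N₀} with hX
  set J := Ideal.span {N * N₀} with hJ
  have hJ0 : J ≠ ⊥ := by simp [hJ, hN, hN₀]
  have hfinJ : Finite (𝓞 K ⧸ J) := Ideal.finiteQuotientOfFreeOfNeBot J hJ0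
  set f : (Fin 2 → 𝓞 K) × (Fin 2 → 𝓞 K) →
    𝓞 K × (Fin 2 → 𝓞 K ⧸ J) × (Fin 2 → 𝓞 K ⧸ J) := fun q =>
      (cross q.1 q.2, fun i => Ideal.Quotient.mk J (q.1 i), fun i => Ideal.Quotient.mk J (q.2 i))
    with hf
  have hfin : (f '' X).Finite := by
    refine ((finite_setOf_dvd hN₀).prod (Set.toFinite (Set.univ))).subset ?_
    rintro _ ⟨q, hq, rfl⟩
    exact ⟨hq.2, trivial⟩
  obtain ⟨S, hSX, hS⟩ := (Set.surjOn_image f X).exists_bijOn_subset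
  refine ⟨S, hS.finite_iff_finite.mpr hfin, fun q hq => (hSX hq).1, fun u v h0 hd => ?_⟩
  obtain ⟨q, hq, hqf⟩ := hS.surjOn (⟨(u, v), ⟨h0, hd⟩, rfl⟩ : f (u, v) ∈ f '' X)
  simp only [hf, Prod.mk.injEq] at hqf
  obtain ⟨γ, hγ, h1, h2⟩ := exists_mulVec_eq (N := N) (hSX hq).1 (hSX hq).2 hqf.1.symm
    (fun i => Ideal.mem_span_singleton.mp
      ((Ideal.Quotient.mk_eq_mk_iff_sub_mem _ _).mp (congrFun hqf.2.1 i).symm))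
    (fun i => Ideal.mem_span_singleton.mp
      ((Ideal.Quotient.mk_eq_mk_iff_sub_mem _ _).mp (congrFun hqf.2.2 i).symm))
  exact ⟨γ, hγ, q, hq, h1, h2⟩

lemma Subgroup.fg_of_isNoetherian_int {A : Type*} [AddCommGroup A] [IsNoetherian ℤ A]
    (P : Subgroup (Multiplicative A)) : P.FG := by
  have h : (Subgroup.toAddSubgroup' P).FG := by
    have := (isNoetherian_def.mp (inferInstance : IsNoetherian ℤ A))
      (AddSubgroup.toIntSubmodule (Subgroup.toAddSubgroup' P))
    rw [Submodule.fg_iff_addSubgroup_fg] at this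
    simpa using this
  exact (AddSubgroup.fg_iff_mul_fg _).mp h

lemma entries_of_mulVec_eq_zero {X : Matrix (Fin 2) (Fin 2) (𝓞 K)} {e : Fin 2 → 𝓞 K}
    (h : X.mulVec e = 0) :
    X 0 0 * e 0 + X 0 1 * e 1 = 0 ∧ X 1 0 * e 0 + X 1 1 * e 1 = 0 := by
  have h0 := congrFun h 0
  have h1 := congrFun h 1
  simp only [Matrix.mulVec, dotProduct, Fin.sum_univ_two, Pi.zero_apply] at h0 h1
  exact ⟨h0, h1⟩

/-- A traceless matrix killing `e` has its image on the line of `e`, which `X` kills. It follows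
that `γ ↦ γ - 1` is additive on the stabilizer of `e`. -/
lemma mul_eq_zero_of_mulVec {X Y : Matrix (Fin 2) (Fin 2) (𝓞 K)} {e : Fin 2 → 𝓞 K} (he : e ≠ 0)
    (hX : X.mulVec e = 0) (hY : Y.mulVec e = 0) (hYt : Y 0 0 + Y 1 1 = 0) :
    X * Y = 0 := by
  obtain ⟨x1, x2⟩ := entries_of_mulVec_eq_zero hX
  obtain ⟨y1, y2⟩ := entries_of_mulVec_eq_zero hY
  have : e 0 ≠ 0 ∨ e 1 ≠ 0 := by
    by_contra! h
    exact he (funext fun i => by fin_cases i <;> simp [h.1, h.2])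
  have hd : Y 1 1 = -Y 0 0 := by linear_combination hYt
  rw [hd] at y2
  have key : ∀ i, X i 0 * e 0 + X i 1 * e 1 = 0 := fun i => by fin_cases i <;> assumption
  refine Matrix.ext fun i j => ?_
  have hi := key i
  rw [Matrix.mul_apply, Fin.sum_univ_two, Matrix.zero_apply]
  have cancel : ∀ k, e k ≠ 0 → ∀ t, e k * t = 0 → t = 0 := fun k hk t ht =>
    (mul_eq_zero.mp ht).resolve_left hk
  rcases this with h | h <;> refine cancel _ h _ ?_ <;> fin_cases j <;>
    simp only [Fin.zero_eta, Fin.mk_one, Fin.isValue, hd]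
  · linear_combination Y 0 0 * hi + X i 1 * y2
  · linear_combination Y 0 1 * hi - X i 1 * y1
  · linear_combination Y 1 0 * hi - X i 0 * y2
  · linear_combination -Y 0 0 * hi + X i 0 * y1

/-- A matrix of determinant `1` with eigenvalue `1` has trace `2`. -/
lemma trace_eq_two {γ : Matrix.SpecialLinearGroup (Fin 2) (𝓞 K)} {e : Fin 2 → 𝓞 K} (he : e ≠ 0)
    (h : (γ.1 - 1).mulVec e = 0) : (γ.1 - 1) 0 0 + (γ.1 - 1) 1 1 = 0 := by
  have h1 := Matrix.exists_mulVec_eq_zero_iff.mp ⟨e, he, h⟩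
  have h2 := γ.2
  rw [Matrix.det_fin_two] at h1 h2
  simp at h1 ⊢
  linear_combination h2 - h1

/-- The stabilizer of a non-zero vector in a subgroup of `SL₂(𝓞_K)` is finitely generated. -/
lemma exists_finite_stabilizer (Γ : Subgroup (Matrix.SpecialLinearGroup (Fin 2) (𝓞 K)))
    {e : Fin 2 → 𝓞 K} (he : e ≠ 0) :
    ∃ F : Set (Matrix.SpecialLinearGroup (Fin 2) (𝓞 K)), F.Finite ∧ F ⊆ Γ ∧
      ∀ γ ∈ Γ, γ.1.mulVec e = e → γ ∈ Subgroup.closure F := by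
  let S : Subgroup (Matrix.SpecialLinearGroup (Fin 2) (𝓞 K)) :=
    { carrier := {γ | γ ∈ Γ ∧ γ.1.mulVec e = e}
      one_mem' := ⟨one_mem _, by simp⟩
      mul_mem' := fun {a b} ha hb => ⟨mul_mem ha.1 hb.1, by
        rw [Matrix.SpecialLinearGroup.coe_mul, ← Matrix.mulVec_mulVec, hb.2, ha.2]⟩
      inv_mem' := fun {a} ha => ⟨inv_mem ha.1, by
        conv_lhs => rw [← ha.2]
        rw [Matrix.mulVec_mulVec, ← Matrix.SpecialLinearGroup.coe_mul, inv_mul_cancel]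
        simp⟩ }
  have hS : ∀ γ : S, (γ.1.1 - 1).mulVec e = 0 := fun γ => by
    rw [Matrix.sub_mulVec, γ.2.2, Matrix.one_mulVec, sub_self]
  let f : S →* Multiplicative (Matrix (Fin 2) (Fin 2) (𝓞 K)) :=
    { toFun := fun γ => Multiplicative.ofAdd (γ.1.1 - 1)
      map_one' := by simp
      map_mul' := fun a b => by
        rw [← ofAdd_add]
        congr 1
        have h := mul_eq_zero_of_mulVec he (hS a) (hS b) (trace_eq_two he (hS b))
        have h2 : (a * b).1.1 = a.1.1 * b.1.1 := rfl
        rw [h2, ← sub_eq_zero, ← h]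
        noncomm_ring }
  have hf : Function.Injective f := fun a b hab => by
    have h := Multiplicative.ofAdd.injective hab
    exact Subtype.ext (Subtype.ext (sub_left_injective h))
  have hfg : Group.FG f.range :=
    (Group.fg_iff_subgroup_fg _).mpr (Subgroup.fg_of_isNoetherian_int _)
  have hSfg : Group.FG S :=
    Group.fg_of_surjective (f := (MonoidHom.ofInjective hf).symm.toMonoidHom)
      (MonoidHom.ofInjective hf).symm.surjective
  obtain ⟨F, hF⟩ := (Group.fg_iff_subgroup_fg S).mp hSfg
  refine ⟨F, F.finite_toSet, fun γ hγ => ?_, fun γ h1 h2 => ?_⟩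
  · have : γ ∈ S := hF ▸ Subgroup.subset_closure hγ
    exact this.1
  · rw [hF]
    exact ⟨h1, h2⟩

/-- The quotient `b / a` is a root of the monic polynomial `X² - tX + 1`, and `𝓞_K` is integrally
closed. -/
lemma dvd_of_quadratic {a b t : 𝓞 K} (ha : a ≠ 0) (h : b * b = a * (t * b - a)) : a ∣ b := by
  have ha' : (a : K) ≠ 0 := fun h => ha (RingOfIntegers.coe_eq_zero_iff.mp h)
  have hint : IsIntegral (𝓞 K) ((b : K) / a) := by
    refine ⟨Polynomial.X ^ 2 - Polynomial.C t * Polynomial.X + 1, by monicity!, ?_⟩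
    have h' := congrArg (algebraMap (𝓞 K) K) h
    rw [map_mul, map_mul, map_sub, map_mul] at h'
    simp only [Polynomial.eval₂_add, Polynomial.eval₂_sub, Polynomial.eval₂_mul,
      Polynomial.eval₂_pow, Polynomial.eval₂_X, Polynomial.eval₂_C, Polynomial.eval₂_one]
    field_simp
    linear_combination h'
  obtain ⟨c, hc⟩ := IsIntegrallyClosed.isIntegral_iff.mp hint
  refine ⟨c, RingOfIntegers.coe_injective ?_⟩
  rw [map_mul, hc]
  field_simp

lemma ne_zero_or_ne_zero {e : Fin 2 → 𝓞 K} (he : e ≠ 0) : ∃ i, e i ≠ 0 := by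
  by_contra! h
  exact he (funext h)

/-- The eigenvalue on the line of `e` is a root of the characteristic polynomial, with constant term
`1`. It is therefore a unit of `𝓞_K` even if `e` is not a unimodular vector. -/
lemma exists_unit_of_cross_eq_zero {γ : Matrix.SpecialLinearGroup (Fin 2) (𝓞 K)}
    {e : Fin 2 → 𝓞 K} (he : e ≠ 0) (h : cross (γ.1.mulVec e) e = 0) :
    ∃ χ : (𝓞 K)ˣ, γ.1.mulVec e = (χ : 𝓞 K) • e := by
  obtain ⟨i, hi⟩ := ne_zero_or_ne_zero he
  set w := γ.1.mulVec e with hw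
  have hdet := γ.2
  rw [Matrix.det_fin_two] at hdet
  have w0 : w 0 = γ.1 0 0 * e 0 + γ.1 0 1 * e 1 := by
    simp only [hw, Matrix.mulVec, dotProduct, Fin.sum_univ_two]
  have w1 : w 1 = γ.1 1 0 * e 0 + γ.1 1 1 * e 1 := by
    simp only [hw, Matrix.mulVec, dotProduct, Fin.sum_univ_two]
  have par : ∀ j k, e j * w k = w j * e k := by
    simp only [cross] at h
    intro j k
    fin_cases j <;> fin_cases k <;> simp only [Fin.zero_eta, Fin.mk_one, Fin.isValue]
    · ring
    · linear_combination -h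
    · linear_combination h
    · ring
  have hq : ∀ j, w j * w j = e j * ((γ.1 0 0 + γ.1 1 1) * w j - e j) := by
    have p01 := par 0 1
    intro j
    fin_cases j <;> simp only [Fin.zero_eta, Fin.mk_one, Fin.isValue]
    · linear_combination w 0 * w0 - γ.1 0 1 * p01 + γ.1 0 1 * e 0 * w1 - γ.1 1 1 * e 0 * w0 -
        e 0 * e 0 * hdet
    · linear_combination w 1 * w1 + γ.1 1 0 * p01 + γ.1 1 0 * e 1 * w0 - γ.1 0 0 * e 1 * w1 -
        e 1 * e 1 * hdet
  obtain ⟨c, hc⟩ := dvd_of_quadratic hi (hq i)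
  have hu : c * (γ.1 0 0 + γ.1 1 1 - c) = 1 := by
    have := hq i
    rw [hc] at this
    refine mul_left_cancel₀ (mul_ne_zero hi hi) ?_
    linear_combination -this
  refine ⟨Units.mkOfMulEqOne _ _ hu, funext fun k => ?_⟩
  have := par i k
  rw [hc] at this
  refine mul_left_cancel₀ hi ?_
  simp only [Pi.smul_apply, smul_eq_mul, Units.val_mkOfMulEqOne]
  linear_combination this

lemma mulVec_mul (γ δ : Matrix.SpecialLinearGroup (Fin 2) (𝓞 K)) (v : Fin 2 → 𝓞 K) :
    (γ * δ).1.mulVec v = γ.1.mulVec (δ.1.mulVec v) := by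
  rw [Matrix.mulVec_mulVec]; rfl

lemma inv_mulVec_eq {γ : Matrix.SpecialLinearGroup (Fin 2) (𝓞 K)} {u v : Fin 2 → 𝓞 K}
    (h : γ.1.mulVec u = v) : γ⁻¹.1.mulVec v = u := by
  rw [← h, ← mulVec_mul, inv_mul_cancel]
  exact Matrix.one_mulVec u

lemma mulVec_ne_zero (γ : Matrix.SpecialLinearGroup (Fin 2) (𝓞 K)) {v : Fin 2 → 𝓞 K}
    (h : v ≠ 0) : γ.1.mulVec v ≠ 0 := fun h0 => h (by
  rw [← inv_mulVec_eq h0, Matrix.mulVec_zero])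

/-- The elements carrying the line of `e'` to that of `e` form one coset of the stabilizer of the
line of `e`. The vector `e` itself is only scaled by one of finitely many units, so the stabilizer
of the vector has finite index in that of the line. -/
lemma exists_finite_closure [Finite (𝓞 K)ˣ]
    (Γ : Subgroup (Matrix.SpecialLinearGroup (Fin 2) (𝓞 K))) {e e' : Fin 2 → 𝓞 K} (he : e ≠ 0)
    (he' : e' ≠ 0) :
    ∃ F : Set (Matrix.SpecialLinearGroup (Fin 2) (𝓞 K)), F.Finite ∧ F ⊆ Γ ∧
      ∀ γ ∈ Γ, cross (γ.1.mulVec e') e = 0 → γ ∈ Subgroup.closure F := by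
  by_cases h0 : ∃ γ₀ ∈ Γ, cross (γ₀.1.mulVec e') e = 0
  swap
  · exact ⟨∅, Set.finite_empty, Set.empty_subset _, fun γ hγ h => (h0 ⟨γ, hγ, h⟩).elim⟩
  obtain ⟨γ₀, hγ₀, h0⟩ := h0
  obtain ⟨F, hF, hFΓ, hFc⟩ := exists_finite_stabilizer Γ he
  have hc : ∀ χ : (𝓞 K)ˣ, ∃ c ∈ Γ, (∃ γ ∈ Γ, γ.1.mulVec e = (χ : 𝓞 K) • e) →
      c.1.mulVec e = (χ : 𝓞 K) • e := fun χ => by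
    by_cases h : ∃ γ ∈ Γ, γ.1.mulVec e = (χ : 𝓞 K) • e
    · obtain ⟨γ, h1, h2⟩ := h
      exact ⟨γ, h1, fun _ => h2⟩
    · exact ⟨1, one_mem _, fun h' => (h h').elim⟩
  choose c hcΓ hce using hc
  refine ⟨insert γ₀ (F ∪ Set.range c), (hF.union (Set.finite_range c)).insert γ₀, ?_,
    fun γ hγ h => ?_⟩
  · rintro x (rfl | hx | ⟨χ, rfl⟩)
    exacts [hγ₀, hFΓ hx, hcΓ χ]
  · have e1 : (γ * γ₀⁻¹).1.mulVec (γ₀.1.mulVec e') = γ.1.mulVec e' := by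
      rw [← mulVec_mul, inv_mul_cancel_right]
    have e2 : cross (γ.1.mulVec e') ((γ * γ₀⁻¹).1.mulVec e) = 0 := by
      rw [← e1, cross_mulVec, h0]
    have e3 : cross ((γ * γ₀⁻¹).1.mulVec e) e = 0 :=
      cross_trans (mulVec_ne_zero γ he') (by rw [cross_comm, e2, neg_zero]) h
    obtain ⟨χ, hχ⟩ := exists_unit_of_cross_eq_zero he e3
    have hmem : γ * γ₀⁻¹ ∈ Γ := mul_mem hγ (inv_mem hγ₀)
    have e4 : (c χ).1.mulVec e = (χ : 𝓞 K) • e := hce χ ⟨_, hmem, hχ⟩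
    have e5 := hFc ((c χ)⁻¹ * (γ * γ₀⁻¹)) (mul_mem (inv_mem (hcΓ χ)) hmem)
      (by rw [mulVec_mul, hχ, inv_mulVec_eq e4])
    have e6 : γ = c χ * ((c χ)⁻¹ * (γ * γ₀⁻¹)) * γ₀ := by group
    rw [e6]
    refine mul_mem (mul_mem (Subgroup.subset_closure ?_) (Subgroup.closure_mono ?_ e5))
      (Subgroup.subset_closure ?_)
    · exact Or.inr (Or.inr ⟨χ, rfl⟩)
    · exact fun x hx => Or.inr (Or.inl hx)
    · exact Or.inl rfl

/-- The principal congruence subgroups are finitely generated and have finitely many orbits on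
`ℙ¹(K)`. -/
lemma exists_finite_generators [Finite (𝓞 K)ˣ] {N : 𝓞 K} (hN : N ≠ 0) :
    ∃ P : Set (Fin 2 → 𝓞 K), P.Finite ∧
      (∀ v ≠ 0, ∃ γ ∈ principalCongr N, ∃ e ∈ P, cross v (γ.1.mulVec e) = 0) ∧
      (∀ e ∈ P, e ≠ 0) ∧
      ∃ F : Set (Matrix.SpecialLinearGroup (Fin 2) (𝓞 K)), F.Finite ∧ F ⊆ principalCongr N ∧
        ∀ γ ∈ principalCongr N, γ ∈ Subgroup.closure F := by
  obtain ⟨N₀, hN₀, hconn⟩ := exists_forall_of_cross_dvd K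
  obtain ⟨S, hS, hS0, hSc⟩ := exists_finite_pairs hN hN₀
  set P : Set (Fin 2 → 𝓞 K) := Prod.fst '' S ∪ Prod.snd '' S with hP
  have hPf : P.Finite := (hS.image _).union (hS.image _)
  have hP0 : ∀ e ∈ P, e ≠ 0 := by
    rintro _ (⟨q, hq, rfl⟩ | ⟨q, hq, rfl⟩) h <;> refine hS0 q hq ?_ <;> simp [cross, h]
  have hfst : ∀ q ∈ S, q.1 ∈ P := fun q hq => Or.inl ⟨q, hq, rfl⟩
  have hsnd : ∀ q ∈ S, q.2 ∈ P := fun q hq => Or.inr ⟨q, hq, rfl⟩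
  have hself : ∀ v : Fin 2 → 𝓞 K, cross v v = 0 := fun v => by simp only [cross]; ring
  set good : (Fin 2 → 𝓞 K) → Prop := fun v =>
    ∃ γ ∈ principalCongr N, ∃ e ∈ P, cross v (γ.1.mulVec e) = 0 with hgood
  have hgood_of : ∀ u v, cross u v ≠ 0 → cross u v ∣ N₀ → good u ∧ good v := by
    intro u v h0 hd
    obtain ⟨γ, hγ, q, hq, rfl, rfl⟩ := hSc u v h0 hd
    exact ⟨⟨γ, hγ, _, hfst q hq, hself _⟩, ⟨γ, hγ, _, hsnd q hq, hself _⟩⟩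
  have hall : ∀ v ≠ 0, good v := by
    have h1 : good ![1, 0] := by
      refine (hgood_of ![1, 0] ![0, 1] ?_ ?_).1 <;> simp [cross]
    intro v hv
    refine (hconn (fun u v => good u ↔ good v) (fun u v w _ => Iff.trans) ?_ ?_ ![1, 0] v ?_
      hv).mp h1
    · intro u v hu hv huv
      constructor
      · rintro ⟨γ, hγ, e, he, h⟩
        exact ⟨γ, hγ, e, he, cross_trans hu (by rw [cross_comm, huv, neg_zero]) h⟩
      · rintro ⟨γ, hγ, e, he, h⟩
        exact ⟨γ, hγ, e, he, cross_trans hv huv h⟩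
    · intro u v h0 hd
      exact iff_of_true (hgood_of u v h0 hd).1 (hgood_of u v h0 hd).2
    · intro h
      simpa using congrFun h 0
  have hF : ∀ q : P × P, ∃ F : Set (Matrix.SpecialLinearGroup (Fin 2) (𝓞 K)), F.Finite ∧
      F ⊆ principalCongr N ∧ ∀ γ ∈ principalCongr N, cross (γ.1.mulVec q.2.1) q.1.1 = 0 →
        γ ∈ Subgroup.closure F := fun q =>
    exists_finite_closure _ (hP0 _ q.1.2) (hP0 _ q.2.2)
  choose F hFf hFs hFc using hF
  have := hPf.to_subtype
  refine ⟨P, hPf, hall, hP0, ⋃ q, F q, Set.finite_iUnion hFf, Set.iUnion_subset hFs, ?_⟩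
  set Δ := Subgroup.closure (⋃ q, F q) with hΔ
  -- Two elements that send representatives to the same point of `ℙ¹(K)` differ by one of the
  -- elements treated in `exists_finite_closure`.
  have hmem : ∀ γ ∈ principalCongr N, ∀ γ' ∈ principalCongr N, ∀ e ∈ P, ∀ e' ∈ P,
      cross (γ.1.mulVec e) (γ'.1.mulVec e') = 0 → γ⁻¹ * γ' ∈ Δ := by
    intro γ hγ γ' hγ' e he e' he' h
    refine Subgroup.closure_mono (Set.subset_iUnion F (⟨e, he⟩, ⟨e', he'⟩))
      (hFc (⟨e, he⟩, ⟨e', he'⟩) _ (mul_mem (inv_mem hγ) hγ') ?_)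
    rw [cross_comm, neg_eq_zero, ← cross_mulVec γ, ← mulVec_mul, mul_inv_cancel_left]
    exact h
  -- The coset `γ Δ` is constant along the connecting chains of vectors, so it depends neither on
  -- the point nor on `γ`; comparison with `1` gives the generation statement.
  have hrel := hconn (fun u v => ∀ γ ∈ principalCongr N, ∀ γ' ∈ principalCongr N, ∀ e ∈ P,
      ∀ e' ∈ P, cross u (γ.1.mulVec e) = 0 → cross v (γ'.1.mulVec e') = 0 → γ⁻¹ * γ' ∈ Δ) ?_ ?_ ?_
  · intro γ hγ
    obtain ⟨-, -, e, he, -⟩ := hall ![1, 0] (by intro h; simpa using congrFun h 0)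
    have := hrel e (γ.1.mulVec e) (hP0 e he) (mulVec_ne_zero _ (hP0 e he)) 1 (one_mem _) γ hγ e he
      e he (by rw [Matrix.SpecialLinearGroup.coe_one, Matrix.one_mulVec, hself]) (hself _)
    rwa [inv_one, one_mul] at this
  · intro u v w hv huv hvw γ hγ γ' hγ' e he e' he' h h'
    obtain ⟨γ₁, hγ₁, e₁, he₁, h₁⟩ := hall v hv
    have := mul_mem (huv γ hγ γ₁ hγ₁ e he e₁ he₁ h h₁) (hvw γ₁ hγ₁ γ' hγ' e₁ he₁ e' he' h₁ h')
    rwa [mul_assoc, mul_inv_cancel_left] at this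
  · intro u v hu hv huv γ hγ γ' hγ' e he e' he' h h'
    refine hmem γ hγ γ' hγ' e he e' he' ?_
    exact cross_trans hu (by rw [cross_comm, h, neg_zero]) (cross_trans hv huv h')
  · intro u v h0 hd γ hγ γ' hγ' e he e' he' h h'
    obtain ⟨g, hg, q, hq, rfl, rfl⟩ := hSc u v h0 hd
    have m1 := hmem γ hγ g hg e he _ (hfst q hq) (by rw [cross_comm, h, neg_zero])
    have m2 := hmem g hg γ' hγ' _ (hsnd q hq) e' he' h'
    have := mul_mem m1 m2
    rwa [mul_assoc, mul_inv_cancel_left] at this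

end Generation

/-! ### Transfer to `ℙ¹(K)` and the groups `Γ_i(𝔫)` -/

section Cusps

variable {K : Type*} [Field K] [NumberField K]

/-- The inclusion of `SL₂(𝓞_K)` into `GL₂(K)`. -/
def slToGL (K : Type*) [Field K] [NumberField K] :
    Matrix.SpecialLinearGroup (Fin 2) (𝓞 K) →* GL (Fin 2) K :=
  Matrix.SpecialLinearGroup.toGL.comp (Matrix.SpecialLinearGroup.map (algebraMap (𝓞 K) K))

lemma one_mem_coeIdeal_inv {I : Ideal (𝓞 K)} (hI : I ≠ 0) :
    (1 : K) ∈ (I : FractionalIdeal (𝓞 K)⁰ K)⁻¹ := by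
  rw [FractionalIdeal.mem_inv_iff (FractionalIdeal.coeIdeal_ne_zero.mpr hI)]
  intro y hy
  rw [one_mul]
  exact FractionalIdeal.coeIdeal_le_one hy

/-- Off-diagonal entries are multiples of `N`, which lies in both `I` and `𝔫`; and `𝔫 ⊆ 𝔫 I⁻¹` as
`I` is integral. -/
lemma slToGL_mem_Gam {I 𝔫 : Ideal (𝓞 K)} (hI : I ≠ 0) {N : 𝓞 K} (hNI : N ∈ I) (hN𝔫 : N ∈ 𝔫)
    {γ : Matrix.SpecialLinearGroup (Fin 2) (𝓞 K)} (hγ : γ ∈ principalCongr N) :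
    slToGL K γ ∈ Gam I 𝔫 := by
  have h := mem_principalCongr.mp hγ
  have hdet := γ.2
  rw [Matrix.det_fin_two] at hdet
  have h01 : γ.1 0 1 ∈ Ideal.span {N} := by
    simpa [Ideal.mem_span_singleton] using h 0 1
  have h10 : γ.1 1 0 ∈ Ideal.span {N} := by
    simpa [Ideal.mem_span_singleton] using h 1 0
  have hle : ∀ {J : Ideal (𝓞 K)} {x}, N ∈ J → x ∈ Ideal.span {N} → x ∈ J := fun hJ hx =>
    (Ideal.span_singleton_le_iff_mem _).mpr hJ hx
  refine ⟨?_, ?_, ?_, ?_, ?_⟩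
  · have := congrArg (algebraMap (𝓞 K) K) hdet
    rw [map_sub, map_mul, map_mul, map_one] at this
    exact this
  · exact (FractionalIdeal.mem_one_iff _).mpr ⟨_, rfl⟩
  · exact (FractionalIdeal.mem_one_iff _).mpr ⟨_, rfl⟩
  · exact FractionalIdeal.mem_coeIdeal_of_mem _ (hle hNI h01)
  · have := FractionalIdeal.mul_mem_mul (FractionalIdeal.mem_coeIdeal_of_mem (𝓞 K)⁰
      (hle hN𝔫 h10)) (one_mem_coeIdeal_inv hI)
    rwa [mul_one] at this

variable [DecidableEq K]

/-- The point of `ℙ¹(K)` with homogeneous coordinates `(x, y)`. -/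
def mkPt (x y : K) : OnePoint K := if y = 0 then OnePoint.infty else ((x / y : K) : OnePoint K)

lemma smul_mkPt (g : GL (Fin 2) K) {x y : K} (h : x ≠ 0 ∨ y ≠ 0) :
    g • mkPt x y = mkPt (g 0 0 * x + g 0 1 * y) (g 1 0 * x + g 1 1 * y) := by
  unfold mkPt
  by_cases hy : y = 0
  · have hx := h.resolve_right (not_not.mpr hy)
    rw [if_pos hy, OnePoint.smul_infty_eq_ite, hy]
    simp only [mul_zero, add_zero, mul_eq_zero, hx, or_false, mul_div_mul_right _ _ hx]
  · rw [if_neg hy, OnePoint.smul_some_eq_ite]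
    have e : ∀ i, g i 0 * (x / y) + g i 1 = (g i 0 * x + g i 1 * y) / y := fun i => by field_simp
    simp only [e, div_eq_zero_iff, hy, or_false, div_div_div_cancel_right₀ hy]

lemma mkPt_eq_mkPt {x y x' y' : K} (h : x ≠ 0 ∨ y ≠ 0) (h' : x' ≠ 0 ∨ y' ≠ 0)
    (he : x * y' - y * x' = 0) : mkPt x y = mkPt x' y' := by
  unfold mkPt
  by_cases h1 : y = 0 <;> by_cases h2 : y' = 0
  · rw [if_pos h1, if_pos h2]
  · rw [h1, zero_mul, sub_zero] at he
    exact ((mul_eq_zero.mp he).elim (h.resolve_right (not_not.mpr h1)) h2).elim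
  · rw [h2, mul_zero, zero_sub, neg_eq_zero] at he
    exact ((mul_eq_zero.mp he).elim h1 (h'.resolve_right (not_not.mpr h2))).elim
  · have e : x / y = x' / y' := (div_eq_div_iff h1 h2).mpr (by linear_combination he)
    rw [if_neg h1, if_neg h2, e]

/-- The point of `ℙ¹(K)` with integral homogeneous coordinates `v`. -/
def toPt (v : Fin 2 → 𝓞 K) : OnePoint K := mkPt (v 0 : K) (v 1 : K)

lemma coe_ne_zero_or {v : Fin 2 → 𝓞 K} (hv : v ≠ 0) : (v 0 : K) ≠ 0 ∨ (v 1 : K) ≠ 0 := by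
  by_contra! h
  refine hv (funext fun i => RingOfIntegers.coe_eq_zero_iff.mp ?_)
  fin_cases i
  exacts [h.1, h.2]

lemma toPt_mulVec {v : Fin 2 → 𝓞 K} (hv : v ≠ 0) (γ : Matrix.SpecialLinearGroup (Fin 2) (𝓞 K)) :
    slToGL K γ • toPt v = toPt (γ.1.mulVec v) := by
  have e : ∀ i, slToGL K γ i 0 * (v 0 : K) + slToGL K γ i 1 * (v 1 : K) =
      ((γ.1.mulVec v i : 𝓞 K) : K) := fun i => by
    have : γ.1.mulVec v i = γ.1 i 0 * v 0 + γ.1 i 1 * v 1 := by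
      simp only [Matrix.mulVec, dotProduct, Fin.sum_univ_two]
    have h := congrArg (algebraMap (𝓞 K) K) this
    rw [map_add, map_mul, map_mul] at h
    exact h.symm
  exact (smul_mkPt _ (coe_ne_zero_or hv)).trans (congrArg₂ mkPt (e 0) (e 1))

lemma toPt_eq_of_cross {u v : Fin 2 → 𝓞 K} (hu : u ≠ 0) (hv : v ≠ 0) (h : cross u v = 0) :
    toPt u = toPt v := by
  have h' := congrArg (algebraMap (𝓞 K) K) h
  rw [cross, map_sub, map_mul, map_mul, map_zero] at h'
  exact mkPt_eq_mkPt (coe_ne_zero_or hu) (coe_ne_zero_or hv) h'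

lemma exists_toPt_eq (x : OnePoint K) : ∃ v : Fin 2 → 𝓞 K, v ≠ 0 ∧ toPt v = x := by
  induction x using OnePoint.rec with
  | infty => exact ⟨![1, 0], fun h => by simpa using congrFun h 0, by simp [toPt, mkPt]⟩
  | coe x =>
    obtain ⟨a, b, hb, rfl⟩ := IsFractionRing.div_surjective (A := 𝓞 K) x
    have hb0 : b ≠ 0 := nonZeroDivisors.ne_zero hb
    have hb' : (b : K) ≠ 0 := fun h => hb0 (RingOfIntegers.coe_eq_zero_iff.mp h)
    refine ⟨![a, b], fun h => hb0 (by simpa using congrFun h 1), ?_⟩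
    exact if_neg hb'

/-- The groups `Γ_i(𝔫)` contain a finitely generated subgroup with finitely many orbits on
`ℙ¹(K)`. -/
theorem exists_le_Gam [Finite (𝓞 K)ˣ] {I 𝔫 : Ideal (𝓞 K)} (hI : I ≠ 0) (h𝔫 : 𝔫 ≠ 0) :
    ∃ F : Set (GL (Fin 2) K), F.Finite ∧ Subgroup.closure F ≤ Gam I 𝔫 ∧
      ∃ P : Set (OnePoint K), P.Finite ∧ ∀ x, ∃ γ ∈ Subgroup.closure F, ∃ e ∈ P, γ • e = x := by
  obtain ⟨N, hN, hN0⟩ : ∃ N ∈ I * 𝔫, N ≠ 0 :=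
    Submodule.exists_mem_ne_zero_of_ne_bot (mul_ne_zero hI h𝔫)
  have hle1 : I * 𝔫 ≤ I := Ideal.mul_le_left
  have hle2 : I * 𝔫 ≤ 𝔫 := Ideal.mul_le_right
  obtain ⟨P, hP, hPc, hP0, F, hF, hFs, hFc⟩ := exists_finite_generators hN0
  refine ⟨slToGL K '' F, hF.image _, ?_, toPt '' P, hP.image _, fun x => ?_⟩
  · rw [Subgroup.closure_le]
    rintro _ ⟨γ, hγ, rfl⟩
    exact slToGL_mem_Gam hI (hle1 hN) (hle2 hN) (hFs hγ)
  · obtain ⟨v, hv, rfl⟩ := exists_toPt_eq x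
    obtain ⟨γ, hγ, e, he, h⟩ := hPc v hv
    refine ⟨slToGL K γ, ?_, toPt e, ⟨e, he, rfl⟩, ?_⟩
    · rw [← MonoidHom.map_closure]
      exact ⟨γ, hFc γ hγ, rfl⟩
    · rw [toPt_mulVec (hP0 e he)]
      exact (toPt_eq_of_cross hv (mulVec_ne_zero _ (hP0 e he)) h).symm

end Cusps

/-! ### Divisors of degree `0` and boundedness of symbols -/

section Divisors

variable {K : Type*} [Field K] [DecidableEq K] {C : Set (OnePoint K)}

/-- The divisor `x - y`. -/
def subDiv (x y : C) : Div0 C := ⟨Finsupp.single x 1 - Finsupp.single y 1, by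
  change degree C _ = 0
  rw [map_sub, degree, Finsupp.liftAddHom_apply_single, Finsupp.liftAddHom_apply_single]
  exact sub_self _⟩

lemma subDiv_add (x y z : C) : subDiv x y + subDiv y z = subDiv x z :=
  Subtype.ext (sub_add_sub_cancel _ _ _)

lemma subDiv_self (x : C) : subDiv x x = 0 := Subtype.ext (sub_self _)

lemma neg_subDiv (x y : C) : -subDiv x y = subDiv y x := Subtype.ext (neg_sub _ _)

lemma moveDiv_subDiv {C' : Set (OnePoint K)} (γ : GL (Fin 2) K) (h : ∀ x ∈ C, γ • x ∈ C')
    (x y : C) :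
    moveDiv γ h (subDiv x y) = subDiv ⟨γ • x.1, h x.1 x.2⟩ ⟨γ • y.1, h y.1 y.2⟩ := by
  apply Subtype.ext
  have e : (moveDiv γ h (subDiv x y)).1 =
    Finsupp.mapDomain.addMonoidHom (fun x : C => (⟨γ • x.1, h x.1 x.2⟩ : C'))
      (Finsupp.single x (1 : ℤ) - Finsupp.single y 1) := rfl
  rw [e, map_sub]
  simp only [Finsupp.mapDomain.addMonoidHom_apply, Finsupp.mapDomain_single]
  rfl

lemma eq_sum_subDiv (x₀ : C) (D : Div0 C) :
    D = ∑ x ∈ D.1.support, D.1 x • subDiv x x₀ := by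
  apply Subtype.ext
  have h0 : ∑ x ∈ D.1.support, D.1 x = 0 := by
    have := D.2
    change degree C D.1 = 0 at this
    simpa [degree, Finsupp.sum] using this
  have h1 : (∑ x ∈ D.1.support, D.1 x • subDiv x x₀).1 =
      ∑ x ∈ D.1.support, D.1 x • (Finsupp.single x (1 : ℤ) - Finsupp.single x₀ 1) := by
    rw [AddSubgroup.val_finsetSum]
    rfl
  rw [h1]
  simp only [smul_sub, Finset.sum_sub_distrib]
  rw [← Finset.sum_smul, h0, zero_smul, sub_zero]
  simp only [Finsupp.smul_single, smul_eq_mul, mul_one]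
  exact (Finsupp.sum_single D.1).symm

/-- The homomorphism on divisors of degree `0` with given values at the points. -/
def ofPts {M : Type*} [AddCommGroup M] (ψ : C → M) : Div0 C →+ M :=
  (Finsupp.liftAddHom fun x => (zmultiplesHom M) (ψ x)).comp (Div0 C).subtype

lemma ofPts_apply {M : Type*} [AddCommGroup M] (ψ : C → M) (D : Div0 C) :
    ofPts ψ D = ∑ x ∈ D.1.support, D.1 x • ψ x := rfl

variable [NumberField K]

lemma exists_subset_of_finite {M : Type*} [AddCommGroup M] {S : ℕ → AddSubgroup M}
    (hmono : Monotone S) (hex : ∀ m, ∃ n, m ∈ S n) {s : Set M} (hs : s.Finite) :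
    ∃ n, s ⊆ S n := by
  induction s, hs using Set.Finite.induction_on with
  | empty => exact ⟨0, Set.empty_subset _⟩
  | @insert a s _ _ ih =>
    obtain ⟨n, hn⟩ := ih
    obtain ⟨m, hm⟩ := hex a
    exact ⟨max n m, Set.insert_subset (hmono (le_max_right n m) hm)
      (hn.trans (hmono (le_max_left n m)))⟩

/-- The map `γ ↦ φ (γx - x)` satisfies the cocycle relation `ab x - x = a (b x - x) + (a x - x)`, so
control on generators suffices for a stable subgroup. -/
lemma subDiv_orbit_mem {M : Type*} [AddCommGroup M] {φ : Div0 C →+ M} {T : AddSubgroup M}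
    {F : Set (GL (Fin 2) K)} (hF : ∀ γ ∈ Subgroup.closure F, ∀ x ∈ C, γ • x ∈ C)
    (hstab : ∀ γ (hγ : γ ∈ Subgroup.closure F) D, φ D ∈ T → φ (moveDiv γ (hF γ hγ) D) ∈ T) (x : C)
    (h : ∀ γ (hγ : γ ∈ F),
      φ (subDiv ⟨γ • x.1, hF γ (Subgroup.subset_closure hγ) _ x.2⟩ x) ∈ T)
    (γ : GL (Fin 2) K) (hγ : γ ∈ Subgroup.closure F) :
    φ (subDiv ⟨γ • x.1, hF γ hγ _ x.2⟩ x) ∈ T := by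
  induction hγ using Subgroup.closure_induction with
  | mem γ hγ => exact h γ hγ
  | one =>
    have e : (⟨(1 : GL (Fin 2) K) • x.1, hF 1 (one_mem _) _ x.2⟩ : C) = x :=
      Subtype.ext (one_smul _ _)
    rw [e, subDiv_self, map_zero]
    exact zero_mem _
  | mul a b ha hb iha ihb =>
    rw [← subDiv_add _ ⟨a • x.1, hF a ha _ x.2⟩, map_add]
    refine add_mem ?_ iha
    have e := hstab a ha _ ihb
    rw [moveDiv_subDiv] at e
    have e2 : (⟨(a * b) • x.1, hF _ (mul_mem ha hb) _ x.2⟩ : C) =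
      ⟨a • b • x.1, hF a ha _ (hF b hb _ x.2)⟩ := Subtype.ext (mul_smul _ _ _)
    rw [e2]
    exact e
  | inv a ha iha =>
    have e := hstab _ (inv_mem ha) _ iha
    rw [moveDiv_subDiv, ← neg_subDiv, map_neg, neg_mem_iff] at e
    have e2 : (⟨a⁻¹ • a • x.1, hF _ (inv_mem ha) _ (hF a ha _ x.2)⟩ : C) = x :=
      Subtype.ext (inv_smul_smul _ _)
    rwa [e2] at e

/-- Boundedness of modular symbols: if the values of a modular symbol lie in the union of an
increasing sequence of stable subgroups, they lie in one of them. -/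
theorem exists_forall_mem_of_stable [Finite (𝓞 K)ˣ] {I 𝔫 : Ideal (𝓞 K)} (hI : I ≠ 0) (h𝔫 : 𝔫 ≠ 0)
    (hC : ∀ γ ∈ Gam I 𝔫, ∀ x ∈ C, γ • x ∈ C) (hne : C.Nonempty) {M : Type*} [AddCommGroup M]
    (φ : Div0 C →+ M) {S : ℕ → AddSubgroup M} (hmono : Monotone S) (hex : ∀ m, ∃ n, m ∈ S n)
    (hstab : ∀ n γ (hγ : γ ∈ Gam I 𝔫) D, φ D ∈ S n → φ (moveDiv γ (hC γ hγ) D) ∈ S n) :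
    ∃ n, ∀ D, φ D ∈ S n := by
  obtain ⟨F, hF, hFΓ, P, hP, hPc⟩ := exists_le_Gam hI h𝔫
  obtain ⟨x₀, hx₀⟩ := hne
  have hFC : ∀ γ ∈ Subgroup.closure F, ∀ x ∈ C, γ • x ∈ C := fun γ hγ => hC γ (hFΓ hγ)
  have hfin : {y : C | y.1 ∈ P ∪ (fun γ : GL (Fin 2) K => γ • x₀) '' F}.Finite :=
    (hP.union (hF.image _)).preimage Subtype.val_injective.injOn
  -- Finitely many divisors suffice: `e - x₀` for the orbit representatives `e` in `C`, and `g x₀ -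
  -- x₀` for the generators `g`.
  obtain ⟨n, hn⟩ := exists_subset_of_finite hmono hex
    (hfin.image fun y : C => φ (subDiv y ⟨x₀, hx₀⟩))
  have horb := subDiv_orbit_mem (φ := φ) (T := S n) hFC (fun γ hγ D => hstab n γ (hFΓ hγ) D)
    ⟨x₀, hx₀⟩ fun γ hγ => hn ⟨_, Or.inr ⟨γ, hγ, rfl⟩, rfl⟩
  have hpt : ∀ x : C, φ (subDiv x ⟨x₀, hx₀⟩) ∈ S n := by
    rintro ⟨x, hx⟩
    obtain ⟨γ, hγ, e, he, rfl⟩ := hPc x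
    have h2 : e ∈ C := by
      have := hFC _ (inv_mem hγ) _ hx
      rwa [inv_smul_smul] at this
    -- This uses `γe - x₀ = γ (e - x₀) + (γx₀ - x₀)`.
    rw [← subDiv_add _ ⟨γ • x₀, hFC γ hγ _ hx₀⟩, map_add]
    refine add_mem ?_ (horb γ hγ)
    have e3 := hstab n γ (hFΓ hγ) (subDiv ⟨e, h2⟩ ⟨x₀, hx₀⟩) (hn ⟨⟨e, h2⟩, Or.inl he, rfl⟩)
    rw [moveDiv_subDiv] at e3
    exact e3
  refine ⟨n, fun D => ?_⟩
  rw [eq_sum_subDiv ⟨x₀, hx₀⟩ D, map_sum]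
  refine sum_mem fun x _ => ?_
  rw [map_zsmul]
  exact zsmul_mem (hpt x) _

end Divisors

/-! ### Bounded symbols and bounded lifts -/

section Boundedness

variable {p : ℕ} [Fact p.Prime] {L : Type*} [Field L] [Algebra L ℂ_[p]] {K : Type*} [Field K]
  [NumberField K] [DecidableEq K] {𝔪 : Ideal (𝓞 K)}
  {R : ClassReps (Ideal.span {(p : 𝓞 K)} * 𝔪)} {H : HeckeData p R} {C : CuspFamily H}
  {σ : EmbPair p K L} {κ : Fin 2 → ℕ}

lemma level_ne_zero (h𝔪 : 𝔪 ≠ 0) : Ideal.span {(p : 𝓞 K)} * 𝔪 ≠ 0 := by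
  refine mul_ne_zero ?_ h𝔪
  have : (p : 𝓞 K) ≠ 0 := Nat.cast_ne_zero.mpr (Fact.out : p.Prime).ne_zero
  simpa [Ideal.span_singleton_eq_bot] using this

/-- A stable subgroup containing the value of an invariant family at `D` contains its value at
`γ · D`. -/
lemma apply_moveDiv_mem {M : Type*} [AddCommGroup M] [Module L M]
    {act : GL (Fin 2) K → M →ₗ[L] M} {Φ : HomFam C M} (hΦ : InvMod act ⊥ Φ) {T : AddSubgroup M}
    (hT : ∀ {γ}, InSigma0 σ γ → ∀ m ∈ T, act γ m ∈ T) (i : ClassGroup (𝓞 K)) {γ : GL (Fin 2) K}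
    (hγ : γ ∈ Gam (R.I i) (Ideal.span {(p : 𝓞 K)} * 𝔪)) (D : Div0 (C.cusps i))
    (h : Φ i D ∈ T) : Φ i (moveDiv γ (C.invariant i γ hγ) D) ∈ T := by
  -- Invariance under `γ⁻¹`, evaluated at `γD`, expresses the value at `γD` as the value at `D`
  -- acted on by `γ⁻¹`.
  have h1 := hΦ i _ (inv_mem hγ) (moveDiv γ (C.invariant i γ hγ) D)
  have e : moveDiv γ⁻¹ (C.invariant i _ (inv_mem hγ)) (moveDiv γ (C.invariant i γ hγ) D) = D := by
    rw [moveDiv_moveDiv _ _ (C.invariant i _ (mul_mem (inv_mem hγ) hγ))]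
    apply Subtype.ext
    change Finsupp.mapDomain _ D.1 = D.1
    conv_rhs => rw [← Finsupp.mapDomain_id (v := D.1)]
    congr 1
    funext x
    refine Subtype.ext ?_
    change (γ⁻¹ * γ) • x.1 = x.1
    rw [inv_mul_cancel, one_smul]
  rw [e, Submodule.mem_bot, sub_eq_zero] at h1
  rw [← h1]
  exact hT (inSigma0_of_mem_Gam (R.ne_zero _) (R.coprime_level _) (inv_mem hγ)) _ h

/-- The distributions bounded by `n` on the radii in a set. -/
def bddDist (κ : Fin 2 → ℕ) (σ : EmbPair p K L) (s : Set Radii) (n : ℕ) : AddSubgroup (Dist σ) where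
  carrier := {μ | ∀ r ∈ s, (TestProj.id κ σ).Bd r n μ}
  zero_mem' _ _ := TestProj.Bd.zero (by simp)
  add_mem' h h' r hr := (h r hr).add (h' r hr)
  neg_mem' h r hr := (h r hr).neg

lemma bddDist_mono (s : Set Radii) : Monotone (bddDist κ σ s) := fun _ _ hmn _ h r hr =>
  (h r hr).mono (by exact_mod_cast hmn)

lemma act_mem_bddDist {s : Set Radii} {n : ℕ} {γ : GL (Fin 2) K} (hγ : InSigma0 σ γ) (μ : Dist σ)
    (h : μ ∈ bddDist κ σ s n) : distAct κ σ γ μ ∈ bddDist κ σ s n := fun r hr =>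
  (h r hr).act hγ

lemma isBdd_of_forall {Φ : HomFam C (Dist σ)}
    (h : ∀ r i, ∃ n : ℕ, ∀ X, (TestProj.id κ σ).Bd r n (Φ i X)) : IsBdd κ Φ := fun r => by
  choose n hn using h r
  refine ⟨((Finset.univ.sup n : ℕ) : ℝ), Nat.cast_nonneg _, fun i X => (hn i X).mono ?_⟩
  exact Nat.cast_le.mpr (Finset.le_sup (f := n) (Finset.mem_univ i))

/-- Invariant families of distributions are bounded. -/
theorem isBdd_of_mem_BianchiSymb [Finite (𝓞 K)ˣ] (h𝔪 : 𝔪 ≠ 0) {Φ : HomFam C (Dist σ)}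
    (hΦ : Φ ∈ BianchiSymb (distAct κ σ) C) : IsBdd κ Φ := by
  refine isBdd_of_forall fun r i => ?_
  have hex : ∀ μ, ∃ n, μ ∈ bddDist κ σ {r} n := fun μ => by
    obtain ⟨B, -, hB⟩ := exists_bound (κ := κ) μ r
    obtain ⟨n, hn⟩ := exists_nat_ge B
    refine ⟨n, fun r' hr' => ?_⟩
    rw [Set.mem_singleton_iff.mp hr']
    exact hB.mono hn
  obtain ⟨n, hn⟩ := exists_forall_mem_of_stable (R.ne_zero i) (level_ne_zero h𝔪) (C.invariant i)
    (C.nonempty i) (Φ i) (S := bddDist κ σ {r}) (bddDist_mono _) hex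
    (fun n γ hγ D h => apply_moveDiv_mem (mem_BianchiSymb_iff.mp hΦ)
      (T := bddDist κ σ {r} n) (fun hγ m hm => act_mem_bddDist hγ m hm) i hγ D h)
  exact ⟨n, fun X => hn X r rfl⟩

/-- A symbol with values in `V*_{k,ℓ}(L)` lifts to a bounded family of homomorphisms with values in
the distributions. -/
theorem exists_isBdd_lift [Finite (𝓞 K)ˣ] (hcl : IsClosed (Set.range (algebraMap L ℂ_[p])))
    (h𝔪 : 𝔪 ≠ 0) {φ : HomFam C (Module.Dual L (Vpoly L κ))}
    (hφ : φ ∈ BianchiSymb (dualAct κ σ) C) :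
    ∃ Φ : HomFam C (Dist σ), IsBdd κ Φ ∧ ∀ i X, specialize κ σ (Φ i X) = φ i X := by
  have hT : ∀ n {γ : GL (Fin 2) K}, InSigma0 σ γ →
      ∀ m ∈ (bddDist κ σ Set.univ n).map (specialize κ σ).toAddMonoidHom,
      dualAct κ σ γ m ∈ (bddDist κ σ Set.univ n).map (specialize κ σ).toAddMonoidHom := by
    rintro n γ hγ _ ⟨μ, hμ, rfl⟩
    exact ⟨distAct κ σ γ μ, act_mem_bddDist hγ μ hμ, specialize_distAct hγ μ⟩
  -- The images of the distributions bounded by `n` for all radii are stable and exhaust `V*`, so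
  -- one `n` serves for all values of the symbol.
  have hb : ∀ i, ∃ n, ∀ X, φ i X ∈ (bddDist κ σ Set.univ n).map
      (specialize κ σ).toAddMonoidHom := fun i =>
    exists_forall_mem_of_stable (R.ne_zero i) (level_ne_zero h𝔪) (C.invariant i)
      (C.nonempty i) (φ i)
      (S := fun n => (bddDist κ σ Set.univ n).map (specialize κ σ).toAddMonoidHom)
      (fun m n hmn => AddSubgroup.map_mono (bddDist_mono _ hmn)) (fun m => by
        obtain ⟨μ, hμ, n, hn⟩ := exists_specialize_eq (σ := σ) hcl m
        exact ⟨n, μ, fun r _ => hn r, hμ⟩)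
      (fun n γ hγ D h => apply_moveDiv_mem (mem_BianchiSymb_iff.mp hφ)
        (T := (bddDist κ σ Set.univ n).map (specialize κ σ).toAddMonoidHom) (hT n) i hγ D h)
  choose n hn using hb
  choose lift hlift hlift2 using hn
  have hx : ∀ i, ∃ x, x ∈ C.cusps i := C.nonempty
  choose x hx using hx
  -- Lifts are chosen independently on the divisors `y - x_i` and extended additively; no
  -- equivariance is needed.
  refine ⟨fun i => ofPts fun y => lift i (subDiv y ⟨x i, hx i⟩), isBdd_of_forall fun r i =>
    ⟨n i, fun X => ?_⟩, fun i X => ?_⟩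
  · have h1 : ∑ y ∈ X.1.support, X.1 y • lift i (subDiv y ⟨x i, hx i⟩) ∈
        bddDist κ σ Set.univ (n i) := sum_mem fun y _ => zsmul_mem (hlift i _) _
    exact h1 r trivial
  · conv_rhs => rw [eq_sum_subDiv ⟨x i, hx i⟩ X, map_sum]
    rw [ofPts_apply, map_sum]
    refine Finset.sum_congr rfl fun y _ => ?_
    rw [map_zsmul, map_zsmul]
    congr 1
    exact hlift2 i _

end Boundedness

/-! ### The indices `j_i` in terms of ideal classes -/

section ClassReps

variable {K : Type*} [Field K] [NumberField K] {𝔫 : Ideal (𝓞 K)}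

lemma ClassReps.eq_mk0_mul (R : ClassReps 𝔫) {𝔞 : Ideal (𝓞 K)} (h𝔞 : 𝔞 ≠ 0) {A : Kˣ}
    {i j : ClassGroup (𝓞 K)} (h : (𝔞 : FractionalIdeal (𝓞 K)⁰ K) * (R.I i) =
      FractionalIdeal.spanSingleton (𝓞 K)⁰ (A : K) * (R.I j)) :
    j = ClassGroup.mk0 ⟨𝔞, mem_nonZeroDivisors_of_ne_zero h𝔞⟩ * i := by
  conv_lhs => rw [← R.class_eq j]
  conv_rhs => rw [← R.class_eq i]
  rw [← map_mul, ClassGroup.mk0_eq_mk0_iff]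
  obtain ⟨a, b, hb, hab⟩ := IsFractionRing.div_surjective (A := 𝓞 K) (A : K)
  have ha0 : a ≠ 0 := by
    rintro rfl
    rw [map_zero, zero_div] at hab
    exact A.ne_zero hab.symm
  refine ⟨a, b, ha0, nonZeroDivisors.ne_zero hb, ?_⟩
  rw [← hab, ← IsFractionRing.mk'_mk_eq_div hb, ← FractionalIdeal.coeIdeal_mul] at h
  exact (FractionalIdeal.mk'_mul_coeIdeal_eq_coeIdeal K hb).mp h.symm

end ClassReps

/-! ### Commutation of the operators up to powers -/

section Commutation

variable {p : ℕ} [Fact p.Prime] {L : Type*} [Field L] [Algebra L ℂ_[p]] {K : Type*} [Field K]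
  [NumberField K] [DecidableEq K] {𝔪 : Ideal (𝓞 K)}
  {R : ClassReps (Ideal.span {(p : 𝓞 K)} * 𝔪)} {H : HeckeData p R} {C : CuspFamily H}
  {σ : EmbPair p K L}

namespace CosetData

/-- The map `J` is multiplication by an ideal class. -/
lemma exists_J_eq (D : CosetData C) (h𝔞 : D.𝔞 ≠ 0) : ∃ c, ∀ i, D.J i = c * i :=
  ⟨_, fun i => R.eq_mk0_mul h𝔞 (D.mul_eq i)⟩

/-- When `J` is the identity, every `A_i` generates `𝔞`; they differ by units, which the order of
the unit group kills. -/
lemma pow_A_eq [Fintype (𝓞 K)ˣ] (D : CosetData C) (hJ : D.J = id) (i j : ClassGroup (𝓞 K)) :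
    D.A i ^ Fintype.card (𝓞 K)ˣ = D.A j ^ Fintype.card (𝓞 K)ˣ := by
  have key : ∀ i, (D.𝔞 : FractionalIdeal (𝓞 K)⁰ K) =
      FractionalIdeal.spanSingleton (𝓞 K)⁰ (D.A i : K) := fun i => by
    have h := D.mul_eq i
    rw [hJ] at h
    exact mul_right_cancel₀ (FractionalIdeal.coeIdeal_ne_zero.mpr (R.ne_zero i)) h
  obtain ⟨u, hu⟩ := FractionalIdeal.spanSingleton_eq_spanSingleton.mp ((key i).symm.trans (key j))
  refine Units.ext ?_
  have h1 : ((u : 𝓞 K) : K) ^ Fintype.card (𝓞 K)ˣ = 1 := by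
    rw [← map_pow, ← Units.val_pow_eq_pow_val, pow_card_eq_one]
    exact map_one _
  have h2 : (D.A j : K) = (u : 𝓞 K) * D.A i := by
    rw [← hu, Units.smul_def, Algebra.smul_def]
  rw [Units.val_pow_eq_pow_val, Units.val_pow_eq_pow_val, h2, mul_pow, h1, one_mul]

variable {M : Type*} [AddCommGroup M] [Module L M] {act : GL (Fin 2) K → M →ₗ[L] M}

/-- Some power of the operator attached to `D` is attached to a principal ideal, with the same
generator for all ideal classes. -/
lemma exists_pow_const [Finite (𝓞 K)ˣ] (hact : IsRightAct σ act) (D : CosetData C)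
    (h𝔞 : D.𝔞 ≠ 0) : ∃ (n : ℕ) (E : CosetData C), E.𝔞 = D.𝔞 ^ (n + 1) ∧ E.J = id ∧
      (∀ i j, E.A i = E.A j) ∧ E.hecke act = (D.hecke act) ^ (n + 1) := by
  have := Fintype.ofFinite (𝓞 K)ˣ
  -- The class number is `h + 1` and the number of units is `w + 1`: the first power turns `J` into
  -- the identity, the second makes the generators independent of the ideal class.
  obtain ⟨h, hh⟩ := Nat.exists_eq_succ_of_ne_zero (Fintype.card_ne_zero (α := ClassGroup (𝓞 K)))
  obtain ⟨w, hw⟩ := Nat.exists_eq_succ_of_ne_zero (Fintype.card_ne_zero (α := (𝓞 K)ˣ))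
  obtain ⟨c, hc⟩ := D.exists_J_eq h𝔞
  obtain ⟨F, hF1, hF2, -, hF4⟩ := D.exists_pow hact h
  have hFJ : F.J = id := by
    rw [hF2, show D.J = fun i => c * i from funext hc, mul_left_iterate, ← Nat.succ_eq_add_one,
      ← hh, pow_card_eq_one]
    exact funext one_mul
  obtain ⟨E, hE1, hE2, hE3, hE4⟩ := F.exists_pow hact w
  have e : (h + 1) * w + h + 1 = (h + 1) * (w + 1) := by ring
  refine ⟨(h + 1) * w + h, E, ?_, ?_, fun i j => ?_, ?_⟩
  · rw [hE1, hF1, e, pow_mul]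
  · rw [hE2, hFJ, Function.iterate_id]
  · rw [hE3 hFJ, hE3 hFJ, ← Nat.succ_eq_add_one, ← hw]
    exact F.pow_A_eq hFJ i j
  · rw [hE4, hF4, e, pow_mul]

/-- The operators commute on families which are invariant modulo `N`. -/
lemma hecke_comm (hact : IsRightAct σ act) {N : Submodule L M} (hN : IsStable σ act N)
    (D E : CosetData C) (hJ : E.J = id) (hA : ∀ i j, E.A i = E.A j) {Φ : HomFam C M}
    (hΦ : InvMod act N Φ) :
    EqMod N (E.hecke act (D.hecke act Φ)) (D.hecke act (E.hecke act Φ)) := by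
  intro i X
  -- Under `hJ` and `hA` both composites have the same ideal, indices and generators, so they differ
  -- only in the choice of representatives.
  have h := hecke_sub_hecke_mem (E.comp D) (D.comp E) hact hN (mul_comm _ _)
    (show (fun i => D.J (E.J i)) = fun i => E.J (D.J i) by rw [hJ]; rfl)
    (show (fun i => E.A i * D.A (E.J i)) = fun i => D.A i * E.A (D.J i) by
      funext i
      rw [hJ, mul_comm, hA i (D.J i)]
      rfl) hΦ i X
  rwa [hecke_comp E D hact, hecke_comp D E hact] at h

end CosetData

variable {M : Type*} [AddCommGroup M] [Module L M] {act : GL (Fin 2) K → M →ₗ[L] M}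
  {N : Submodule L M}

lemma EqMod.hecke_smul (hN : IsStable σ act N) {D : CosetData C} {c c' : L} {Φ Ψ : HomFam C M}
    (h : EqMod N Φ (c • Ψ)) (h' : EqMod N (D.hecke act Ψ) (c' • Ψ)) :
    EqMod N (D.hecke act Φ) ((c * c') • Ψ) := by
  refine (h.hecke hN D).trans ?_
  rw [map_smul, mul_smul]
  exact h'.smul c

lemma EqMod.hecke_pow (hN : IsStable σ act N) {D : CosetData C} {c : L} {Φ : HomFam C M}
    (h : EqMod N (D.hecke act Φ) (c • Φ)) (n : ℕ) :
    EqMod N ((D.hecke act ^ n) Φ) (c ^ n • Φ) := by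
  induction n with
  | zero =>
    rw [pow_zero, pow_zero, one_smul]
    exact EqMod.refl _
  | succ n ih =>
    rw [pow_succ', pow_succ]
    exact ih.hecke_smul hN h

lemma EqMod.eigen_congr (hN : IsStable σ act N) {D : CosetData C} {c : L} {Φ Ψ : HomFam C M}
    (h : EqMod N Ψ Φ) (h' : EqMod N (D.hecke act Φ) (c • Φ)) :
    EqMod N (D.hecke act Ψ) (c • Ψ) :=
  ((h.hecke hN D).trans h').trans (h.symm.smul c)

/-- If `E` commutes with `D` modulo `N`, then `D` preserves eigenvectors of `E`. -/
lemma EqMod.hecke_sub_smul (hN : IsStable σ act N) {D E : CosetData C} {c c' : L} {Φ : HomFam C M}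
    (hcomm : EqMod N (E.hecke act (D.hecke act Φ)) (D.hecke act (E.hecke act Φ)))
    (h : EqMod N (E.hecke act Φ) (c • Φ)) :
    EqMod N (E.hecke act (D.hecke act Φ - c' • Φ)) (c • (D.hecke act Φ - c' • Φ)) := by
  rw [map_sub, map_smul, smul_sub, smul_comm c c']
  refine (hcomm.trans ?_).sub (h.smul c')
  rw [← map_smul]
  exact h.hecke hN D

end Commutation

/-! ### The lifting step for a system of eigenvalues -/

section Steps

variable {p : ℕ} [Fact p.Prime] {L : Type*} [Field L] [Algebra L ℂ_[p]] {K : Type*} [Field K]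
  [NumberField K] [DecidableEq K] {𝔪 : Ideal (𝓞 K)}
  {R : ClassReps (Ideal.span {(p : 𝓞 K)} * 𝔪)} {H : HeckeData p R} {C : CuspFamily H}
  {σ : EmbPair p K L} {κ : Fin 2 → ℕ} {π : TestProj κ σ} {N : Submodule L (Dist σ)}
  {S : Finset (Fin 2)}

lemma contracts_pow (h : ContractsMat π N S) {D E : CosetData C} {n : ℕ}
    (hE : E.𝔞 = D.𝔞 ^ (n + 1)) {lam : L} (hlam : lam ≠ 0) {θ : ℝ} (hθ0 : 0 ≤ θ)
    (hθ1 : θ < 1) (hθ : ∀ s ∈ S, ∀ x ∈ D.𝔞, ‖emb σ (x : K) s‖ ≤ θ)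
    (hslope : ∀ s ∈ S, θ ^ (κ s + 1) < ‖algebraMap L ℂ_[p] lam‖) :
    Contracts π N E (lam ^ (n + 1)) := by
  refine contracts_of_contractsMat h (pow_ne_zero _ hlam) (pow_nonneg hθ0 (n + 1))
    (pow_lt_one₀ hθ0 hθ1 n.succ_ne_zero) (fun s hs x hx => ?_) fun s hs => ?_
  · rw [hE] at hx
    exact norm_emb_le_of_mem_pow hθ0 (hθ s hs) _ hx
  · rw [← pow_mul, mul_comm, pow_mul, map_pow, norm_pow]
    exact pow_lt_pow_left₀ (hslope s hs) (pow_nonneg hθ0 _) n.succ_ne_zero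

set_option maxHeartbeats 2000000 in
/-- The lifting step for a system of eigenvalues: a bounded family which, modulo `N`, is invariant
and an eigenvector of all the operators `D 𝔮`, one of which contracts, can be changed modulo `N` so
that this is true modulo `π.ker`. -/
theorem exists_eigen_lift [Finite (𝓞 K)ˣ] (hcl : IsClosed (Set.range (algebraMap L ℂ_[p])))
    (h : ContractsMat π N S) (hN : IsStable (M := Dist σ) σ (distAct κ σ) N)
    (hNcl : ∀ μ : Dist σ, (∀ r, ∀ ε > 0, ∃ ν ∈ N, π.Bd r ε (μ - ν)) → μ ∈ N)
    {ι : Type*} {D : ι → CosetData C} {lam : ι → L} (q : ι) (hq : (D q).𝔞 ≠ 0)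
    (hlam : lam q ≠ 0) {θ : ℝ} (hθ0 : 0 ≤ θ)
    (hθ1 : θ < 1) (hθ : ∀ s ∈ S, ∀ x ∈ (D q).𝔞, ‖emb σ (x : K) s‖ ≤ θ)
    (hslope : ∀ s ∈ S, θ ^ (κ s + 1) < ‖algebraMap L ℂ_[p] (lam q)‖)
    {Φ : HomFam C (Dist σ)} (hb : IsBdd κ Φ) (hinv : InvMod (distAct κ σ) N Φ)
    (heig : ∀ q, EqMod N ((D q).hecke (distAct κ σ) Φ) (lam q • Φ)) :
    ∃ Ψ : HomFam C (Dist σ), IsBdd κ Ψ ∧ EqMod N Ψ Φ ∧ InvMod (distAct κ σ) π.ker Ψ ∧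
      ∀ q, EqMod π.ker ((D q).hecke (distAct κ σ) Ψ) (lam q • Ψ) := by
  obtain ⟨Ψ, hΨb, hΨ, hΨinv, hΨq⟩ := exists_lift_of_contracts hcl
    (contracts_of_contractsMat h hlam hθ0 hθ1 hθ hslope) hlam hN hNcl hb hinv (heig q)
  refine ⟨Ψ, hΨb, hΨ, hΨinv, fun q' => ?_⟩
  have hact : IsRightAct (M := Dist σ) σ (distAct κ σ) := isRightAct_distAct
  -- The generators are arbitrary up to units, so `D q` and `D q'` need not commute; but a suitable
  -- power `E` of `D q` commutes with every `D q'` on invariant families.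
  obtain ⟨n, E, hE𝔞, hEJ, hEA, hE⟩ := (D q).exists_pow_const (M := Dist σ) (act := distAct κ σ)
    hact hq
  have hcomm := CosetData.hecke_comm (M := Dist σ) (act := distAct κ σ) hact π.isStable_ker (D q')
    E hEJ hEA hΨinv
  have hEe : EqMod π.ker (E.hecke (distAct κ σ) Ψ) (lam q ^ (n + 1) • Ψ) := by
    rw [hE]
    exact hΨq.hecke_pow π.isStable_ker (n + 1)
  have hNq := hΨ.eigen_congr hN (heig q')
  -- The difference `D q' Ψ - lam q' Ψ` takes values in `N` and is an eigenvector of the contracting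
  -- `E` modulo `π.ker`, so uniqueness forces it into `π.ker`.
  exact eqMod_zero_of_contracts (contracts_pow h hE𝔞 hlam hθ0 hθ1 hθ hslope)
    (pow_ne_zero _ hlam) (Φ := (D q').hecke (distAct κ σ) Ψ - lam q' • Ψ) hNq ((hΨb.hecke (D q')).sub (hΨb.smul _))
    (EqMod.hecke_sub_smul π.isStable_ker hcomm hEe)

end Steps

/-! ### Reduction of the isomorphism to kernels and lifts -/

section Control

variable {p : ℕ} [Fact p.Prime] {L : Type*} [Field L] [Algebra L ℂ_[p]] {K : Type*} [Field K]
  [NumberField K] [DecidableEq K] {𝔪 : Ideal (𝓞 K)}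
  {R : ClassReps (Ideal.span {(p : 𝓞 K)} * 𝔪)} {H : HeckeData p R} {C : CuspFamily H}
  {σ : EmbPair p K L} {κ : Fin 2 → ℕ} {lam : PrimesAbove K p → Lˣ}

/-- Inherited from the action on distributions, since specialization is surjective and equivariant.
-/
lemma isRightAct_dualAct (hcl : IsClosed (Set.range (algebraMap L ℂ_[p]))) :
    IsRightAct σ (dualAct κ σ) := fun {γ δ} hγ hδ m => by
  obtain ⟨μ, rfl, -⟩ := exists_specialize_eq (σ := σ) hcl m
  rw [← specialize_distAct (hγ.mul hδ), distAct_mul hγ hδ, specialize_distAct hδ,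
    specialize_distAct hγ]

lemma specMap_apply (Φ : HomFam C (Dist σ)) (i : ClassGroup (𝓞 K)) (X : Div0 (C.cusps i)) :
    specMap κ σ C Φ i X = specialize κ σ (Φ i X) := rfl

lemma specMap_hecke (D : CosetData C) (Φ : HomFam C (Dist σ)) :
    D.hecke (dualAct κ σ) (specMap κ σ C Φ) = specMap κ σ C (D.hecke (distAct κ σ) Φ) := by
  funext i
  ext1 X
  rw [specMap_apply, CosetData.hecke_apply, CosetData.hecke_apply, map_sum]
  refine Finset.sum_congr rfl fun b _ => ?_
  rw [specMap_apply]
  exact (specialize_distAct (D.inSigma0 (D.mem i b.1 b.2)) _).symm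

lemma mem_eigenSymb_iff {M : Type*} [AddCommGroup M] [Module L M]
    {act : GL (Fin 2) K → M →ₗ[L] M} (hact : IsRightAct σ act)
    {D : PrimesAbove K p → CosetData C} (hJ : ∀ 𝔭, (D 𝔭).J = H.j 𝔭) (hA : ∀ 𝔭, (D 𝔭).A = H.α 𝔭)
    {Φ : HomFam C M} : Φ ∈ eigenSymb act C lam ↔
      InvMod act ⊥ Φ ∧ ∀ 𝔭, (D 𝔭).hecke act Φ = (lam 𝔭 : L) • Φ := by
  rw [eigenSymb, Submodule.mem_inf, Submodule.mem_iInf, mem_BianchiSymb_iff]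
  refine and_congr_right fun h => forall_congr' fun 𝔭 => ?_
  rw [Module.End.mem_eigenspace_iff,
    heckeU_eq hact (hJ 𝔭) (hA 𝔭) (mem_BianchiSymb_iff.mpr h)]

lemma mem_ker_specialize_sub_iff {μ ν : Dist σ} :
    μ - ν ∈ LinearMap.ker (specialize κ σ) ↔ specialize κ σ μ = specialize κ σ ν := by
  have h : specialize κ σ (μ - ν) = specialize κ σ μ - specialize κ σ ν :=
    LinearMap.map_sub _ μ ν
  rw [LinearMap.mem_ker, h, sub_eq_zero]

lemma invMod_specMap_iff {Φ : HomFam C (Dist σ)} :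
    InvMod (dualAct κ σ) ⊥ (specMap κ σ C Φ) ↔
      InvMod (distAct κ σ) (LinearMap.ker (specialize κ σ)) Φ := by
  refine forall_congr' fun i => forall₂_congr fun γ hγ => forall_congr' fun X => ?_
  rw [Submodule.mem_bot, sub_eq_zero, specMap_apply, specMap_apply, ← specialize_distAct
    (inSigma0_of_mem_Gam (R.ne_zero _) (R.coprime_level _) hγ)]
  exact mem_ker_specialize_sub_iff.symm

lemma eqMod_specialize_iff {Φ Ψ : HomFam C (Dist σ)} :
    specMap κ σ C Φ = specMap κ σ C Ψ ↔ EqMod (LinearMap.ker (specialize κ σ)) Φ Ψ := by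
  constructor
  · intro h i X
    exact mem_ker_specialize_sub_iff.mpr (DFunLike.congr_fun (congrFun h i) X)
  · intro h
    funext i
    ext1 X
    exact mem_ker_specialize_sub_iff.mp (h i X)

lemma eqMod_id_iff {Φ Ψ : HomFam C (Dist σ)} :
    EqMod (TestProj.id κ σ).ker Φ Ψ ↔ Φ = Ψ := by
  constructor
  · intro h
    funext i
    ext1 X
    exact sub_eq_zero.mp (TestProj.mem_ker_id.mp (h i X))
  · rintro rfl
    exact EqMod.refl _

lemma invMod_id_iff {Φ : HomFam C (Dist σ)} :
    InvMod (distAct κ σ) (TestProj.id κ σ).ker Φ ↔ InvMod (distAct κ σ) ⊥ Φ := by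
  refine forall_congr' fun i => forall₂_congr fun γ hγ => forall_congr' fun X => ?_
  exact TestProj.mem_ker_id.trans (Submodule.mem_bot L).symm

lemma restrictsToIso_of_bijective {V W : Type*} [AddCommGroup V] [Module L V] [AddCommGroup W]
    [Module L W] {f : V →ₗ[L] W} {A : Submodule L V} {B : Submodule L W}
    (hmap : ∀ x ∈ A, f x ∈ B) (hinj : ∀ x ∈ A, f x = 0 → x = 0) (hsurj : ∀ y ∈ B, ∃ x ∈ A, f x = y) :
    RestrictsToIso f A B := by
  refine ⟨LinearEquiv.ofBijective (f.restrict hmap) ⟨?_, ?_⟩, fun x => rfl⟩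
  · rw [← LinearMap.ker_eq_bot, LinearMap.ker_eq_bot']
    exact fun x hx => Subtype.ext (hinj x x.2 (congrArg Subtype.val hx))
  · rintro ⟨y, hy⟩
    obtain ⟨x, hx, rfl⟩ := hsurj y hy
    exact ⟨⟨x, hx⟩, rfl⟩

/-- A criterion for the specialization map to restrict to an isomorphism of eigenspaces. -/
theorem restrictsToIso_specMap [Finite (𝓞 K)ˣ] (hcl : IsClosed (Set.range (algebraMap L ℂ_[p])))
    (h𝔪 : 𝔪 ≠ 0) {D : PrimesAbove K p → CosetData C} (hJ : ∀ 𝔭, (D 𝔭).J = H.j 𝔭)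
    (hA : ∀ 𝔭, (D 𝔭).A = H.α 𝔭)
    (hinj : ∀ X : HomFam C (Dist σ), IsBdd κ X → (∀ i Y, X i Y ∈ LinearMap.ker (specialize κ σ)) →
      (∀ 𝔭, (D 𝔭).hecke (distAct κ σ) X = (lam 𝔭 : L) • X) →
      ∀ i Y, X i Y ∈ (TestProj.id κ σ).ker)
    (hsurj : ∀ Φ : HomFam C (Dist σ), IsBdd κ Φ →
      InvMod (distAct κ σ) (LinearMap.ker (specialize κ σ)) Φ →
      (∀ 𝔭, EqMod (LinearMap.ker (specialize κ σ)) ((D 𝔭).hecke (distAct κ σ) Φ)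
        ((lam 𝔭 : L) • Φ)) →
      ∃ Ψ : HomFam C (Dist σ), EqMod (LinearMap.ker (specialize κ σ)) Ψ Φ ∧
        InvMod (distAct κ σ) (TestProj.id κ σ).ker Ψ ∧
        ∀ 𝔭, EqMod (TestProj.id κ σ).ker ((D 𝔭).hecke (distAct κ σ) Ψ) ((lam 𝔭 : L) • Ψ)) :
    RestrictsToIso (specMap κ σ C) (eigenSymb (distAct κ σ) C lam)
      (eigenSymb (dualAct κ σ) C lam) := by
  have hact : IsRightAct (M := Dist σ) σ (distAct κ σ) := isRightAct_distAct
  have hact' : IsRightAct σ (dualAct κ σ) := isRightAct_dualAct hcl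
  have iff1 := fun Φ : HomFam C (Dist σ) => mem_eigenSymb_iff (lam := lam) (M := Dist σ)
    (act := distAct κ σ) hact hJ hA (Φ := Φ)
  have iff2 := fun φ : HomFam C (Module.Dual L (Vpoly L κ)) => mem_eigenSymb_iff (lam := lam)
    (act := dualAct κ σ) hact' hJ hA (Φ := φ)
  refine restrictsToIso_of_bijective (fun Φ hΦ => ?_) (fun Φ hΦ h0 => ?_) fun φ hφ => ?_
  · obtain ⟨h1, h2⟩ := (iff1 Φ).mp hΦ
    refine (iff2 _).mpr ⟨invMod_specMap_iff.mpr fun i γ hγ X => ?_, fun 𝔭 => ?_⟩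
    · have h3 := (Submodule.mem_bot L).mp (h1 i γ hγ X)
      rw [h3]
      exact Submodule.zero_mem _
    · rw [specMap_hecke, h2, map_smul]
  · obtain ⟨h1, h2⟩ := (iff1 Φ).mp hΦ
    have hb := isBdd_of_mem_BianchiSymb (κ := κ) h𝔪 (mem_BianchiSymb_iff.mpr h1)
    have h3 := hinj Φ hb (fun i Y => LinearMap.mem_ker.mpr
      (DFunLike.congr_fun (congrFun h0 i) Y)) h2
    funext i
    ext1 Y
    exact TestProj.mem_ker_id.mp (h3 i Y)
  · obtain ⟨h1, h2⟩ := (iff2 φ).mp hφ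
    obtain ⟨Φ, hb, hΦ⟩ := exists_isBdd_lift (σ := σ) hcl h𝔪 (mem_BianchiSymb_iff.mpr h1)
    have hφΦ : specMap κ σ C Φ = φ := by
      funext i
      ext1 X
      exact hΦ i X
    subst hφΦ
    obtain ⟨Ψ, hΨ, h3, h4⟩ := hsurj Φ hb (invMod_specMap_iff.mp h1) fun 𝔭 => by
      rw [← eqMod_specialize_iff, ← specMap_hecke, h2, map_smul]
    refine ⟨Ψ, (iff1 Ψ).mpr ⟨invMod_id_iff.mp h3, fun 𝔭 => eqMod_id_iff.mp (h4 𝔭)⟩,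
      eqMod_specialize_iff.mpr hΨ⟩

end Control

/-! ### The control theorem for one or two primes above `p` -/

section SmallSlope

variable {p : ℕ} [Fact p.Prime] {L : Type*} [Field L] [Algebra L ℂ_[p]] {K : Type*} [Field K]
  [NumberField K] [DecidableEq K] {𝔪 : Ideal (𝓞 K)}
  {R : ClassReps (Ideal.span {(p : 𝓞 K)} * 𝔪)} {H : HeckeData p R} {C : CuspFamily H}
  {σ : EmbPair p K L} {κ : Fin 2 → ℕ} {lam : PrimesAbove K p → Lˣ}

lemma norm_lam_ne_zero (𝔭 : PrimesAbove K p) : (lam 𝔭 : L) ≠ 0 := (lam 𝔭).ne_zero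

/-- If `𝔭` is the only prime above `p`, its elements have absolute value at most `|p| ^ (1 / e)`. -/
lemma norm_emb_le_rpow (𝔭 : PrimesAbove K p) (h𝔭 : ∀ 𝔮 : PrimesAbove K p, 𝔮 = 𝔭) (s : Fin 2)
    {x : 𝓞 K} (hx : x ∈ (𝔭 : Ideal (𝓞 K))) :
    (𝔭 : Ideal (𝓞 K)).ramificationIdx ℤ ≠ 0 ∧ ‖emb σ (x : K) s‖ ≤
      ‖(p : ℂ_[p])‖ ^ ((1 : ℝ) / (𝔭 : Ideal (𝓞 K)).ramificationIdx ℤ) := by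
  set e := (𝔭 : Ideal (𝓞 K)).ramificationIdx ℤ with he
  have hpow := pow_ramificationIdx_eq 𝔭 h𝔭
  rw [← he] at hpow
  have he0 : e ≠ 0 := by
    intro h0
    rw [h0, pow_zero, Ideal.one_eq_top] at hpow
    have h1 : (1 : 𝓞 K) ∈ Ideal.span {(p : 𝓞 K)} := hpow ▸ Submodule.mem_top
    have h2 := norm_emb_le_of_mem_span (σ := σ) h1 0
    have e1 : ((1 : 𝓞 K) : K) = 1 := map_one (algebraMap (𝓞 K) K)
    rw [e1, map_one, Pi.one_apply, norm_one] at h2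
    exact absurd (norm_p_lt_one (p := p)) (not_lt.mpr h2)
  refine ⟨he0, ?_⟩
  have h1 : x ^ e ∈ Ideal.span {(p : 𝓞 K)} := hpow ▸ Ideal.pow_mem_pow hx e
  have h2 := norm_emb_le_of_mem_span (σ := σ) h1 s
  have e1 : ((x ^ e : 𝓞 K) : K) = (x : K) ^ e := map_pow (algebraMap (𝓞 K) K) x e
  rw [e1, map_pow, Pi.pow_apply, norm_pow] at h2
  rw [one_div, Real.le_rpow_inv_iff_of_pos (norm_nonneg _) (norm_nonneg _) (by positivity),
    Real.rpow_natCast]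
  exact h2

/-- The control theorem when there is only one prime above `p`. -/
theorem restrictsToIso_of_unique [Finite (𝓞 K)ˣ]
    (hcl : IsClosed (Set.range (algebraMap L ℂ_[p]))) (h𝔪 : 𝔪 ≠ 0) (𝔭 : PrimesAbove K p)
    (h𝔭 : ∀ 𝔮 : PrimesAbove K p, 𝔮 = 𝔭)
    (hslope : ∀ s, vp p (lam 𝔭 : L) <
      (κ s + 1 : ℝ) / ((𝔭 : Ideal (𝓞 K)).ramificationIdx ℤ : ℝ)) :
    RestrictsToIso (specMap κ σ C) (eigenSymb (distAct κ σ) C lam)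
      (eigenSymb (dualAct κ σ) C lam) := by
  choose D h𝔞 hJ hA using exists_cosetData C
  set e := (𝔭 : Ideal (𝓞 K)).ramificationIdx ℤ with he
  -- As `(p) = 𝔭 ^ e`, elements of `𝔭` have absolute value at most `|p| ^ (1 / e)` at both
  -- embeddings; the condition `θ ^ (κ s + 1) < |λ|` is then the slope hypothesis.
  set θ := ‖(p : ℂ_[p])‖ ^ ((1 : ℝ) / e) with hθdef
  have he0 : e ≠ 0 := (norm_emb_le_rpow (σ := σ) 𝔭 h𝔭 0 (Ideal.zero_mem _)).1
  have hθ0 : 0 ≤ θ := Real.rpow_nonneg (norm_nonneg _) _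
  have hθ1 : θ < 1 := Real.rpow_lt_one (norm_nonneg _) norm_p_lt_one (by positivity)
  have hθ : ∀ s ∈ (Finset.univ : Finset (Fin 2)), ∀ x ∈ (D 𝔭).𝔞, ‖emb σ (x : K) s‖ ≤ θ :=
    fun s _ x hx => (norm_emb_le_rpow 𝔭 h𝔭 s (h𝔞 𝔭 ▸ hx)).2
  have hsl : ∀ s ∈ (Finset.univ : Finset (Fin 2)),
      θ ^ (κ s + 1) < ‖algebraMap L ℂ_[p] (lam 𝔭 : L)‖ := fun s _ => by
    have h1 := rpow_lt_norm_of_vp_lt (norm_lam_ne_zero 𝔭) (hslope s)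
    rw [hθdef, ← Real.rpow_natCast, ← Real.rpow_mul (norm_nonneg _), one_div_mul_eq_div]
    push_cast
    exact h1
  have hc := contractsMat_id (κ := κ) (σ := σ) hcl
  refine restrictsToIso_specMap hcl h𝔪 hJ hA (fun X hb hX hD => ?_) fun Φ hb hinv heig => ?_
  · exact eqMod_zero_of_contracts (contracts_of_contractsMat hc (D := D 𝔭) (norm_lam_ne_zero 𝔭)
      hθ0 hθ1 hθ hsl) (norm_lam_ne_zero 𝔭) hX hb (eqMod_id_iff.mpr (hD 𝔭))
  · obtain ⟨Ψ, -, h2, h3, h4⟩ := exists_eigen_lift hcl hc isStable_ker_specialize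
      (fun μ => mem_ker_specialize_of_bd _) (lam := fun 𝔭 => (lam 𝔭 : L)) 𝔭
      (h𝔞 𝔭 ▸ primesAbove_ne_zero 𝔭) (norm_lam_ne_zero 𝔭) hθ0 hθ1 hθ hsl hb hinv heig
    exact ⟨Ψ, h2, h3, h4⟩

/-- The control theorem when `p` splits. -/
theorem restrictsToIso_of_split [Finite (𝓞 K)ˣ] (hK : Module.finrank ℚ K = 2)
    (hcl : IsClosed (Set.range (algebraMap L ℂ_[p]))) (h𝔪 : 𝔪 ≠ 0)
    (hne : primeAt σ 0 ≠ primeAt σ 1)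
    (hslope : ∀ s, vp p (lam ⟨primeAt σ s, primeAt_mem s⟩ : L) < κ s + 1) :
    RestrictsToIso (specMap κ σ C) (eigenSymb (distAct κ σ) C lam)
      (eigenSymb (dualAct κ σ) C lam) := by
  choose D h𝔞 hJ hA using exists_cosetData C
  set P : Fin 2 → PrimesAbove K p := fun s => ⟨primeAt σ s, primeAt_mem s⟩ with hP
  have hs0 := single_mem_OKp (σ := σ) hK hne 0
  have hs1 := single_mem_OKp (σ := σ) hK hne 1
  have hθ0 := norm_nonneg (p : ℂ_[p])
  have hθ1 := norm_p_lt_one (p := p)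
  have hθ : ∀ s, ∀ t ∈ ({s} : Finset (Fin 2)), ∀ x ∈ (D (P s)).𝔞,
      ‖emb σ (x : K) t‖ ≤ ‖(p : ℂ_[p])‖ := fun s t ht x hx => by
    rw [Finset.mem_singleton.mp ht]
    rw [h𝔞] at hx
    exact norm_emb_le_of_mem_primeAt hK hne s hx
  have hsl : ∀ s, ∀ t ∈ ({s} : Finset (Fin 2)),
      ‖(p : ℂ_[p])‖ ^ (κ t + 1) < ‖algebraMap L ℂ_[p] (lam (P s) : L)‖ := fun s t ht => by
    rw [Finset.mem_singleton.mp ht]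
    have h1 := rpow_lt_norm_of_vp_lt (norm_lam_ne_zero (P s)) (hslope s)
    rw [← Real.rpow_natCast]
    push_cast
    exact h1
  have hne0 : ∀ s, (D (P s)).𝔞 ≠ 0 := fun s => by
    rw [h𝔞]
    exact primesAbove_ne_zero (P s)
  have hc1 := contractsMat_interp (κ := κ) hcl hs0 hs1
  have hc0 := contractsMat_ker_interp (κ := κ) hs0
  refine restrictsToIso_specMap hcl h𝔪 hJ hA (fun X hb hX hD => ?_) fun Φ hb hinv heig => ?_
  -- The prime of `σ₂` makes `X` vanish on functions polynomial in the first coordinate; then the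
  -- prime of `σ₁` makes it vanish altogether.
  · have h1 : ∀ i Y, X i Y ∈ (TestProj.interp κ hs0).ker :=
      eqMod_zero_of_contracts (contracts_of_contractsMat hc1 (D := D (P 1))
        (norm_lam_ne_zero (P 1)) hθ0 hθ1 (hθ 1) (hsl 1)) (norm_lam_ne_zero (P 1)) hX hb
        (by rw [hD]; exact EqMod.refl _)
    exact eqMod_zero_of_contracts (contracts_of_contractsMat hc0 (D := D (P 0))
        (norm_lam_ne_zero (P 0)) hθ0 hθ1 (hθ 0) (hsl 0)) (norm_lam_ne_zero (P 0)) h1 hb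
        (by rw [hD]; exact EqMod.refl _)
  -- Lifting runs through the same two stages: first to distributions on functions polynomial in the
  -- first coordinate, then to all distributions.
  · obtain ⟨Ψ, hΨb, h2, h3, h4⟩ := exists_eigen_lift hcl hc1 isStable_ker_specialize
      (fun μ => mem_ker_specialize_of_bd _) (lam := fun 𝔭 => (lam 𝔭 : L)) (P 1)
      (hne0 1) (norm_lam_ne_zero (P 1)) hθ0 hθ1 (hθ 1) (hsl 1) hb hinv heig
    obtain ⟨Ψ', -, h2', h3', h4'⟩ := exists_eigen_lift hcl hc0
      (TestProj.interp κ hs0).isStable_ker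
      (fun μ => TestProj.mem_ker_of_bd_id _) (lam := fun 𝔭 => (lam 𝔭 : L)) (P 0)
      (hne0 0) (norm_lam_ne_zero (P 0)) hθ0 hθ1 (hθ 0) (hsl 0) hΨb h3 h4
    exact ⟨Ψ', EqMod.trans (fun i X => (TestProj.interp κ hs0).ker_le_ker_specialize (h2' i X)) h2,
      h3', h4'⟩

/-- The control theorem for partial Bianchi modular symbols of small slope. -/
theorem restrictsToIso_of_smallSlope [Algebra ℚ_[p] L] [FiniteDimensional ℚ_[p] L]
    [IsScalarTower ℚ_[p] L ℂ_[p]] (hK : Module.finrank ℚ K = 2)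
    (hK' : NumberField.IsTotallyComplex K) (h𝔪 : 𝔪 ≠ 0) {k ℓ : ℕ} (h : SmallSlope σ k ℓ lam) :
    RestrictsToIso (specMap ![k, ℓ] σ C) (eigenSymb (distAct ![k, ℓ] σ) C lam)
      (eigenSymb (dualAct ![k, ℓ] σ) C lam) := by
  have := finite_units hK hK'
  have hcl : IsClosed (Set.range (algebraMap L ℂ_[p])) := isClosed_range_algebraMap
  by_cases hne : primeAt σ 0 = primeAt σ 1
  · have h𝔭 : ∀ 𝔮 : PrimesAbove K p, 𝔮 = ⟨primeAt σ 0, primeAt_mem 0⟩ := fun 𝔮 => Subtype.ext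
      ((eq_primeAt hK σ 𝔮).elim id fun h => h.trans hne.symm)
    refine restrictsToIso_of_unique hcl h𝔪 _ h𝔭 fun s => (h.1 _ h𝔭).trans_le ?_
    have : ((min k ℓ : ℕ) : ℝ) ≤ ((![k, ℓ] s : ℕ) : ℝ) := by
      refine Nat.cast_le.mpr ?_
      fin_cases s
      exacts [min_le_left _ _, min_le_right _ _]
    gcongr
  · have h2 := h.2 ⟨primeAt σ 0, primeAt_mem 0⟩ ⟨primeAt σ 1, primeAt_mem 1⟩
      (fun h => hne (congrArg Subtype.val h)) fun x hx => hx
    refine restrictsToIso_of_split hK hcl h𝔪 hne fun s => ?_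
    fin_cases s
    exacts [h2.1, h2.2]

end SmallSlope

/-! ### The cusps `Γ_i(𝔪)∞ ∪ Γ_i(𝔪)0` for principal primes above `p` -/

section StandardCusps

variable {K : Type*} [Field K] [NumberField K] [DecidableEq K]

lemma smul_infty_eq_mkPt (γ : GL (Fin 2) K) :
    γ • (OnePoint.infty : OnePoint K) = mkPt (γ 0 0) (γ 1 0) := by
  have h := smul_mkPt γ (x := 1) (y := 0) (Or.inl one_ne_zero)
  simpa [mkPt] using h

lemma smul_zero_eq_mkPt (γ : GL (Fin 2) K) :
    γ • ((0 : K) : OnePoint K) = mkPt (γ 0 1) (γ 1 1) := by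
  have h := smul_mkPt γ (x := 0) (y := 1) (Or.inr one_ne_zero)
  simpa [mkPt] using h

lemma smul_diagMat_mkPt (A : Kˣ) {x y : K} (h : x ≠ 0 ∨ y ≠ 0) :
    diagMat A • mkPt x y = mkPt x (A * y) := by
  rw [smul_mkPt _ h]
  simp [diagMat, Matrix.GeneralLinearGroup.mkOfDetNeZero]

lemma mkPt_mul_left {c : K} (hc : c ≠ 0) (x y : K) : mkPt (c * x) (c * y) = mkPt x y := by
  simp only [mkPt, mul_eq_zero, hc, false_or, mul_div_mul_left _ _ hc]

lemma mkPt_mem_standardCusps {I 𝔪 : Ideal (𝓞 K)} {a b c d : K} (hdet : a * d - b * c = 1)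
    (ha : a ∈ (1 : FractionalIdeal (𝓞 K)⁰ K)) (hd : d ∈ (1 : FractionalIdeal (𝓞 K)⁰ K))
    (hb : b ∈ (I : FractionalIdeal (𝓞 K)⁰ K))
    (hc : c ∈ (𝔪 : FractionalIdeal (𝓞 K)⁰ K) * (I : FractionalIdeal (𝓞 K)⁰ K)⁻¹) :
    mkPt a c ∈ standardCusps I 𝔪 ∧ mkPt b d ∈ standardCusps I 𝔪 := by
  have h0 : (!![a, b; c, d] : Matrix (Fin 2) (Fin 2) K).det ≠ 0 := by
    rw [Matrix.det_fin_two_of, hdet]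
    exact one_ne_zero
  have hmem : Matrix.GeneralLinearGroup.mkOfDetNeZero !![a, b; c, d] h0 ∈ Gam I 𝔪 :=
    ⟨hdet, ha, hd, hb, hc⟩
  refine ⟨⟨_, hmem, Or.inl ?_⟩, ⟨_, hmem, Or.inr ?_⟩⟩
  · rw [smul_infty_eq_mkPt]
    rfl
  · rw [smul_zero_eq_mkPt]
    rfl

lemma Gam_mono (I : Ideal (𝓞 K)) {𝔞 𝔟 : Ideal (𝓞 K)} (h : 𝔞 ≤ 𝔟) : Gam I 𝔞 ≤ Gam I 𝔟 :=
  fun _ ⟨h0, ha, hd, hb, hc⟩ => ⟨h0, ha, hd, hb,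
    mul_le_mul_left ((FractionalIdeal.coeIdeal_le_coeIdeal K).mpr h) _ hc⟩

lemma smul_mem_standardCusps {I 𝔪 : Ideal (𝓞 K)} {γ : GL (Fin 2) K} (hγ : γ ∈ Gam I 𝔪)
    {x : OnePoint K} (hx : x ∈ standardCusps I 𝔪) : γ • x ∈ standardCusps I 𝔪 := by
  obtain ⟨δ, hδ, rfl | rfl⟩ := hx
  · exact ⟨γ * δ, mul_mem hγ hδ, Or.inl (mul_smul _ _ _).symm⟩
  · exact ⟨γ * δ, mul_mem hγ hδ, Or.inr (mul_smul _ _ _).symm⟩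

/-- If `α` generates a maximal ideal prime to `𝔪`, then `(1, 0; 0, α)` preserves the standard
cusps. -/
lemma diagMat_smul_mem_standardCusps {I 𝔪 : Ideal (𝓞 K)} (hI : I ≠ 0) {α : 𝓞 K} {A : Kˣ}
    (hA : (α : K) = A) (hmax : (Ideal.span {α}).IsMaximal) (hcop : IsCoprime 𝔪 (Ideal.span {α}))
    {x : OnePoint K} (hx : x ∈ standardCusps I 𝔪) : diagMat A • x ∈ standardCusps I 𝔪 := by
  have hA0 : (A : K) ≠ 0 := A.ne_zero
  have hI0 : (I : FractionalIdeal (𝓞 K)⁰ K) ≠ 0 := FractionalIdeal.coeIdeal_ne_zero.mpr hI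
  have hint : ∀ y : 𝓞 K, (y : K) ∈ (1 : FractionalIdeal (𝓞 K)⁰ K) := fun y =>
    (FractionalIdeal.mem_one_iff _).mpr ⟨y, rfl⟩
  have hAint : (A : K) ∈ (1 : FractionalIdeal (𝓞 K)⁰ K) := hA ▸ hint α
  have hmul : ∀ {y z : K}, y ∈ (1 : FractionalIdeal (𝓞 K)⁰ K) →
      z ∈ (1 : FractionalIdeal (𝓞 K)⁰ K) → y * z ∈ (1 : FractionalIdeal (𝓞 K)⁰ K) :=
    fun hy hz => mul_mem_frac hy hz
  have hunit : ∀ y : 𝓞 K, y ∉ Ideal.span {α} → ∃ s t : 𝓞 K, (y : K) * s + A * t = 1 := by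
    intro y hy
    obtain ⟨s, t, ht, h⟩ := hmax.exists_inv hy
    obtain ⟨t', rfl⟩ := Ideal.mem_span_singleton.mp ht
    have h' := congrArg (algebraMap (𝓞 K) K) h
    rw [map_add, map_mul, map_mul, map_one] at h'
    exact ⟨s, t', by rw [← hA]; linear_combination h'⟩
  obtain ⟨γ, ⟨hdet, ha, hd, hb, hc⟩, hx⟩ := hx
  set a := γ 0 0
  set b := γ 0 1
  set c := γ 1 0
  set d := γ 1 1
  rcases hx with rfl | rfl
  · have hac : a ≠ 0 ∨ c ≠ 0 := by
      by_contra! h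
      rw [h.1, h.2, zero_mul, mul_zero, sub_zero] at hdet
      exact zero_ne_one hdet
    rw [smul_infty_eq_mkPt, smul_diagMat_mkPt A hac]
    obtain ⟨a₀, ha₀⟩ := (FractionalIdeal.mem_one_iff _).mp ha
    -- The cusp `(a : c)` goes to `(a : Ac)`. If `α` divides `a`, cancel it and complete by the
    -- column `(b, Ad)`. Otherwise `a s + A t = 1`, and `(t b, s + A t d)` completes the column.
    by_cases h : a₀ ∈ Ideal.span {α}
    · obtain ⟨a₁, rfl⟩ := Ideal.mem_span_singleton.mp h
      have e : a = A * a₁ := by rw [← ha₀, map_mul, ← hA]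
      rw [e, mkPt_mul_left hA0]
      exact (mkPt_mem_standardCusps (b := b) (d := A * d) (by linear_combination hdet - d * e)
        (hint a₁) (hmul hAint hd) hb hc).1
    · obtain ⟨s, t, hst⟩ := hunit a₀ h
      have ha₀' : (a₀ : K) = a := ha₀
      rw [ha₀'] at hst
      exact (mkPt_mem_standardCusps (b := t * b) (d := s + A * t * d)
        (by linear_combination hst + A * t * hdet)
        ha (add_mem_frac (hint s) (hmul (hmul hAint (hint t)) hd)) (mul_mem_frac (hint t) hb)
        (mul_mem_frac hAint hc)).1
  · have hbd : b ≠ 0 ∨ d ≠ 0 := by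
      by_contra! h
      rw [h.1, h.2, zero_mul, mul_zero, sub_zero] at hdet
      exact zero_ne_one hdet
    rw [smul_zero_eq_mkPt, smul_diagMat_mkPt A hbd]
    -- The cusp `(b : d)` goes to `(b : Ad)`. If some `b c₀` is prime to `α`, then `s b c₀ + A t =
    -- 1` gives the first column `(a t, c - a d s c₀)`.
    by_cases h : ∃ c₀ ∈ (𝔪 : FractionalIdeal (𝓞 K)⁰ K) * (I : FractionalIdeal (𝓞 K)⁰ K)⁻¹,
        b * c₀ ∉ ((Ideal.span {α} : Ideal (𝓞 K)) : FractionalIdeal (𝓞 K)⁰ K)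
    · obtain ⟨c₀, hc₀, hbc⟩ := h
      obtain ⟨y, hy, hyb⟩ := (FractionalIdeal.mem_coeIdeal _).mp (mul_mem_of_mem_inv hb hc₀)
      have hyα : y ∉ Ideal.span {α} := fun h => hbc (hyb ▸ FractionalIdeal.mem_coeIdeal_of_mem _ h)
      obtain ⟨s, t, hst⟩ := hunit y hyα
      have hyb' : (y : K) = b * c₀ := hyb
      rw [hyb'] at hst
      refine (mkPt_mem_standardCusps (a := a * t) (c := c - a * d * (s * c₀))
        (by linear_combination hdet + a * d * hst) (hmul ha (hint t)) (hmul hAint hd) hb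
        (sub_mem_frac hc (mul_mem_frac (hmul ha hd) (mul_mem_frac (hint s) hc₀)))).2
    -- Otherwise `b 𝔪 I⁻¹ ⊆ (α)`; as `𝔪` is prime to `α`, this forces `b ∈ αI`. The factor `α`
    -- cancels from `(b : Ad)`, and `(a, Ac)` is the first column.
    · push Not at h
      have hbI : ∀ m ∈ 𝔪, ∃ z ∈ (I : FractionalIdeal (𝓞 K)⁰ K), b * (m : K) = A * z := by
        have h1 : FractionalIdeal.spanSingleton (𝓞 K)⁰ b * ((𝔪 : FractionalIdeal (𝓞 K)⁰ K) *
            (I : FractionalIdeal (𝓞 K)⁰ K)⁻¹) ≤ FractionalIdeal.spanSingleton (𝓞 K)⁰ (A : K) := by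
          rw [FractionalIdeal.spanSingleton_mul_le_iff]
          intro z hz
          have := h z hz
          rwa [FractionalIdeal.coeIdeal_span_singleton, show algebraMap (𝓞 K) K α = A from hA]
            at this
        intro m hm
        have h2 := mul_le_mul_left h1 (I : FractionalIdeal (𝓞 K)⁰ K)
        rw [mul_assoc, mul_assoc, inv_mul_cancel₀ hI0, mul_one] at h2
        have h3 := h2 (FractionalIdeal.mul_mem_mul
          (FractionalIdeal.mem_spanSingleton_self (𝓞 K)⁰ b)
          (FractionalIdeal.mem_coeIdeal_of_mem (𝓞 K)⁰ hm))
        obtain ⟨z, hz, h4⟩ := FractionalIdeal.mem_singleton_mul.mp h3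
        exact ⟨z, hz, h4⟩
      obtain ⟨m, hm, w, hw, hmw⟩ := Ideal.isCoprime_iff_exists.mp hcop
      obtain ⟨t, rfl⟩ := Ideal.mem_span_singleton.mp hw
      obtain ⟨z, hz, hbz⟩ := hbI m hm
      have h' := congrArg (algebraMap (𝓞 K) K) hmw
      rw [map_add, map_mul, map_one, show algebraMap (𝓞 K) K α = A from hA] at h'
      have e : b = A * (z + t * b) := by linear_combination hbz - b * h'
      have hz' : z + t * b ∈ (I : FractionalIdeal (𝓞 K)⁰ K) :=
        add_mem_frac hz (mul_mem_frac (hint t) hb)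
      rw [e, mkPt_mul_left hA0]
      exact (mkPt_mem_standardCusps (a := a) (c := A * c) (by linear_combination hdet + c * e)
        ha hd hz' (mul_mem_frac hAint hc)).2

variable {p : ℕ} [Fact p.Prime]

/-- If the primes above `p` are principal, the standard cusps satisfy the conditions imposed on the
families of cusps. -/
theorem exists_cuspFamily_standardCusps {𝔪 : Ideal (𝓞 K)}
    (h𝔪p : IsCoprime 𝔪 (Ideal.span {(p : 𝓞 K)}))
    {R : ClassReps (Ideal.span {(p : 𝓞 K)} * 𝔪)} (H : HeckeData p R)
    (hprin : ∀ 𝔭 : PrimesAbove K p, (𝔭 : Ideal (𝓞 K)).IsPrincipal) :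
    ∃ C : CuspFamily H, ∀ i, C.cusps i = standardCusps (R.I i) 𝔪 := by
  -- A principal prime has trivial class, so multiplication by it fixes every index.
  have hj : ∀ 𝔭 i, H.j 𝔭 i = i := fun 𝔭 i => by
    rw [R.eq_mk0_mul (primesAbove_ne_zero 𝔭) (H.mul_eq 𝔭 i),
      (ClassGroup.mk0_eq_one_iff (mem_nonZeroDivisors_of_ne_zero (primesAbove_ne_zero 𝔭))).mpr
        (hprin 𝔭), one_mul]
  refine ⟨⟨fun i => standardCusps (R.I i) 𝔪, fun i => ⟨_, 1, one_mem _, Or.inl rfl⟩,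
    fun i γ hγ x hx => smul_mem_standardCusps (Gam_mono _ Ideal.mul_le_right hγ) hx,
    fun 𝔭 i x hx => ?_⟩, fun i => rfl⟩
  rw [hj]
  have hspan : ((𝔭 : Ideal (𝓞 K)) : FractionalIdeal (𝓞 K)⁰ K) =
      FractionalIdeal.spanSingleton (𝓞 K)⁰ (H.α 𝔭 i : K) := by
    have h := H.mul_eq 𝔭 i
    rw [hj] at h
    exact mul_right_cancel₀ (FractionalIdeal.coeIdeal_ne_zero.mpr (R.ne_zero i)) h
  have hmem : (H.α 𝔭 i : K) ∈ ((𝔭 : Ideal (𝓞 K)) : FractionalIdeal (𝓞 K)⁰ K) :=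
    hspan ▸ FractionalIdeal.mem_spanSingleton_self _ _
  obtain ⟨α, hα, hαA⟩ := (FractionalIdeal.mem_coeIdeal _).mp hmem
  have h𝔭 : (𝔭 : Ideal (𝓞 K)) = Ideal.span {α} := by
    refine (FractionalIdeal.coeIdeal_inj (K := K)).mp ?_
    rw [hspan, FractionalIdeal.coeIdeal_span_singleton, hαA]
  refine diagMat_smul_mem_standardCusps (R.ne_zero i) hαA (h𝔭 ▸ isMaximal_primesAbove 𝔭) ?_ hx
  rw [← h𝔭]
  obtain ⟨m, hm, w, hw, h⟩ := Ideal.isCoprime_iff_exists.mp h𝔪p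
  exact Ideal.isCoprime_iff_exists.mpr ⟨m, hm, w,
    (Ideal.span_singleton_le_iff_mem _).mpr (natCast_mem_primesAbove 𝔭) hw, h⟩

end StandardCusps

end Bianchi

theorem mainTheorem4 {K : Type*} [Field K] [NumberField K] [DecidableEq K]
    (hK : Module.finrank ℚ K = 2) (hK' : NumberField.IsTotallyComplex K)
    {p : ℕ} [Fact p.Prime]
    {L : Type*} [Field L] [Algebra ℚ_[p] L] (hL : FiniteDimensional ℚ_[p] L)
    [Algebra L ℂ_[p]] [IsScalarTower ℚ_[p] L ℂ_[p]] (σ : Bianchi.EmbPair p K L)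
    (𝔪 : Ideal (𝓞 K)) (h𝔪 : 𝔪 ≠ 0) (h𝔪p : IsCoprime 𝔪 (Ideal.span {(p : 𝓞 K)}))
    (R : Bianchi.ClassReps (Ideal.span {(p : 𝓞 K)} * 𝔪)) (H : Bianchi.HeckeData p R)
    (k ℓ : ℕ) :
    ((∀ 𝔭 : Bianchi.PrimesAbove K p, (𝔭 : Ideal (𝓞 K)).IsPrincipal) →
      ∃ C : Bianchi.CuspFamily H, ∀ i, C.cusps i = Bianchi.standardCusps (R.I i) 𝔪) ∧
    ∀ (C : Bianchi.CuspFamily H) (lam : Bianchi.PrimesAbove K p → Lˣ),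
      Bianchi.SmallSlope σ k ℓ lam →
      Bianchi.RestrictsToIso (Bianchi.specMap ![k, ℓ] σ C)
        (Bianchi.eigenSymb (Bianchi.distAct ![k, ℓ] σ) C lam)
        (Bianchi.eigenSymb (Bianchi.dualAct ![k, ℓ] σ) C lam) := by
  have := hL
  exact ⟨fun h => Bianchi.exists_cuspFamily_standardCusps h𝔪p H h,
    fun C lam h => Bianchi.restrictsToIso_of_smallSlope hK hK' h𝔪 h⟩
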